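/- Let $(M,J,g)$ be a Hermitian surface (a complex manifold of complex dimension $2$ with a smooth Hermitian metric), and let $\nabla$ be its Chern connection, i.e. the unique connection on $TM$ with $\nabla J=0$, $\nabla g=0$ whose torsion has vanishing $(1,1)$-part. Let $\Sigma$ be a compact connected Riemann surface with complex structure $j$, and let $f:\Sigma\to M$ be a smooth conformal immersion; give $\Sigma$ the induced metric $ds^2=f^*g$, with area form $dA$ and Gaussian curvature $K$. Suppose that $f$ is Chern minimal, i.e. $\operatorname{tr}\nabla df=0$, where $\nabla df$ is the second fundamental form given by the Chern connection of $M$ and the Levi-Civita connection of $ds^2$, and that $f$ is generic, i.e. neither holomorphic nor antiholomorphic. A point of $\Sigma$ is called complex if $df\circ j=J\circ df$ there, and anticomplex if $df\circ j=-J\circ df$ there. Near any point, write $ds^2=\varphi\bar\varphi$ with $\varphi$ smooth of type $(1,0)$, and choose a smooth unitary coframe $\{\omega^1,\omega^2\}$ of $M$ along $f$ such that $f^*\omega^1=s\,\varphi$ and $f^*\omega^2=t\,\bar\varphi$. The order of a complex point is the integer $p$ with $t=\bar z^{\,p}h$ near it, and the order of an anticomplex point is the integer $p$ with $s=z^{p}h$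 near it, where $z$ is a holomorphic coordinate centred at the point and $h$ is continuous without zeros. Then there are only finitely many complex and anticomplex points, and each of them has a well-defined positive order. Let $P$ and $Q$ be the sums of the orders of all complex points and of all anticomplex points, respectively. Then the Webster formulae hold: $$P-Q=-f^*c_1(M)[\Sigma],\qquad P+Q=-\big(\chi(T\Sigma)+\chi(T^\perp\Sigma)\big).$$ Here $f^*c_1(M)[\Sigma]=\frac1{2\pi}\int_\Sigma f^*\mathrm{Ric}_M$, where $\mathrm{Ric}_M=\sqrt{-1}\,\operatorname{tr}\Omega$ is the Ricci form of the curvature $\Omega$ of the Chern connection; $\chi(T\Sigma)=\frac1{2\pi}\int_\Sigma K\,dA$; and $\chi(T^\perp\Sigma)=\frac1{2\pi}\int_\Sigma K^\perp dA$, where the normal bundle $T^\perp\Sigma$ is oriented so that $T\Sigma\oplus T^\perp\Sigma$ has the complex orientation of $M$, and the normal curvature $K^\perp$ is determined by $d\rho^\perp=-K^\perp dA$ with $\rho^\perp=\langle Dn_1,n_2\rangle$ for a local oriented orthonormal normal frame $n_1,n_2$ and the Levi-Civita connection $D$ of $g$. -/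

import Mathlib

open scoped Manifold ContDiff Topology

noncomputable section

namespace ChernMinimal

/-! ### Local Riemannian and Hermitian geometry on an open set of a vector space

A tensor field or a connection on an open set of `V` is given by its values on constant vector
fields. -/

section Local

variable {V : Type*} [NormedAddCommGroup V] [NormedSpace ℝ V]

/-- Christoffel symbols of the Levi-Civita connection of the metric `G`: the vector `D_u v` at `q`
for constant vector fields `u`, `v`. It is determined by the Koszul formula
`2 G(D_u v, w) = u G(v, w) + v G(u, w) - w G(u, v)` (for constant fields `u`, `v`, `w`). -/
def leviCivita (G : V → V →L[ℝ] V →L[ℝ] ℝ) (q u v : V) : V :=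
  (G q).inverse ((1 / 2 : ℝ) •
    (fderiv ℝ G q u v + fderiv ℝ G q v u - ((fderiv ℝ G q).flip u).flip v))

/-- The curvature `R(u, v) w = D_u D_v w - D_v D_u w` (for constant fields `u`, `v`, `w`)
at `q` of the connection with Christoffel symbols `Γ q u v = D_u v`. -/
def curvature (Γ : V → V → V → V) (q u v w : V) : V :=
  fderiv ℝ (fun p => Γ p v w) q u - fderiv ℝ (fun p => Γ p u w) q v
    + Γ q u (Γ q v w) - Γ q v (Γ q u w)

variable [NormedSpace ℂ V] [IsScalarTower ℝ ℂ V]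

/-- Multiplication by `i`, as a real linear map. -/
def mulI (V : Type*) [NormedAddCommGroup V] [NormedSpace ℝ V] [NormedSpace ℂ V]
    [IsScalarTower ℝ ℂ V] : V →L[ℝ] V :=
  (Complex.I • ContinuousLinearMap.id ℂ V : V →L[ℂ] V).restrictScalars ℝ

@[simp] theorem mulI_apply (v : V) : mulI V v = Complex.I • v := rfl

/-- Christoffel symbols of the Chern connection of a metric `G` for which multiplication by `i` is
orthogonal: the vector `∇_u v` at `q` for constant vector fields `u`, `v`.

With the Hermitian form `h(v, w) = G(v, w) + i G(v, i w)` and `∂_u = (u - i (iu)) / 2`, this is the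
usual formula `h(∇_u v, w) = ∂_u h(v, w)`, whose real part is
`G(∇_u v, w) = (u G(v, w) + (iu) G(v, iw)) / 2`. -/
def chern (G : V → V →L[ℝ] V →L[ℝ] ℝ) (q u v : V) : V :=
  (G q).inverse ((1 / 2 : ℝ) •
    (fderiv ℝ G q u v + (fderiv ℝ G q (Complex.I • u) v).comp (mulI V)))

/-- The Hermitian form whose real part is the metric `G`; it is complex linear in `u` and conjugate
linear in `v`. -/
def herm (G : V →L[ℝ] V →L[ℝ] ℝ) (u v : V) : ℂ := G u v + Complex.I * G u (Complex.I • v)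

/-- The properties that characterize the Chern connection at the point `q`: it preserves the complex
structure and the metric, and the `(1,1)`-part of its torsion `T(u, v) = ∇_u v - ∇_v u` vanishes,
that is, `T(iu, iv) = - T(u, v)`. Here `Γ u v = ∇_u v` for constant vector fields `u`, `v`. -/
structure IsChernAt (G : V → V →L[ℝ] V →L[ℝ] ℝ) (q : V) (Γ : V →ₗ[ℝ] V →ₗ[ℝ] V) : Prop where
  preserves_complex_structure : ∀ u v, Γ u (Complex.I • v) = Complex.I • Γ u v
  preserves_metric : ∀ u v w, fderiv ℝ G q u v w = G q (Γ u v) w + G q v (Γ u w)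
  torsion : ∀ u v, Γ (Complex.I • u) (Complex.I • v) - Γ (Complex.I • v) (Complex.I • u)
    = -(Γ u v - Γ v u)

/-- `chern G` is the unique connection that preserves the complex structure and the metric and has
torsion with vanishing `(1,1)`-part. -/
theorem chern_spec [FiniteDimensional ℝ V] (G : V → V →L[ℝ] V →L[ℝ] ℝ) (q : V)
    (hG : DifferentiableAt ℝ G q)
    (hsymm : ∀ᶠ p in 𝓝 q, ∀ u v, G p u v = G p v u)
    (hpos : ∀ v, v ≠ 0 → 0 < G q v v)
    (hJ : ∀ᶠ p in 𝓝 q, ∀ u v, G p (Complex.I • u) (Complex.I • v) = G p u v) :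
    ∃ Γ : V →ₗ[ℝ] V →ₗ[ℝ] V, (∀ u v, Γ u v = chern G q u v) ∧ IsChernAt G q Γ ∧
      ∀ Γ', IsChernAt G q Γ' → Γ' = Γ := by
  have hinj : Function.Injective (G q) := by
    intro u v h
    by_contra hne
    have := hpos (u - v) (sub_ne_zero.2 hne)
    rw [(G q).map_sub, h, sub_self] at this
    simp at this
  have key : ∀ (ℓ : V →L[ℝ] ℝ) w, G q ((G q).inverse ℓ) w = ℓ w := by
    intro ℓ w
    have hfr : Module.finrank ℝ V = Module.finrank ℝ (V →L[ℝ] ℝ) := by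
      rw [← (LinearMap.toContinuousLinearMap (𝕜 := ℝ) (E := V) (F' := ℝ)).finrank_eq]
      exact (Subspace.dual_finrank_eq).symm
    let A : V ≃ₗ[ℝ] (V →L[ℝ] ℝ) :=
      LinearEquiv.ofInjectiveOfFinrankEq (G q : V →ₗ[ℝ] (V →L[ℝ] ℝ)) hinj hfr
    have hA : ((A.toContinuousLinearEquiv : V ≃L[ℝ] (V →L[ℝ] ℝ)) : V →L[ℝ] (V →L[ℝ] ℝ)) = G q := by
      ext u v; rfl
    have h2 : (G q).comp ((G q).inverse) = ContinuousLinearMap.id ℝ _ := by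
      rw [← hA, ContinuousLinearMap.inverse_equiv]; ext; simp
    exact congrArg (fun k : (V →L[ℝ] ℝ) →L[ℝ] (V →L[ℝ] ℝ) => k ℓ w) h2
  have hD : ∀ v w, HasFDerivAt (fun p => G p v w) (((fderiv ℝ G q).flip v).flip w) q := by
    intro v w
    exact (hG.hasFDerivAt.clm_apply (hasFDerivAt_const v q)).clm_apply (hasFDerivAt_const w q)
      |>.congr_fderiv (by ext; simp)
  have Dsymm : ∀ u v w, fderiv ℝ G q u v w = fderiv ℝ G q u w v := by
    intro u v w
    have h := (hD v w).unique ((hD w v).congr_of_eventuallyEq (hsymm.mono fun p hp => hp v w))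
    exact congrArg (fun k : V →L[ℝ] ℝ => k u) h
  have DJ : ∀ u v w, fderiv ℝ G q u (Complex.I • v) (Complex.I • w) = fderiv ℝ G q u v w := by
    intro u v w
    have h := (hD _ _).unique ((hD v w).congr_of_eventuallyEq (hJ.mono fun p hp => hp v w))
    exact congrArg (fun k : V →L[ℝ] ℝ => k u) h
  have hII : ∀ v : V, Complex.I • Complex.I • v = -v := by
    intro v; rw [smul_smul, Complex.I_mul_I, neg_one_smul]
  have DJ' : ∀ u v w, fderiv ℝ G q u (Complex.I • v) w = - fderiv ℝ G q u v (Complex.I • w) := by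
    intro u v w
    rw [← DJ u v (Complex.I • w), hII]; simp
  have GJ := hJ.self_of_nhds
  have Gs := hsymm.self_of_nhds
  have GJ' : ∀ v w, G q (Complex.I • v) w = - G q v (Complex.I • w) := by
    intro v w
    rw [← GJ v (Complex.I • w), hII]; simp
  have hC : ∀ u v w, G q (chern G q u v) w
      = (1 / 2) * (fderiv ℝ G q u v w + fderiv ℝ G q (Complex.I • u) v (Complex.I • w)) := by
    intro u v w
    rw [chern, key]; rfl
  have ext' : ∀ a b, (∀ w, G q a w = G q b w) → a = b := fun a b h =>
    hinj (ContinuousLinearMap.ext h)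
  have Dneg : ∀ u v w, fderiv ℝ G q (-u) v w = - fderiv ℝ G q u v w := by
    intro u v w; simp
  have Dsmul : ∀ (a : ℝ) u v w, fderiv ℝ G q (a • u) v w = a * fderiv ℝ G q u v w := by
    intro a u v w; exact (((fderiv ℝ G q).flip v).flip w).map_smul a u
  have Dsmul' : ∀ (a : ℝ) u v w, fderiv ℝ G q u (a • v) w = a * fderiv ℝ G q u v w := by
    intro a u v w; rw [(fderiv ℝ G q u).map_smul_of_tower a v]; rfl
  have Gsmul : ∀ (a : ℝ) v w, G q (a • v) w = a * G q v w := by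
    intro a v w; rw [(G q).map_smul_of_tower a v]; rfl
  let Γ : V →ₗ[ℝ] V →ₗ[ℝ] V := LinearMap.mk₂ ℝ (chern G q)
    (fun a b c => ext' _ _ fun w => by
      rw [hC, (G q).map_add, add_apply, hC, hC, smul_add Complex.I a b, (fderiv ℝ G q).map_add,
        (fderiv ℝ G q).map_add]
      simp only [add_apply]; ring)
    (fun a b c => ext' _ _ fun w => by
      rw [hC, Gsmul, hC, smul_comm Complex.I a, Dsmul, Dsmul]; ring)
    (fun a b c => ext' _ _ fun w => by
      simp only [map_add, add_apply, hC]; ring)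
    (fun a b c => ext' _ _ fun w => by
      rw [hC, Gsmul, hC, Dsmul', Dsmul']; ring)
  have hΓ : ∀ u v, Γ u v = chern G q u v := fun _ _ => rfl
  refine ⟨Γ, hΓ, ⟨?_, ?_, ?_⟩, ?_⟩
  · intro u v
    refine ext' _ _ fun w => ?_
    rw [GJ', hΓ, hΓ, hC, hC, DJ', DJ, hII]
    simp only [map_neg]; ring
  · intro u v w
    rw [Gs v, hΓ, hΓ, hC, hC, Dsymm u w v, Dsymm _ w, DJ']
    ring
  · intro u v
    have : ∀ u v, Γ (Complex.I • u) (Complex.I • v) = - Γ u v := by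
      intro u v
      refine ext' _ _ fun w => ?_
      rw [(G q).map_neg, neg_apply, hΓ, hΓ, hC, hC, hII]
      rw [DJ', DJ, Dneg]
      ring
    rw [this, this]; abel
  · rintro Γ' ⟨h1, h2, h3⟩
    have hlin : ∀ u v, Γ' (Complex.I • u) v = Complex.I • Γ' u v := by
      have hA : ∀ u v, Γ' (Complex.I • u) v - Complex.I • Γ' u v
          = Γ' (Complex.I • v) u - Complex.I • Γ' v u := by
        intro u v
        have h := congrArg (fun x => Complex.I • x) (h3 u v)
        simp only [h1, smul_sub, smul_neg, hII] at h
        linear_combination (norm := module) -h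
      intro u v
      have e1 := hA (Complex.I • u) v
      rw [h1, hII, map_neg, LinearMap.neg_apply, h1] at e1
      have e2 := hA u v
      have e3 : Complex.I • (Γ' (Complex.I • u) v - Complex.I • Γ' u v)
        = Complex.I • (Γ' (Complex.I • v) u - Complex.I • Γ' v u) := by rw [e2]
      simp only [smul_sub, hII] at e1 e3
      have e4 : (2 : ℝ) • (Complex.I • Γ' (Complex.I • u) v) = (2 : ℝ) • (- Γ' u v) := by
        rw [two_smul, two_smul]
        linear_combination (norm := module) e3 - e1
      have e5 := congrArg (fun x => - (Complex.I • x)) (smul_right_injective V (two_ne_zero) e4)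
      simpa [hII] using e5
    refine LinearMap.ext fun u => LinearMap.ext fun v => ext' _ _ fun w => ?_
    rw [hΓ, hC, h2, h2, hlin, hlin, h1, GJ, hII]
    simp only [map_neg]; ring

end Local

/-- The model space of complex surfaces. -/
abbrev C2 : Type := Fin 2 → ℂ

/-- The Ricci form `i tr_ℂ Ω(u, v)` at `q` of a metric on an open set of `ℂ²`, where `Ω` is the
curvature of the Chern connection (the trace is purely imaginary). -/
def ricciForm (G : C2 → C2 →L[ℝ] C2 →L[ℝ] ℝ) (q u v : C2) : ℝ :=
  (Complex.I * ∑ k : Fin 2, curvature (chern G) q u v (Pi.single k 1) k).re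

/-- The real coordinates `(x₁, y₁, x₂, y₂)` of a vector of `ℂ²`, in the order that gives the
complex orientation. -/
def realCoords (v : C2) : Fin 4 → ℝ := ![(v 0).re, (v 0).im, (v 1).re, (v 1).im]

/-! ### Complex manifolds and Hermitian metrics -/

section Manifold

variable {E : Type*} [NormedAddCommGroup E] [NormedSpace ℝ E] [NormedSpace ℂ E]
  [IsScalarTower ℝ ℂ E]

/-- A complex manifold is a smooth real manifold. -/
instance isManifold_real {X : Type*} [TopologicalSpace X] [ChartedSpace E X]
    [IsManifold 𝓘(ℂ, E) ω X] : IsManifold 𝓘(ℝ, E) ∞ X := by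
  apply isManifold_of_contDiffOn
  intro e e' he he'
  have h := (contDiffGroupoid ω 𝓘(ℂ, E)).compatible he he'
  rw [contDiffGroupoid, mem_groupoid_of_pregroupoid] at h
  have h1 : ContDiffOn ℂ ω (𝓘(ℂ, E) ∘ (e.symm ≫ₕ e') ∘ 𝓘(ℂ, E).symm)
    (𝓘(ℂ, E).symm ⁻¹' (e.symm ≫ₕ e').source ∩ Set.range 𝓘(ℂ, E)) := h.1
  simp only [mfld_simps] at h1 ⊢
  exact (h1.restrict_scalars ℝ).of_le le_top

/-- The complex structure of a complex manifold on its real tangent space at `p`. -/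
def almostComplex {X : Type*} [TopologicalSpace X] [ChartedSpace E X] (p : X) :
    TangentSpace 𝓘(ℝ, E) p →L[ℝ] TangentSpace 𝓘(ℝ, E) p :=
  mulI E

end Manifold

section Surface

/-- A Hermitian metric on a complex surface: a smooth Riemannian metric for which the complex
structure is orthogonal. -/
structure HermitianMetric (M : Type*) [TopologicalSpace M] [ChartedSpace C2 M]
    [IsManifold 𝓘(ℂ, C2) ω M] extends
    Bundle.ContMDiffRiemannianMetric 𝓘(ℝ, C2) ∞ C2 (fun p : M => TangentSpace 𝓘(ℝ, C2) p) where
  inner_almostComplex : ∀ (p : M) (u v : TangentSpace 𝓘(ℝ, C2) p),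
    inner p (almostComplex p u) (almostComplex p v) = inner p u v

variable {M : Type*} [TopologicalSpace M] [ChartedSpace C2 M] [IsManifold 𝓘(ℂ, C2) ω M]

/-- The coordinate expression of a Hermitian metric in a chart `e`: for `q` in the target of `e`,
the pull-back of the metric by `e.symm`. -/
def HermitianMetric.inChart (g : HermitianMetric M) (e : OpenPartialHomeomorph M C2) (q : C2) :
    C2 →L[ℝ] C2 →L[ℝ] ℝ :=
  (show C2 →L[ℝ] C2 →L[ℝ] ℝ from g.inner (e.symm q)).bilinearComp
    (mfderiv 𝓘(ℝ, C2) 𝓘(ℝ, C2) e.symm q) (mfderiv 𝓘(ℝ, C2) 𝓘(ℝ, C2) e.symm q)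

variable {S : Type*} [TopologicalSpace S] [ChartedSpace ℂ S]

/-! ### Immersions of Riemann surfaces, complex and anticomplex points -/

/-- A smooth immersion that is conformal: the complex structure of `S` is orthogonal for the induced
metric, so that `f` is isometric for a (unique) metric on `S` conformal to the complex structure. -/
structure IsConformalImmersion (g : HermitianMetric M) (f : S → M) : Prop where
  contMDiff : ContMDiff 𝓘(ℝ, ℂ) 𝓘(ℝ, C2) ∞ f
  injective_mfderiv : ∀ x, Function.Injective (mfderiv 𝓘(ℝ, ℂ) 𝓘(ℝ, C2) f x)
  conformal : ∀ (x : S) (v w : TangentSpace 𝓘(ℝ, ℂ) x),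
    g.inner (f x) (mfderiv 𝓘(ℝ, ℂ) 𝓘(ℝ, C2) f x (almostComplex x v))
      (mfderiv 𝓘(ℝ, ℂ) 𝓘(ℝ, C2) f x (almostComplex x w)) =
    g.inner (f x) (mfderiv 𝓘(ℝ, ℂ) 𝓘(ℝ, C2) f x v) (mfderiv 𝓘(ℝ, ℂ) 𝓘(ℝ, C2) f x w)

/-- The complex points of `f`: those where `df ∘ j = J ∘ df`. -/
def complexPoints (f : S → M) : Set S :=
  {x | ∀ v : TangentSpace 𝓘(ℝ, ℂ) x, mfderiv 𝓘(ℝ, ℂ) 𝓘(ℝ, C2) f x (almostComplex x v) =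
    almostComplex (f x) (mfderiv 𝓘(ℝ, ℂ) 𝓘(ℝ, C2) f x v)}

/-- The anticomplex points of `f`: those where `df ∘ j = - J ∘ df`. -/
def anticomplexPoints (f : S → M) : Set S :=
  {x | ∀ v : TangentSpace 𝓘(ℝ, ℂ) x, mfderiv 𝓘(ℝ, ℂ) 𝓘(ℝ, C2) f x (almostComplex x v) =
    -almostComplex (f x) (mfderiv 𝓘(ℝ, ℂ) 𝓘(ℝ, C2) f x v)}

/-- `f` is holomorphic if every point is complex. -/
def IsHolomorphic (f : S → M) : Prop := ∀ x, x ∈ complexPoints f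

/-- `f` is antiholomorphic if every point is anticomplex. -/
def IsAntiholomorphic (f : S → M) : Prop := ∀ x, x ∈ anticomplexPoints f

/-! ### Coordinate expressions

Everything below is computed at a point `z₀ = e x` of the target of a chart `e` of `S`, using near
`f x` the preferred chart of `M` at `f x`. -/

/-- The chart of `M` used near `f (e.symm z₀)`. -/
def targetChart (f : S → M) (e : OpenPartialHomeomorph S ℂ) (z₀ : ℂ) : OpenPartialHomeomorph M C2 :=
  chartAt C2 (f (e.symm z₀))

/-- The coordinate expression of `f` near `z₀`. -/
def localRep (f : S → M) (e : OpenPartialHomeomorph S ℂ) (z₀ : ℂ) (z : ℂ) : C2 :=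
  targetChart f e z₀ (f (e.symm z))

/-- The coordinate expression, near the image of `z₀`, of the metric of `M`. -/
def localMetric (g : HermitianMetric M) (f : S → M) (e : OpenPartialHomeomorph S ℂ) (z₀ : ℂ) :
    C2 → C2 →L[ℝ] C2 →L[ℝ] ℝ :=
  g.inChart (targetChart f e z₀)

/-- The coordinate expression near `z₀` of the induced metric on `S`. -/
def inducedMetric (g : HermitianMetric M) (f : S → M) (e : OpenPartialHomeomorph S ℂ) (z₀ : ℂ)
    (z : ℂ) : ℂ →L[ℝ] ℂ →L[ℝ] ℝ :=
  (localMetric g f e z₀ (localRep f e z₀ z)).bilinearComp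
    (fderiv ℝ (localRep f e z₀) z) (fderiv ℝ (localRep f e z₀) z)

/-- The second fundamental form `(∇ df)(a, b) = ∇_a (df b) - df (D_a b)` at `z₀`, where `∇` is the
Chern connection of `M` and `D` is the Levi-Civita connection of the induced metric. -/
def secondFundamentalForm (g : HermitianMetric M) (f : S → M) (e : OpenPartialHomeomorph S ℂ)
    (z₀ a b : ℂ) : C2 :=
  let F := localRep f e z₀
  fderiv ℝ (fun z => fderiv ℝ F z b) z₀ a
    + chern (localMetric g f e z₀) (F z₀) (fderiv ℝ F z₀ a) (fderiv ℝ F z₀ b)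
    - fderiv ℝ F z₀ (leviCivita (inducedMetric g f e z₀) z₀ a b)

/-- `f` is Chern minimal if `tr (∇ df) = 0`; the trace is taken in an orthonormal basis `a`, `b` of
the tangent plane of `S`. -/
def IsChernMinimal (g : HermitianMetric M) (f : S → M) : Prop :=
  ∀ (x : S) (a b : ℂ), let e := chartAt ℂ x
    inducedMetric g f e (e x) (e x) a a = 1 → inducedMetric g f e (e x) (e x) b b = 1 →
    inducedMetric g f e (e x) (e x) a b = 0 →
    secondFundamentalForm g f e (e x) a a + secondFundamentalForm g f e (e x) b b = 0

/-! ### Orders of complex and anticomplex points -/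

/-- Near `z₀`: `φ = μ dz` is a smooth form of type `(1, 0)` with `ds² = φ φ̄` for the induced metric
`ds²`; `e₁`, `e₂` is a smooth unitary frame of `TM` along `f`; and the dual coframe satisfies
`f*ω¹ = s φ` and `f*ω² = t φ̄`. -/
structure IsAdaptedFrame (g : HermitianMetric M) (f : S → M) (e : OpenPartialHomeomorph S ℂ)
    (z₀ : ℂ) (e₁ e₂ : ℂ → C2) (μ s t : ℂ → ℂ) : Prop where
  contDiffAt_fst : ContDiffAt ℝ ∞ e₁ z₀
  contDiffAt_snd : ContDiffAt ℝ ∞ e₂ z₀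
  contDiffAt_coframe : ContDiffAt ℝ ∞ μ z₀
  coframe : ∀ᶠ z in 𝓝 z₀, ∀ a : ℂ, inducedMetric g f e z₀ z a a = ‖μ z * a‖ ^ 2
  unitary : ∀ᶠ z in 𝓝 z₀, let G := localMetric g f e z₀ (localRep f e z₀ z)
    herm G (e₁ z) (e₁ z) = 1 ∧ herm G (e₂ z) (e₂ z) = 1 ∧ herm G (e₁ z) (e₂ z) = 0
  adapted : ∀ᶠ z in 𝓝 z₀, ∀ a : ℂ, fderiv ℝ (localRep f e z₀) z a =
    (s z * (μ z * a)) • e₁ z + (t z * (starRingEnd ℂ) (μ z * a)) • e₂ z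

/-- `p` is the order at `x` of the zero of `t`, where `f*ω² = t φ̄`: in a holomorphic coordinate `z`
centred at `x`, `t = z̄ ^ p h` with `h` continuous and without zeros. -/
def IsComplexOrder (g : HermitianMetric M) (f : S → M) (x : S) (p : ℕ) : Prop :=
  ∃ (e₁ e₂ : ℂ → C2) (μ s t h : ℂ → ℂ),
    IsAdaptedFrame g f (chartAt ℂ x) (chartAt ℂ x x) e₁ e₂ μ s t ∧
    ContinuousAt h (chartAt ℂ x x) ∧ h (chartAt ℂ x x) ≠ 0 ∧
    ∀ᶠ z in 𝓝 (chartAt ℂ x x), t z = (starRingEnd ℂ) (z - chartAt ℂ x x) ^ p * h z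

/-- `p` is the order at `x` of the zero of `s`, where `f*ω¹ = s φ`: in a holomorphic coordinate `z`
centred at `x`, `s = z ^ p h` with `h` continuous and without zeros. -/
def IsAnticomplexOrder (g : HermitianMetric M) (f : S → M) (x : S) (p : ℕ) : Prop :=
  ∃ (e₁ e₂ : ℂ → C2) (μ s t h : ℂ → ℂ),
    IsAdaptedFrame g f (chartAt ℂ x) (chartAt ℂ x x) e₁ e₂ μ s t ∧
    ContinuousAt h (chartAt ℂ x x) ∧ h (chartAt ℂ x x) ≠ 0 ∧
    ∀ᶠ z in 𝓝 (chartAt ℂ x x), s z = (z - chartAt ℂ x x) ^ p * h z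

/-- The order of a complex point. -/
def complexOrder (g : HermitianMetric M) (f : S → M) (x : S) : ℕ :=
  sInf {p | IsComplexOrder g f x p}

/-- The order of an anticomplex point. -/
def anticomplexOrder (g : HermitianMetric M) (f : S → M) (x : S) : ℕ :=
  sInf {p | IsAnticomplexOrder g f x p}

/-- The number of complex points, counted with orders. -/
def numComplex (g : HermitianMetric M) (f : S → M) : ℕ :=
  ∑ᶠ x ∈ complexPoints f, complexOrder g f x

/-- The number of anticomplex points, counted with orders. -/
def numAnticomplex (g : HermitianMetric M) (f : S → M) : ℕ :=
  ∑ᶠ x ∈ anticomplexPoints f, anticomplexOrder g f x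

/-! ### Curvatures -/

/-- The area density of the induced metric: `dA = areaDensity dx ∧ dy`. -/
def areaDensity (g : HermitianMetric M) (f : S → M) (e : OpenPartialHomeomorph S ℂ) (z : ℂ) : ℝ :=
  let G := inducedMetric g f e z z
  √(G 1 1 * G Complex.I Complex.I - G 1 Complex.I ^ 2)

/-- The Gaussian curvature of the induced metric. -/
def gaussCurvature (g : HermitianMetric M) (f : S → M) (e : OpenPartialHomeomorph S ℂ) (z : ℂ) :
    ℝ :=
  let G := inducedMetric g f e z
  G z (curvature (leviCivita G) z 1 Complex.I Complex.I) 1 / areaDensity g f e z ^ 2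

/-- A smooth oriented orthonormal frame of the normal bundle near `z₀`; the orientation of the
normal bundle is such that tangent and normal orientation together give the complex orientation
of `M`. -/
structure IsNormalFrame (g : HermitianMetric M) (f : S → M) (e : OpenPartialHomeomorph S ℂ)
    (z₀ : ℂ) (n : (ℂ → C2) × (ℂ → C2)) : Prop where
  contDiffAt_fst : ContDiffAt ℝ ∞ n.1 z₀
  contDiffAt_snd : ContDiffAt ℝ ∞ n.2 z₀
  normal : ∀ᶠ z in 𝓝 z₀, ∀ a : ℂ,
    localMetric g f e z₀ (localRep f e z₀ z) (fderiv ℝ (localRep f e z₀) z a) (n.1 z) = 0 ∧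
    localMetric g f e z₀ (localRep f e z₀ z) (fderiv ℝ (localRep f e z₀) z a) (n.2 z) = 0
  orthonormal : ∀ᶠ z in 𝓝 z₀, let G := localMetric g f e z₀ (localRep f e z₀ z)
    G (n.1 z) (n.1 z) = 1 ∧ G (n.2 z) (n.2 z) = 1 ∧ G (n.1 z) (n.2 z) = 0
  oriented : ∀ᶠ z in 𝓝 z₀, 0 < Matrix.det (Matrix.of
    ![realCoords (fderiv ℝ (localRep f e z₀) z 1),
      realCoords (fderiv ℝ (localRep f e z₀) z Complex.I), realCoords (n.1 z), realCoords (n.2 z)])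

/-- The normal connection form `ρ^⊥(a) = ⟨D_a n₁, n₂⟩` at `z`, where `D` is the Levi-Civita
connection of `M`. -/
def normalConnectionForm (g : HermitianMetric M) (f : S → M) (e : OpenPartialHomeomorph S ℂ)
    (z₀ : ℂ) (n : (ℂ → C2) × (ℂ → C2)) (z a : ℂ) : ℝ :=
  let F := localRep f e z₀
  let G := localMetric g f e z₀
  G (F z) (fderiv ℝ n.1 z a + leviCivita G (F z) (fderiv ℝ F z a) (n.1 z)) (n.2 z)

/-- The coefficient `dρ(∂_x, ∂_y)` at `z` of the exterior derivative of a 1-form `ρ`. -/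
def extDerivCoeff (ρ : ℂ → ℂ → ℝ) (z : ℂ) : ℝ :=
  fderiv ℝ (fun w => ρ w Complex.I) z 1 - fderiv ℝ (fun w => ρ w 1) z Complex.I

/-- The normal curvature `K^⊥`, determined by `dρ^⊥ = - K^⊥ dA`. It does not depend on the choice of
the normal frame. -/
def normalCurvature (g : HermitianMetric M) (f : S → M) (e : OpenPartialHomeomorph S ℂ) (z₀ : ℂ) :
    ℝ :=
  -extDerivCoeff
      (normalConnectionForm g f e z₀ (Classical.epsilon (IsNormalFrame g f e z₀))) z₀
    / areaDensity g f e z₀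

/-- The coefficient at `z` (with respect to `dx ∧ dy`) of the pull-back by `f` of the first Chern
form `Ric_M / 2π` of the Chern connection. -/
def pullbackFirstChernForm (g : HermitianMetric M) (f : S → M) (e : OpenPartialHomeomorph S ℂ)
    (z : ℂ) : ℝ :=
  let F := localRep f e z
  1 / (2 * Real.pi) * ricciForm (localMetric g f e z) (F z) (fderiv ℝ F z 1)
    (fderiv ℝ F z Complex.I)

/-! ### Integrals over compact Riemann surfaces -/

/-- A smooth partition of unity on a compact Riemann surface, subordinate to the preferred charts. -/
def chartPartition (S : Type*) [TopologicalSpace S] [ChartedSpace ℂ S] [IsManifold 𝓘(ℂ, ℂ) ω S]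
    [T2Space S] [CompactSpace S] : SmoothPartitionOfUnity S 𝓘(ℝ, ℂ) S Set.univ :=
  (SmoothPartitionOfUnity.exists_isSubordinate_chartAt_source 𝓘(ℝ, ℂ) S).choose

variable [IsManifold 𝓘(ℂ, ℂ) ω S] [T2Space S] [CompactSpace S]

/-- The integral over a compact Riemann surface (with the orientation of the complex structure) of
the 2-form whose coefficient with respect to `dx ∧ dy` in the chart `e` is `η e`. -/
def surfaceIntegral (η : OpenPartialHomeomorph S ℂ → ℂ → ℝ) : ℝ :=
  ∑ᶠ x : S, ∫ z in (chartAt ℂ x).target,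
    chartPartition S x ((chartAt ℂ x).symm z) * η (chartAt ℂ x) z

/-- `f*c₁(M)[S]`. -/
def chernNumber (g : HermitianMetric M) (f : S → M) : ℝ :=
  surfaceIntegral fun e z => pullbackFirstChernForm g f e z

/-- The Euler characteristic of the tangent bundle, `(1 / 2π) ∫ K dA`. -/
def eulerTangent (g : HermitianMetric M) (f : S → M) : ℝ :=
  1 / (2 * Real.pi) * surfaceIntegral fun e z => gaussCurvature g f e z * areaDensity g f e z

/-- The Euler characteristic of the normal bundle, `(1 / 2π) ∫ K^⊥ dA`. -/
def eulerNormal (g : HermitianMetric M) (f : S → M) : ℝ :=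
  1 / (2 * Real.pi) * surfaceIntegral fun e z => normalCurvature g f e z * areaDensity g f e z

end Surface

end ChernMinimal

end

/-!
# The Webster formulae for Chern minimal surfaces

In a local coordinate `z` of the surface, and a chart of `M`, the map is a function `F` into `ℂ²`,
with complex derivatives `∂F/∂z` and `∂F/∂z̄`. Conformality says that these two vectors are
orthogonal for the Hermitian metric, so that `∂F/∂z = σ e₁` and `∂F/∂z̄ = τ e₂` for a smooth unitary
frame `e₁, e₂` along `F`, even where one of them vanishes (`IsConformalPatch.exists_frame`). The
complex points are the zeros of `τ`, and the anticomplex points those of `σ`.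

The torsion of the Chern connection has no `(1,1)`-part, so Chern minimality says that the covariant
derivative of `∂F/∂z` along `∂/∂z̄`, and that of `∂F/∂z̄` along `∂/∂z`, vanish. In the frame, these
are linear Cauchy–Riemann equations `∂̄σ = a σ` and `∂̄τ̄ = b τ̄`. By the similarity principle
(`eventually_eq_zero_or_exists_pow_mul`), `σ = exp u · (holomorphic function)` locally, and likewise
for `τ̄`. So either the map is holomorphic or antiholomorphic on the whole connected surface, or the
zeros are isolated and have orders, `q` for `σ` and `p` for `τ̄` (`exists_hasOrders`); by
compactness there are finitely many.

Both formulae are instances of one index formula (`formIntegral_eq_neg_two_pi_mul_sum`): if a smooth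
real 1-form off a finite set agrees, up to a 1-form that extends, with `n d(arg z)` near each point
of that set, then the integral of its exterior derivative is `-2π` times the sum of the indices
`n`. It follows from Stokes' theorem and the Cauchy–Pompeiu formula, with a partition of unity.

* The first 1-form is the connection form of the determinant bundle in the section
  `∂F/∂x ∧ ∂F/∂y`, which is `στ · (e₁ ∧ e₂)` up to a constant and so rotates with index `q - p`. Its
  exterior derivative is the trace of the Chern curvature. This gives `chernNumber_eq`.
* The second 1-form (`eulerForm`) is the connection form of an explicit oriented normal frame
  (`normalField`), which in the frame `e₁, e₂` rotates like `τ σ̄`, with index `-(p + q)`, plus the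
  connection form of the tangent frame `∂/∂x, ∂/∂y`. The exterior derivative of the sum is
  `-(K + K^⊥) dA`. Each summand depends on the coordinate `z`, since both frames turn with it, but
  the sum does not. This gives `eulerTangent_add_eulerNormal_eq`.
-/

noncomputable section

namespace ChernMinimal

/-! ### The Cauchy–Riemann operator -/

section CauchyRiemannOperator

open MeasureTheory Set

/-- The Cauchy–Riemann operator `∂̄ u = (∂_x u + i ∂_y u) / 2`. -/
def dbar (u : ℂ → ℂ) (z : ℂ) : ℂ := (fderiv ℝ u z 1 + Complex.I * fderiv ℝ u z Complex.I) / 2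

theorem dbar_add {u v : ℂ → ℂ} {z : ℂ} (hu : DifferentiableAt ℝ u z)
    (hv : DifferentiableAt ℝ v z) : dbar (fun w => u w + v w) z = dbar u z + dbar v z := by
  simp only [dbar, fderiv_fun_add hu hv, add_apply]; ring

theorem dbar_mul {u v : ℂ → ℂ} {z : ℂ} (hu : DifferentiableAt ℝ u z)
    (hv : DifferentiableAt ℝ v z) :
    dbar (fun w => u w * v w) z = dbar u z * v z + u z * dbar v z := by
  simp only [dbar, fderiv_fun_mul hu hv, add_apply, smul_apply, smul_eq_mul]
  ring

theorem dbar_sum {ι : Type*} {s : Finset ι} {u : ι → ℂ → ℂ} {z : ℂ}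
    (hu : ∀ i ∈ s, DifferentiableAt ℝ (u i) z) :
    dbar (fun w => ∑ i ∈ s, u i w) z = ∑ i ∈ s, dbar (u i) z := by
  simp only [dbar, fderiv_fun_sum hu, sum_apply, Finset.mul_sum,
    ← Finset.sum_add_distrib, ← Finset.sum_div]

theorem dbar_congr {u v : ℂ → ℂ} {z : ℂ} (h : u =ᶠ[𝓝 z] v) : dbar u z = dbar v z := by
  rw [dbar, dbar, h.fderiv_eq]

theorem dbar_eq_zero_of_differentiableAt {u : ℂ → ℂ} {z : ℂ} (hu : DifferentiableAt ℂ u z) :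
    dbar u z = 0 := by
  have h := (hu.hasFDerivAt.restrictScalars ℝ).fderiv
  have h1 : fderiv ℂ u z Complex.I = Complex.I * fderiv ℂ u z 1 := by
    rw [← smul_eq_mul, ← map_smul, smul_eq_mul, mul_one]
  simp only [dbar, h, ContinuousLinearMap.coe_restrictScalars', h1]
  linear_combination (fderiv ℂ u z 1 / 2) * Complex.I_mul_I

theorem differentiableAt_of_dbar_eq_zero {u : ℂ → ℂ} {z : ℂ} (hu : DifferentiableAt ℝ u z)
    (h : dbar u z = 0) : DifferentiableAt ℂ u z := by
  refine (differentiableAt_complex_iff_differentiableAt_real).2 ⟨hu, ?_⟩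
  rw [dbar, div_eq_zero_iff] at h
  have h := h.resolve_right two_ne_zero
  rw [smul_eq_mul]
  linear_combination (-Complex.I) * h + (fderiv ℝ u z Complex.I) * Complex.I_mul_I

theorem fderiv_real_apply_of_differentiableAt {u : ℂ → ℂ} {z : ℂ} (hu : DifferentiableAt ℂ u z)
    (a : ℂ) : fderiv ℝ u z a = deriv u z * a := by
  rw [(hu.hasFDerivAt.restrictScalars ℝ).fderiv, ContinuousLinearMap.coe_restrictScalars',
    fderiv_eq_smul_deriv, smul_eq_mul, mul_comm]

theorem fderiv_real_apply {F : Type*} [NormedAddCommGroup F] [NormedSpace ℝ F] (L : ℂ →L[ℝ] F)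
    (a : ℂ) : L a = a.re • L 1 + a.im • L Complex.I := by
  conv_lhs => rw [← Complex.re_add_im a]
  rw [map_add, ← map_smul, ← map_smul]; simp

theorem dbar_comp {u φ : ℂ → ℂ} {z : ℂ} (hu : DifferentiableAt ℝ u (φ z))
    (hφ : DifferentiableAt ℂ φ z) :
    dbar (fun w => u (φ w)) z = dbar u (φ z) * (starRingEnd ℂ) (deriv φ z) := by
  have h : fderiv ℝ (fun w => u (φ w)) z = (fderiv ℝ u (φ z)).comp (fderiv ℝ φ z) :=
    fderiv_comp z hu (hφ.restrictScalars ℝ)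
  simp only [dbar, h, ContinuousLinearMap.comp_apply, fderiv_real_apply_of_differentiableAt hφ]
  rw [fderiv_real_apply (fderiv ℝ u (φ z)) (deriv φ z * 1),
    fderiv_real_apply (fderiv ℝ u (φ z)) (deriv φ z * Complex.I)]
  generalize deriv φ z = d
  generalize fderiv ℝ u (φ z) 1 = p
  generalize fderiv ℝ u (φ z) Complex.I = q
  rw [show (starRingEnd ℂ) d = d.re - d.im * Complex.I by apply Complex.ext <;> simp]
  simp
  linear_combination (q * d.im / 2) * Complex.I_mul_I

theorem continuousAt_dbar {u : ℂ → ℂ} {z : ℂ} (hu : ContDiffAt ℝ 1 u z) :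
    ContinuousAt (dbar u) z := by
  have h := (hu.fderiv_right (m := 0) (by norm_num)).continuousAt
  unfold dbar
  fun_prop

theorem dbar_hasCompactSupport {u : ℂ → ℂ} (hc : HasCompactSupport u) :
    HasCompactSupport (dbar u) := by
  refine HasCompactSupport.intro hc.isCompact fun z hz => ?_
  have h : u =ᶠ[𝓝 z] fun _ => 0 := notMem_tsupport_iff_eventuallyEq.1 hz
  rw [dbar_congr h]; simp [dbar]

theorem continuous_dbar {u : ℂ → ℂ} (hu : ContDiff ℝ 1 u) : Continuous (dbar u) :=
  continuous_iff_continuousAt.2 fun _ => continuousAt_dbar hu.contDiffAt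

theorem integrable_dbar {u : ℂ → ℂ} (hu : ContDiff ℝ 1 u) (hc : HasCompactSupport u) :
    Integrable (dbar u) :=
  (continuous_dbar hu).integrable_of_hasCompactSupport (dbar_hasCompactSupport hc)

theorem integral_dbar_eq_zero {u : ℂ → ℂ} (hu : ContDiff ℝ 1 u) (hc : HasCompactSupport u) :
    ∫ z, dbar u z = 0 := by
  have hd : ∀ v, Continuous fun z => fderiv ℝ u z v := fun v =>
    (hu.continuous_fderiv one_ne_zero).clm_apply continuous_const
  have hcs : ∀ v, HasCompactSupport fun z => fderiv ℝ u z v := fun v => hc.fderiv_apply ℝ v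
  have hi : ∀ v, Integrable fun z => fderiv ℝ u z v := fun v =>
    (hd v).integrable_of_hasCompactSupport (hcs v)
  have h0 : ∀ v, ∫ z, fderiv ℝ u z v = 0 := by
    intro v
    have := integral_mul_fderiv_eq_neg_fderiv_mul_of_integrable (𝕜 := ℂ) (μ := volume)
      (f := fun _ : ℂ => (1 : ℂ)) (g := u) (v := v)
      (by simp) (by simpa using hi v)
      (by simpa using hu.continuous.integrable_of_hasCompactSupport hc)
      (by simp) (fun x _ => hu.differentiable one_ne_zero x)
    simpa using this
  unfold dbar
  rw [integral_div, integral_add (hi 1) ((hi _).const_mul _), integral_const_mul, h0, h0]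
  simp

theorem locallyIntegrable_inv : LocallyIntegrable (fun z : ℂ => z⁻¹) := by
  rw [locallyIntegrable_iff]
  intro K hK
  obtain ⟨R, hR⟩ := hK.isBounded.subset_closedBall 0
  refine IntegrableOn.mono_set (t := Metric.closedBall 0 R) ⟨by fun_prop, ?_⟩ hR
  rw [HasFiniteIntegral, ← lintegral_indicator measurableSet_closedBall,
    ← Complex.lintegral_comp_polarCoord_symm]
  refine lt_of_le_of_lt (b := ∫⁻ p in Icc (0 : ℝ) R ×ˢ Icc (-Real.pi) Real.pi, 1) ?_ ?_
  · rw [← lintegral_indicator polarCoord.open_target.measurableSet,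
      ← lintegral_indicator (measurableSet_Icc.prod measurableSet_Icc)]
    refine lintegral_mono fun p => ?_
    by_cases h1 : p ∈ polarCoord.target
    swap
    · rw [indicator_of_notMem h1]; exact zero_le
    have hp : 0 < p.1 := h1.1
    rw [indicator_of_mem h1]
    by_cases h2 : Complex.polarCoord.symm p ∈ Metric.closedBall (0 : ℂ) R
    swap
    · rw [indicator_of_notMem h2, smul_zero]; exact zero_le
    have h3 := mem_closedBall_zero_iff.1 h2
    rw [Complex.norm_polarCoord_symm, abs_of_pos hp] at h3
    have h4 : p ∈ Icc (0 : ℝ) R ×ˢ Icc (-Real.pi) Real.pi :=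
      ⟨⟨hp.le, h3⟩, ⟨h1.2.1.le, h1.2.2.le⟩⟩
    rw [indicator_of_mem h2, indicator_of_mem h4,
      enorm_inv (by rw [← norm_ne_zero_iff, Complex.norm_polarCoord_symm]; simpa using hp.ne'),
      smul_eq_mul, ← ofReal_norm, Complex.norm_polarCoord_symm, abs_of_pos hp]
    exact le_of_eq (ENNReal.mul_inv_cancel (by simpa using hp) ENNReal.ofReal_ne_top)
  · rw [setLIntegral_one]
    exact (isCompact_Icc.prod isCompact_Icc).measure_lt_top

theorem integrable_div_of_hasCompactSupport {φ : ℂ → ℂ} (hφ : Continuous φ)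
    (hc : HasCompactSupport φ) : Integrable fun z => φ z / z := by
  have := locallyIntegrable_inv.integrable_smul_left_of_hasCompactSupport hφ hc
  simpa [div_eq_mul_inv] using this

/-- The Cauchy–Pompeiu formula for a function with compact support, at the origin. -/
theorem integral_dbar_div {κ : ℂ → ℂ} (hκ : ContDiff ℝ 1 κ) (hc : HasCompactSupport κ) :
    ∫ z, dbar κ z / z = -Real.pi * κ 0 := by
  set E : ℝ → ℂ := fun θ => Complex.exp (θ * Complex.I) with hE
  have hEc : Continuous E := by fun_prop
  have hdκ := hκ.continuous_fderiv one_ne_zero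
  have hκd : ∀ z, HasFDerivAt κ (fderiv ℝ κ z) z := fun z =>
    (hκ.differentiable one_ne_zero z).hasFDerivAt
  set g : ℂ → ℝ × ℝ → ℂ := fun d p => fderiv ℝ κ (p.1 * E p.2) (d * E p.2) with hg
  have hgc : ∀ d, Continuous (g d) := by intro d; fun_prop
  obtain ⟨R, hR⟩ := (hc.fderiv ℝ).isCompact.isBounded.subset_closedBall 0
  have hnE : ∀ θ, ‖E θ‖ = 1 := fun θ => Complex.norm_exp_ofReal_mul_I θ
  have hg0 : ∀ d (p : ℝ × ℝ), 0 < p.1 → R < p.1 → g d p = 0 := by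
    intro d p hp hpR
    have : fderiv ℝ κ (p.1 * E p.2) = 0 := by
      by_contra hne
      have := hR (subset_tsupport _ hne)
      rw [mem_closedBall_zero_iff, norm_mul, hnE, Complex.norm_real, Real.norm_eq_abs,
        abs_of_pos hp] at this
      linarith
    simp [hg, this]
  have hgi : ∀ d, IntegrableOn (g d) (Ioi (0 : ℝ) ×ˢ Ioo (-Real.pi) Real.pi)
      ((volume : Measure ℝ).prod volume) := by
    intro d
    have h1 : IntegrableOn (g d) (Icc (0 : ℝ) R ×ˢ Icc (-Real.pi) Real.pi)
        ((volume : Measure ℝ).prod volume) :=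
      (hgc d).continuousOn.integrableOn_compact (isCompact_Icc.prod isCompact_Icc)
    refine h1.of_forall_sdiff_eq_zero (measurableSet_Ioi.prod measurableSet_Ioo) ?_
    rintro p ⟨⟨hp1, hp2⟩, hp3⟩
    refine hg0 d p hp1 ?_
    by_contra hle
    exact hp3 ⟨⟨le_of_lt hp1, not_lt.1 hle⟩, ⟨hp2.1.le, hp2.2.le⟩⟩
  have hgi' := fun d => (hgi d).swap
  -- the radial derivative integrates to `-κ 0` along each ray
  have hrad : ∀ θ, ∫ r in Ioi (0 : ℝ), g 1 (r, θ) = -κ 0 := by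
    intro θ
    have hder : ∀ r : ℝ, HasDerivAt (fun r : ℝ => κ (r * E θ)) (g 1 (r, θ)) r := by
      intro r
      have h1 : HasDerivAt (fun r : ℝ => (r : ℂ) * E θ) (1 * E θ) r :=
        (Complex.ofRealCLM.hasDerivAt).mul_const (E θ)
      exact (hκd _).comp_hasDerivAt r h1
    have hsupp : HasCompactSupport fun r : ℝ => κ (r * E θ) := by
      obtain ⟨R', hR'⟩ := hc.isCompact.isBounded.subset_closedBall 0
      refine HasCompactSupport.intro (isCompact_Icc (a := -R') (b := R')) fun r hr => ?_
      by_contra hne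
      have := hR' (subset_tsupport _ hne)
      rw [mem_closedBall_zero_iff, norm_mul, hnE, Complex.norm_real, Real.norm_eq_abs,
        mul_one] at this
      exact hr (abs_le.1 this)
    have hcd : ContDiff ℝ 1 fun r : ℝ => κ (r * E θ) :=
      hκ.comp ((Complex.ofRealCLM.contDiff).mul contDiff_const)
    have := hsupp.integral_Ioi_deriv_eq hcd 0
    simp only [fun r => (hder r).deriv] at this
    simpa using this
  -- the angular derivative integrates to zero along each circle
  have hang : ∀ r ∈ Ioi (0 : ℝ), ∫ θ in Ioo (-Real.pi) Real.pi, g Complex.I (r, θ) = 0 := by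
    intro r hr
    have hr0 : (r : ℂ) ≠ 0 := by exact_mod_cast (ne_of_gt hr)
    have hder : ∀ θ : ℝ, HasDerivAt (fun θ : ℝ => κ (r * E θ)) (r * g Complex.I (r, θ)) θ := by
      intro θ
      have h1 : HasDerivAt (fun θ : ℝ => (r : ℂ) * E θ) (r * (E θ * (1 * Complex.I))) θ :=
        (((Complex.ofRealCLM.hasDerivAt (x := θ)).mul_const Complex.I).cexp).const_mul (r : ℂ)
      refine ((hκd _).comp_hasDerivAt θ h1).congr_deriv ?_
      have : (r : ℂ) * (E θ * (1 * Complex.I)) = r • (Complex.I * E θ) := by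
        rw [Complex.real_smul]; ring
      rw [this, map_smul, Complex.real_smul]
    have hi : IntervalIntegrable (fun θ => r * g Complex.I (r, θ)) volume (-Real.pi) Real.pi := by
      apply Continuous.intervalIntegrable
      have := hgc Complex.I
      fun_prop
    have h2 := intervalIntegral.integral_eq_sub_of_hasDerivAt (fun θ _ => hder θ) hi
    have hEE : E Real.pi = E (-Real.pi) := by
      simp only [hE]; rw [Complex.exp_pi_mul_I]; push_cast
      rw [neg_mul, Complex.exp_neg, Complex.exp_pi_mul_I]; norm_num
    rw [hEE, sub_self, intervalIntegral.integral_const_mul,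
      intervalIntegral.integral_of_le (by linarith [Real.pi_pos]),
      integral_Ioc_eq_integral_Ioo] at h2
    exact (mul_eq_zero.1 h2).resolve_left hr0
  have hI1 : ∫ p in Ioi (0 : ℝ) ×ˢ Ioo (-Real.pi) Real.pi, g 1 p
      ∂((volume : Measure ℝ).prod volume) = -(2 * Real.pi) * κ 0 := by
    rw [← setIntegral_prod_swap]
    refine (setIntegral_prod _ (hgi' 1)).trans ?_
    simp only [Function.comp_def, Prod.swap_prod_mk, hrad]
    rw [setIntegral_const, Measure.real, Real.volume_Ioo, ENNReal.toReal_ofReal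
      (by linarith [Real.pi_pos]), Complex.real_smul]
    push_cast; ring
  have hI2 : ∫ p in Ioi (0 : ℝ) ×ˢ Ioo (-Real.pi) Real.pi, g Complex.I p
      ∂((volume : Measure ℝ).prod volume) = 0 := by
    rw [setIntegral_prod _ (hgi Complex.I), setIntegral_congr_fun measurableSet_Ioi hang]
    simp
  rw [← Complex.integral_comp_polarCoord_symm]
  have hcongr : ∀ p ∈ polarCoord.target,
      p.1 • (dbar κ (Complex.polarCoord.symm p) / Complex.polarCoord.symm p)
        = (g 1 p + Complex.I * g Complex.I p) / 2 := by
    rintro p ⟨hp, -⟩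
    have hp0 : (p.1 : ℂ) ≠ 0 := by exact_mod_cast (ne_of_gt hp)
    have hpe : Complex.polarCoord.symm p = p.1 * E p.2 := by
      rw [Complex.polarCoord_symm_apply, hE]; simp only
      rw [Complex.exp_mul_I]; push_cast; rfl
    have hE0 : E p.2 ≠ 0 := Complex.exp_ne_zero _
    simp only [hpe, hg, dbar]
    rw [fderiv_real_apply _ (1 * E p.2), fderiv_real_apply _ (Complex.I * E p.2),
      Complex.real_smul]
    have hcs : E p.2 = Real.cos p.2 + Real.sin p.2 * Complex.I := by
      simp only [hE]; rw [Complex.exp_mul_I]; push_cast; rfl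
    field_simp
    rw [hcs]
    have hcs1 : ((Real.cos p.2 : ℝ) : ℂ) ^ 2 + ((Real.sin p.2 : ℝ) : ℂ) ^ 2 = 1 := by
      exact_mod_cast Real.cos_sq_add_sin_sq p.2
    generalize (Real.cos p.2) = c at *
    generalize (Real.sin p.2) = s at *
    generalize fderiv ℝ κ _ _ = a
    generalize fderiv ℝ κ _ _ = b
    simp
    linear_combination (-(a + Complex.I * b)) * hcs1 + (a * s ^ 2 - c * s * b) * Complex.I_sq
  rw [setIntegral_congr_fun polarCoord.open_target.measurableSet hcongr, integral_div]
  change (∫ p in Ioi (0 : ℝ) ×ˢ Ioo (-Real.pi) Real.pi, _ ∂((volume : Measure ℝ).prod volume)) / 2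
    = _
  rw [integral_add (hgi 1) ((hgi Complex.I).const_mul _), integral_const_mul, hI1, hI2]
  ring

/-- The convolution of `a` with the Cauchy kernel `1 / (π z)` solves `∂̄ u = a`. -/
theorem exists_dbar_eq {a : ℂ → ℂ} (ha : ContDiff ℝ 2 a) (hc : HasCompactSupport a) :
    ∃ u : ℂ → ℂ, ContDiff ℝ 2 u ∧ ∀ z, dbar u z = a z := by
  set L := ContinuousLinearMap.mul ℝ ℂ
  set k : ℂ → ℂ := fun w => (Real.pi : ℂ)⁻¹ * w⁻¹
  have hk : LocallyIntegrable k := by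
    exact locallyIntegrable_inv.smul (Real.pi : ℂ)⁻¹
  have hpi : (Real.pi : ℂ) ≠ 0 := by exact_mod_cast Real.pi_ne_zero
  refine ⟨convolution k a L volume, hc.contDiff_convolution_right L hk ha, fun z => ?_⟩
  have hd := (hc.hasFDerivAt_convolution_right L hk (ha.of_le (by norm_num)) z).fderiv
  have hex : ConvolutionExistsAt k (fderiv ℝ a) z (L.precompR ℂ) volume :=
    (hc.fderiv ℝ).convolutionExists_right (L.precompR ℂ) hk
      (ha.continuous_fderiv (by norm_num)) z
  have happ : ∀ v, fderiv ℝ (convolution k a L volume) z v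
      = ∫ t, k t * fderiv ℝ a (z - t) v := by
    intro v
    rw [hd, convolution_def, ContinuousLinearMap.integral_apply hex]
    rfl
  have hint : ∀ v, Integrable fun t => k t * fderiv ℝ a (z - t) v := by
    intro v
    exact hex.integrable.apply_continuousLinearMap v
  rw [dbar, happ, happ, ← integral_const_mul, ← integral_add (hint _) ((hint _).const_mul _),
    ← integral_div]
  -- the integrand is the one of the Cauchy–Pompeiu formula for `w ↦ a (z - w)`
  have hb : ∀ w, dbar (fun w => a (z - w)) w = -dbar a (z - w) := by
    intro w
    rw [dbar_comp (u := a) (φ := fun w => z - w) (ha.differentiable (by norm_num) _) (by fun_prop)]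
    have : deriv (fun w => z - w) w = -1 := by simp
    rw [this]; simp
  have hcs : HasCompactSupport fun w => a (z - w) :=
    hc.comp_homeomorph (Homeomorph.subLeft z)
  have hCP := integral_dbar_div (κ := fun w => a (z - w))
    ((ha.of_le (by norm_num)).comp (contDiff_const.sub contDiff_id)) hcs
  simp only [hb, sub_zero] at hCP
  have h3 : ∀ t, (k t * fderiv ℝ a (z - t) 1 + Complex.I * (k t * fderiv ℝ a (z - t) Complex.I)) / 2
      = -(Real.pi : ℂ)⁻¹ * (-dbar a (z - t) / t) := by
    intro t; simp only [k, dbar]; ring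
  simp only [h3]
  rw [integral_const_mul, hCP]
  field_simp

/-- The similarity principle: a solution of `∂̄ σ = a σ` is a holomorphic function up to a factor
without zeros. -/
theorem eventually_eq_zero_or_exists_pow_mul {a σ : ℂ → ℂ} {z₀ : ℂ} (ha : ContDiffAt ℝ 2 a z₀)
    (hσ : ContDiffAt ℝ 2 σ z₀) (h : ∀ᶠ z in 𝓝 z₀, dbar σ z = a z * σ z) :
    (∀ᶠ z in 𝓝 z₀, σ z = 0) ∨ ∃ (p : ℕ) (H : ℂ → ℂ), ContDiffAt ℝ 2 H z₀ ∧ H z₀ ≠ 0 ∧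
      ∀ᶠ z in 𝓝 z₀, σ z = (z - z₀) ^ p * H z := by
  -- cut off `a`, so that `∂̄ u = a` can be solved
  obtain ⟨r, hr, hball⟩ := Metric.eventually_nhds_iff_ball.1 (ha.eventually (by simp))
  let χ : ContDiffBump z₀ := ⟨r / 4, r / 2, by linarith, by linarith⟩
  set A : ℂ → ℂ := fun z => (χ z : ℂ) * a z with hA
  have hAs : HasCompactSupport A := by
    refine HasCompactSupport.intro (isCompact_closedBall z₀ (r / 2)) fun z hz => ?_
    have : χ z = 0 := χ.zero_of_le_dist (by simpa using (not_le.1 hz).le)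
    simp [hA, this]
  have hAc : ContDiff ℝ 2 A := by
    rw [contDiff_iff_contDiffAt]
    intro z
    by_cases hz : z ∈ Metric.ball z₀ r
    · exact (Complex.ofRealCLM.contDiff.contDiffAt.comp z χ.contDiff.contDiffAt).mul (hball z hz)
    · have hz' : A =ᶠ[𝓝 z] fun _ => 0 := by
        have : ∀ᶠ w in 𝓝 z, r / 2 < dist w z₀ := by
          apply (continuous_id.dist continuous_const).continuousAt.eventually_const_lt
          simp only [Metric.mem_ball, not_lt] at hz
          simp only [id]; linarith
        filter_upwards [this] with w hw
        simp [hA, χ.zero_of_le_dist hw.le]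
      exact contDiffAt_const.congr_of_eventuallyEq hz'
  obtain ⟨u, hu, hua⟩ := exists_dbar_eq hAc hAs
  set q : ℂ → ℂ := fun z => σ z * Complex.exp (-u z) with hq
  have hexpd : ∀ z, DifferentiableAt ℝ (fun z => Complex.exp (-u z)) z := by
    intro z
    exact ((hu.neg).cexp).differentiable (by norm_num) z
  have hqd : ∀ᶠ z in 𝓝 z₀, DifferentiableAt ℂ q z := by
    have hχ : ∀ᶠ z in 𝓝 z₀, χ z = 1 := χ.eventuallyEq_one
    filter_upwards [h, hσ.eventually (by simp), hχ] with z hz hσz hχz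
    have hσd : DifferentiableAt ℝ σ z := hσz.differentiableAt (by norm_num)
    refine differentiableAt_of_dbar_eq_zero (hσd.mul (hexpd z)) ?_
    rw [dbar_mul hσd (hexpd z), hz]
    have : dbar (fun z => Complex.exp (-u z)) z = -a z * Complex.exp (-u z) := by
      have hud : DifferentiableAt ℝ u z := hu.differentiable (by norm_num) z
      have h1 := ((hud.hasFDerivAt.neg).cexp).fderiv
      have h2 := hua z
      simp only [hA, hχz, Complex.ofReal_one, one_mul] at h2
      rw [dbar] at h2 ⊢
      simp only [Pi.neg_apply] at h1
      rw [h1]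
      simp only [smul_apply, neg_apply, smul_eq_mul]
      rw [← h2]; ring
    rw [this]; ring
  have han : AnalyticAt ℂ q z₀ := by
    obtain ⟨s, hs, hso, hz⟩ := eventually_nhds_iff.1 hqd
    exact DifferentiableOn.analyticAt (s := s)
      (fun w hw => (hs w hw).differentiableWithinAt) (hso.mem_nhds hz)
  have hσq : ∀ z, σ z = q z * Complex.exp (u z) := by
    intro z; simp only [hq]
    rw [mul_assoc, ← Complex.exp_add]; simp
  by_cases h0 : ∀ᶠ z in 𝓝 z₀, q z = 0
  · left
    filter_upwards [h0] with z hz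
    rw [hσq, hz, zero_mul]
  · right
    obtain ⟨n, G, hG, hG0, hqG⟩ := (han.exists_eventuallyEq_pow_smul_nonzero_iff).2 h0
    refine ⟨n, fun z => G z * Complex.exp (u z), ?_, ?_, ?_⟩
    · exact (hG.contDiffAt.restrict_scalars ℝ).mul hu.cexp.contDiffAt
    · exact mul_ne_zero hG0 (Complex.exp_ne_zero _)
    · filter_upwards [hqG] with z hz
      rw [hσq, hz, smul_eq_mul]; ring

end CauchyRiemannOperator

/-! ### Forms on a compact Riemann surface and their integrals -/

section Transition

variable {E : Type*} [NormedAddCommGroup E] {X : Type*} [TopologicalSpace X]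

theorem mem_transition_source {e e' : OpenPartialHomeomorph X E} {z : E} :
    z ∈ (e.symm ≫ₕ e').source ↔ z ∈ e.target ∧ e.symm z ∈ e'.source := by
  simp

theorem eventually_mem_target_and_source {e e' : OpenPartialHomeomorph X E} {z : E}
    (hz : z ∈ e.target) (hz' : e.symm z ∈ e'.source) :
    ∀ᶠ w in 𝓝 z, w ∈ e.target ∧ e.symm w ∈ e'.source :=
  ((e.symm ≫ₕ e').open_source.eventually_mem (mem_transition_source.2 ⟨hz, hz'⟩)).mono
    fun _ h => mem_transition_source.1 h

variable [NormedSpace ℂ E] [ChartedSpace E X] [IsManifold 𝓘(ℂ, E) ω X]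

theorem contDiffOn_transition {e e' : OpenPartialHomeomorph X E} (he : e ∈ atlas E X)
    (he' : e' ∈ atlas E X) :
    ContDiffOn ℂ ω (fun z => e' (e.symm z)) (e.symm ≫ₕ e').source := by
  have h := (contDiffGroupoid ω 𝓘(ℂ, E)).compatible he he'
  rw [contDiffGroupoid, mem_groupoid_of_pregroupoid] at h
  have h1 : ContDiffOn ℂ ω (𝓘(ℂ, E) ∘ (e.symm ≫ₕ e') ∘ 𝓘(ℂ, E).symm)
    (𝓘(ℂ, E).symm ⁻¹' (e.symm ≫ₕ e').source ∩ Set.range 𝓘(ℂ, E)) := h.1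
  simp only [mfld_simps] at h1 ⊢
  exact h1

theorem contDiffAt_transition {e e' : OpenPartialHomeomorph X E} (he : e ∈ atlas E X)
    (he' : e' ∈ atlas E X) {z : E} (hz : z ∈ e.target) (hz' : e.symm z ∈ e'.source) :
    ContDiffAt ℂ ω (fun z => e' (e.symm z)) z :=
  (contDiffOn_transition he he').contDiffAt
    ((e.symm ≫ₕ e').open_source.mem_nhds (mem_transition_source.2 ⟨hz, hz'⟩))

end Transition

section Forms

open MeasureTheory Set

variable {S : Type*} [TopologicalSpace S] [ChartedSpace ℂ S]

/-- The coordinate change from the preferred chart at `p` to the preferred chart at `q`. -/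
def coordChange (p q : S) (z : ℂ) : ℂ := chartAt ℂ q ((chartAt ℂ p).symm z)

/-- The coefficients `b p` of a real 1-form on `S` away from `Z`, equal to `Re (b p dz)` in the
preferred chart at `p`. -/
def IsOneForm (Z : Set S) (b : S → ℂ → ℂ) : Prop :=
  ∀ p q : S, ∀ z ∈ (chartAt ℂ p).target, (chartAt ℂ p).symm z ∈ (chartAt ℂ q).source →
    (chartAt ℂ p).symm z ∉ Z → b p z = b q (coordChange p q z) * deriv (coordChange p q) z

/-- The coefficients `w p` of a 2-form on `S`, equal to `w p dx ∧ dy` in the preferred chart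
at `p`. -/
def IsTwoForm (w : S → ℂ → ℝ) : Prop :=
  ∀ p q : S, ∀ z ∈ (chartAt ℂ p).target, (chartAt ℂ p).symm z ∈ (chartAt ℂ q).source →
    w p z = ‖deriv (coordChange p q) z‖ ^ 2 * w q (coordChange p q z)

/-- The coefficient with respect to `dx ∧ dy` of the exterior derivative of `Re (b dz)`. -/
def dForm (b : ℂ → ℂ) (z : ℂ) : ℝ := -2 * (dbar b z).im

theorem dForm_add {u v : ℂ → ℂ} {z : ℂ} (hu : DifferentiableAt ℝ u z)
    (hv : DifferentiableAt ℝ v z) : dForm (fun w => u w + v w) z = dForm u z + dForm v z := by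
  simp only [dForm, dbar_add hu hv, Complex.add_im]; ring

theorem dForm_congr {u v : ℂ → ℂ} {z : ℂ} (h : u =ᶠ[𝓝 z] v) : dForm u z = dForm v z := by
  rw [dForm, dForm, dbar_congr h]

theorem dForm_zero (z : ℂ) : dForm (fun _ => 0) z = 0 := by simp [dForm, dbar]

theorem dForm_sum {ι : Type*} {s : Finset ι} {u : ι → ℂ → ℂ} {z : ℂ}
    (hu : ∀ i ∈ s, DifferentiableAt ℝ (u i) z) :
    dForm (fun w => ∑ i ∈ s, u i w) z = ∑ i ∈ s, dForm (u i) z := by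
  simp only [dForm, dbar_sum hu, Complex.im_sum, Finset.mul_sum]

theorem integrable_dForm {u : ℂ → ℂ} (hu : ContDiff ℝ 1 u) (hc : HasCompactSupport u) :
    Integrable (dForm u) :=
  (integrable_dbar hu hc).im.const_mul (-2)

theorem integral_dForm {u : ℂ → ℂ} (hu : Integrable (dbar u)) :
    ∫ z, dForm u z = -2 * (∫ z, dbar u z).im := by
  simp only [dForm, integral_const_mul]
  rw [show ∫ z, (dbar u z).im = _ from integral_im hu]; rfl

variable [IsManifold 𝓘(ℂ, ℂ) ω S]

theorem contDiffAt_coordChange {p q : S} {z : ℂ} (hz : z ∈ (chartAt ℂ p).target)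
    (hz' : (chartAt ℂ p).symm z ∈ (chartAt ℂ q).source) :
    ContDiffAt ℂ ω (coordChange p q) z :=
  contDiffAt_transition (chart_mem_atlas ℂ p) (chart_mem_atlas ℂ q) hz hz'

theorem dForm_of_isOneForm {Z : Set S} (hZ : IsClosed Z) {b : S → ℂ → ℂ} (hb : IsOneForm Z b)
    {p q : S} {z : ℂ} (hz : z ∈ (chartAt ℂ p).target)
    (hz' : (chartAt ℂ p).symm z ∈ (chartAt ℂ q).source) (hzZ : (chartAt ℂ p).symm z ∉ Z)
    (hd : DifferentiableAt ℝ (b q) (coordChange p q z)) :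
    dForm (b p) z = ‖deriv (coordChange p q) z‖ ^ 2 * dForm (b q) (coordChange p q z) := by
  have hφ := contDiffAt_coordChange hz hz'
  have hφd : DifferentiableAt ℂ (coordChange p q) z := hφ.differentiableAt (by simp)
  have hφ' : DifferentiableAt ℂ (deriv (coordChange p q)) z := hφ.analyticAt.deriv.differentiableAt
  have hev : b p =ᶠ[𝓝 z]
      fun w => b q (coordChange p q w) * deriv (coordChange p q) w := by
    filter_upwards [eventually_mem_target_and_source hz hz',
      ((chartAt ℂ p).continuousAt_symm hz).eventually (hZ.isOpen_compl.eventually_mem hzZ)]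
      with w hw hwZ
    exact hb p q w hw.1 hw.2 hwZ
  have hcomp : DifferentiableAt ℝ (fun w => b q (coordChange p q w)) z :=
    hd.comp z (hφd.restrictScalars ℝ)
  rw [dForm_congr hev, dForm, dbar_mul hcomp
    (hφ'.restrictScalars ℝ), dbar_eq_zero_of_differentiableAt hφ', dbar_comp hd hφd, dForm,
    mul_zero, add_zero, mul_assoc, mul_comm ((starRingEnd ℂ) _), Complex.mul_conj,
    Complex.im_mul_ofReal, Complex.normSq_eq_norm_sq]
  ring

variable [T2Space S] [CompactSpace S]

theorem tsupport_chartPartition_subset (x : S) :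
    tsupport (chartPartition S x) ⊆ (chartAt ℂ x).source :=
  (SmoothPartitionOfUnity.exists_isSubordinate_chartAt_source 𝓘(ℝ, ℂ) S).choose_spec x

variable (S) in
/-- The finitely many points of `S` whose function in `chartPartition S` does not vanish. -/
def partitionIndex : Finset S :=
  ((chartPartition S).locallyFinite.finite_nonempty_of_compact).toFinset

theorem chartPartition_eq_zero {x : S} (hx : x ∉ partitionIndex S) (y : S) :
    chartPartition S x y = 0 := by
  by_contra h
  exact hx ((Finite.mem_toFinset _).2 ⟨y, h⟩)

theorem sum_chartPartition (y : S) : ∑ x ∈ partitionIndex S, chartPartition S x y = 1 := by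
  rw [← (chartPartition S).sum_eq_one (mem_univ y)]
  refine (finsum_eq_sum_of_support_subset _ fun x hx => ?_).symm
  by_contra h
  exact hx (chartPartition_eq_zero h y)

theorem contDiffAt_chartPartition (x p : S) {z : ℂ} (hz : z ∈ (chartAt ℂ p).target) :
    ContDiffAt ℝ 1 (fun w => chartPartition S x ((chartAt ℂ p).symm w)) z := by
  have h1 : ContMDiffOn 𝓘(ℝ, ℂ) 𝓘(ℝ) ∞ (fun w => chartPartition S x ((chartAt ℂ p).symm w))
      (chartAt ℂ p).target :=
    (chartPartition S x).contMDiff.comp_contMDiffOn contMDiffOn_chart_symm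
  exact ((contMDiffOn_iff_contDiffOn.1 h1).contDiffAt
    ((chartAt ℂ p).open_target.mem_nhds hz)).of_le (by simp)

/-- The integral over `S` of the 2-form with coefficients `w`. -/
def formIntegral (w : S → ℂ → ℝ) : ℝ :=
  ∑ x ∈ partitionIndex S, ∫ z in (chartAt ℂ x).target,
    chartPartition S x ((chartAt ℂ x).symm z) * w x z

theorem surfaceIntegral_eq_formIntegral (η : OpenPartialHomeomorph S ℂ → ℂ → ℝ) :
    surfaceIntegral η = formIntegral fun x => η (chartAt ℂ x) := by
  refine finsum_eq_sum_of_support_subset _ fun x hx => ?_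
  by_contra h
  refine hx ?_
  simp [chartPartition_eq_zero h]

/-- The integrals in the definition of the integral of a 2-form exist. -/
def IntegrableForm (w : S → ℂ → ℝ) : Prop :=
  ∀ x : S, IntegrableOn (fun z => chartPartition S x ((chartAt ℂ x).symm z) * w x z)
    (chartAt ℂ x).target

theorem IntegrableForm.add {w w' : S → ℂ → ℝ} (h : IntegrableForm w) (h' : IntegrableForm w') :
    IntegrableForm fun x z => w x z + w' x z := fun x => by
  simpa only [mul_add] using! (h x).add (h' x)

theorem IntegrableForm.sum {ι : Type*} {s : Finset ι} {w : ι → S → ℂ → ℝ}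
    (h : ∀ i ∈ s, IntegrableForm (w i)) : IntegrableForm fun x z => ∑ i ∈ s, w i x z := fun x => by
  simpa only [Finset.mul_sum] using! integrable_finsetSum s fun i hi => h i hi x

theorem formIntegral_add {w w' : S → ℂ → ℝ} (h : IntegrableForm w) (h' : IntegrableForm w') :
    formIntegral (fun x z => w x z + w' x z) = formIntegral w + formIntegral w' := by
  simp only [formIntegral, mul_add, ← Finset.sum_add_distrib]
  exact Finset.sum_congr rfl fun x _ => integral_add (h x) (h' x)

theorem formIntegral_sum {ι : Type*} {s : Finset ι} {w : ι → S → ℂ → ℝ}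
    (h : ∀ i ∈ s, IntegrableForm (w i)) :
    formIntegral (fun x z => ∑ i ∈ s, w i x z) = ∑ i ∈ s, formIntegral (w i) := by
  simp only [formIntegral, Finset.mul_sum]
  rw [Finset.sum_comm]
  exact Finset.sum_congr rfl fun x _ => integral_finsetSum s fun i hi => h i hi x

/-- The integral does not see the values at the points of a countable set. -/
theorem formIntegral_congr {w w' : S → ℂ → ℝ} {N : Set S} (hN : N.Countable)
    (h : ∀ x, ∀ z ∈ (chartAt ℂ x).target, (chartAt ℂ x).symm z ∉ N → w x z = w' x z) :
    formIntegral w = formIntegral w' ∧ (IntegrableForm w → IntegrableForm w') := by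
  have hae : ∀ x : S, (fun z => chartPartition S x ((chartAt ℂ x).symm z) * w x z)
      =ᵐ[volume.restrict (chartAt ℂ x).target]
      (fun z => chartPartition S x ((chartAt ℂ x).symm z) * w' x z) := by
    intro x
    have hc : (chartAt ℂ x '' N).Countable := hN.image _
    rw [Filter.EventuallyEq, ae_restrict_iff' (chartAt ℂ x).open_target.measurableSet]
    filter_upwards [(hc.measure_zero volume : volume _ = 0) |> compl_mem_ae_iff.2] with z hz hzt
    rw [h x z hzt fun hzN => hz ⟨_, hzN, (chartAt ℂ x).right_inv hzt⟩]
  exact ⟨Finset.sum_congr rfl fun x _ => integral_congr_ae (hae x),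
    fun hi x => (hi x).congr (hae x)⟩

theorem abs_det_fderiv_of_differentiableAt {φ : ℂ → ℂ} {z : ℂ} (hφ : DifferentiableAt ℂ φ z) :
    |(fderiv ℝ φ z).det| = ‖deriv φ z‖ ^ 2 := by
  have h : (fderiv ℝ φ z : ℂ →ₗ[ℝ] ℂ)
      = ((LinearMap.mulLeft ℂ (deriv φ z) : ℂ →ₗ[ℂ] ℂ)).restrictScalars ℝ := by
    ext a; simp [fderiv_real_apply_of_differentiableAt hφ]
  rw [ContinuousLinearMap.det, h, LinearMap.det_restrictScalars, Algebra.norm_complex_eq]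
  simp [Complex.normSq_eq_norm_sq]

/-- A 2-form that vanishes outside of the domain of one chart can be integrated in that chart. -/
theorem formIntegral_eq_of_chart {w : S → ℂ → ℝ} (hw : IsTwoForm w) (x : S)
    (h0 : ∀ p : S, ∀ z ∈ (chartAt ℂ p).target, (chartAt ℂ p).symm z ∉ (chartAt ℂ x).source →
      w p z = 0)
    (hi : IntegrableOn (w x) (chartAt ℂ x).target) :
    IntegrableForm w ∧ formIntegral w = ∫ z in (chartAt ℂ x).target, w x z := by
  set e := chartAt ℂ x with he
  have hmeas : MeasurableSet e.target := e.open_target.measurableSet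
  -- each integral in the definition, computed in the chart at `x`
  have hi' : ∀ p : S, IntegrableOn (fun z => chartPartition S p (e.symm z) * w x z) e.target := by
    intro p
    refine Integrable.bdd_mul (c := 1) hi ?_ ?_
    · refine ContinuousOn.aestronglyMeasurable ?_ hmeas
      exact fun z hz => (contDiffAt_chartPartition p x hz).continuousAt.continuousWithinAt
    · refine Filter.Eventually.of_forall fun z => ?_
      rw [Real.norm_eq_abs, abs_of_nonneg ((chartPartition S).nonneg p _)]
      exact (chartPartition S).le_one p _
  have key : ∀ p : S,
      IntegrableOn (fun z => chartPartition S p ((chartAt ℂ p).symm z) * w p z)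
        (chartAt ℂ p).target ∧
      ∫ z in (chartAt ℂ p).target, chartPartition S p ((chartAt ℂ p).symm z) * w p z
        = ∫ z in e.target, chartPartition S p (e.symm z) * w x z := by
    intro p
    set φ := (chartAt ℂ p).symm ≫ₕ e with hφ
    have hUm : MeasurableSet φ.source := φ.open_source.measurableSet
    have hsub : φ.source ⊆ (chartAt ℂ p).target := fun z hz => (mem_transition_source.1 hz).1
    have hd : ∀ z ∈ φ.source, DifferentiableAt ℂ φ z := fun z hz =>
      (contDiffAt_coordChange (mem_transition_source.1 hz).1
        (mem_transition_source.1 hz).2).differentiableAt (by simp)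
    have hfd : ∀ z ∈ φ.source, HasFDerivWithinAt φ (fderiv ℝ φ z) φ.source z := fun z hz =>
      ((hd z hz).restrictScalars ℝ).hasFDerivAt.hasFDerivWithinAt
    have himg : φ '' φ.source ⊆ e.target := by
      rw [φ.image_source_eq_target]
      intro z hz
      simp only [hφ, OpenPartialHomeomorph.trans_target] at hz
      exact hz.1
    have hcongr : ∀ z ∈ φ.source,
        |(fderiv ℝ φ z).det| • (chartPartition S p (e.symm (φ z)) * w x (φ z))
          = chartPartition S p ((chartAt ℂ p).symm z) * w p z := by
      intro z hz
      have hz' := mem_transition_source.1 hz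
      have h1 : e.symm (φ z) = (chartAt ℂ p).symm z := e.left_inv hz'.2
      rw [abs_det_fderiv_of_differentiableAt (hd z hz), hw p x z hz'.1 hz'.2, h1, smul_eq_mul]
      change ‖deriv (coordChange p x) z‖ ^ 2 * (_ * w x (coordChange p x z)) = _
      ring
    have hoff1 : ∀ z ∈ (chartAt ℂ p).target \ φ.source,
        chartPartition S p ((chartAt ℂ p).symm z) * w p z = 0 := by
      rintro z ⟨hz, hz'⟩
      rw [h0 p z hz fun h => hz' (mem_transition_source.2 ⟨hz, h⟩), mul_zero]
    have hoff2 : ∀ z ∈ e.target \ (φ '' φ.source), chartPartition S p (e.symm z) * w x z = 0 := by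
      rintro z ⟨hz, hz'⟩
      have : chartPartition S p (e.symm z) = 0 := by
        by_contra hne
        have hs := tsupport_chartPartition_subset p (subset_tsupport _ hne)
        refine hz' ?_
        rw [φ.image_source_eq_target]
        simpa [hφ, OpenPartialHomeomorph.trans_target, hz] using hs
      rw [this, zero_mul]
    refine ⟨?_, ?_⟩
    · refine IntegrableOn.of_forall_sdiff_eq_zero (s := φ.source) ?_
        (chartAt ℂ p).open_target.measurableSet hoff1
      have := (integrableOn_image_iff_integrableOn_abs_det_fderiv_smul volume hUm hfd φ.injOn
        fun z => chartPartition S p (e.symm z) * w x z).1 ((hi' p).mono_set himg)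
      exact this.congr_fun hcongr hUm
    · rw [setIntegral_eq_of_subset_of_forall_sdiff_eq_zero
        (chartAt ℂ p).open_target.measurableSet hsub hoff1,
        setIntegral_eq_of_subset_of_forall_sdiff_eq_zero hmeas himg hoff2,
        integral_image_eq_integral_abs_det_fderiv_smul volume hUm hfd φ.injOn]
      exact (setIntegral_congr_fun hUm hcongr).symm
  refine ⟨fun p => (key p).1, ?_⟩
  rw [formIntegral, Finset.sum_congr rfl fun p _ => (key p).2,
    ← integral_finsetSum _ fun p _ => hi' p]
  congr 1
  funext z
  rw [← Finset.sum_mul, sum_chartPartition, one_mul]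

end Forms

section Stokes

open MeasureTheory Set

variable {S : Type*} [TopologicalSpace S] [ChartedSpace ℂ S] [IsManifold 𝓘(ℂ, ℂ) ω S]
  [T2Space S]

/-- A cut-off function near `x`, as a function `κ` of the coordinate and as a function `K` on the
surface, that vanishes near the other points of `Z`. -/
theorem exists_cutoff (Z : Finset S) (x : S) {P : ℂ → Prop} (hP : ∀ᶠ z in 𝓝 (chartAt ℂ x x), P z) :
    ∃ (K : S → ℂ) (κ : ℂ → ℂ), ContDiff ℝ 1 κ ∧ HasCompactSupport κ ∧
      (∀ z ∈ tsupport κ, z ∈ (chartAt ℂ x).target ∧ P z) ∧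
      (∀ᶠ z in 𝓝 (chartAt ℂ x x), κ z = 1) ∧
      (∀ z ∈ (chartAt ℂ x).target, K ((chartAt ℂ x).symm z) = κ z) ∧
      (∀ y, y ∉ (chartAt ℂ x).source → ∀ᶠ y' in 𝓝 y, K y' = 0) ∧
      (∀ p : S, ∀ z ∈ (chartAt ℂ p).target,
        ContDiffAt ℝ 1 (fun w => K ((chartAt ℂ p).symm w)) z) ∧
      (∀ x' ∈ Z, x' ≠ x → ∀ᶠ y in 𝓝 x', K y = 0) ∧ ∀ᶠ y in 𝓝 x, K y = 1 := by
  classical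
  set e := chartAt ℂ x with he
  have hxs : x ∈ e.source := mem_chart_source ℂ x
  have hxt : e x ∈ e.target := e.map_source hxs
  have hZ : ∀ᶠ z in 𝓝 (e x), e.symm z ∉ (Z.erase x : Finset S) := by
    have hc : ContinuousAt e.symm (e x) := e.continuousAt_symm hxt
    have h2 : IsOpen ((Z.erase x : Finset S) : Set S)ᶜ :=
      ((Z.erase x).finite_toSet.isClosed).isOpen_compl
    refine hc.eventually (h2.eventually_mem ?_)
    rw [e.left_inv hxs]; simp
  obtain ⟨r, hr, hball⟩ := Metric.eventually_nhds_iff_ball.1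
    ((e.open_target.eventually_mem hxt).and (hZ.and hP))
  let χ : ContDiffBump (e x) := ⟨r / 4, r / 2, by linarith, by linarith⟩
  have hχs : tsupport χ ⊆ Metric.ball (e x) r := by
    rw [χ.tsupport_eq]; exact Metric.closedBall_subset_ball (by change r / 2 < r; linarith)
  set κ : ℂ → ℂ := fun z => (χ z : ℂ) with hκ
  have hκs : tsupport κ ⊆ tsupport χ := by
    refine closure_mono fun z hz => ?_
    simp only [Function.mem_support, hκ, ne_eq, Complex.ofReal_eq_zero] at hz ⊢
    exact hz
  have hκc : ContDiff ℝ 1 κ := Complex.ofRealCLM.contDiff.comp χ.contDiff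
  have hC : IsCompact (e.symm '' tsupport χ) :=
    χ.hasCompactSupport.isCompact.image_of_continuousOn
      (e.continuousOn_symm.mono fun z hz => (hball z (hχs hz)).1)
  set K : S → ℂ := fun y => if y ∈ e.source then κ (e y) else 0 with hK
  have hK0 : ∀ y, y ∉ e.symm '' tsupport χ → ∀ᶠ y' in 𝓝 y, K y' = 0 := by
    intro y hy
    filter_upwards [hC.isClosed.isOpen_compl.mem_nhds hy] with y' hy'
    by_cases h : y' ∈ e.source
    · simp only [hK, if_pos h, hκ]
      have : χ (e y') = 0 := by
        by_contra hne
        exact hy' ⟨e y', subset_tsupport _ hne, e.left_inv h⟩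
      rw [this]; rfl
    · simp only [hK, if_neg h]
  have hKe : ∀ z ∈ e.target, K (e.symm z) = κ z := fun z hz => by
    simp only [hK, if_pos (e.map_target hz), e.right_inv hz]
  have h1 : ∀ᶠ z in 𝓝 (e x), κ z = 1 := by
    filter_upwards [χ.eventuallyEq_one] with z hz
    simp only [hκ, hz]; simp
  refine ⟨K, κ, hκc, χ.hasCompactSupport.isCompact.of_isClosed_subset (isClosed_tsupport _) hκs,
    fun z hz => ⟨(hball z (hχs (hκs hz))).1, (hball z (hχs (hκs hz))).2.2⟩, h1, hKe, ?_, ?_, ?_, ?_⟩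
  · intro y hy
    refine hK0 y ?_
    rintro ⟨z, hz, rfl⟩
    exact hy (e.map_target (hball z (hχs hz)).1)
  · intro p z hz
    by_cases hy : (chartAt ℂ p).symm z ∈ e.source
    · have hφ : ContDiffAt ℝ 1 (coordChange p x) z :=
        ((contDiffAt_coordChange hz hy).restrict_scalars ℝ).of_le (by simp)
      refine (hκc.contDiffAt.comp z hφ).congr_of_eventuallyEq ?_
      filter_upwards [eventually_mem_target_and_source hz hy] with w hw
      simp only [hK, if_pos hw.2]; rfl
    · refine contDiffAt_const (c := (0 : ℂ)) |>.congr_of_eventuallyEq ?_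
      refine ((chartAt ℂ p).continuousAt_symm hz).eventually (hK0 _ ?_)
      rintro ⟨w, hw, hw'⟩
      exact hy (hw' ▸ e.map_target (hball w (hχs hw)).1)
  · intro x' hx' hne
    refine hK0 x' ?_
    rintro ⟨w, hw, rfl⟩
    exact (hball w (hχs hw)).2.1 (Finset.mem_erase.2 ⟨hne, hx'⟩)
  · filter_upwards [(e.continuousAt hxs).eventually h1, e.open_source.mem_nhds hxs] with y hy hys
    simp only [hK, if_pos hys, hy]

variable [CompactSpace S]

/-- A function on the target of the chart `e` extends by zero from a compact set. -/
theorem contDiff_indicator {s K : Set ℂ} {u : ℂ → ℂ} (hs : IsOpen s) (hK : IsCompact K)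
    (hu : ∀ z ∈ s, ContDiffAt ℝ 1 u z) (hKs : K ⊆ s) (h0 : ∀ z ∈ s, z ∉ K → u z = 0) :
    ContDiff ℝ 1 (s.indicator u) ∧ HasCompactSupport (s.indicator u) ∧
      ∀ z ∈ s, s.indicator u =ᶠ[𝓝 z] u := by
  have hz0 : ∀ z, z ∉ K → s.indicator u z = 0 := by
    intro z hz
    by_cases h : z ∈ s
    · rw [indicator_of_mem h, h0 z h hz]
    · rw [indicator_of_notMem h]
  have hev : ∀ z ∈ s, s.indicator u =ᶠ[𝓝 z] u := fun z hz => by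
    filter_upwards [hs.mem_nhds hz] with w hw
    rw [indicator_of_mem hw]
  refine ⟨contDiff_iff_contDiffAt.2 fun z => ?_, HasCompactSupport.intro hK hz0, hev⟩
  by_cases hz : z ∈ s
  · exact (hu z hz).congr_of_eventuallyEq (hev z hz)
  · refine contDiffAt_const (c := (0 : ℂ)) |>.congr_of_eventuallyEq ?_
    filter_upwards [hK.isClosed.isOpen_compl.mem_nhds fun h => hz (hKs h)] with w hw
    exact hz0 w hw

theorem integral_dForm_of_isCompact {s K : Set ℂ} {u : ℂ → ℂ} (hs : IsOpen s) (hK : IsCompact K)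
    (hu : ∀ z ∈ s, ContDiffAt ℝ 1 u z) (hKs : K ⊆ s) (h0 : ∀ z ∈ s, z ∉ K → u z = 0) :
    IntegrableOn (dForm u) s ∧ ∫ z in s, dForm u z = 0 := by
  obtain ⟨h1, h2, h3⟩ := contDiff_indicator hs hK hu hKs h0
  have heq : ∀ z ∈ s, dForm (s.indicator u) z = dForm u z := fun z hz => dForm_congr (h3 z hz)
  have hi := integrable_dForm h1 h2
  refine ⟨hi.integrableOn.congr_fun heq hs.measurableSet, ?_⟩
  rw [← setIntegral_congr_fun hs.measurableSet heq,
    setIntegral_eq_integral_of_forall_compl_eq_zero, integral_dForm (integrable_dbar h1 h2),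
    integral_dbar_eq_zero h1 h2]
  · simp
  · intro z hz
    have : s.indicator u =ᶠ[𝓝 z] fun _ => 0 := by
      filter_upwards [hK.isClosed.isOpen_compl.mem_nhds fun h => hz (hKs h)] with w hw
      by_cases h : w ∈ s
      · rw [indicator_of_mem h, h0 w h hw]
      · rw [indicator_of_notMem h]
    rw [dForm_congr this, dForm_zero]

/-- Stokes' theorem on a compact Riemann surface. -/
theorem formIntegral_dForm {b : S → ℂ → ℂ} (hb : IsOneForm ∅ b)
    (hsm : ∀ p : S, ∀ z ∈ (chartAt ℂ p).target, ContDiffAt ℝ 1 (b p) z) :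
    IntegrableForm (fun p => dForm (b p)) ∧ formIntegral (fun p => dForm (b p)) = 0 := by
  set ρ : S → S → ℂ := fun q y => (chartPartition S q y : ℂ) with hρ
  set β : S → S → ℂ → ℂ := fun q p z => ρ q ((chartAt ℂ p).symm z) * b p z with hβ
  have hρs : ∀ q p : S, ∀ z ∈ (chartAt ℂ p).target,
      ContDiffAt ℝ 1 (fun w => ρ q ((chartAt ℂ p).symm w)) z := fun q p z hz =>
    Complex.ofRealCLM.contDiff.contDiffAt.comp z (contDiffAt_chartPartition q p hz)
  have hβs : ∀ q p : S, ∀ z ∈ (chartAt ℂ p).target, ContDiffAt ℝ 1 (β q p) z :=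
    fun q p z hz => (hρs q p z hz).mul (hsm p z hz)
  have hβf : ∀ q : S, IsOneForm ∅ (β q) := by
    intro q p p' z hz hz' h
    simp only [hβ]
    rw [hb p p' z hz hz' h, coordChange, (chartAt ℂ p').left_inv hz']
    ring
  have hpiece : ∀ q : S, IntegrableForm (fun p => dForm (β q p)) ∧
      formIntegral (fun p => dForm (β q p)) = 0 := by
    intro q
    have hK : IsCompact (chartAt ℂ q '' tsupport (chartPartition S q)) :=
      (isClosed_tsupport _).isCompact.image_of_continuousOn
        ((chartAt ℂ q).continuousOn.mono (tsupport_chartPartition_subset q))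
    have hstokes := integral_dForm_of_isCompact (u := β q q) (chartAt ℂ q).open_target hK
      (hβs q q) (by
        rintro _ ⟨y, hy, rfl⟩
        exact (chartAt ℂ q).map_source (tsupport_chartPartition_subset q hy)) (by
        intro z hz hzK
        have : chartPartition S q ((chartAt ℂ q).symm z) = 0 := by
          by_contra hne
          exact hzK ⟨_, subset_tsupport _ hne, (chartAt ℂ q).right_inv hz⟩
        simp [hβ, hρ, this])
    have := formIntegral_eq_of_chart (w := fun p => dForm (β q p)) (fun p p' z hz hz' =>
        dForm_of_isOneForm isClosed_empty (hβf q) hz hz' (notMem_empty _)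
          ((hβs q p' _ ((chartAt ℂ p').map_source hz')).differentiableAt one_ne_zero)) q
      (by
        intro p z hz hzq
        have hev : β q p =ᶠ[𝓝 z] fun _ => 0 := by
          have h1 : (chartAt ℂ p).symm z ∉ tsupport (chartPartition S q) := fun h =>
            hzq (tsupport_chartPartition_subset q h)
          have h2 := notMem_tsupport_iff_eventuallyEq.1 h1
          filter_upwards [((chartAt ℂ p).continuousAt_symm hz).eventually h2] with w hw
          simp [hβ, hρ, hw]
        rw [dForm_congr hev, dForm_zero])
      hstokes.1
    exact ⟨this.1, this.2.trans hstokes.2⟩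
  have hsum : ∀ p : S, ∀ z ∈ (chartAt ℂ p).target, (chartAt ℂ p).symm z ∉ (∅ : Set S) →
      ∑ q ∈ partitionIndex S, dForm (β q p) z = dForm (b p) z := by
    intro p z hz _
    rw [← dForm_sum fun q _ => (hβs q p z hz).differentiableAt one_ne_zero]
    congr 1
    funext w
    simp only [hβ, hρ, ← Finset.sum_mul]
    rw [← Complex.ofReal_sum, sum_chartPartition, Complex.ofReal_one, one_mul]
  have hcongr := formIntegral_congr countable_empty hsum
  refine ⟨hcongr.2 (IntegrableForm.sum fun q _ => (hpiece q).1), ?_⟩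
  rw [← hcongr.1, formIntegral_sum fun q _ => (hpiece q).1]
  exact Finset.sum_eq_zero fun q _ => (hpiece q).2

/-- The index formula: let `b` be a 1-form with singularities `n dθ` at finitely many points, and
let `w` be the 2-form `db`. Then `∫ w = - 2π ∑ n`. -/
theorem formIntegral_eq_neg_two_pi_mul_sum (Z : Finset S) {b : S → ℂ → ℂ} (hb : IsOneForm Z b)
    (hsm : ∀ p : S, ∀ z ∈ (chartAt ℂ p).target, (chartAt ℂ p).symm z ∉ Z →
      ContDiffAt ℝ 1 (b p) z)
    (n : S → ℝ)
    (hsing : ∀ x ∈ Z, ∃ b' : ℂ → ℂ, ContDiffAt ℝ 1 b' (chartAt ℂ x x) ∧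
      ∀ᶠ z in 𝓝[≠] (chartAt ℂ x x), b x z = b' z - Complex.I * n x / (z - chartAt ℂ x x))
    {w : S → ℂ → ℝ}
    (hw : ∀ p : S, ∀ z ∈ (chartAt ℂ p).target, (chartAt ℂ p).symm z ∉ Z →
      w p z = dForm (b p) z) :
    IntegrableForm w ∧ formIntegral w = -2 * Real.pi * ∑ x ∈ Z, n x := by
  classical
  choose! b' hb's hb'e using hsing
  have hcut : ∀ x ∈ Z, _ := fun x hx => exists_cutoff Z x
    (((hb's x hx).eventually (by simp)).and (eventually_nhdsWithin_iff.1 (hb'e x hx)))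
  choose! K κ hκc hκs hκt hκ1 hKκ hK0 hKc hKZ hK1 using hcut
  have hZc : IsClosed (Z : Set S) := Z.finite_toSet.isClosed
  -- the part of `b` away from the singularities
  set β : S → ℂ → ℂ := fun p z => (1 - ∑ x ∈ Z, K x ((chartAt ℂ p).symm z)) * b p z with hβ
  have hβ0 : ∀ (p : S) (z : ℂ), z ∈ (chartAt ℂ p).target → (chartAt ℂ p).symm z ∈ Z →
      β p =ᶠ[𝓝 z] fun _ => 0 := by
    intro p z hz hzZ
    have hev : ∀ᶠ y in 𝓝 ((chartAt ℂ p).symm z), ∑ x ∈ Z, K x y = 1 := by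
      have h1 : ∀ x ∈ Z, ∀ᶠ y in 𝓝 ((chartAt ℂ p).symm z),
          K x y = if x = (chartAt ℂ p).symm z then 1 else 0 := by
        intro x hx
        split_ifs with h
        · rw [← h]; exact hK1 x hx
        · exact hKZ x hx _ hzZ (Ne.symm h)
      filter_upwards [(Filter.eventually_all_finset Z).2 h1] with y hy
      rw [Finset.sum_congr rfl hy, Finset.sum_ite_eq' Z, if_pos hzZ]
    filter_upwards [((chartAt ℂ p).continuousAt_symm hz).eventually hev] with z' hz'
    simp only [hβ, hz', sub_self, zero_mul]
  have hβs : ∀ p : S, ∀ z ∈ (chartAt ℂ p).target, ContDiffAt ℝ 1 (β p) z := by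
    intro p z hz
    by_cases hzZ : (chartAt ℂ p).symm z ∈ Z
    · exact contDiffAt_const.congr_of_eventuallyEq (hβ0 p z hz hzZ)
    · exact (contDiffAt_const.sub (ContDiffAt.sum fun x hx => hKc x hx p z hz)).mul
        (hsm p z hz hzZ)
  have hβf : IsOneForm ∅ β := by
    intro p q z hz hzq _
    by_cases hzZ : (chartAt ℂ p).symm z ∈ Z
    · rw [(hβ0 p z hz hzZ).self_of_nhds]
      have := (hβ0 q (coordChange p q z) ((chartAt ℂ q).map_source hzq)
        (by rw [coordChange, (chartAt ℂ q).left_inv hzq]; exact hzZ)).self_of_nhds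
      rw [this, zero_mul]
    · simp only [hβ]
      rw [hb p q z hz hzq hzZ, coordChange, (chartAt ℂ q).left_inv hzq]
      ring
  obtain ⟨hβi, hβ⟩ := formIntegral_dForm hβf hβs
  -- the parts of `w` near the singularities
  set γ : S → S → ℂ → ℂ := fun x p z => K x ((chartAt ℂ p).symm z) * b p z with hγ
  have hγs : ∀ x ∈ Z, ∀ p : S, ∀ z ∈ (chartAt ℂ p).target, (chartAt ℂ p).symm z ∉ Z →
      ContDiffAt ℝ 1 (γ x p) z := fun x hx p z hz hzZ => (hKc x hx p z hz).mul (hsm p z hz hzZ)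
  set ν : S → S → ℂ → ℝ := fun x p z =>
    if (chartAt ℂ p).symm z ∈ Z then 0 else dForm (γ x p) z with hν
  have hνf : ∀ x ∈ Z, IsTwoForm (ν x) := by
    intro x hx p q z hz hzq
    have h1 : (chartAt ℂ q).symm (coordChange p q z) = (chartAt ℂ p).symm z := by
      rw [coordChange, (chartAt ℂ q).left_inv hzq]
    simp only [hν, h1]
    split_ifs with hzZ
    · rw [mul_zero]
    · refine dForm_of_isOneForm hZc ?_ hz hzq hzZ
        ((hγs x hx q _ ((chartAt ℂ q).map_source hzq) (by
          change (chartAt ℂ q).symm (coordChange p q z) ∉ Z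
          rwa [h1])).differentiableAt one_ne_zero)
      intro p q z hz hzq hzZ
      simp only [hγ]
      rw [hb p q z hz hzq hzZ, coordChange, (chartAt ℂ q).left_inv hzq]
      ring
  have hpiece : ∀ x ∈ Z, IntegrableForm (ν x) ∧ formIntegral (ν x) = -2 * Real.pi * n x := by
    intro x hx
    set e := chartAt ℂ x with he
    have hxt : e x ∈ e.target := e.map_source (mem_chart_source ℂ x)
    have hκb : ∀ z ∈ e.target, ContDiffAt ℝ 1 (fun z => κ x z * b' x z) z := by
      intro z _
      by_cases hz : z ∈ tsupport (κ x)
      · exact (hκc x hx).contDiffAt.mul (hκt x hx z hz).2.1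
      · refine contDiffAt_const (c := (0 : ℂ)) |>.congr_of_eventuallyEq ?_
        filter_upwards [notMem_tsupport_iff_eventuallyEq.1 hz] with z' hz'
        simp [hz']
    obtain ⟨hi1, hI1⟩ := integral_dForm_of_isCompact (u := fun z => κ x z * b' x z) e.open_target
      (hκs x hx).isCompact hκb (fun z hz => (hκt x hx z hz).1)
      (fun z _ hz => by simp [image_eq_zero_of_notMem_tsupport hz])
    -- the singular part is evaluated with the Cauchy–Pompeiu formula
    set h : ℂ → ℂ := fun z => dbar (κ x) z / (z - e x) with hh
    have hshift : ∀ z, dbar (fun z => κ x (z + e x)) z = dbar (κ x) (z + e x) := by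
      intro z
      rw [dbar_comp (u := κ x) (φ := fun z => z + e x)
        ((hκc x hx).differentiable one_ne_zero _) (by fun_prop)]
      simp
    have hsc : HasCompactSupport fun z => κ x (z + e x) :=
      (hκs x hx).comp_homeomorph (Homeomorph.addRight (e x))
    have hscd : ContDiff ℝ 1 fun z => κ x (z + e x) :=
      (hκc x hx).comp (contDiff_id.add contDiff_const)
    have hhI : Integrable h ∧ ∫ z, h z = -Real.pi := by
      have h1 := integrable_div_of_hasCompactSupport (continuous_dbar hscd)
        (dbar_hasCompactSupport hsc)
      have h2 := integral_dbar_div hscd hsc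
      simp only [hshift, zero_add] at h1 h2
      have h3 : ∀ z, dbar (κ x) (z + e x) / z = h (z + e x) := by intro z; simp [hh]
      simp only [h3] at h1 h2
      rw [(hκ1 x hx).self_of_nhds, mul_one, integral_add_right_eq_self] at h2
      refine ⟨?_, h2⟩
      simpa using h1.comp_sub_right (e x)
    have hhs : ∀ z, z ∉ e.target → h z = 0 := by
      intro z hz
      have : z ∉ tsupport (dbar (κ x)) := by
        intro hz'
        have hsub : tsupport (dbar (κ x)) ⊆ tsupport (κ x) := by
          refine closure_minimal (fun y hy => ?_) (isClosed_tsupport _)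
          by_contra hy'
          have := notMem_tsupport_iff_eventuallyEq.1 hy'
          refine hy ?_
          rw [dbar_congr (v := fun _ => 0) this]
          simp [dbar]
        exact hz (hκt x hx z (hsub hz')).1
      simp [hh, image_eq_zero_of_notMem_tsupport this]
    have hform : ∀ z ∈ e.target, z ≠ e x → ν x x z
        = dForm (fun z => κ x z * b' x z) z + 2 * n x * (h z).re := by
      intro z hz hzx
      have hzκ : ContDiffAt ℝ 1 (κ x) z := (hκc x hx).contDiffAt
      by_cases hzs : z ∈ tsupport (κ x)
      swap
      · have hκ0 : κ x =ᶠ[𝓝 z] fun _ => 0 := notMem_tsupport_iff_eventuallyEq.1 hzs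
        have hd0 : dbar (κ x) z = 0 := by rw [dbar_congr hκ0]; simp [dbar]
        have e1 : (fun z => κ x z * b' x z) =ᶠ[𝓝 z] fun _ => 0 := by
          filter_upwards [hκ0] with y hy; simp [hy]
        have e2 : γ x x =ᶠ[𝓝 z] fun _ => 0 := by
          filter_upwards [hκ0, e.open_target.mem_nhds hz] with y hy hyt
          simp only [hγ]
          rw [hKκ x hx y hyt, hy, zero_mul]
        rw [dForm_congr e1, dForm_zero]
        simp only [hν, hh, hd0, zero_div, Complex.zero_re, mul_zero, add_zero]
        split_ifs
        · rfl
        · rw [dForm_congr e2, dForm_zero]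
      -- `κ` has its support in a disc that contains no other point of `Z`
      have hzZ : e.symm z ∉ Z := by
        intro hzZ
        have hne : e.symm z ≠ x := fun h => hzx (by rw [← h, e.right_inv hz])
        refine (notMem_tsupport_iff_eventuallyEq (f := κ x)).2 ?_ hzs
        filter_upwards [(e.continuousAt_symm hz).eventually (hKZ x hx _ hzZ hne),
          e.open_target.mem_nhds hz] with y hy hyt
        rw [← hKκ x hx y hyt, hy]; rfl
      set s : ℂ → ℂ := fun z => -Complex.I * n x / (z - e x) with hs
      have hsd : DifferentiableAt ℂ s z :=
        (differentiableAt_const _).div (by fun_prop) (sub_ne_zero.2 hzx)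
      have hev : γ x x =ᶠ[𝓝 z] fun z => κ x z * b' x z + κ x z * s z := by
        filter_upwards [e.open_target.mem_nhds hz, isOpen_ne.mem_nhds hzx] with y hyt hyx
        simp only [hγ, hs]
        rw [hKκ x hx y hyt]
        by_cases hys : y ∈ tsupport (κ x)
        · rw [(hκt x hx y hys).2.2 hyx]; ring
        · rw [image_eq_zero_of_notMem_tsupport hys]; simp
      have hκd := hzκ.differentiableAt one_ne_zero
      have e1 : dForm (fun z => κ x z * s z) z = 2 * n x * (h z).re := by
        rw [dForm, dbar_mul hκd (hsd.restrictScalars ℝ), dbar_eq_zero_of_differentiableAt hsd,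
          mul_zero, add_zero]
        have : dbar (κ x) z * s z = ((-n x : ℝ) : ℂ) * (Complex.I * h z) := by
          simp only [hs, hh]; push_cast; ring
        rw [this, Complex.im_ofReal_mul, Complex.I_mul_im]
        ring
      have h2 : ν x x z = dForm (γ x x) z := if_neg hzZ
      have h3 : DifferentiableAt ℝ (fun z => κ x z * s z) z := hκd.mul (hsd.restrictScalars ℝ)
      rw [h2, dForm_congr hev, dForm_add ((hκb z hz).differentiableAt one_ne_zero) h3, e1]
    have hae : (fun z => dForm (fun z => κ x z * b' x z) z + 2 * n x * (h z).re)
        =ᵐ[volume.restrict e.target] ν x x := by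
      rw [Filter.EventuallyEq, ae_restrict_iff' e.open_target.measurableSet]
      filter_upwards [compl_mem_ae_iff.2 (measure_singleton (e x) : volume {e x} = 0)]
        with z hz hzt
      exact (hform z hzt hz).symm
    have hhi : IntegrableOn (fun z => 2 * n x * (h z).re) e.target :=
      (hhI.1.re.const_mul _).integrableOn
    obtain ⟨hi, hI⟩ := formIntegral_eq_of_chart (hνf x hx) x (by
      intro p z hz hzx
      have hev : γ x p =ᶠ[𝓝 z] fun _ => 0 := by
        filter_upwards [((chartAt ℂ p).continuousAt_symm hz).eventually (hK0 x hx _ hzx)]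
          with y hy
        simp [hγ, hy]
      simp only [hν]
      split_ifs
      · rfl
      · rw [dForm_congr hev, dForm_zero]) (Integrable.congr (hi1.add hhi) hae)
    refine ⟨hi, ?_⟩
    rw [hI, ← integral_congr_ae hae, integral_add hi1 hhi, hI1, zero_add, integral_const_mul,
      setIntegral_eq_integral_of_forall_compl_eq_zero fun z hz => by rw [hhs z hz]; rfl,
      show ∫ z, (h z).re = _ from integral_re hhI.1, hhI.2]
    simp; ring
  have hdecomp : ∀ p : S, ∀ z ∈ (chartAt ℂ p).target, (chartAt ℂ p).symm z ∉ (Z : Set S) →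
      dForm (β p) z + ∑ x ∈ Z, ν x p z = w p z := by
    intro p z hz hzZ
    rw [hw p z hz hzZ]
    have : ∀ x ∈ Z, ν x p z = dForm (γ x p) z := fun x _ => if_neg hzZ
    rw [Finset.sum_congr rfl this,
      ← dForm_sum fun x hx => (hγs x hx p z hz hzZ).differentiableAt one_ne_zero, ← dForm_add
      ((hβs p z hz).differentiableAt one_ne_zero)
      (DifferentiableAt.fun_sum fun x hx => (hγs x hx p z hz hzZ).differentiableAt one_ne_zero)]
    congr 1
    funext z'
    simp only [hγ, ← Finset.sum_mul]
    ring
  obtain ⟨hc1, hc2⟩ := formIntegral_congr (Z.finite_toSet.countable) hdecomp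
  have hsi := IntegrableForm.sum fun x hx => (hpiece x hx).1
  refine ⟨hc2 (hβi.add hsi), ?_⟩
  rw [← hc1, formIntegral_add hβi hsi, formIntegral_sum fun x hx => (hpiece x hx).1, hβ,
    Finset.sum_congr rfl fun x hx => (hpiece x hx).2, zero_add, Finset.mul_sum]

end Stokes

/-! ### The Levi-Civita and the Chern connection in coordinates -/

section Inverse

variable {V : Type*} [NormedAddCommGroup V] [NormedSpace ℝ V]

theorem eq_of_forall_apply_eq {B : V →L[ℝ] V →L[ℝ] ℝ} (hpos : ∀ v, v ≠ 0 → 0 < B v v) {a b : V}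
    (h : ∀ w, B a w = B b w) : a = b := by
  by_contra hne
  have := hpos (a - b) (sub_ne_zero.2 hne)
  rw [B.map_sub, sub_apply, h, sub_self] at this
  exact lt_irrefl _ this

variable [FiniteDimensional ℝ V]

theorem isInvertible_of_pos {B : V →L[ℝ] V →L[ℝ] ℝ} (hpos : ∀ v, v ≠ 0 → 0 < B v v) :
    B.IsInvertible := by
  have hinj : Function.Injective B := by
    intro u v h
    by_contra hne
    have := hpos (u - v) (sub_ne_zero.2 hne)
    rw [B.map_sub, h, sub_self] at this
    simp at this
  have hfr : Module.finrank ℝ V = Module.finrank ℝ (V →L[ℝ] ℝ) := by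
    rw [← (LinearMap.toContinuousLinearMap (𝕜 := ℝ) (E := V) (F' := ℝ)).finrank_eq]
    exact (Subspace.dual_finrank_eq).symm
  let A : V ≃ₗ[ℝ] (V →L[ℝ] ℝ) :=
    LinearEquiv.ofInjectiveOfFinrankEq (B : V →ₗ[ℝ] (V →L[ℝ] ℝ)) hinj hfr
  exact ⟨A.toContinuousLinearEquiv, by ext u v; rfl⟩

theorem apply_inverse_of_pos {B : V →L[ℝ] V →L[ℝ] ℝ} (hpos : ∀ v, v ≠ 0 → 0 < B v v)
    (l : V →L[ℝ] ℝ) : B (B.inverse l) = l := by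
  obtain ⟨A, hA⟩ := isInvertible_of_pos hpos
  rw [← hA, ContinuousLinearMap.inverse_equiv]; simp

end Inverse

section Pullback

variable {V : Type*} [NormedAddCommGroup V] [NormedSpace ℝ V]

theorem hasFDerivAt_clm_apply₂ {E : Type*} [NormedAddCommGroup E] [NormedSpace ℝ E]
    {B : E → V →L[ℝ] V →L[ℝ] ℝ} {X Y : E → V} {z : E} (hB : DifferentiableAt ℝ B z)
    (hX : DifferentiableAt ℝ X z) (hY : DifferentiableAt ℝ Y z) (a : E) :
    fderiv ℝ (fun z => B z (X z) (Y z)) z a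
      = fderiv ℝ B z a (X z) (Y z) + B z (fderiv ℝ X z a) (Y z) + B z (X z) (fderiv ℝ Y z a) := by
  have h := ((hB.hasFDerivAt.clm_apply hX.hasFDerivAt).clm_apply hY.hasFDerivAt).fderiv
  rw [h]
  simp
  ring

/-- The derivative of a metric that is the pull-back of `G'` by `ψ`. -/
theorem fderiv_pullback {G G' : V → V →L[ℝ] V →L[ℝ] ℝ} {ψ : V → V} {q : V}
    (hG : DifferentiableAt ℝ G q) (hG' : DifferentiableAt ℝ G' (ψ q)) (hψ : ContDiffAt ℝ 2 ψ q)
    (h : ∀ᶠ p in 𝓝 q, ∀ u v, G p u v = G' (ψ p) (fderiv ℝ ψ p u) (fderiv ℝ ψ p v)) (u v w : V) :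
    fderiv ℝ G q u v w = fderiv ℝ G' (ψ q) (fderiv ℝ ψ q u) (fderiv ℝ ψ q v) (fderiv ℝ ψ q w)
      + G' (ψ q) (fderiv ℝ (fderiv ℝ ψ) q u v) (fderiv ℝ ψ q w)
      + G' (ψ q) (fderiv ℝ ψ q v) (fderiv ℝ (fderiv ℝ ψ) q u w) := by
  have hψd : DifferentiableAt ℝ ψ q := hψ.differentiableAt (by norm_num)
  have hψ' : DifferentiableAt ℝ (fderiv ℝ ψ) q :=
    (hψ.fderiv_right (m := 1) (by norm_num)).differentiableAt one_ne_zero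
  have hc : ∀ v, DifferentiableAt ℝ (fun p => fderiv ℝ ψ p v) q := fun v =>
    hψ'.clm_apply (differentiableAt_const v)
  have hc' : ∀ v u, fderiv ℝ (fun p => fderiv ℝ ψ p v) q u = fderiv ℝ (fderiv ℝ ψ) q u v := by
    intro v u
    rw [(hψ'.hasFDerivAt.clm_apply (hasFDerivAt_const v q)).fderiv]
    simp
  have h1 : fderiv ℝ (fun p => G p v w) q u = fderiv ℝ G q u v w := by
    rw [hasFDerivAt_clm_apply₂ hG (differentiableAt_const v) (differentiableAt_const w)]
    simp
  have h2 : (fun p => G p v w)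
      =ᶠ[𝓝 q] fun p => G' (ψ p) (fderiv ℝ ψ p v) (fderiv ℝ ψ p w) := h.mono fun p hp => hp v w
  have h3 : DifferentiableAt ℝ (fun p => G' (ψ p)) q :=
    DifferentiableAt.comp (G := V →L[ℝ] V →L[ℝ] ℝ) (g := G') q hG' hψd
  have h4 : fderiv ℝ (fun p => G' (ψ p)) q = (fderiv ℝ G' (ψ q)).comp (fderiv ℝ ψ q) :=
    fderiv_comp (G := V →L[ℝ] V →L[ℝ] ℝ) (g := G') q hG' hψd
  rw [← h1, h2.fderiv_eq, hasFDerivAt_clm_apply₂ h3 (hc v) (hc w), hc', hc', h4]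
  rfl

end Pullback

section Connections

variable {V : Type*} [NormedAddCommGroup V] [NormedSpace ℝ V]

/-- `G` is a Riemannian metric near `q`, given there by a differentiable function. -/
structure IsMetricAt (G : V → V →L[ℝ] V →L[ℝ] ℝ) (q : V) : Prop where
  differentiableAt : DifferentiableAt ℝ G q
  symm : ∀ᶠ p in 𝓝 q, ∀ u v, G p u v = G p v u
  pos : ∀ v, v ≠ 0 → 0 < G q v v

theorem IsMetricAt.fderiv_symm {G : V → V →L[ℝ] V →L[ℝ] ℝ} {q : V} (h : IsMetricAt G q)
    (u v w : V) : fderiv ℝ G q u v w = fderiv ℝ G q u w v := by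
  have h1 : ∀ v w, fderiv ℝ (fun p => G p v w) q u = fderiv ℝ G q u v w := by
    intro v w
    rw [hasFDerivAt_clm_apply₂ h.differentiableAt (differentiableAt_const v)
      (differentiableAt_const w)]
    simp
  have h2 : (fun p => G p v w) =ᶠ[𝓝 q] fun p => G p w v := h.symm.mono fun p hp => hp v w
  rw [← h1, h2.fderiv_eq, h1]

/-- The connections `Γ` and `Γ'` correspond to each other under the coordinate change `ψ`
at `q`. -/
def ConnectionsRelated (Γ Γ' : V → V → V → V) (ψ : V → V) (q : V) : Prop :=
  ∀ u v, Γ' (ψ q) (fderiv ℝ ψ q u) (fderiv ℝ ψ q v)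
    = fderiv ℝ ψ q (Γ q u v) - fderiv ℝ (fderiv ℝ ψ) q u v

/-- The covariant derivative in the direction `a` of the vector field `X` along `F`. -/
def cov (Γ : V → V → V → V) (F X : ℂ → V) (z a : ℂ) : V :=
  fderiv ℝ X z a + Γ (F z) (fderiv ℝ F z a) (X z)

theorem cov_of_connectionsRelated {Γ Γ' : V → V → V → V} {ψ : V → V} {F F' X X' : ℂ → V} {z : ℂ}
    (h : ConnectionsRelated Γ Γ' ψ (F z)) (hψ : ContDiffAt ℝ 2 ψ (F z))
    (hF : DifferentiableAt ℝ F z) (hX : DifferentiableAt ℝ X z)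
    (hF' : F' =ᶠ[𝓝 z] fun z => ψ (F z)) (hX' : X' =ᶠ[𝓝 z] fun z => fderiv ℝ ψ (F z) (X z))
    (a : ℂ) : cov Γ' F' X' z a = fderiv ℝ ψ (F z) (cov Γ F X z a) := by
  have hψd : DifferentiableAt ℝ ψ (F z) := hψ.differentiableAt (by norm_num)
  have hψ' : DifferentiableAt ℝ (fderiv ℝ ψ) (F z) :=
    (hψ.fderiv_right (m := 1) (by norm_num)).differentiableAt one_ne_zero
  have h1 : fderiv ℝ F' z a = fderiv ℝ ψ (F z) (fderiv ℝ F z a) := by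
    rw [hF'.fderiv_eq]
    exact congrArg (fun L : ℂ →L[ℝ] V => L a) (fderiv_comp z hψd hF)
  have h2 : fderiv ℝ X' z a = fderiv ℝ (fderiv ℝ ψ) (F z) (fderiv ℝ F z a) (X z)
      + fderiv ℝ ψ (F z) (fderiv ℝ X z a) := by
    have h3 : HasFDerivAt (fun z => fderiv ℝ ψ (F z)) _ z := hψ'.hasFDerivAt.comp z hF.hasFDerivAt
    rw [hX'.fderiv_eq, (h3.clm_apply hX.hasFDerivAt).fderiv]
    simp [add_comm]
  simp only [cov, h1, h2, hF'.self_of_nhds, hX'.self_of_nhds]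
  rw [h, map_add]
  abel

theorem leviCivita_add_right (G : V → V →L[ℝ] V →L[ℝ] ℝ) (q u v v' : V) :
    leviCivita G q u (v + v') = leviCivita G q u v + leviCivita G q u v' := by
  simp only [leviCivita, ← map_add, ← smul_add]
  congr 2
  ext w
  simp
  ring

theorem leviCivita_smul_right (G : V → V →L[ℝ] V →L[ℝ] ℝ) (q u v : V) (c : ℝ) :
    leviCivita G q u (c • v) = c • leviCivita G q u v := by
  simp only [leviCivita, ← map_smul, smul_comm c (1 / 2 : ℝ)]
  congr 2
  ext w
  simp
  ring

variable [FiniteDimensional ℝ V]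

theorem IsMetricAt.leviCivita_apply {G : V → V →L[ℝ] V →L[ℝ] ℝ} {q : V} (h : IsMetricAt G q)
    (u v w : V) : G q (leviCivita G q u v) w
      = (1 / 2) * (fderiv ℝ G q u v w + fderiv ℝ G q v u w - fderiv ℝ G q w u v) := by
  rw [leviCivita, apply_inverse_of_pos h.pos]; rfl

theorem IsMetricAt.leviCivita_metric {G : V → V →L[ℝ] V →L[ℝ] ℝ} {q : V} (h : IsMetricAt G q)
    (u v w : V) :
    fderiv ℝ G q u v w = G q (leviCivita G q u v) w + G q v (leviCivita G q u w) := by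
  rw [h.symm.self_of_nhds v, h.leviCivita_apply, h.leviCivita_apply, h.fderiv_symm u w v,
    h.fderiv_symm v u w, h.fderiv_symm w u v]
  ring

theorem connectionsRelated_leviCivita {G G' : V → V →L[ℝ] V →L[ℝ] ℝ} {ψ : V → V} {q : V}
    (hG : IsMetricAt G q) (hG' : IsMetricAt G' (ψ q)) (hψ : ContDiffAt ℝ 2 ψ q)
    (h : ∀ᶠ p in 𝓝 q, ∀ u v, G p u v = G' (ψ p) (fderiv ℝ ψ p u) (fderiv ℝ ψ p v))
    (hsurj : Function.Surjective (fderiv ℝ ψ q)) :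
    ConnectionsRelated (leviCivita G) (leviCivita G') ψ q := by
  intro u v
  refine eq_of_forall_apply_eq hG'.pos fun w' => ?_
  obtain ⟨w, rfl⟩ := hsurj w'
  have hp := fderiv_pullback hG.differentiableAt hG'.differentiableAt hψ h
  have hs : ∀ u v, fderiv ℝ (fderiv ℝ ψ) q u v = fderiv ℝ (fderiv ℝ ψ) q v u := fun u v =>
    (hψ.isSymmSndFDerivAt (by simp)).eq u v
  have hs' := hG'.symm.self_of_nhds
  have hΓ := hG.leviCivita_apply u v w
  rw [h.self_of_nhds, hp, hp, hp] at hΓ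
  rw [map_sub, sub_apply, hΓ, hG'.leviCivita_apply, hs v u, hs w u, hs w v,
    hs' (fderiv ℝ ψ q v) (fderiv ℝ (fderiv ℝ ψ) q u w),
    hs' (fderiv ℝ ψ q u) (fderiv ℝ (fderiv ℝ ψ) q v w)]
  ring

end Connections

section Chern

variable {V : Type*} [NormedAddCommGroup V] [NormedSpace ℝ V] [NormedSpace ℂ V]
  [IsScalarTower ℝ ℂ V]

theorem map_smul_real {V W : Type*} [NormedAddCommGroup V] [NormedSpace ℝ V]
    [NormedAddCommGroup W] [NormedSpace ℝ W] (L : V →L[ℝ] W) (c : ℝ) (v : V) :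
    L (c • v) = c • L v := map_smul L c v

theorem chern_add_right (G : V → V →L[ℝ] V →L[ℝ] ℝ) (q u v v' : V) :
    chern G q u (v + v') = chern G q u v + chern G q u v' := by
  simp only [chern, ← map_add, ← smul_add]
  congr 2
  ext w
  simp only [add_apply, ContinuousLinearMap.comp_apply, map_add, mulI_apply]
  ring

theorem chern_add_left (G : V → V →L[ℝ] V →L[ℝ] ℝ) (q u u' v : V) :
    chern G q (u + u') v = chern G q u v + chern G q u' v := by
  simp only [chern, ← map_add, ← smul_add]
  congr 2
  ext w
  simp only [add_apply, ContinuousLinearMap.comp_apply, map_add, mulI_apply, smul_add]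
  ring

theorem chern_smul_left_real (G : V → V →L[ℝ] V →L[ℝ] ℝ) (q u v : V) (c : ℝ) :
    chern G q (c • u) v = c • chern G q u v := by
  have h : ∀ x, fderiv ℝ G q (c • x) = c • fderiv ℝ G q x := fun x => (fderiv ℝ G q).map_smul c x
  rw [chern, chern, smul_comm Complex.I c u, h, h, ← map_smul_real]
  congr 1
  ext w
  simp only [add_apply, smul_apply, smul_eq_mul, ContinuousLinearMap.comp_apply, mulI_apply]
  ring

theorem chern_smul_right_real (G : V → V →L[ℝ] V →L[ℝ] ℝ) (q u v : V) (c : ℝ) :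
    chern G q u (c • v) = c • chern G q u v := by
  simp only [chern, ← map_smul, smul_comm c (1 / 2 : ℝ)]
  congr 2
  ext w
  simp only [add_apply, smul_apply, smul_eq_mul, ContinuousLinearMap.comp_apply, mulI_apply,
    map_smul_real]
  ring

/-- `G` is a Hermitian metric near `q`, given there by a differentiable function. -/
structure IsHermitianAt (G : V → V →L[ℝ] V →L[ℝ] ℝ) (q : V) : Prop extends IsMetricAt G q where
  complex : ∀ᶠ p in 𝓝 q, ∀ u v, G p (Complex.I • u) (Complex.I • v) = G p u v

theorem I_smul_I_smul (v : V) : Complex.I • Complex.I • v = -v := by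
  rw [smul_smul, Complex.I_mul_I, neg_one_smul]

theorem complex_smul_eq (c : ℂ) (v : V) : c • v = c.re • v + c.im • Complex.I • v := by
  have h : ∀ (r : ℝ) (x : V), (r : ℂ) • x = r • x := fun r x => algebraMap_smul ℂ r x
  conv_lhs => rw [← Complex.re_add_im c]
  rw [add_smul, mul_smul, h, h]

theorem apply_I_smul_left {B : V →L[ℝ] V →L[ℝ] ℝ}
    (hB : ∀ u v, B (Complex.I • u) (Complex.I • v) = B u v) (u v : V) :
    B (Complex.I • u) v = -B u (Complex.I • v) := by
  rw [← hB u, I_smul_I_smul, map_neg, neg_neg]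

variable [FiniteDimensional ℝ V] {G : V → V →L[ℝ] V →L[ℝ] ℝ} {q : V}

theorem IsHermitianAt.chern_apply (h : IsHermitianAt G q) (u v w : V) :
    G q (chern G q u v) w
      = (1 / 2) * (fderiv ℝ G q u v w + fderiv ℝ G q (Complex.I • u) v (Complex.I • w)) := by
  rw [chern, apply_inverse_of_pos h.pos]; rfl

theorem IsHermitianAt.chern_I_smul_left (h : IsHermitianAt G q) (u v : V) :
    chern G q (Complex.I • u) v = Complex.I • chern G q u v := by
  refine eq_of_forall_apply_eq h.pos fun w => ?_
  rw [apply_I_smul_left h.complex.self_of_nhds, h.chern_apply, h.chern_apply, I_smul_I_smul,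
    I_smul_I_smul, map_neg, map_neg, neg_apply, neg_apply]
  ring

theorem IsHermitianAt.chern_I_smul_right (h : IsHermitianAt G q) (u v : V) :
    chern G q u (Complex.I • v) = Complex.I • chern G q u v := by
  obtain ⟨Γ, hΓ, hch, -⟩ := chern_spec G q h.differentiableAt h.symm h.pos h.complex
  rw [← hΓ, ← hΓ, hch.preserves_complex_structure]

theorem IsHermitianAt.chern_smul_left (h : IsHermitianAt G q) (c : ℂ) (u v : V) :
    chern G q (c • u) v = c • chern G q u v := by
  rw [complex_smul_eq c u, chern_add_left, chern_smul_left_real, chern_smul_left_real,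
    h.chern_I_smul_left, ← complex_smul_eq]

theorem IsHermitianAt.chern_smul_right (h : IsHermitianAt G q) (c : ℂ) (u v : V) :
    chern G q u (c • v) = c • chern G q u v := by
  rw [complex_smul_eq c v, chern_add_right, chern_smul_right_real, chern_smul_right_real,
    h.chern_I_smul_right, ← complex_smul_eq]

/-- The Chern connection is natural under holomorphic coordinate changes. -/
theorem connectionsRelated_chern {G' : V → V →L[ℝ] V →L[ℝ] ℝ} {ψ : V → V}
    (hG : IsHermitianAt G q) (hG' : IsHermitianAt G' (ψ q)) (hψ : ContDiffAt ℂ 2 ψ q)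
    (h : ∀ᶠ p in 𝓝 q, ∀ u v, G p u v = G' (ψ p) (fderiv ℝ ψ p u) (fderiv ℝ ψ p v))
    (hsurj : Function.Surjective (fderiv ℝ ψ q)) :
    ConnectionsRelated (chern G) (chern G') ψ q := by
  intro u v
  refine eq_of_forall_apply_eq hG'.pos fun w' => ?_
  obtain ⟨w, rfl⟩ := hsurj w'
  have hψr : ContDiffAt ℝ 2 ψ q := hψ.restrict_scalars ℝ
  have hp := fderiv_pullback hG.differentiableAt hG'.differentiableAt hψr h
  have hs : ∀ u v, fderiv ℝ (fderiv ℝ ψ) q u v = fderiv ℝ (fderiv ℝ ψ) q v u := fun u v =>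
    (hψr.isSymmSndFDerivAt (by simp)).eq u v
  have hI : ∀ᶠ p in 𝓝 q, ∀ u, fderiv ℝ ψ p (Complex.I • u) = Complex.I • fderiv ℝ ψ p u := by
    filter_upwards [hψ.eventually (by simp)] with p hp u
    rw [((hp.differentiableAt (by norm_num)).hasFDerivAt.restrictScalars ℝ).fderiv]
    simp
  have hψ' : DifferentiableAt ℝ (fderiv ℝ ψ) q :=
    (hψr.fderiv_right (m := 1) (by norm_num)).differentiableAt one_ne_zero
  have hc' : ∀ v u, fderiv ℝ (fun p => fderiv ℝ ψ p v) q u = fderiv ℝ (fderiv ℝ ψ) q u v := by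
    intro v u
    rw [(hψ'.hasFDerivAt.clm_apply (hasFDerivAt_const v q)).fderiv]
    simp
  have hDI : ∀ u v, fderiv ℝ (fderiv ℝ ψ) q u (Complex.I • v)
      = Complex.I • fderiv ℝ (fderiv ℝ ψ) q u v := by
    intro u v
    have h1 : (fun p => fderiv ℝ ψ p (Complex.I • v))
        =ᶠ[𝓝 q] fun p => mulI V (fderiv ℝ ψ p v) := hI.mono fun p hp => hp v
    rw [← hc', h1.fderiv_eq, ← hc' v u]
    have h2 : DifferentiableAt ℝ (fun p => fderiv ℝ ψ p v) q :=
      hψ'.clm_apply (differentiableAt_const v)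
    have h3 : HasFDerivAt (fun p => mulI V (fderiv ℝ ψ p v)) _ q :=
      (mulI V).hasFDerivAt.comp q h2.hasFDerivAt
    rw [h3.fderiv]
    rfl
  have hDI' : ∀ u v, fderiv ℝ (fderiv ℝ ψ) q (Complex.I • u) v
      = Complex.I • fderiv ℝ (fderiv ℝ ψ) q u v := by
    intro u v; rw [hs, hDI, hs]
  have hΓ := hG.chern_apply u v w
  have hJ := hG'.complex.self_of_nhds
  rw [h.self_of_nhds, hp, hp] at hΓ
  simp only [hI.self_of_nhds, hDI, hDI', I_smul_I_smul, hJ] at hΓ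
  rw [map_sub, sub_apply, hΓ, hG'.chern_apply, map_neg (G' (ψ q) (fderiv ℝ ψ q v))]
  ring

end Chern

/-! ### Coordinate expressions of metrics and maps in arbitrary charts -/

section Transition

variable {E : Type*} [NormedAddCommGroup E] [NormedSpace ℝ E] [NormedSpace ℂ E]
  [IsScalarTower ℝ ℂ E] {X : Type*} [TopologicalSpace X] [ChartedSpace E X]
  [IsManifold 𝓘(ℂ, E) ω X]

/-- The real derivative at `z` of the coordinate change from `e` to `e'`. -/
def dTrans (e e' : OpenPartialHomeomorph X E) (z : E) : E →L[ℝ] E :=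
  fderiv ℝ (fun w => e' (e.symm w)) z

theorem dTrans_I_smul {e e' : OpenPartialHomeomorph X E} (he : e ∈ atlas E X)
    (he' : e' ∈ atlas E X) {z : E} (hz : z ∈ e.target) (hz' : e.symm z ∈ e'.source) (a : E) :
    dTrans e e' z (Complex.I • a) = Complex.I • dTrans e e' z a := by
  have h := (contDiffAt_transition he he' hz hz').differentiableAt (by simp)
  rw [dTrans, (h.hasFDerivAt.restrictScalars ℝ).fderiv]
  simp

theorem contDiffAt_transition_real {e e' : OpenPartialHomeomorph X E} (he : e ∈ atlas E X)
    (he' : e' ∈ atlas E X) {z : E} (hz : z ∈ e.target) (hz' : e.symm z ∈ e'.source) :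
    ContDiffAt ℝ ∞ (fun z => e' (e.symm z)) z :=
  ((contDiffAt_transition he he' hz hz').restrict_scalars ℝ).of_le (by simp)

theorem dTrans_dTrans {e e' e'' : OpenPartialHomeomorph X E} (he : e ∈ atlas E X)
    (he' : e' ∈ atlas E X) (he'' : e'' ∈ atlas E X) {z : E} (hz : z ∈ e.target)
    (hz' : e.symm z ∈ e'.source) (hz'' : e.symm z ∈ e''.source) (a : E) :
    dTrans e' e'' (e' (e.symm z)) (dTrans e e' z a) = dTrans e e'' z a := by
  have h1 := (contDiffAt_transition_real he he' hz hz').differentiableAt (by simp)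
  have h2 := (contDiffAt_transition_real he' he'' (e'.map_source hz')
    (by rwa [e'.left_inv hz'])).differentiableAt (by simp)
  have h3 : (fun w => e'' (e.symm w)) =ᶠ[𝓝 z]
      (fun w => e'' (e'.symm w)) ∘ fun w => e' (e.symm w) := by
    filter_upwards [eventually_mem_target_and_source hz hz'] with w hw
    simp [e'.left_inv hw.2]
  rw [dTrans, dTrans, dTrans, h3.fderiv_eq, fderiv_comp z h2 h1]
  rfl

theorem dTrans_self {e : OpenPartialHomeomorph X E} {z : E} (hz : z ∈ e.target) (a : E) :
    dTrans e e z a = a := by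
  have h : (fun w => e (e.symm w)) =ᶠ[𝓝 z] fun w => w := by
    filter_upwards [e.open_target.mem_nhds hz] with w hw
    exact e.right_inv hw
  rw [dTrans, h.fderiv_eq]
  simp

theorem dTrans_dTrans_symm {e e' : OpenPartialHomeomorph X E} (he : e ∈ atlas E X)
    (he' : e' ∈ atlas E X) {z : E} (hz : z ∈ e.target) (hz' : e.symm z ∈ e'.source) (a : E) :
    dTrans e' e (e' (e.symm z)) (dTrans e e' z a) = a := by
  rw [dTrans_dTrans he he' he hz hz' (e.map_target hz), dTrans_self hz]

theorem bijective_dTrans {e e' : OpenPartialHomeomorph X E} (he : e ∈ atlas E X)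
    (he' : e' ∈ atlas E X) {z : E} (hz : z ∈ e.target) (hz' : e.symm z ∈ e'.source) :
    Function.Bijective (dTrans e e' z) := by
  refine ⟨Function.LeftInverse.injective (dTrans_dTrans_symm he he' hz hz'),
    Function.RightInverse.surjective (g := dTrans e' e (e' (e.symm z))) fun a => ?_⟩
  have := dTrans_dTrans_symm he' he (e'.map_source hz') (by rw [e'.left_inv hz']
                                                            exact e.map_target hz) a
  rwa [e'.left_inv hz', e.right_inv hz] at this

theorem mfderiv_symm_eq_dTrans {e : OpenPartialHomeomorph X E} (he : e ∈ atlas E X) {q : E}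
    (hq : q ∈ e.target) :
    mfderiv 𝓘(ℝ, E) 𝓘(ℝ, E) e.symm q = dTrans e (chartAt E (e.symm q)) q := by
  have hm : MDifferentiableAt 𝓘(ℝ, E) 𝓘(ℝ, E) e.symm q :=
    ((contMDiffOn_symm_of_mem_maximalAtlas (I := 𝓘(ℝ, E)) (n := ∞)
      (IsManifold.subset_maximalAtlas he)).contMDiffAt
        (e.open_target.mem_nhds hq)).mdifferentiableAt (by simp)
  rw [hm.mfderiv]
  simp only [mfld_simps, fderivWithin_univ]
  rfl

theorem mfderiv_eq_fderiv {Y : Type*} {E' : Type*} [NormedAddCommGroup E'] [NormedSpace ℝ E']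
    [TopologicalSpace Y] [ChartedSpace E' Y] {f : Y → X} {x : Y}
    (hf : MDifferentiableAt 𝓘(ℝ, E') 𝓘(ℝ, E) f x) :
    mfderiv 𝓘(ℝ, E') 𝓘(ℝ, E) f x
      = fderiv ℝ (fun z => chartAt E (f x) (f ((chartAt E' x).symm z))) (chartAt E' x x) := by
  rw [hf.mfderiv]
  simp only [mfld_simps, fderivWithin_univ]
  rfl

/-- The coordinate vector fields are smooth. -/
theorem contMDiffOn_coordinateField {e : OpenPartialHomeomorph X E} (he : e ∈ atlas E X) (u : E) :
    ContMDiffOn 𝓘(ℝ, E) (𝓘(ℝ, E).prod 𝓘(ℝ, E)) ∞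
      (fun q => Bundle.TotalSpace.mk' E (E := fun m : X => TangentSpace 𝓘(ℝ, E) m) (e.symm q)
        (mfderiv 𝓘(ℝ, E) 𝓘(ℝ, E) e.symm q u)) e.target := by
  have h1 := (contMDiffOn_symm_of_mem_maximalAtlas (I := 𝓘(ℝ, E)) (n := ∞)
    (IsManifold.subset_maximalAtlas he)).contMDiffOn_tangentMapWithin (m := ∞) (by simp)
    e.open_target.uniqueMDiffOn
  have h2 : ContMDiff 𝓘(ℝ, E) (𝓘(ℝ, E).prod 𝓘(ℝ, E)) ∞
      (fun q : E => Bundle.TotalSpace.mk' E (E := fun m : E => TangentSpace 𝓘(ℝ, E) m) q u) := by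
    intro q
    exact contMDiffAt_vectorSpace_iff_contDiffAt.2 contDiffAt_const
  refine (h1.comp h2.contMDiffOn (s := e.target) (fun q hq => hq)).congr fun q hq => ?_
  simp only [Function.comp, tangentMapWithin]
  rw [mfderivWithin_of_isOpen e.open_target hq]

end Transition

section Metric

variable {M : Type*} [TopologicalSpace M] [ChartedSpace C2 M] [IsManifold 𝓘(ℂ, C2) ω M]

/-- `G` is a smooth Hermitian metric on the open set `U`. -/
structure IsHermitianOn (U : Set C2) (G : C2 → C2 →L[ℝ] C2 →L[ℝ] ℝ) : Prop where
  isOpen : IsOpen U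
  contDiffOn : ContDiffOn ℝ ∞ G U
  symm : ∀ q ∈ U, ∀ u v, G q u v = G q v u
  pos : ∀ q ∈ U, ∀ v, v ≠ 0 → 0 < G q v v
  complex : ∀ q ∈ U, ∀ u v, G q (Complex.I • u) (Complex.I • v) = G q u v

theorem IsHermitianOn.contDiffAt {U : Set C2} {G : C2 → C2 →L[ℝ] C2 →L[ℝ] ℝ}
    (h : IsHermitianOn U G) {q : C2} (hq : q ∈ U) : ContDiffAt ℝ ∞ G q :=
  h.contDiffOn.contDiffAt (h.isOpen.mem_nhds hq)

theorem IsHermitianOn.isHermitianAt {U : Set C2} {G : C2 → C2 →L[ℝ] C2 →L[ℝ] ℝ}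
    (h : IsHermitianOn U G) {q : C2} (hq : q ∈ U) : IsHermitianAt G q where
  differentiableAt := (h.contDiffAt hq).differentiableAt (by simp)
  symm := (h.isOpen.eventually_mem hq).mono h.symm
  pos := h.pos q hq
  complex := (h.isOpen.eventually_mem hq).mono h.complex

/-- The metric on the tangent space at `m`, which is identified with `ℂ²` by the preferred
chart. -/
def HermitianMetric.form (g : HermitianMetric M) (m : M) : C2 →L[ℝ] C2 →L[ℝ] ℝ := g.inner m

theorem HermitianMetric.inChart_apply (g : HermitianMetric M) {c : OpenPartialHomeomorph M C2}
    (hc : c ∈ atlas C2 M) {q : C2} (hq : q ∈ c.target) (u v : C2) :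
    g.inChart c q u v = g.form (c.symm q) (dTrans c (chartAt C2 (c.symm q)) q u)
      (dTrans c (chartAt C2 (c.symm q)) q v) := by
  have h : g.inChart c q u v = g.form (c.symm q) (mfderiv 𝓘(ℝ, C2) 𝓘(ℝ, C2) c.symm q u)
      (mfderiv 𝓘(ℝ, C2) 𝓘(ℝ, C2) c.symm q v) := rfl
  rw [h, mfderiv_symm_eq_dTrans hc hq]
  rfl

theorem HermitianMetric.inChart_dTrans (g : HermitianMetric M) {c c' : OpenPartialHomeomorph M C2}
    (hc : c ∈ atlas C2 M) (hc' : c' ∈ atlas C2 M) {q : C2} (hq : q ∈ c.target)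
    (hq' : c.symm q ∈ c'.source) (u v : C2) :
    g.inChart c q u v = g.inChart c' (c' (c.symm q)) (dTrans c c' q u) (dTrans c c' q v) := by
  rw [g.inChart_apply hc hq, g.inChart_apply hc' (c'.map_source hq'), c'.left_inv hq',
    dTrans_dTrans hc hc' (chart_mem_atlas _ _) hq hq' (mem_chart_source _ _),
    dTrans_dTrans hc hc' (chart_mem_atlas _ _) hq hq' (mem_chart_source _ _)]

theorem HermitianMetric.contDiffOn_inChart (g : HermitianMetric M)
    {c : OpenPartialHomeomorph M C2} (hc : c ∈ atlas C2 M) :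
    ContDiffOn ℝ ∞ (g.inChart c) c.target := by
  have hcs : ContMDiffOn 𝓘(ℝ, C2) 𝓘(ℝ, C2) ∞ c.symm c.target :=
    contMDiffOn_symm_of_mem_maximalAtlas (IsManifold.subset_maximalAtlas hc)
  have hv := fun u : C2 => contMDiffOn_coordinateField hc u
  have happ : ∀ u v : C2, ContDiffOn ℝ ∞ (fun q => g.inChart c q u v) c.target := by
    intro u v
    have h4 : ContMDiffOn 𝓘(ℝ, C2) (𝓘(ℝ, C2).prod 𝓘(ℝ)) ∞
        (fun q => Bundle.TotalSpace.mk' ℝ (E := Bundle.Trivial M ℝ) (c.symm q)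
          (g.inner (c.symm q) (mfderiv 𝓘(ℝ, C2) 𝓘(ℝ, C2) c.symm q u)
            (mfderiv 𝓘(ℝ, C2) 𝓘(ℝ, C2) c.symm q v))) c.target := by
      apply ContMDiffOn.clm_bundle_apply₂ (F₁ := C2) (F₂ := C2)
      · exact g.contMDiff.comp_contMDiffOn hcs
      · exact hv u
      · exact hv v
    rw [← contMDiffOn_iff_contDiffOn]
    intro q hq
    have h5 := h4 q hq
    simp only [Bundle.contMDiffWithinAt_totalSpace] at h5
    exact h5.2
  rw [contDiffOn_clm_apply]
  intro u
  rw [contDiffOn_clm_apply]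
  exact fun v => happ u v

theorem HermitianMetric.isHermitianOn_inChart (g : HermitianMetric M)
    {c : OpenPartialHomeomorph M C2} (hc : c ∈ atlas C2 M) :
    IsHermitianOn c.target (g.inChart c) where
  isOpen := c.open_target
  contDiffOn := g.contDiffOn_inChart hc
  symm q hq u v := by
    rw [g.inChart_apply hc hq, g.inChart_apply hc hq]
    exact g.symm _ _ _
  pos q hq v hv := by
    rw [g.inChart_apply hc hq]
    refine g.pos _ _ fun h => hv ?_
    exact (bijective_dTrans hc (chart_mem_atlas _ _) hq (mem_chart_source _ _)).1
      (h.trans (map_zero _).symm)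
  complex q hq u v := by
    rw [g.inChart_apply hc hq, g.inChart_apply hc hq,
      dTrans_I_smul hc (chart_mem_atlas _ _) hq (mem_chart_source _ _),
      dTrans_I_smul hc (chart_mem_atlas _ _) hq (mem_chart_source _ _)]
    exact g.inner_almostComplex _ _ _

end Metric

section Maps

variable {M : Type*} [TopologicalSpace M] [ChartedSpace C2 M] [IsManifold 𝓘(ℂ, C2) ω M]
  {S : Type*} [TopologicalSpace S] [ChartedSpace ℂ S] [IsManifold 𝓘(ℂ, ℂ) ω S]

/-- The coordinate expression of `f` in the charts `e` of `S` and `c` of `M`. -/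
def rep (f : S → M) (e : OpenPartialHomeomorph S ℂ) (c : OpenPartialHomeomorph M C2) (z : ℂ) : C2 :=
  c (f (e.symm z))

/-- The set where `rep f e c` is a coordinate expression of `f`. -/
def repDomain (f : S → M) (e : OpenPartialHomeomorph S ℂ) (c : OpenPartialHomeomorph M C2) :
    Set ℂ :=
  e.target ∩ (fun z => f (e.symm z)) ⁻¹' c.source

variable {f : S → M} {e e' : OpenPartialHomeomorph S ℂ} {c c' : OpenPartialHomeomorph M C2} {z : ℂ}

theorem isOpen_repDomain (hf : Continuous f) : IsOpen (repDomain f e c) :=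
  (hf.comp_continuousOn e.continuousOn_symm).isOpen_inter_preimage e.open_target c.open_source

theorem contDiffOn_rep (hf : ContMDiff 𝓘(ℝ, ℂ) 𝓘(ℝ, C2) ∞ f) (he : e ∈ atlas ℂ S)
    (hc : c ∈ atlas C2 M) : ContDiffOn ℝ ∞ (rep f e c) (repDomain f e c) := by
  rw [← contMDiffOn_iff_contDiffOn]
  refine (contMDiffOn_of_mem_maximalAtlas (IsManifold.subset_maximalAtlas hc)).comp
    ((hf.comp_contMDiffOn (contMDiffOn_symm_of_mem_maximalAtlas
      (IsManifold.subset_maximalAtlas he))).mono ?_) ?_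
  · exact Set.inter_subset_left
  · exact fun z hz => hz.2

theorem rep_change_target (hz : z ∈ repDomain f e c) (hf : Continuous f) :
    rep f e c' =ᶠ[𝓝 z] fun w => c' (c.symm (rep f e c w)) := by
  filter_upwards [(isOpen_repDomain hf).mem_nhds hz] with w hw
  rw [rep, rep, c.left_inv hw.2]

theorem rep_change_source (hz : z ∈ e.target) (hz' : e.symm z ∈ e'.source) :
    rep f e c =ᶠ[𝓝 z] fun w => rep f e' c (e' (e.symm w)) := by
  filter_upwards [eventually_mem_target_and_source hz hz'] with w hw
  rw [rep, rep, e'.left_inv hw.2]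

theorem mem_repDomain_change_source (hz : z ∈ repDomain f e c) (hz' : e.symm z ∈ e'.source) :
    e' (e.symm z) ∈ repDomain f e' c :=
  ⟨e'.map_source hz', by simpa [e'.left_inv hz'] using hz.2⟩

theorem symm_rep (hz : z ∈ repDomain f e c) : c.symm (rep f e c z) = f (e.symm z) :=
  c.left_inv hz.2

theorem rep_mem_target (hz : z ∈ repDomain f e c) : rep f e c z ∈ c.target := c.map_source hz.2

theorem fderiv_rep_change_target (hf : ContMDiff 𝓘(ℝ, ℂ) 𝓘(ℝ, C2) ∞ f) (he : e ∈ atlas ℂ S)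
    (hc : c ∈ atlas C2 M) (hc' : c' ∈ atlas C2 M) (hz : z ∈ repDomain f e c)
    (hz' : f (e.symm z) ∈ c'.source) (a : ℂ) :
    fderiv ℝ (rep f e c') z a = dTrans c c' (rep f e c z) (fderiv ℝ (rep f e c) z a) := by
  rw [(rep_change_target hz hf.continuous).fderiv_eq]
  have h1 := (contDiffAt_transition_real hc hc' (rep_mem_target hz)
    (by rwa [symm_rep hz])).differentiableAt (by simp)
  have h2 := ((contDiffOn_rep hf he hc).contDiffAt
    ((isOpen_repDomain hf.continuous).mem_nhds hz)).differentiableAt (by simp)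
  exact congrArg (fun L : ℂ →L[ℝ] C2 => L a) (fderiv_comp z h1 h2)

theorem fderiv_rep_change_source (hf : ContMDiff 𝓘(ℝ, ℂ) 𝓘(ℝ, C2) ∞ f) (he : e ∈ atlas ℂ S)
    (he' : e' ∈ atlas ℂ S) (hc : c ∈ atlas C2 M) (hz : z ∈ repDomain f e c)
    (hz' : e.symm z ∈ e'.source) (a : ℂ) :
    fderiv ℝ (rep f e c) z a
      = fderiv ℝ (rep f e' c) (e' (e.symm z)) (dTrans e e' z a) := by
  rw [(rep_change_source hz.1 hz').fderiv_eq]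
  have h1 := (contDiffAt_transition_real he he' hz.1 hz').differentiableAt (by simp)
  have h2 := ((contDiffOn_rep hf he' hc).contDiffAt ((isOpen_repDomain hf.continuous).mem_nhds
    (mem_repDomain_change_source hz hz'))).differentiableAt (by simp)
  exact congrArg (fun L : ℂ →L[ℝ] C2 => L a) (fderiv_comp z h2 h1)

/-- The derivative of `f` at `x`, with the tangent spaces identified with `ℂ` and `ℂ²` by the
preferred charts. -/
def dMap (f : S → M) (x : S) : ℂ →L[ℝ] C2 := mfderiv 𝓘(ℝ, ℂ) 𝓘(ℝ, C2) f x

theorem dMap_eq (hf : ContMDiff 𝓘(ℝ, ℂ) 𝓘(ℝ, C2) ∞ f) (x : S) :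
    dMap f x = fderiv ℝ (rep f (chartAt ℂ x) (chartAt C2 (f x))) (chartAt ℂ x x) :=
  mfderiv_eq_fderiv (hf.mdifferentiable (by simp) x)

theorem fderiv_rep_eq_dMap (hf : ContMDiff 𝓘(ℝ, ℂ) 𝓘(ℝ, C2) ∞ f) (he : e ∈ atlas ℂ S)
    (hc : c ∈ atlas C2 M) (hz : z ∈ repDomain f e c) (a : ℂ) :
    dTrans c (chartAt C2 (f (e.symm z))) (rep f e c z) (fderiv ℝ (rep f e c) z a)
      = dMap f (e.symm z) (dTrans e (chartAt ℂ (e.symm z)) z a) := by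
  have hx := mem_chart_source ℂ (e.symm z)
  have hy := mem_chart_source C2 (f (e.symm z))
  rw [← fderiv_rep_change_target hf he hc (chart_mem_atlas _ _) hz hy, dMap_eq hf,
    fderiv_rep_change_source hf he (chart_mem_atlas _ _) (chart_mem_atlas _ _) ⟨hz.1, hy⟩ hx]

end Maps

/-! ### Hermitian linear algebra in `ℂ²` -/

section HermitianForm

/-- `B` is the real part of a positive definite Hermitian form on `ℂ²`. -/
structure IsHermitianForm (B : C2 →L[ℝ] C2 →L[ℝ] ℝ) : Prop where
  symm : ∀ u v, B u v = B v u
  pos : ∀ v, v ≠ 0 → 0 < B v v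
  complex : ∀ u v, B (Complex.I • u) (Complex.I • v) = B u v

variable {B : C2 →L[ℝ] C2 →L[ℝ] ℝ}

theorem re_herm (u v : C2) : (herm B u v).re = B u v := by simp [herm]

theorem herm_add_left (u u' v : C2) : herm B (u + u') v = herm B u v + herm B u' v := by
  simp only [herm, map_add, add_apply]; push_cast; ring

namespace IsHermitianForm

variable (h : IsHermitianForm B)
include h

theorem apply_I_smul (u : C2) : B u (Complex.I • u) = 0 := by
  have := apply_I_smul_left h.complex u u
  have := h.symm u (Complex.I • u)
  linarith

theorem herm_self (u : C2) : herm B u u = (B u u : ℂ) := by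
  simp [herm, h.apply_I_smul u]

theorem herm_smul_left (c : ℂ) (u v : C2) : herm B (c • u) v = c * herm B u v := by
  have h1 := apply_I_smul_left h.complex u v
  have h2 := h.complex u v
  rw [complex_smul_eq c u]
  simp only [herm, map_add, add_apply, map_smul_real, smul_apply, smul_eq_mul, h1, h2]
  apply Complex.ext <;> simp [sub_eq_add_neg]

theorem herm_symm (u v : C2) : herm B v u = (starRingEnd ℂ) (herm B u v) := by
  have h1 := apply_I_smul_left h.complex u v
  have h2 := h.symm v u
  have h3 := h.symm v (Complex.I • u)
  apply Complex.ext <;> simp [herm, h1, h2, h3]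

theorem herm_smul_right (c : ℂ) (u v : C2) :
    herm B u (c • v) = (starRingEnd ℂ) c * herm B u v := by
  rw [h.herm_symm, h.herm_smul_left, map_mul, ← h.herm_symm]

theorem herm_add_right (u v v' : C2) : herm B u (v + v') = herm B u v + herm B u v' := by
  rw [h.herm_symm, herm_add_left, map_add, ← h.herm_symm, ← h.herm_symm]

theorem apply_smul_self (c : ℂ) (u : C2) : B (c • u) (c • u) = ‖c‖ ^ 2 * B u u := by
  have h1 := h.herm_self (c • u)
  rw [h.herm_smul_left, h.herm_smul_right, h.herm_self, ← mul_assoc, Complex.mul_conj] at h1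
  rw [← Complex.normSq_eq_norm_sq]
  exact_mod_cast h1.symm

end IsHermitianForm

/-- The complex determinant of two vectors of `ℂ²`. -/
def det2 (u v : C2) : ℂ := u 0 * v 1 - u 1 * v 0

theorem det2_smul_left (c : ℂ) (u v : C2) : det2 (c • u) v = c * det2 u v := by
  simp [det2]; ring

theorem det2_smul_right (c : ℂ) (u v : C2) : det2 u (c • v) = c * det2 u v := by
  simp [det2]; ring

theorem IsHermitianForm.det2_ne_zero (h : IsHermitianForm B) {u v : C2} (huv : herm B u v = 0)
    (hu : u ≠ 0) (hv : v ≠ 0) : det2 u v ≠ 0 := by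
  intro hd
  have key : ∀ k, u k • v = v k • u := by
    intro k
    simp only [det2] at hd
    fin_cases k <;> ext j <;> fin_cases j <;> simp <;>
      first | linear_combination (0 : ℂ) * hd | linear_combination hd | linear_combination -hd
  have hvv : herm B v v ≠ 0 := by
    rw [h.herm_self]; exact_mod_cast (h.pos v hv).ne'
  have hz : ∀ k, u k = 0 := by
    intro k
    have := congrArg (fun x => herm B x v) (key k)
    simp only [h.herm_smul_left, huv, mul_zero] at this
    exact (mul_eq_zero.1 this).resolve_right hvv
  exact hu (funext hz)

/-- `e₁`, `e₂` is a unitary basis for `B`. -/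
structure IsUnitary (B : C2 →L[ℝ] C2 →L[ℝ] ℝ) (e₁ e₂ : C2) : Prop where
  fst : herm B e₁ e₁ = 1
  snd : herm B e₂ e₂ = 1
  orthogonal : herm B e₁ e₂ = 0

namespace IsUnitary

variable {e₁ e₂ : C2}

theorem ne_zero_left (he : IsUnitary B e₁ e₂) : e₁ ≠ 0 := by
  rintro rfl
  simpa [herm] using he.fst

theorem ne_zero_right (he : IsUnitary B e₁ e₂) : e₂ ≠ 0 := by
  rintro rfl
  simpa [herm] using he.snd

theorem swap (h : IsHermitianForm B) (he : IsUnitary B e₁ e₂) : IsUnitary B e₂ e₁ :=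
  ⟨he.snd, he.fst, by rw [h.herm_symm, he.orthogonal, map_zero]⟩

theorem det2_ne_zero (h : IsHermitianForm B) (he : IsUnitary B e₁ e₂) : det2 e₁ e₂ ≠ 0 :=
  h.det2_ne_zero he.orthogonal he.ne_zero_left he.ne_zero_right

theorem eq_add (h : IsHermitianForm B) (he : IsUnitary B e₁ e₂) (v : C2) :
    v = herm B v e₁ • e₁ + herm B v e₂ • e₂ := by
  obtain ⟨a, b, rfl⟩ : ∃ a b : ℂ, v = a • e₁ + b • e₂ := by
    refine ⟨det2 v e₂ / det2 e₁ e₂, det2 e₁ v / det2 e₁ e₂, ?_⟩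
    have hd := he.det2_ne_zero h
    ext k
    simp only [Pi.add_apply, Pi.smul_apply, smul_eq_mul]
    field_simp
    simp only [det2]
    fin_cases k <;> simp <;> ring
  have h1 := he.orthogonal
  have h2 := (he.swap h).orthogonal
  simp only [herm_add_left, h.herm_smul_left, he.fst, he.snd, h1, h2]
  simp

/-- A vector orthogonal to `e₂` is a multiple of `e₁`. -/
theorem eq_smul_fst (h : IsHermitianForm B) (he : IsUnitary B e₁ e₂) {v : C2}
    (hv : herm B v e₂ = 0) : v = herm B v e₁ • e₁ := by
  conv_lhs => rw [he.eq_add h v, hv, zero_smul, add_zero]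

end IsUnitary

end HermitianForm

/-! ### Smooth dependence -/

section Smooth

variable {E : Type*} [NormedAddCommGroup E] [NormedSpace ℝ E]

theorem contDiffAt_apply₂ {V : Type*} [NormedAddCommGroup V] [NormedSpace ℝ V] {n : WithTop ℕ∞}
    {B : E → V →L[ℝ] V →L[ℝ] ℝ} {X Y : E → V} {z : E}
    (hB : ContDiffAt ℝ n B z) (hX : ContDiffAt ℝ n X z) (hY : ContDiffAt ℝ n Y z) :
    ContDiffAt ℝ n (fun z => B z (X z) (Y z)) z :=
  (hB.clm_apply hX).clm_apply hY

theorem contDiffAt_complex_smul {n : WithTop ℕ∞} {σ : E → ℂ} {X : E → C2} {z : E}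
    (hσ : ContDiffAt ℝ n σ z) (hX : ContDiffAt ℝ n X z) :
    ContDiffAt ℝ n (fun z => σ z • X z) z := hσ.smul hX

theorem contDiffAt_herm {n : WithTop ℕ∞} {B : E → C2 →L[ℝ] C2 →L[ℝ] ℝ} {X Y : E → C2} {z : E}
    (hB : ContDiffAt ℝ n B z) (hX : ContDiffAt ℝ n X z) (hY : ContDiffAt ℝ n Y z) :
    ContDiffAt ℝ n (fun z => herm (B z) (X z) (Y z)) z := by
  have h1 := Complex.ofRealCLM.contDiff.contDiffAt.comp z (contDiffAt_apply₂ hB hX hY)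
  have h2 := Complex.ofRealCLM.contDiff.contDiffAt.comp z
    (contDiffAt_apply₂ hB hX (contDiffAt_complex_smul (σ := fun _ => Complex.I)
      contDiffAt_const hY))
  exact h1.add (contDiffAt_const.mul h2)

theorem contDiffAt_normalize {n : WithTop ℕ∞} {B : E → C2 →L[ℝ] C2 →L[ℝ] ℝ} {X : E → C2} {z : E}
    (hB : ContDiffAt ℝ n B z) (hX : ContDiffAt ℝ n X z) (hpos : 0 < B z (X z) (X z)) :
    ContDiffAt ℝ n (fun z => (((√(B z (X z) (X z)))⁻¹ : ℝ) : ℂ) • X z) z := by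
  refine contDiffAt_complex_smul ?_ hX
  exact Complex.ofRealCLM.contDiff.contDiffAt.comp z
    (((contDiffAt_apply₂ hB hX hX).sqrt hpos.ne').inv (Real.sqrt_pos.2 hpos).ne')

theorem IsHermitianForm.herm_normalize {B : C2 →L[ℝ] C2 →L[ℝ] ℝ} (h : IsHermitianForm B) {v : C2}
    (hv : v ≠ 0) : herm B ((((√(B v v))⁻¹ : ℝ) : ℂ) • v) ((((√(B v v))⁻¹ : ℝ) : ℂ) • v) = 1 := by
  have hp := h.pos v hv
  rw [h.herm_smul_left, h.herm_smul_right, h.herm_self, Complex.conj_ofReal]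
  norm_cast
  have h1 := Real.sq_sqrt hp.le
  have h2 := (Real.sqrt_pos.2 hp).ne'
  field_simp
  linarith

/-- A vector field without zeros can be completed to a unitary frame, by Gram-Schmidt. -/
theorem exists_unitary_frame {N : Set E} {B : E → C2 →L[ℝ] C2 →L[ℝ] ℝ} {X : E → C2}
    (hB : ∀ z ∈ N, ContDiffAt ℝ ∞ B z) (hX : ∀ z ∈ N, ContDiffAt ℝ ∞ X z)
    (hh : ∀ z ∈ N, IsHermitianForm (B z)) (h0 : ∀ z ∈ N, X z ≠ 0) :
    ∃ (e₁ e₂ : E → C2) (r : E → ℂ), (∀ z ∈ N, ContDiffAt ℝ ∞ e₁ z) ∧ (∀ z ∈ N, ContDiffAt ℝ ∞ e₂ z) ∧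
      (∀ z ∈ N, IsUnitary (B z) (e₁ z) (e₂ z)) ∧ ∀ z ∈ N, X z = r z • e₁ z := by
  let e₁ : E → C2 := fun z => (((√(B z (X z) (X z)))⁻¹ : ℝ) : ℂ) • X z
  let Y : E → C2 := fun z =>
    ![-herm (B z) (Pi.single 1 1) (e₁ z), herm (B z) (Pi.single 0 1) (e₁ z)]
  let e₂ : E → C2 := fun z => (((√(B z (Y z) (Y z)))⁻¹ : ℝ) : ℂ) • Y z
  have h1 : ∀ z ∈ N, herm (B z) (e₁ z) (e₁ z) = 1 := fun z hz => (hh z hz).herm_normalize (h0 z hz)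
  have hexp : ∀ z ∈ N, ∀ u v : C2, herm (B z) u v
      = u 0 * herm (B z) (Pi.single 0 1) v + u 1 * herm (B z) (Pi.single 1 1) v := by
    intro z hz u v
    rw [← (hh z hz).herm_smul_left, ← (hh z hz).herm_smul_left, ← herm_add_left]
    congr 1
    ext k; fin_cases k <;> simp
  have hY : ∀ z ∈ N, herm (B z) (Y z) (e₁ z) = 0 := by
    intro z hz
    rw [hexp z hz]
    simp [Y]; ring
  have hY0 : ∀ z ∈ N, Y z ≠ 0 := by
    intro z hz h
    have h2 := h1 z hz
    have h3 : herm (B z) (Pi.single 1 1) (e₁ z) = 0 := by simpa [Y] using congrFun h 0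
    have h4 : herm (B z) (Pi.single 0 1) (e₁ z) = 0 := by simpa [Y] using congrFun h 1
    rw [hexp z hz, h3, h4] at h2
    simp at h2
  have hs1 : ∀ z ∈ N, ContDiffAt ℝ ∞ e₁ z := fun z hz =>
    contDiffAt_normalize (hB z hz) (hX z hz) ((hh z hz).pos _ (h0 z hz))
  have hsY : ∀ z ∈ N, ContDiffAt ℝ ∞ Y z := by
    intro z hz
    rw [contDiffAt_pi]
    intro k
    fin_cases k
    · exact (contDiffAt_herm (hB z hz) contDiffAt_const (hs1 z hz)).neg
    · exact contDiffAt_herm (hB z hz) contDiffAt_const (hs1 z hz)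
  refine ⟨e₁, e₂, fun z => ((√(B z (X z) (X z)) : ℝ) : ℂ), hs1, fun z hz =>
    contDiffAt_normalize (hB z hz) (hsY z hz) ((hh z hz).pos _ (hY0 z hz)), fun z hz =>
    ⟨h1 z hz, (hh z hz).herm_normalize (hY0 z hz), ?_⟩, fun z hz => ?_⟩
  · rw [(hh z hz).herm_smul_right, (hh z hz).herm_symm, hY z hz]; simp
  · have hp := Real.sqrt_pos.2 ((hh z hz).pos _ (h0 z hz))
    simp only [e₁, smul_smul]
    rw [← Complex.ofReal_mul, mul_inv_cancel₀ hp.ne']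
    simp

theorem contDiffAt_inverse {V : Type*} [NormedAddCommGroup V] [NormedSpace ℝ V]
    [FiniteDimensional ℝ V] {n : WithTop ℕ∞} {B : E → V →L[ℝ] V →L[ℝ] ℝ} {z : E}
    (hB : ContDiffAt ℝ n B z) (hpos : ∀ v, v ≠ 0 → 0 < B z v v) :
    ContDiffAt ℝ n (fun z => (B z).inverse) z := by
  have : CompleteSpace V := FiniteDimensional.complete ℝ V
  obtain ⟨A, hA⟩ := isInvertible_of_pos hpos
  have := contDiffAt_map_inverse (𝕜 := ℝ) (n := n) A
  rw [hA] at this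
  exact this.comp z hB

set_option maxSynthPendingDepth 4 in
theorem contDiffAt_leviCivita {V : Type*} [NormedAddCommGroup V] [NormedSpace ℝ V]
    [FiniteDimensional ℝ V] {G : V → V →L[ℝ] V →L[ℝ] ℝ} {F X Y : E → V} {z : E}
    (hG : ContDiffAt ℝ ∞ G (F z)) (hpos : ∀ v, v ≠ 0 → 0 < G (F z) v v)
    (hF : ContDiffAt ℝ ∞ F z) (hX : ContDiffAt ℝ ∞ X z) (hY : ContDiffAt ℝ ∞ Y z) :
    ContDiffAt ℝ ∞ (fun z => leviCivita G (F z) (X z) (Y z)) z := by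
  have hGF : ContDiffAt ℝ ∞ (fun z => G (F z)) z := hG.comp z hF
  have hD : ContDiffAt ℝ ∞ (fun z => fderiv ℝ G (F z)) z :=
    (hG.fderiv_right (m := ∞) (by simp)).comp z hF
  have hflip : ContDiffAt ℝ ∞ (fun z => (fderiv ℝ G (F z)).flip) z :=
    (ContinuousLinearMap.flipₗᵢ ℝ V V (V →L[ℝ] ℝ)).contDiff.contDiffAt.comp z hD
  have hflip' : ContDiffAt ℝ ∞ (fun z => ((fderiv ℝ G (F z)).flip (X z)).flip) z :=
    (ContinuousLinearMap.flipₗᵢ ℝ V V ℝ).contDiff.contDiffAt.comp z (hflip.clm_apply hX)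
  exact (contDiffAt_inverse hGF hpos).clm_apply (ContDiffAt.const_smul (1 / 2 : ℝ)
    ((((hD.clm_apply hX).clm_apply hY).add ((hD.clm_apply hY).clm_apply hX)).sub
      (hflip'.clm_apply hY)))

set_option maxSynthPendingDepth 4 in
theorem contDiffAt_chern {G : C2 → C2 →L[ℝ] C2 →L[ℝ] ℝ} {F X Y : E → C2} {z : E}
    (hG : ContDiffAt ℝ ∞ G (F z)) (hpos : ∀ v, v ≠ 0 → 0 < G (F z) v v)
    (hF : ContDiffAt ℝ ∞ F z) (hX : ContDiffAt ℝ ∞ X z) (hY : ContDiffAt ℝ ∞ Y z) :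
    ContDiffAt ℝ ∞ (fun z => chern G (F z) (X z) (Y z)) z := by
  have hGF : ContDiffAt ℝ ∞ (fun z => G (F z)) z := hG.comp z hF
  have hD : ContDiffAt ℝ ∞ (fun z => fderiv ℝ G (F z)) z :=
    (hG.fderiv_right (m := ∞) (by simp)).comp z hF
  have hIX : ContDiffAt ℝ ∞ (fun z => Complex.I • X z) z :=
    contDiffAt_complex_smul contDiffAt_const hX
  exact (contDiffAt_inverse hGF hpos).clm_apply (ContDiffAt.const_smul (1 / 2 : ℝ)
    (((hD.clm_apply hX).clm_apply hY).add
      (((hD.clm_apply hIX).clm_apply hY).clm_comp contDiffAt_const)))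

end Smooth

/-! ### The complex derivatives of a map into `ℂ²` -/

section Wirtinger

/-- The complex linear part `v` of `L a = a v + ā w`. -/
def linPart (L : ℂ →L[ℝ] C2) : C2 := (1 / 2 : ℂ) • (L 1 - Complex.I • L Complex.I)

/-- The antilinear part `w` of `L a = a v + ā w`. -/
def antiPart (L : ℂ →L[ℝ] C2) : C2 := (1 / 2 : ℂ) • (L 1 + Complex.I • L Complex.I)

theorem apply_eq_linPart_add (L : ℂ →L[ℝ] C2) (a : ℂ) :
    L a = a • linPart L + (starRingEnd ℂ) a • antiPart L := by
  rw [fderiv_real_apply L a]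
  have ha : (starRingEnd ℂ) a = a.re - a.im * Complex.I := by apply Complex.ext <;> simp
  have ha' : a = a.re + a.im * Complex.I := (Complex.re_add_im a).symm
  rw [ha]
  nth_rw 3 [ha']
  ext k
  simp only [linPart, antiPart, Pi.add_apply, Pi.smul_apply, Pi.sub_apply, smul_eq_mul,
    Complex.real_smul]
  linear_combination (a.im * L Complex.I k : ℂ) * Complex.I_sq

/-- The complex derivative `∂X/∂z`. -/
def del (X : ℂ → C2) (z : ℂ) : C2 := linPart (fderiv ℝ X z)

/-- The complex derivative `∂X/∂z̄`. -/
def delBar (X : ℂ → C2) (z : ℂ) : C2 := antiPart (fderiv ℝ X z)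

theorem fderiv_eq_del_add_delBar (X : ℂ → C2) (z a : ℂ) :
    fderiv ℝ X z a = a • del X z + (starRingEnd ℂ) a • delBar X z := apply_eq_linPart_add _ a

theorem fderiv_one_eq (X : ℂ → C2) (z : ℂ) : fderiv ℝ X z 1 = del X z + delBar X z := by
  simp [fderiv_eq_del_add_delBar]

theorem fderiv_I_eq (X : ℂ → C2) (z : ℂ) :
    fderiv ℝ X z Complex.I = Complex.I • (del X z - delBar X z) := by
  simp [fderiv_eq_del_add_delBar, sub_eq_add_neg]

theorem fderiv_complex_smul {σ : ℂ → ℂ} {X : ℂ → C2} {z : ℂ} (hσ : DifferentiableAt ℝ σ z)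
    (hX : DifferentiableAt ℝ X z) (a : ℂ) :
    fderiv ℝ (fun z => σ z • X z) z a = σ z • fderiv ℝ X z a + fderiv ℝ σ z a • X z := by
  rw [fderiv_fun_smul hσ hX]; rfl

theorem delBar_smul {σ : ℂ → ℂ} {X : ℂ → C2} {z : ℂ} (hσ : DifferentiableAt ℝ σ z)
    (hX : DifferentiableAt ℝ X z) :
    delBar (fun z => σ z • X z) z = σ z • delBar X z + dbar σ z • X z := by
  simp only [delBar, antiPart, dbar, fderiv_complex_smul hσ hX]
  module

theorem conj_dbar_conj {τ : ℂ → ℂ} {z : ℂ} (hτ : DifferentiableAt ℝ τ z) :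
    (starRingEnd ℂ) (dbar (fun z => (starRingEnd ℂ) (τ z)) z)
      = (fderiv ℝ τ z 1 - Complex.I * fderiv ℝ τ z Complex.I) / 2 := by
  have h : HasFDerivAt (fun z => (starRingEnd ℂ) (τ z))
      ((Complex.conjCLE : ℂ →L[ℝ] ℂ).comp (fderiv ℝ τ z)) z :=
    (Complex.conjCLE : ℂ →L[ℝ] ℂ).hasFDerivAt.comp z hτ.hasFDerivAt
  rw [dbar, h.fderiv]
  have h2 : (starRingEnd ℂ) 2 = 2 := Complex.conj_ofNat 2
  simp [sub_eq_add_neg, h2]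

theorem del_smul {τ : ℂ → ℂ} {X : ℂ → C2} {z : ℂ} (hτ : DifferentiableAt ℝ τ z)
    (hX : DifferentiableAt ℝ X z) : del (fun z => τ z • X z) z
      = τ z • del X z + (starRingEnd ℂ) (dbar (fun z => (starRingEnd ℂ) (τ z)) z) • X z := by
  rw [conj_dbar_conj hτ]
  simp only [del, linPart, fderiv_complex_smul hτ hX]
  module

theorem contDiffAt_fderiv_apply {X : ℂ → C2} {z : ℂ} (hX : ContDiffAt ℝ ∞ X z) (a : ℂ) :
    ContDiffAt ℝ ∞ (fun z => fderiv ℝ X z a) z :=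
  (hX.fderiv_right (m := ∞) (by simp)).clm_apply contDiffAt_const

theorem contDiffAt_del {X : ℂ → C2} {z : ℂ} (hX : ContDiffAt ℝ ∞ X z) :
    ContDiffAt ℝ ∞ (del X) z :=
  contDiffAt_complex_smul contDiffAt_const ((contDiffAt_fderiv_apply hX 1).sub
    (contDiffAt_complex_smul contDiffAt_const (contDiffAt_fderiv_apply hX Complex.I)))

theorem contDiffAt_delBar {X : ℂ → C2} {z : ℂ} (hX : ContDiffAt ℝ ∞ X z) :
    ContDiffAt ℝ ∞ (delBar X) z :=
  contDiffAt_complex_smul contDiffAt_const ((contDiffAt_fderiv_apply hX 1).add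
    (contDiffAt_complex_smul contDiffAt_const (contDiffAt_fderiv_apply hX Complex.I)))

theorem fderiv_fderiv_apply {X : ℂ → C2} {z : ℂ} (hX : ContDiffAt ℝ ∞ X z) (a b : ℂ) :
    fderiv ℝ (fun z => fderiv ℝ X z b) z a = fderiv ℝ (fderiv ℝ X) z a b := by
  have h : DifferentiableAt ℝ (fderiv ℝ X) z :=
    (hX.fderiv_right (m := ∞) (by simp)).differentiableAt (by simp)
  rw [(h.hasFDerivAt.clm_apply (hasFDerivAt_const b z)).fderiv]
  simp

theorem fderiv_fderiv_symm {X : ℂ → C2} {z : ℂ} (hX : ContDiffAt ℝ ∞ X z) (a b : ℂ) :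
    fderiv ℝ (fderiv ℝ X) z a b = fderiv ℝ (fderiv ℝ X) z b a :=
  (hX.isSymmSndFDerivAt (by simpa using ENat.LEInfty.out)).eq a b

theorem fderiv_del {X : ℂ → C2} {z : ℂ} (hX : ContDiffAt ℝ ∞ X z) (a : ℂ) :
    fderiv ℝ (del X) z a = linPart (fderiv ℝ (fderiv ℝ X) z a) := by
  have h : ∀ b, DifferentiableAt ℝ (fun z => fderiv ℝ X z b) z := fun b =>
    (contDiffAt_fderiv_apply hX b).differentiableAt (by simp)
  have h1 : del X = fun z => (1 / 2 : ℂ) • (fderiv ℝ X z 1 - Complex.I • fderiv ℝ X z Complex.I) :=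
    rfl
  have h2 : DifferentiableAt ℝ (fun z => Complex.I • fderiv ℝ X z Complex.I) z :=
    (h Complex.I).fun_const_smul _
  rw [h1, fderiv_fun_const_smul ((h 1).fun_sub h2), fderiv_fun_sub (h 1) h2,
    fderiv_fun_const_smul (h Complex.I)]
  simp only [smul_apply, sub_apply, fderiv_fderiv_apply hX, linPart]

theorem fderiv_delBar {X : ℂ → C2} {z : ℂ} (hX : ContDiffAt ℝ ∞ X z) (a : ℂ) :
    fderiv ℝ (delBar X) z a = antiPart (fderiv ℝ (fderiv ℝ X) z a) := by
  have h : ∀ b, DifferentiableAt ℝ (fun z => fderiv ℝ X z b) z := fun b =>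
    (contDiffAt_fderiv_apply hX b).differentiableAt (by simp)
  have h1 : delBar X =
      fun z => (1 / 2 : ℂ) • (fderiv ℝ X z 1 + Complex.I • fderiv ℝ X z Complex.I) := rfl
  have h2 : DifferentiableAt ℝ (fun z => Complex.I • fderiv ℝ X z Complex.I) z :=
    (h Complex.I).fun_const_smul _
  rw [h1, fderiv_fun_const_smul ((h 1).fun_add h2), fderiv_fun_add (h 1) h2,
    fderiv_fun_const_smul (h Complex.I)]
  simp only [smul_apply, add_apply, fderiv_fderiv_apply hX, antiPart]

theorem delBar_del {X : ℂ → C2} {z : ℂ} (hX : ContDiffAt ℝ ∞ X z) :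
    delBar (del X) z = (1 / 4 : ℂ) • (fderiv ℝ (fun w => fderiv ℝ X w 1) z 1
      + fderiv ℝ (fun w => fderiv ℝ X w Complex.I) z Complex.I) := by
  simp only [fderiv_fderiv_apply hX]
  rw [delBar, antiPart, fderiv_del hX, fderiv_del hX, linPart, linPart,
    fderiv_fderiv_symm hX 1 Complex.I]
  ext k
  simp
  linear_combination (-(1 / 4) * fderiv ℝ (fderiv ℝ X) z Complex.I Complex.I k) * Complex.I_sq

theorem del_delBar {X : ℂ → C2} {z : ℂ} (hX : ContDiffAt ℝ ∞ X z) :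
    del (delBar X) z = (1 / 4 : ℂ) • (fderiv ℝ (fun w => fderiv ℝ X w 1) z 1
      + fderiv ℝ (fun w => fderiv ℝ X w Complex.I) z Complex.I) := by
  simp only [fderiv_fderiv_apply hX]
  rw [del, linPart, fderiv_delBar hX, fderiv_delBar hX, antiPart, antiPart,
    fderiv_fderiv_symm hX 1 Complex.I]
  ext k
  simp
  linear_combination (-(1 / 4) * fderiv ℝ (fderiv ℝ X) z Complex.I Complex.I k) * Complex.I_sq

end Wirtinger

/-! ### Conformal immersions of plane domains -/

section Patch

/-- `F` is a conformal immersion of the open set `W` of `ℂ` into the open set `U` of `ℂ²`, on which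
`G` is a Hermitian metric. -/
structure IsConformalPatch (U : Set C2) (G : C2 → C2 →L[ℝ] C2 →L[ℝ] ℝ) (F : ℂ → C2)
    (W : Set ℂ) : Prop where
  hermitian : IsHermitianOn U G
  isOpen : IsOpen W
  contDiffOn : ContDiffOn ℝ ∞ F W
  mapsTo : Set.MapsTo F W U
  injective : ∀ z ∈ W, Function.Injective (fderiv ℝ F z)
  conformal : ∀ z ∈ W, ∀ a b, G (F z) (fderiv ℝ F z (Complex.I * a))
    (fderiv ℝ F z (Complex.I * b)) = G (F z) (fderiv ℝ F z a) (fderiv ℝ F z b)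

/-- The conformal factor `λ` of the induced metric `λ |dz|²`. -/
def conformalFactor (G : C2 → C2 →L[ℝ] C2 →L[ℝ] ℝ) (F : ℂ → C2) (z : ℂ) : ℝ :=
  G (F z) (fderiv ℝ F z 1) (fderiv ℝ F z 1)

/-- The trace of `∇ dF` for the Chern connection and the flat metric of `ℂ`. -/
def tension (G : C2 → C2 →L[ℝ] C2 →L[ℝ] ℝ) (F : ℂ → C2) (z : ℂ) : C2 :=
  cov (chern G) F (fun w => fderiv ℝ F w 1) z 1
    + cov (chern G) F (fun w => fderiv ℝ F w Complex.I) z Complex.I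

namespace IsConformalPatch

variable {U : Set C2} {G : C2 → C2 →L[ℝ] C2 →L[ℝ] ℝ} {F : ℂ → C2} {W : Set ℂ} {z : ℂ}

theorem contDiffAt (h : IsConformalPatch U G F W) (hz : z ∈ W) : ContDiffAt ℝ ∞ F z :=
  h.contDiffOn.contDiffAt (h.isOpen.mem_nhds hz)

theorem isHermitianAt (h : IsConformalPatch U G F W) (hz : z ∈ W) : IsHermitianAt G (F z) :=
  h.hermitian.isHermitianAt (h.mapsTo hz)

theorem isHermitianForm (h : IsConformalPatch U G F W) (hz : z ∈ W) : IsHermitianForm (G (F z)) :=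
  ⟨h.hermitian.symm _ (h.mapsTo hz), h.hermitian.pos _ (h.mapsTo hz),
    h.hermitian.complex _ (h.mapsTo hz)⟩

theorem contDiffAt_metric (h : IsConformalPatch U G F W) (hz : z ∈ W) : ContDiffAt ℝ ∞ G (F z) :=
  h.hermitian.contDiffAt (h.mapsTo hz)

theorem contDiffAt_metric_comp (h : IsConformalPatch U G F W) (hz : z ∈ W) :
    ContDiffAt ℝ ∞ (fun z => G (F z)) z :=
  ContDiffAt.comp (G := C2 →L[ℝ] C2 →L[ℝ] ℝ) (g := G) z (h.contDiffAt_metric hz) (h.contDiffAt hz)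

theorem contDiffAt_conformalFactor (h : IsConformalPatch U G F W) (hz : z ∈ W) :
    ContDiffAt ℝ ∞ (conformalFactor G F) z :=
  contDiffAt_apply₂ (h.contDiffAt_metric_comp hz) (contDiffAt_fderiv_apply (h.contDiffAt hz) 1)
    (contDiffAt_fderiv_apply (h.contDiffAt hz) 1)

theorem conformalFactor_pos (h : IsConformalPatch U G F W) (hz : z ∈ W) :
    0 < conformalFactor G F z :=
  (h.isHermitianForm hz).pos _ fun h0 =>
    one_ne_zero (h.injective z hz (h0.trans (map_zero _).symm))

theorem apply_I_I (h : IsConformalPatch U G F W) (hz : z ∈ W) :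
    G (F z) (fderiv ℝ F z Complex.I) (fderiv ℝ F z Complex.I) = conformalFactor G F z := by
  simpa [conformalFactor] using h.conformal z hz 1 1

theorem apply_one_I (h : IsConformalPatch U G F W) (hz : z ∈ W) :
    G (F z) (fderiv ℝ F z 1) (fderiv ℝ F z Complex.I) = 0 := by
  have h1 := h.conformal z hz 1 Complex.I
  simp only [mul_one, Complex.I_mul_I, map_neg] at h1
  have := (h.isHermitianForm hz).symm (fderiv ℝ F z Complex.I) (fderiv ℝ F z 1)
  linarith

theorem metric_apply (h : IsConformalPatch U G F W) (hz : z ∈ W) (a b : ℂ) :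
    G (F z) (fderiv ℝ F z a) (fderiv ℝ F z b)
      = conformalFactor G F z * (a * (starRingEnd ℂ) b).re := by
  rw [fderiv_real_apply (fderiv ℝ F z) a, fderiv_real_apply (fderiv ℝ F z) b]
  have h1 := h.apply_one_I hz
  have h2 := (h.isHermitianForm hz).symm (fderiv ℝ F z Complex.I) (fderiv ℝ F z 1)
  simp only [map_add, add_apply, map_smul_real, smul_apply, smul_eq_mul, h.apply_I_I hz, h1, h2]
  rw [← conformalFactor]
  simp
  ring

theorem herm_del_delBar (h : IsConformalPatch U G F W) (hz : z ∈ W) :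
    herm (G (F z)) (del F z) (delBar F z) = 0 := by
  have hB := h.isHermitianForm hz
  have h1 := h.apply_one_I hz
  have h2 := h.apply_I_I hz
  rw [conformalFactor] at h2
  have hh : ∀ X Y : C2, G (F z) X Y = 0 → G (F z) Y Y = G (F z) X X →
      herm (G (F z)) ((1 / 2 : ℂ) • (X - Complex.I • Y)) ((1 / 2 : ℂ) • (X + Complex.I • Y)) = 0 := by
    intro X Y hXY hYY
    have e1 : herm (G (F z)) X X = herm (G (F z)) Y Y := by
      rw [hB.herm_self, hB.herm_self, hYY]
    have e2 : herm (G (F z)) Y X = - herm (G (F z)) X Y := by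
      rw [hB.herm_symm X Y]
      apply Complex.ext
      · simp [herm, hXY]
      · simp [herm]
    rw [hB.herm_smul_left, hB.herm_smul_right, hB.herm_add_right, hB.herm_smul_right,
      sub_eq_add_neg, ← neg_smul, herm_add_left, herm_add_left, hB.herm_smul_left,
      hB.herm_smul_left, e2, e1]
    simp
    linear_combination (herm (G (F z)) Y Y) * Complex.I_sq
  exact hh _ _ h1 h2

theorem conformalFactor_eq (h : IsConformalPatch U G F W) (hz : z ∈ W) :
    conformalFactor G F z
      = G (F z) (del F z) (del F z) + G (F z) (delBar F z) (delBar F z) := by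
  have h1 : G (F z) (del F z) (delBar F z) = 0 := by
    rw [← re_herm, h.herm_del_delBar hz]; rfl
  have h2 := (h.isHermitianForm hz).symm (delBar F z) (del F z)
  rw [conformalFactor, fderiv_one_eq]
  simp only [map_add, add_apply, h2, h1]
  ring

theorem contDiffAt_chern_apply (h : IsConformalPatch U G F W) (hz : z ∈ W) {X Y : ℂ → C2}
    (hX : ContDiffAt ℝ ∞ X z) (hY : ContDiffAt ℝ ∞ Y z) :
    ContDiffAt ℝ ∞ (fun z => chern G (F z) (X z) (Y z)) z :=
  contDiffAt_chern (h.contDiffAt_metric hz) (h.isHermitianForm hz).pos (h.contDiffAt hz) hX hY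

/-- Minimality in complex notation. -/
theorem tension_eq (h : IsConformalPatch U G F W) (hz : z ∈ W) :
    tension G F z = (4 : ℂ) • delBar (del F) z
      + (2 : ℂ) • (chern G (F z) (del F z) (delBar F z)
        + chern G (F z) (delBar F z) (del F z)) := by
  have hH := h.isHermitianAt hz
  rw [delBar_del (h.contDiffAt hz), tension, cov, cov,
    fderiv_one_eq F z, fderiv_I_eq F z, hH.chern_I_smul_left, hH.chern_I_smul_right,
    I_smul_I_smul, sub_eq_add_neg, ← neg_one_smul ℂ (delBar F z)]
  simp only [chern_add_left, chern_add_right, hH.chern_smul_left, hH.chern_smul_right]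
  module

end IsConformalPatch

end Patch

/-! ### Adapted frames and the zeros of the complex derivatives -/

section Frame

/-- On the open set `N`, `e₁`, `e₂` is a smooth unitary frame along `F` with `∂F/∂z = σ e₁` and
`∂F/∂z̄ = τ e₂`. -/
structure IsFrameOn (G : C2 → C2 →L[ℝ] C2 →L[ℝ] ℝ) (F : ℂ → C2) (N : Set ℂ) (e₁ e₂ : ℂ → C2)
    (σ τ : ℂ → ℂ) : Prop where
  isOpen : IsOpen N
  contDiffAt_fst : ∀ z ∈ N, ContDiffAt ℝ ∞ e₁ z
  contDiffAt_snd : ∀ z ∈ N, ContDiffAt ℝ ∞ e₂ z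
  isUnitary : ∀ z ∈ N, IsUnitary (G (F z)) (e₁ z) (e₂ z)
  del_eq : ∀ z ∈ N, del F z = σ z • e₁ z
  delBar_eq : ∀ z ∈ N, delBar F z = τ z • e₂ z
  contDiffAt_del_coeff : ∀ z ∈ N, ContDiffAt ℝ ∞ σ z
  contDiffAt_delBar_coeff : ∀ z ∈ N, ContDiffAt ℝ ∞ τ z

variable {U : Set C2} {G : C2 → C2 →L[ℝ] C2 →L[ℝ] ℝ} {F : ℂ → C2} {W : Set ℂ}

theorem IsConformalPatch.exists_frame (h : IsConformalPatch U G F W) {z₀ : ℂ} (hz₀ : z₀ ∈ W) :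
    ∃ N ⊆ W, z₀ ∈ N ∧ ∃ e₁ e₂ σ τ, IsFrameOn G F N e₁ e₂ σ τ := by
  have hd : ∀ z ∈ W, ContDiffAt ℝ ∞ (del F) z := fun z hz => contDiffAt_del (h.contDiffAt hz)
  have hd' : ∀ z ∈ W, ContDiffAt ℝ ∞ (delBar F) z := fun z hz =>
    contDiffAt_delBar (h.contDiffAt hz)
  -- The vectors orthogonal to the second (first) vector of the frame are multiples of the other.
  have key : ∀ (N : Set ℂ) (e₁ e₂ : ℂ → C2), IsOpen N → N ⊆ W →
      (∀ z ∈ N, ContDiffAt ℝ ∞ e₁ z) → (∀ z ∈ N, ContDiffAt ℝ ∞ e₂ z) →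
      (∀ z ∈ N, IsUnitary (G (F z)) (e₁ z) (e₂ z)) →
      (∀ z ∈ N, herm (G (F z)) (del F z) (e₂ z) = 0) →
      (∀ z ∈ N, herm (G (F z)) (delBar F z) (e₁ z) = 0) →
      IsFrameOn G F N e₁ e₂ (fun z => herm (G (F z)) (del F z) (e₁ z))
        (fun z => herm (G (F z)) (delBar F z) (e₂ z)) := by
    intro N e₁ e₂ hN hNW h1 h2 hu hV hW
    exact
      { isOpen := hN
        contDiffAt_fst := h1
        contDiffAt_snd := h2
        isUnitary := hu
        del_eq := fun z hz => (hu z hz).eq_smul_fst (h.isHermitianForm (hNW hz)) (hV z hz)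
        delBar_eq := fun z hz => ((hu z hz).swap (h.isHermitianForm (hNW hz))).eq_smul_fst
          (h.isHermitianForm (hNW hz)) (hW z hz)
        contDiffAt_del_coeff := fun z hz =>
          contDiffAt_herm (h.contDiffAt_metric_comp (hNW hz)) (hd z (hNW hz)) (h1 z hz)
        contDiffAt_delBar_coeff := fun z hz =>
          contDiffAt_herm (h.contDiffAt_metric_comp (hNW hz)) (hd' z (hNW hz)) (h2 z hz) }
  by_cases hV : del F z₀ = 0
  · have hW : delBar F z₀ ≠ 0 := by
      intro hW
      have := h.conformalFactor_pos hz₀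
      rw [h.conformalFactor_eq hz₀, hV, hW] at this
      simp at this
    obtain ⟨N, hN, hNo, hzN⟩ := mem_nhds_iff.1
      (Filter.inter_mem (h.isOpen.mem_nhds hz₀) ((hd' z₀ hz₀).continuousAt.eventually_ne hW))
    obtain ⟨e₂, e₁, r, h2, h1, hu, hr⟩ := exists_unitary_frame (N := N) (B := fun z => G (F z))
      (X := delBar F) (fun z hz => h.contDiffAt_metric_comp (hN hz).1)
      (fun z hz => hd' z (hN hz).1) (fun z hz => h.isHermitianForm (hN hz).1)
      (fun z hz => (hN hz).2)
    have hNW : N ⊆ W := fun z hz => (hN hz).1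
    have hu' : ∀ z ∈ N, IsUnitary (G (F z)) (e₁ z) (e₂ z) := fun z hz =>
      (hu z hz).swap (h.isHermitianForm (hNW hz))
    refine ⟨N, hNW, hzN, e₁, e₂, _, _, key N e₁ e₂ hNo hNW h1 h2 hu' (fun z hz => ?_)
      fun z hz => ?_⟩
    · have hh := h.isHermitianForm (hNW hz)
      have hrz : r z ≠ 0 := by
        intro h0
        exact (hN hz).2 (by rw [hr z hz, h0, zero_smul])
      have := h.herm_del_delBar (hNW hz)
      rw [hr z hz, hh.herm_smul_right] at this
      exact (mul_eq_zero.1 this).resolve_left (by simpa using hrz)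
    · rw [hr z hz, (h.isHermitianForm (hNW hz)).herm_smul_left, (hu z hz).orthogonal, mul_zero]
  · obtain ⟨N, hN, hNo, hzN⟩ := mem_nhds_iff.1
      (Filter.inter_mem (h.isOpen.mem_nhds hz₀) ((hd z₀ hz₀).continuousAt.eventually_ne hV))
    obtain ⟨e₁, e₂, r, h1, h2, hu, hr⟩ := exists_unitary_frame (N := N) (B := fun z => G (F z))
      (X := del F) (fun z hz => h.contDiffAt_metric_comp (hN hz).1)
      (fun z hz => hd z (hN hz).1) (fun z hz => h.isHermitianForm (hN hz).1)
      (fun z hz => (hN hz).2)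
    have hNW : N ⊆ W := fun z hz => (hN hz).1
    refine ⟨N, hNW, hzN, e₁, e₂, _, _, key N e₁ e₂ hNo hNW h1 h2 hu (fun z hz => ?_)
      fun z hz => ?_⟩
    · rw [hr z hz, (h.isHermitianForm (hNW hz)).herm_smul_left, (hu z hz).orthogonal, mul_zero]
    · have hh := h.isHermitianForm (hNW hz)
      have hrz : r z ≠ 0 := by
        intro h0
        exact (hN hz).2 (by rw [hr z hz, h0, zero_smul])
      have := h.herm_del_delBar (hNW hz)
      rw [hr z hz, hh.herm_smul_left] at this
      have := (mul_eq_zero.1 this).resolve_left hrz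
      rw [hh.herm_symm, this, map_zero]

namespace IsFrameOn

variable {N : Set ℂ} {e₁ e₂ : ℂ → C2} {σ τ : ℂ → ℂ} {z : ℂ}

theorem conformalFactor_eq (hf : IsFrameOn G F N e₁ e₂ σ τ) (h : IsConformalPatch U G F W)
    (hN : N ⊆ W) (hz : z ∈ N) : conformalFactor G F z = ‖σ z‖ ^ 2 + ‖τ z‖ ^ 2 := by
  have hh := h.isHermitianForm (hN hz)
  have h1 := hh.herm_self (e₁ z)
  have h2 := hh.herm_self (e₂ z)
  rw [(hf.isUnitary z hz).fst] at h1
  rw [(hf.isUnitary z hz).snd] at h2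
  have h1' : G (F z) (e₁ z) (e₁ z) = 1 := by exact_mod_cast h1.symm
  have h2' : G (F z) (e₂ z) (e₂ z) = 1 := by exact_mod_cast h2.symm
  rw [h.conformalFactor_eq (hN hz), hf.del_eq z hz, hf.delBar_eq z hz, hh.apply_smul_self,
    hh.apply_smul_self, h1', h2', mul_one, mul_one]

theorem del_eq_zero_iff (hf : IsFrameOn G F N e₁ e₂ σ τ) (hz : z ∈ N) :
    del F z = 0 ↔ σ z = 0 := by
  rw [hf.del_eq z hz, smul_eq_zero, or_iff_left (hf.isUnitary z hz).ne_zero_left]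

theorem delBar_eq_zero_iff (hf : IsFrameOn G F N e₁ e₂ σ τ) (hz : z ∈ N) :
    delBar F z = 0 ↔ τ z = 0 := by
  rw [hf.delBar_eq z hz, smul_eq_zero, or_iff_left (hf.isUnitary z hz).ne_zero_right]

/-- The coefficient of `∂F/∂z` solves a linear Cauchy-Riemann equation. -/
theorem exists_dbar_del_coeff_eq (hf : IsFrameOn G F N e₁ e₂ σ τ) (h : IsConformalPatch U G F W)
    (hN : N ⊆ W) (hmin : ∀ z ∈ W, tension G F z = 0) :
    ∃ a : ℂ → ℂ, (∀ z ∈ N, ContDiffAt ℝ ∞ a z) ∧ ∀ z ∈ N, dbar σ z = a z * σ z := by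
  refine ⟨fun z => -herm (G (F z)) ((1 / 2 : ℂ) • (chern G (F z) (e₁ z) (delBar F z)
      + chern G (F z) (delBar F z) (e₁ z)) + delBar e₁ z) (e₁ z), fun z hz => ?_, fun z hz => ?_⟩
  · have he := hf.contDiffAt_fst z hz
    have hW := contDiffAt_delBar (h.contDiffAt (hN hz))
    exact (contDiffAt_herm (h.contDiffAt_metric_comp (hN hz)) ((contDiffAt_complex_smul
      contDiffAt_const ((h.contDiffAt_chern_apply (hN hz) he hW).add
        (h.contDiffAt_chern_apply (hN hz) hW he))).add (contDiffAt_delBar he)) he).neg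
  · have hH := h.isHermitianAt (hN hz)
    have hh := h.isHermitianForm (hN hz)
    have h1 := h.tension_eq (hN hz)
    have h2 : delBar (del F) z = σ z • delBar e₁ z + dbar σ z • e₁ z := by
      have : del F =ᶠ[𝓝 z] fun z => σ z • e₁ z := by
        filter_upwards [hf.isOpen.mem_nhds hz] with w hw using hf.del_eq w hw
      rw [delBar, this.fderiv_eq, ← delBar,
        delBar_smul ((hf.contDiffAt_del_coeff z hz).differentiableAt (by simp))
          ((hf.contDiffAt_fst z hz).differentiableAt (by simp))]
    rw [hmin z (hN hz), h2, hf.del_eq z hz, hH.chern_smul_left, hH.chern_smul_right] at h1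
    have h3 : dbar σ z • e₁ z = -σ z • ((1 / 2 : ℂ) • (chern G (F z) (e₁ z) (delBar F z)
      + chern G (F z) (delBar F z) (e₁ z)) + delBar e₁ z) := by
      linear_combination (norm := module) (-(1 / 4) : ℂ) • h1
    have h4 := congrArg (fun x => herm (G (F z)) x (e₁ z)) h3
    simp only [hh.herm_smul_left, (hf.isUnitary z hz).fst] at h4
    rw [mul_one] at h4
    rw [h4]
    ring

/-- The conjugate of the coefficient of `∂F/∂z̄` solves a linear Cauchy-Riemann equation. -/
theorem exists_dbar_delBar_coeff_eq (hf : IsFrameOn G F N e₁ e₂ σ τ)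
    (h : IsConformalPatch U G F W) (hN : N ⊆ W) (hmin : ∀ z ∈ W, tension G F z = 0) :
    ∃ a : ℂ → ℂ, (∀ z ∈ N, ContDiffAt ℝ ∞ a z) ∧
      ∀ z ∈ N, dbar (fun z => (starRingEnd ℂ) (τ z)) z = a z * (starRingEnd ℂ) (τ z) := by
  refine ⟨fun z => (starRingEnd ℂ) (-herm (G (F z)) ((1 / 2 : ℂ) • (chern G (F z) (del F z) (e₂ z)
      + chern G (F z) (e₂ z) (del F z)) + del e₂ z) (e₂ z)), fun z hz => ?_, fun z hz => ?_⟩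
  · have he := hf.contDiffAt_snd z hz
    have hW := contDiffAt_del (h.contDiffAt (hN hz))
    exact Complex.conjCLE.contDiff.contDiffAt.comp z (contDiffAt_herm
      (h.contDiffAt_metric_comp (hN hz)) ((contDiffAt_complex_smul
      contDiffAt_const ((h.contDiffAt_chern_apply (hN hz) hW he).add
        (h.contDiffAt_chern_apply (hN hz) he hW))).add (contDiffAt_del he)) he).neg
  · have hH := h.isHermitianAt (hN hz)
    have hh := h.isHermitianForm (hN hz)
    have h1 := h.tension_eq (hN hz)
    have h2 : delBar (del F) z = τ z • del e₂ z
        + (starRingEnd ℂ) (dbar (fun z => (starRingEnd ℂ) (τ z)) z) • e₂ z := by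
      have : delBar F =ᶠ[𝓝 z] fun z => τ z • e₂ z := by
        filter_upwards [hf.isOpen.mem_nhds hz] with w hw using hf.delBar_eq w hw
      rw [delBar_del (h.contDiffAt (hN hz)), ← del_delBar (h.contDiffAt (hN hz)), del,
        this.fderiv_eq, ← del,
        del_smul ((hf.contDiffAt_delBar_coeff z hz).differentiableAt (by simp))
          ((hf.contDiffAt_snd z hz).differentiableAt (by simp))]
    rw [hmin z (hN hz), h2, hf.delBar_eq z hz, hH.chern_smul_left, hH.chern_smul_right] at h1
    have h3 : (starRingEnd ℂ) (dbar (fun z => (starRingEnd ℂ) (τ z)) z) • e₂ z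
        = -τ z • ((1 / 2 : ℂ) • (chern G (F z) (del F z) (e₂ z)
      + chern G (F z) (e₂ z) (del F z)) + del e₂ z) := by
      linear_combination (norm := module) (-(1 / 4) : ℂ) • h1
    have h4 := congrArg (fun x => (starRingEnd ℂ) (herm (G (F z)) x (e₂ z))) h3
    simp only [hh.herm_smul_left, (hf.isUnitary z hz).snd] at h4
    rw [mul_one, Complex.conj_conj] at h4
    rw [h4, map_mul]
    simp only [map_neg]
    ring

theorem del_coeff_eq_zero_or (hf : IsFrameOn G F N e₁ e₂ σ τ) (h : IsConformalPatch U G F W)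
    (hN : N ⊆ W) (hmin : ∀ z ∈ W, tension G F z = 0) {z₀ : ℂ} (hz₀ : z₀ ∈ N) :
    (∀ᶠ z in 𝓝 z₀, σ z = 0) ∨ ∃ (p : ℕ) (H : ℂ → ℂ), ContDiffAt ℝ 2 H z₀ ∧ H z₀ ≠ 0 ∧
      ∀ᶠ z in 𝓝 z₀, σ z = (z - z₀) ^ p * H z := by
  obtain ⟨a, ha, hσ⟩ := hf.exists_dbar_del_coeff_eq h hN hmin
  exact eventually_eq_zero_or_exists_pow_mul ((ha z₀ hz₀).of_le ENat.LEInfty.out)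
    ((hf.contDiffAt_del_coeff z₀ hz₀).of_le ENat.LEInfty.out)
    ((hf.isOpen.eventually_mem hz₀).mono hσ)

theorem delBar_coeff_eq_zero_or (hf : IsFrameOn G F N e₁ e₂ σ τ) (h : IsConformalPatch U G F W)
    (hN : N ⊆ W) (hmin : ∀ z ∈ W, tension G F z = 0) {z₀ : ℂ} (hz₀ : z₀ ∈ N) :
    (∀ᶠ z in 𝓝 z₀, τ z = 0) ∨ ∃ (p : ℕ) (H : ℂ → ℂ), ContDiffAt ℝ 2 H z₀ ∧ H z₀ ≠ 0 ∧
      ∀ᶠ z in 𝓝 z₀, τ z = (starRingEnd ℂ) ((z - z₀) ^ p * H z) := by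
  obtain ⟨a, ha, hτ⟩ := hf.exists_dbar_delBar_coeff_eq h hN hmin
  have h1 : ContDiffAt ℝ 2 (fun z => (starRingEnd ℂ) (τ z)) z₀ :=
    Complex.conjCLE.contDiff.contDiffAt.comp z₀
      ((hf.contDiffAt_delBar_coeff z₀ hz₀).of_le ENat.LEInfty.out)
  rcases eventually_eq_zero_or_exists_pow_mul ((ha z₀ hz₀).of_le ENat.LEInfty.out) h1
    ((hf.isOpen.eventually_mem hz₀).mono hτ) with h2 | ⟨p, H, hH, hH0, h2⟩
  · exact Or.inl (h2.mono fun z hz => by simpa using hz)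
  · refine Or.inr ⟨p, H, hH, hH0, h2.mono fun z hz => ?_⟩
    rw [← hz, Complex.conj_conj]

end IsFrameOn

end Frame

/-! ### Coordinate expressions of conformal immersions -/

section LeviCivita

/-- The logarithmic derivative `∂ log λ / ∂z`: the Levi-Civita connection of `λ |dz|²` is
`D_u v = m u v` with this coefficient `m`. -/
def conformalCoeff (l : ℂ → ℝ) (z : ℂ) : ℂ :=
  (fderiv ℝ l z 1 - Complex.I * fderiv ℝ l z Complex.I) / (2 * l z)

set_option maxSynthPendingDepth 4 in
theorem isMetricAt_of_conformal {H : ℂ → ℂ →L[ℝ] ℂ →L[ℝ] ℝ} {l : ℂ → ℝ} {z : ℂ}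
    (hl : DifferentiableAt ℝ l z) (hpos : 0 < l z)
    (h : ∀ᶠ w in 𝓝 z, ∀ a b, H w a b = l w * (a * (starRingEnd ℂ) b).re) :
    IsMetricAt H z ∧ ∀ u v w, fderiv ℝ H z u v w = fderiv ℝ l z u * (v * (starRingEnd ℂ) w).re := by
  obtain ⟨B, hB⟩ : ∃ B : ℂ →L[ℝ] ℂ →L[ℝ] ℝ, ∀ a b, B a b = (a * (starRingEnd ℂ) b).re :=
    ⟨Complex.reCLM.smulRight Complex.reCLM + Complex.imCLM.smulRight Complex.imCLM, fun a b => by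
      simp⟩
  have hH : H =ᶠ[𝓝 z] fun w => l w • B := by
    filter_upwards [h] with w hw
    refine ContinuousLinearMap.ext fun a => ContinuousLinearMap.ext fun b => ?_
    simp only [hw, smul_apply, hB, smul_eq_mul]
  have hd : DifferentiableAt ℝ (fun w => l w • B) z := hl.smul_const B
  refine ⟨⟨hH.symm.differentiableAt_iff.1 hd, ?_, fun v hv => ?_⟩,
    fun u v w => ?_⟩
  · filter_upwards [h] with w hw u v
    rw [hw, hw, mul_comm u, ← Complex.conj_re, map_mul, Complex.conj_conj, mul_comm]
  · rw [h.self_of_nhds, Complex.mul_conj, Complex.ofReal_re]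
    exact mul_pos hpos (Complex.normSq_pos.2 hv)
  · rw [hH.fderiv_eq, fderiv_smul_const hl]
    simp only [ContinuousLinearMap.smulRight_apply, smul_apply, hB, smul_eq_mul]

theorem leviCivita_of_conformal {H : ℂ → ℂ →L[ℝ] ℂ →L[ℝ] ℝ} {l : ℂ → ℝ} {z : ℂ}
    (hl : DifferentiableAt ℝ l z) (hpos : 0 < l z)
    (h : ∀ᶠ w in 𝓝 z, ∀ a b, H w a b = l w * (a * (starRingEnd ℂ) b).re) (u v : ℂ) :
    leviCivita H z u v = conformalCoeff l z * u * v := by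
  obtain ⟨hM, hD⟩ := isMetricAt_of_conformal hl hpos h
  refine eq_of_forall_apply_eq hM.pos fun w => ?_
  rw [hM.leviCivita_apply, hD, hD, hD, h.self_of_nhds, conformalCoeff,
    fderiv_real_apply _ u, fderiv_real_apply _ v, fderiv_real_apply _ w]
  have h1 : ((fderiv ℝ l z 1 - Complex.I * fderiv ℝ l z Complex.I) / (2 * l z) : ℂ)
      = ((1 / (2 * l z) : ℝ) : ℂ) * (fderiv ℝ l z 1 - Complex.I * fderiv ℝ l z Complex.I) := by
    push_cast; ring
  rw [h1, mul_assoc, mul_assoc, mul_assoc, Complex.re_ofReal_mul, ← mul_assoc]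
  have h2 : l z * (1 / (2 * l z)) = 1 / 2 := by field_simp
  rw [h2]
  simp
  ring

end LeviCivita

section Complex

theorem antiPart_eq_zero_iff (L : ℂ →L[ℝ] C2) :
    antiPart L = 0 ↔ ∀ a, L (Complex.I * a) = Complex.I • L a := by
  constructor
  · intro h a
    rw [apply_eq_linPart_add L, apply_eq_linPart_add L a, h]
    module
  · intro h
    have := h 1
    rw [mul_one] at this
    rw [antiPart, this, I_smul_I_smul]
    simp

theorem linPart_eq_zero_iff (L : ℂ →L[ℝ] C2) :
    linPart L = 0 ↔ ∀ a, L (Complex.I * a) = -(Complex.I • L a) := by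
  constructor
  · intro h a
    rw [apply_eq_linPart_add L, apply_eq_linPart_add L a, h]
    simp only [map_mul, Complex.conj_I]
    module
  · intro h
    have := h 1
    rw [mul_one] at this
    rw [linPart, this, smul_neg, I_smul_I_smul]
    simp

theorem del_comp {X : ℂ → C2} {φ : ℂ → ℂ} {z : ℂ} (hX : DifferentiableAt ℝ X (φ z))
    (hφ : DifferentiableAt ℂ φ z) :
    del (fun w => X (φ w)) z = deriv φ z • del X (φ z) := by
  have h : ∀ a, fderiv ℝ (fun w => X (φ w)) z a = fderiv ℝ X (φ z) (deriv φ z * a) := by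
    intro a
    rw [← fderiv_real_apply_of_differentiableAt hφ]
    exact congrArg (fun L : ℂ →L[ℝ] C2 => L a) (fderiv_comp z hX (hφ.restrictScalars ℝ))
  rw [del, linPart, h, h, fderiv_eq_del_add_delBar X, fderiv_eq_del_add_delBar X]
  ext k
  simp
  linear_combination (-(1 / 2) * deriv φ z * del X (φ z) k
    + (1 / 2) * (starRingEnd ℂ) (deriv φ z) * delBar X (φ z) k) * Complex.I_sq

theorem delBar_comp {X : ℂ → C2} {φ : ℂ → ℂ} {z : ℂ} (hX : DifferentiableAt ℝ X (φ z))
    (hφ : DifferentiableAt ℂ φ z) :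
    delBar (fun w => X (φ w)) z = (starRingEnd ℂ) (deriv φ z) • delBar X (φ z) := by
  have h : ∀ a, fderiv ℝ (fun w => X (φ w)) z a = fderiv ℝ X (φ z) (deriv φ z * a) := by
    intro a
    rw [← fderiv_real_apply_of_differentiableAt hφ]
    exact congrArg (fun L : ℂ →L[ℝ] C2 => L a) (fderiv_comp z hX (hφ.restrictScalars ℝ))
  rw [delBar, antiPart, h, h, fderiv_eq_del_add_delBar X, fderiv_eq_del_add_delBar X]
  ext k
  simp
  linear_combination ((1 / 2) * deriv φ z * del X (φ z) k
    - (1 / 2) * (starRingEnd ℂ) (deriv φ z) * delBar X (φ z) k) * Complex.I_sq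

theorem del_congr {X Y : ℂ → C2} {z : ℂ} (h : X =ᶠ[𝓝 z] Y) : del X z = del Y z := by
  rw [del, del, h.fderiv_eq]

theorem delBar_congr {X Y : ℂ → C2} {z : ℂ} (h : X =ᶠ[𝓝 z] Y) : delBar X z = delBar Y z := by
  rw [delBar, delBar, h.fderiv_eq]

end Complex

section Charts

variable {M : Type*} [TopologicalSpace M] [ChartedSpace C2 M] [IsManifold 𝓘(ℂ, C2) ω M]
  {S : Type*} [TopologicalSpace S] [ChartedSpace ℂ S] [IsManifold 𝓘(ℂ, ℂ) ω S]
  {g : HermitianMetric M} {f : S → M} {e e' : OpenPartialHomeomorph S ℂ}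
  {c c' : OpenPartialHomeomorph M C2} {z : ℂ}

theorem inChart_rep_apply (hf : ContMDiff 𝓘(ℝ, ℂ) 𝓘(ℝ, C2) ∞ f) (he : e ∈ atlas ℂ S)
    (hc : c ∈ atlas C2 M) (hz : z ∈ repDomain f e c) (a b : ℂ) :
    g.inChart c (rep f e c z) (fderiv ℝ (rep f e c) z a) (fderiv ℝ (rep f e c) z b)
      = g.form (f (e.symm z)) (dMap f (e.symm z) (dTrans e (chartAt ℂ (e.symm z)) z a))
        (dMap f (e.symm z) (dTrans e (chartAt ℂ (e.symm z)) z b)) := by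
  rw [g.inChart_apply hc (rep_mem_target hz), symm_rep hz, fderiv_rep_eq_dMap hf he hc hz,
    fderiv_rep_eq_dMap hf he hc hz]

theorem isConformalPatch_rep (hf : IsConformalImmersion g f) (he : e ∈ atlas ℂ S)
    (hc : c ∈ atlas C2 M) :
    IsConformalPatch c.target (g.inChart c) (rep f e c) (repDomain f e c) where
  hermitian := g.isHermitianOn_inChart hc
  isOpen := isOpen_repDomain hf.contMDiff.continuous
  contDiffOn := contDiffOn_rep hf.contMDiff he hc
  mapsTo _ hz := rep_mem_target hz
  injective z hz a b hab := by
    have h := congrArg (dTrans c (chartAt C2 (f (e.symm z))) (rep f e c z)) hab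
    rw [fderiv_rep_eq_dMap hf.contMDiff he hc hz, fderiv_rep_eq_dMap hf.contMDiff he hc hz] at h
    exact (bijective_dTrans he (chart_mem_atlas _ _) hz.1 (mem_chart_source _ _)).1
      (hf.injective_mfderiv _ h)
  conformal z hz a b := by
    rw [inChart_rep_apply hf.contMDiff he hc hz, inChart_rep_apply hf.contMDiff he hc hz,
      ← smul_eq_mul, ← smul_eq_mul, dTrans_I_smul he (chart_mem_atlas _ _) hz.1
        (mem_chart_source _ _), dTrans_I_smul he (chart_mem_atlas _ _) hz.1 (mem_chart_source _ _)]
    exact hf.conformal _ _ _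

theorem mem_complexPoints_iff (hf : ContMDiff 𝓘(ℝ, ℂ) 𝓘(ℝ, C2) ∞ f) (he : e ∈ atlas ℂ S)
    (hc : c ∈ atlas C2 M) (hz : z ∈ repDomain f e c) :
    e.symm z ∈ complexPoints f ↔ delBar (rep f e c) z = 0 := by
  have hbe := bijective_dTrans he (chart_mem_atlas ℂ (e.symm z)) hz.1 (mem_chart_source _ _)
  have hys : c.symm (rep f e c z) ∈ (chartAt C2 (f (e.symm z))).source := by
    rw [symm_rep hz]; exact mem_chart_source _ _
  have hbc := bijective_dTrans hc (chart_mem_atlas C2 (f (e.symm z))) (rep_mem_target hz) hys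
  rw [delBar, antiPart_eq_zero_iff]
  have h1 : e.symm z ∈ complexPoints f ↔ ∀ v : ℂ, dMap f (e.symm z) (Complex.I • v)
    = Complex.I • dMap f (e.symm z) v := Iff.rfl
  rw [h1, hbe.2.forall]
  refine forall_congr' fun a => ?_
  rw [← dTrans_I_smul he (chart_mem_atlas _ _) hz.1 (mem_chart_source _ _),
    ← fderiv_rep_eq_dMap hf he hc hz, ← fderiv_rep_eq_dMap hf he hc hz,
    ← dTrans_I_smul hc (chart_mem_atlas _ _) (rep_mem_target hz) hys, hbc.1.eq_iff, smul_eq_mul]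

theorem mem_anticomplexPoints_iff (hf : ContMDiff 𝓘(ℝ, ℂ) 𝓘(ℝ, C2) ∞ f) (he : e ∈ atlas ℂ S)
    (hc : c ∈ atlas C2 M) (hz : z ∈ repDomain f e c) :
    e.symm z ∈ anticomplexPoints f ↔ del (rep f e c) z = 0 := by
  have hbe := bijective_dTrans he (chart_mem_atlas ℂ (e.symm z)) hz.1 (mem_chart_source _ _)
  have hys : c.symm (rep f e c z) ∈ (chartAt C2 (f (e.symm z))).source := by
    rw [symm_rep hz]; exact mem_chart_source _ _
  have hbc := bijective_dTrans hc (chart_mem_atlas C2 (f (e.symm z))) (rep_mem_target hz) hys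
  rw [del, linPart_eq_zero_iff]
  have h1 : e.symm z ∈ anticomplexPoints f ↔ ∀ v : ℂ, dMap f (e.symm z) (Complex.I • v)
    = -(Complex.I • dMap f (e.symm z) v) := Iff.rfl
  rw [h1, hbe.2.forall]
  refine forall_congr' fun a => ?_
  rw [← dTrans_I_smul he (chart_mem_atlas _ _) hz.1 (mem_chart_source _ _),
    ← fderiv_rep_eq_dMap hf he hc hz, ← fderiv_rep_eq_dMap hf he hc hz,
    ← dTrans_I_smul hc (chart_mem_atlas _ _) (rep_mem_target hz) hys, ← map_neg,
    hbc.1.eq_iff, smul_eq_mul]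

theorem connectionsRelated_chern_inChart (g : HermitianMetric M) (hc : c ∈ atlas C2 M)
    (hc' : c' ∈ atlas C2 M) {q : C2} (hq : q ∈ c.target) (hq' : c.symm q ∈ c'.source) :
    ConnectionsRelated (chern (g.inChart c)) (chern (g.inChart c')) (fun q => c' (c.symm q)) q :=
  connectionsRelated_chern ((g.isHermitianOn_inChart hc).isHermitianAt hq)
    ((g.isHermitianOn_inChart hc').isHermitianAt (c'.map_source hq'))
    ((contDiffAt_transition hc hc' hq hq').of_le le_top)
    ((eventually_mem_target_and_source hq hq').mono fun _ hp u v =>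
      g.inChart_dTrans hc hc' hp.1 hp.2 u v) (bijective_dTrans hc hc' hq hq').2

theorem connectionsRelated_leviCivita_inChart (g : HermitianMetric M) (hc : c ∈ atlas C2 M)
    (hc' : c' ∈ atlas C2 M) {q : C2} (hq : q ∈ c.target) (hq' : c.symm q ∈ c'.source) :
    ConnectionsRelated (leviCivita (g.inChart c)) (leviCivita (g.inChart c'))
      (fun q => c' (c.symm q)) q :=
  connectionsRelated_leviCivita ((g.isHermitianOn_inChart hc).isHermitianAt hq).toIsMetricAt
    ((g.isHermitianOn_inChart hc').isHermitianAt (c'.map_source hq')).toIsMetricAt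
    ((contDiffAt_transition_real hc hc' hq hq').of_le ENat.LEInfty.out)
    ((eventually_mem_target_and_source hq hq').mono fun _ hp u v =>
      g.inChart_dTrans hc hc' hp.1 hp.2 u v) (bijective_dTrans hc hc' hq hq').2

/-- Covariant derivatives along `f` do not depend on the chart of `M`. -/
theorem cov_rep_change_target {Γ Γ' : C2 → C2 → C2 → C2} (hf : IsConformalImmersion g f)
    (he : e ∈ atlas ℂ S) (hc : c ∈ atlas C2 M) (hc' : c' ∈ atlas C2 M) (hz : z ∈ repDomain f e c)
    (hz' : f (e.symm z) ∈ c'.source)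
    (hΓ : ConnectionsRelated Γ Γ' (fun q => c' (c.symm q)) (rep f e c z)) {X X' : ℂ → C2}
    (hX : DifferentiableAt ℝ X z)
    (hX' : X' =ᶠ[𝓝 z] fun w => dTrans c c' (rep f e c w) (X w)) (a : ℂ) :
    cov Γ' (rep f e c') X' z a = dTrans c c' (rep f e c z) (cov Γ (rep f e c) X z a) :=
  cov_of_connectionsRelated hΓ ((contDiffAt_transition_real hc hc' (rep_mem_target hz)
      (by rwa [symm_rep hz])).of_le ENat.LEInfty.out)
    (((isConformalPatch_rep hf he hc).contDiffAt hz).differentiableAt (by simp)) hX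
    (rep_change_target hz hf.contMDiff.continuous) hX' a

theorem fderiv_rep_change_target_eventually (hf : ContMDiff 𝓘(ℝ, ℂ) 𝓘(ℝ, C2) ∞ f)
    (he : e ∈ atlas ℂ S) (hc : c ∈ atlas C2 M) (hc' : c' ∈ atlas C2 M)
    (hz : z ∈ repDomain f e c) (hz' : f (e.symm z) ∈ c'.source) (a : ℂ) :
    (fun w => fderiv ℝ (rep f e c') w a)
      =ᶠ[𝓝 z] fun w => dTrans c c' (rep f e c w) (fderiv ℝ (rep f e c) w a) := by
  have h1 : z ∈ repDomain f e c' := ⟨hz.1, hz'⟩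
  filter_upwards [(isOpen_repDomain hf.continuous).mem_nhds hz,
    (isOpen_repDomain hf.continuous).mem_nhds h1] with w hw hw'
  exact fderiv_rep_change_target hf he hc hc' hw hw'.2 a

theorem tension_change_target (hf : IsConformalImmersion g f) (he : e ∈ atlas ℂ S)
    (hc : c ∈ atlas C2 M) (hc' : c' ∈ atlas C2 M) (hz : z ∈ repDomain f e c)
    (hz' : f (e.symm z) ∈ c'.source) : tension (g.inChart c') (rep f e c') z
      = dTrans c c' (rep f e c z) (tension (g.inChart c) (rep f e c) z) := by
  have h : ∀ a b, cov (chern (g.inChart c')) (rep f e c') (fun w => fderiv ℝ (rep f e c') w b) z a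
      = dTrans c c' (rep f e c z)
        (cov (chern (g.inChart c)) (rep f e c) (fun w => fderiv ℝ (rep f e c) w b) z a) :=
    fun a b => cov_rep_change_target hf he hc hc' hz hz'
      (connectionsRelated_chern_inChart g hc hc' (rep_mem_target hz) (by rwa [symm_rep hz]))
      ((contDiffAt_fderiv_apply ((isConformalPatch_rep hf he hc).contDiffAt hz) b).differentiableAt
        (by simp))
      (fderiv_rep_change_target_eventually hf.contMDiff he hc hc' hz hz' b) a
  rw [tension, tension, h, h, map_add]

theorem tension_change_source (hf : IsConformalImmersion g f) (he : e ∈ atlas ℂ S)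
    (he' : e' ∈ atlas ℂ S) (hc : c ∈ atlas C2 M) (hz : z ∈ repDomain f e c)
    (hz' : e.symm z ∈ e'.source) :
    ∃ k : ℂ, tension (g.inChart c) (rep f e c) z
      = k • tension (g.inChart c) (rep f e' c) (e' (e.symm z)) := by
  set φ : ℂ → ℂ := fun w => e' (e.symm w)
  have hφ : ContDiffAt ℂ ω φ z := contDiffAt_transition he he' hz.1 hz'
  have hφd : DifferentiableAt ℂ φ z := hφ.differentiableAt (by simp)
  have hP := isConformalPatch_rep hf he hc
  have hP' := isConformalPatch_rep hf he' hc
  have hφz : φ z ∈ repDomain f e' c := mem_repDomain_change_source hz hz'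
  have hFd := (hP'.contDiffAt hφz)
  have hF : rep f e c =ᶠ[𝓝 z] fun w => rep f e' c (φ w) := rep_change_source hz.1 hz'
  have h1 : del (rep f e c) =ᶠ[𝓝 z] fun w => deriv φ w • del (rep f e' c) (φ w) := by
    filter_upwards [eventually_mem_target_and_source hz.1 hz', hP.isOpen.mem_nhds hz] with w hw hw'
    rw [del_congr (rep_change_source hw.1 hw.2), del_comp]
    · exact (hP'.contDiffAt (mem_repDomain_change_source hw' hw.2)).differentiableAt (by simp)
    · exact (contDiffAt_transition he he' hw.1 hw.2).differentiableAt (by simp)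
  have h2 : delBar (rep f e c) z = (starRingEnd ℂ) (deriv φ z) • delBar (rep f e' c) (φ z) := by
    rw [delBar_congr hF, delBar_comp (hFd.differentiableAt (by simp)) hφd]
  have h3 : DifferentiableAt ℂ (deriv φ) z := by
    have := hφ.analyticAt.deriv
    exact this.differentiableAt
  have hd : DifferentiableAt ℝ (del (rep f e' c)) (φ z) :=
    (contDiffAt_del hFd).differentiableAt (by simp)
  have h4 : delBar (del (rep f e c)) z = deriv φ z • (starRingEnd ℂ) (deriv φ z) •
      delBar (del (rep f e' c)) (φ z) := by
    have hd' : DifferentiableAt ℝ (fun w => del (rep f e' c) (φ w)) z :=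
      hd.comp z (hφd.restrictScalars ℝ)
    rw [delBar_congr h1, delBar_smul (h3.restrictScalars ℝ) hd',
      dbar_eq_zero_of_differentiableAt h3, zero_smul, add_zero, delBar_comp hd hφd]
  have hH := hP'.isHermitianAt hφz
  refine ⟨deriv φ z * (starRingEnd ℂ) (deriv φ z), ?_⟩
  rw [hP.tension_eq hz, hP'.tension_eq hφz, h4, h1.self_of_nhds, h2, hF.self_of_nhds]
  simp only [hH.chern_smul_left, hH.chern_smul_right]
  module

end Charts

/-! ### Minimality in arbitrary charts -/

section Minimal

variable {M : Type*} [TopologicalSpace M] [ChartedSpace C2 M] [IsManifold 𝓘(ℂ, C2) ω M]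
  {S : Type*} [TopologicalSpace S] [ChartedSpace ℂ S] [IsManifold 𝓘(ℂ, ℂ) ω S]
  {g : HermitianMetric M} {f : S → M} {e : OpenPartialHomeomorph S ℂ}
  {c : OpenPartialHomeomorph M C2} {z : ℂ}

theorem mem_repDomain_targetChart {z₀ : ℂ} (hz : z₀ ∈ e.target) :
    z₀ ∈ repDomain f e (targetChart f e z₀) := ⟨hz, mem_chart_source C2 _⟩

theorem targetChart_mem_atlas (f : S → M) (e : OpenPartialHomeomorph S ℂ) (z₀ : ℂ) :
    targetChart f e z₀ ∈ atlas C2 M := chart_mem_atlas _ _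

/-- In an isothermal coordinate the Levi-Civita part of the trace of the second fundamental form
cancels. -/
theorem tension_eq_zero_chartAt (hf : IsConformalImmersion g f) (hmin : IsChernMinimal g f)
    (x : S) : tension (localMetric g f (chartAt ℂ x) (chartAt ℂ x x))
      (localRep f (chartAt ℂ x) (chartAt ℂ x x)) (chartAt ℂ x x) = 0 := by
  set e := chartAt ℂ x with he
  set z₀ := e x with hz₀
  set c := targetChart f e z₀ with hc
  have hP := isConformalPatch_rep hf (chart_mem_atlas ℂ x) (targetChart_mem_atlas f e z₀)
  have hz : z₀ ∈ repDomain f e c := mem_repDomain_targetChart (mem_chart_target ℂ x)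
  set l := conformalFactor (g.inChart c) (rep f e c) with hl
  have hpos : 0 < l z₀ := hP.conformalFactor_pos hz
  have hH : ∀ᶠ w in 𝓝 z₀, ∀ a b, inducedMetric g f e z₀ w a b
      = l w * (a * (starRingEnd ℂ) b).re := by
    filter_upwards [hP.isOpen.mem_nhds hz] with w hw a b
    exact hP.metric_apply hw a b
  have hLC : ∀ u v, leviCivita (inducedMetric g f e z₀) z₀ u v = conformalCoeff l z₀ * u * v :=
    leviCivita_of_conformal ((hP.contDiffAt_conformalFactor hz).differentiableAt (by simp)) hpos hH
  set r : ℝ := (√(l z₀))⁻¹ with hr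
  have hrl : l z₀ * (r * r) = 1 := by
    rw [hr, ← mul_inv, Real.mul_self_sqrt hpos.le, mul_inv_cancel₀ hpos.ne']
  have h := hmin x (r : ℂ) (r * Complex.I)
  simp only [← he, ← hz₀, hH.self_of_nhds] at h
  have h := h (by simp [hrl]) (by simp [hrl]) (by simp)
  simp only [secondFundamentalForm] at h
  rw [hLC, hLC] at h
  have hF : ContDiffAt ℝ ∞ (localRep f e z₀) z₀ := hP.contDiffAt hz
  simp only [fderiv_fderiv_apply hF] at h
  have h1 : (r : ℂ) = r • (1 : ℂ) := by simp
  have h2 : (r : ℂ) * Complex.I = r • Complex.I := by simp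
  have h3 : conformalCoeff l z₀ * (r * Complex.I) * (r * Complex.I)
      = -(conformalCoeff l z₀ * r * r) := by
    linear_combination (conformalCoeff l z₀ * r * r) * Complex.I_sq
  rw [h3, map_neg, h2, h1] at h
  simp only [map_smul_real, smul_apply, chern_smul_left_real, chern_smul_right_real] at h
  have h4 : (r * r) • tension (localMetric g f e z₀) (localRep f e z₀) z₀ = 0 := by
    rw [← h, tension, cov, cov, fderiv_fderiv_apply hF, fderiv_fderiv_apply hF]
    module
  refine (smul_eq_zero.1 h4).resolve_left fun h0 => ?_
  rw [h0] at hrl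
  simp at hrl

theorem tension_rep_eq_zero (hf : IsConformalImmersion g f) (hmin : IsChernMinimal g f)
    (he : e ∈ atlas ℂ S) (hc : c ∈ atlas C2 M) (hz : z ∈ repDomain f e c) :
    tension (g.inChart c) (rep f e c) z = 0 := by
  have hx := mem_chart_source ℂ (e.symm z)
  obtain ⟨k, hk⟩ := tension_change_source hf he (chart_mem_atlas ℂ (e.symm z)) hc hz hx
  have hz1 := mem_repDomain_change_source hz hx
  have h1 : tension (g.inChart (targetChart f (chartAt ℂ (e.symm z))
      (chartAt ℂ (e.symm z) (e.symm z)))) (rep f (chartAt ℂ (e.symm z)) _)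
      (chartAt ℂ (e.symm z) (e.symm z)) = 0 := tension_eq_zero_chartAt hf hmin (e.symm z)
  rw [hk, tension_change_target hf (chart_mem_atlas ℂ (e.symm z)) (targetChart_mem_atlas f _ _) hc
    (mem_repDomain_targetChart (mem_chart_target ℂ _)) hz1.2, h1, map_zero, smul_zero]

end Minimal

/-! ### Orders -/

section Order

variable {M : Type*} [TopologicalSpace M] [ChartedSpace C2 M] [IsManifold 𝓘(ℂ, C2) ω M]
  {S : Type*} [TopologicalSpace S] [ChartedSpace ℂ S] [IsManifold 𝓘(ℂ, ℂ) ω S]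
  {g : HermitianMetric M} {f : S → M} {e : OpenPartialHomeomorph S ℂ} {z₀ : ℂ}

theorem IsFrameOn.isAdaptedFrame (hf : IsConformalImmersion g f) (he : e ∈ atlas ℂ S)
    {N : Set ℂ} (hN : N ⊆ repDomain f e (targetChart f e z₀)) {e₁ e₂ : ℂ → C2} {σ τ : ℂ → ℂ}
    (h : IsFrameOn (localMetric g f e z₀) (localRep f e z₀) N e₁ e₂ σ τ) (hz₀ : z₀ ∈ N) :
    IsAdaptedFrame g f e z₀ e₁ e₂
      (fun z => (√(conformalFactor (localMetric g f e z₀) (localRep f e z₀) z) : ℝ))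
      (fun z => σ z / (√(conformalFactor (localMetric g f e z₀) (localRep f e z₀) z) : ℝ))
      (fun z => τ z / (√(conformalFactor (localMetric g f e z₀) (localRep f e z₀) z) : ℝ)) := by
  have hP := isConformalPatch_rep hf he (targetChart_mem_atlas f e z₀)
  have hpos : ∀ z ∈ N, 0 < conformalFactor (localMetric g f e z₀) (localRep f e z₀) z :=
    fun z hz => hP.conformalFactor_pos (hN hz)
  refine ⟨h.contDiffAt_fst _ hz₀, h.contDiffAt_snd _ hz₀, ?_, ?_, ?_, ?_⟩
  · exact Complex.ofRealCLM.contDiff.contDiffAt.comp z₀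
      ((hP.contDiffAt_conformalFactor (hN hz₀)).sqrt (hpos z₀ hz₀).ne')
  · filter_upwards [h.isOpen.mem_nhds hz₀] with z hz a
    have h1 : inducedMetric g f e z₀ z a a
        = conformalFactor (localMetric g f e z₀) (localRep f e z₀) z * (a * (starRingEnd ℂ) a).re :=
      hP.metric_apply (hN hz) a a
    rw [h1, norm_mul, Complex.norm_real, Real.norm_of_nonneg (Real.sqrt_nonneg _), mul_pow,
      Real.sq_sqrt (hpos z hz).le, Complex.mul_conj, Complex.ofReal_re, Complex.normSq_eq_norm_sq]
  · filter_upwards [h.isOpen.mem_nhds hz₀] with z hz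
    exact ⟨(h.isUnitary z hz).fst, (h.isUnitary z hz).snd, (h.isUnitary z hz).orthogonal⟩
  · filter_upwards [h.isOpen.mem_nhds hz₀] with z hz a
    have h0 : ((√(conformalFactor (localMetric g f e z₀) (localRep f e z₀) z) : ℝ) : ℂ) ≠ 0 := by
      exact_mod_cast (Real.sqrt_pos.2 (hpos z hz)).ne'
    rw [fderiv_eq_del_add_delBar, h.del_eq z hz, h.delBar_eq z hz, map_mul, Complex.conj_ofReal,
      smul_smul, smul_smul]
    congr 2 <;> field_simp

/-- The absolute values of `s` and `t` do not depend on the adapted frame. -/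
theorem IsAdaptedFrame.norm_eq (hf : IsConformalImmersion g f) (he : e ∈ atlas ℂ S)
    (hz₀ : z₀ ∈ e.target) {e₁ e₂ : ℂ → C2} {μ s t : ℂ → ℂ}
    (h : IsAdaptedFrame g f e z₀ e₁ e₂ μ s t) : ∀ᶠ z in 𝓝 z₀,
      let G := localMetric g f e z₀ (localRep f e z₀ z)
      let l := conformalFactor (localMetric g f e z₀) (localRep f e z₀) z
      0 < l ∧ ‖s z‖ ^ 2 = G (del (localRep f e z₀) z) (del (localRep f e z₀) z) / l ∧
        ‖t z‖ ^ 2 = G (delBar (localRep f e z₀) z) (delBar (localRep f e z₀) z) / l := by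
  have hP := isConformalPatch_rep hf he (targetChart_mem_atlas f e z₀)
  have hz : z₀ ∈ repDomain f e (targetChart f e z₀) := mem_repDomain_targetChart hz₀
  filter_upwards [hP.isOpen.mem_nhds hz, h.coframe, h.unitary, h.adapted] with z hzW hco hu had
  have hpos : 0 < conformalFactor (localMetric g f e z₀) (localRep f e z₀) z :=
    hP.conformalFactor_pos hzW
  have hl : conformalFactor (localMetric g f e z₀) (localRep f e z₀) z = ‖μ z‖ ^ 2 := by
    have h1 : inducedMetric g f e z₀ z 1 1 = ‖μ z‖ ^ 2 := by simpa using hco 1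
    exact h1
  have hh : IsHermitianForm (localMetric g f e z₀ (localRep f e z₀ z)) := hP.isHermitianForm hzW
  have hd : del (localRep f e z₀) z = (s z * μ z) • e₁ z := by
    rw [del, linPart, had, had]
    simp only [map_mul, map_one, Complex.conj_I]
    ext k
    simp
    linear_combination (-(1 / 2) * s z * μ z * e₁ z k
      + (1 / 2) * t z * (starRingEnd ℂ) (μ z) * e₂ z k) * Complex.I_sq
  have hd' : delBar (localRep f e z₀) z = (t z * (starRingEnd ℂ) (μ z)) • e₂ z := by
    rw [delBar, antiPart, had, had]
    simp only [map_mul, map_one, Complex.conj_I]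
    ext k
    simp
    linear_combination ((1 / 2) * s z * μ z * e₁ z k
      - (1 / 2) * t z * (starRingEnd ℂ) (μ z) * e₂ z k) * Complex.I_sq
  have h1 := hh.herm_self (e₁ z)
  have h2 := hh.herm_self (e₂ z)
  rw [hu.1] at h1
  rw [hu.2.1] at h2
  have h1' : localMetric g f e z₀ (localRep f e z₀ z) (e₁ z) (e₁ z) = 1 := by
    exact_mod_cast h1.symm
  have h2' : localMetric g f e z₀ (localRep f e z₀ z) (e₂ z) (e₂ z) = 1 := by
    exact_mod_cast h2.symm
  refine ⟨hpos, ?_, ?_⟩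
  · rw [hd, hh.apply_smul_self, h1', hl, norm_mul]
    rw [hl] at hpos
    have hμ : ‖μ z‖ ≠ 0 := fun h0 => by simp [h0] at hpos
    field_simp
  · rw [hd', hh.apply_smul_self, h2', hl, norm_mul, RCLike.norm_conj]
    rw [hl] at hpos
    have hμ : ‖μ z‖ ≠ 0 := fun h0 => by simp [h0] at hpos
    field_simp

/-- The order of a zero is determined by the absolute value. -/
theorem le_of_norm_pow_mul_eq {z₀ : ℂ} {p q : ℕ} {h k : ℂ → ℂ} (hh : ContinuousAt h z₀)
    (hh0 : h z₀ ≠ 0) (hk : ContinuousAt k z₀)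
    (heq : ∀ᶠ z in 𝓝 z₀, ‖z - z₀‖ ^ p * ‖h z‖ = ‖z - z₀‖ ^ q * ‖k z‖) : q ≤ p := by
  by_contra! hlt
  obtain ⟨m, rfl⟩ := Nat.exists_eq_add_of_lt hlt
  have h1 : ∀ᶠ z in 𝓝[≠] z₀, ‖h z‖ = ‖z - z₀‖ ^ (m + 1) * ‖k z‖ := by
    filter_upwards [heq.filter_mono nhdsWithin_le_nhds, self_mem_nhdsWithin] with z hz hne
    have hp : ‖z - z₀‖ ≠ 0 := norm_ne_zero_iff.2 (sub_ne_zero.2 hne)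
    refine mul_left_cancel₀ (pow_ne_zero p hp) ?_
    rw [hz]
    ring
  have h2 : Filter.Tendsto (fun z => ‖z - z₀‖ ^ (m + 1) * ‖k z‖) (𝓝[≠] z₀) (𝓝 0) := by
    have h3 : ContinuousAt (fun z => ‖z - z₀‖ ^ (m + 1) * ‖k z‖) z₀ := by fun_prop
    have h4 := h3.tendsto
    simp only [sub_self, norm_zero, ne_eq, Nat.add_eq_zero_iff, one_ne_zero, and_false,
      not_false_eq_true, zero_pow, zero_mul] at h4
    exact h4.mono_left nhdsWithin_le_nhds
  have h3 : Filter.Tendsto (fun z => ‖h z‖) (𝓝[≠] z₀) (𝓝 ‖h z₀‖) :=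
    hh.norm.tendsto.mono_left nhdsWithin_le_nhds
  have h4 := tendsto_nhds_unique (h3.congr' h1) h2
  exact hh0 (norm_eq_zero.1 h4)

theorem IsComplexOrder.unique (hf : IsConformalImmersion g f) {x : S} {p q : ℕ}
    (hp : IsComplexOrder g f x p) (hq : IsComplexOrder g f x q) : p = q := by
  obtain ⟨e₁, e₂, μ, s, t, h, had, hh, hh0, ht⟩ := hp
  obtain ⟨e₁', e₂', μ', s', t', k, had', hk, hk0, ht'⟩ := hq
  have h1 := had.norm_eq hf (chart_mem_atlas ℂ x) (mem_chart_target ℂ x)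
  have h2 := had'.norm_eq hf (chart_mem_atlas ℂ x) (mem_chart_target ℂ x)
  have key : ∀ᶠ z in 𝓝 (chartAt ℂ x x),
      ‖z - chartAt ℂ x x‖ ^ p * ‖h z‖ = ‖z - chartAt ℂ x x‖ ^ q * ‖k z‖ := by
    filter_upwards [h1, h2, ht, ht'] with z hz1 hz2 hz3 hz4
    have h5 : ‖t z‖ = ‖t' z‖ := by
      rw [← sq_eq_sq₀ (norm_nonneg _) (norm_nonneg _), hz1.2.2, hz2.2.2]
    rwa [hz3, hz4, norm_mul, norm_mul, norm_pow, norm_pow, RCLike.norm_conj] at h5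
  exact le_antisymm (le_of_norm_pow_mul_eq hk hk0 hh (key.mono fun z hz => hz.symm))
    (le_of_norm_pow_mul_eq hh hh0 hk key)

theorem IsAnticomplexOrder.unique (hf : IsConformalImmersion g f) {x : S} {p q : ℕ}
    (hp : IsAnticomplexOrder g f x p) (hq : IsAnticomplexOrder g f x q) : p = q := by
  obtain ⟨e₁, e₂, μ, s, t, h, had, hh, hh0, hs⟩ := hp
  obtain ⟨e₁', e₂', μ', s', t', k, had', hk, hk0, hs'⟩ := hq
  have h1 := had.norm_eq hf (chart_mem_atlas ℂ x) (mem_chart_target ℂ x)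
  have h2 := had'.norm_eq hf (chart_mem_atlas ℂ x) (mem_chart_target ℂ x)
  have key : ∀ᶠ z in 𝓝 (chartAt ℂ x x),
      ‖z - chartAt ℂ x x‖ ^ p * ‖h z‖ = ‖z - chartAt ℂ x x‖ ^ q * ‖k z‖ := by
    filter_upwards [h1, h2, hs, hs'] with z hz1 hz2 hz3 hz4
    have h5 : ‖s z‖ = ‖s' z‖ := by
      rw [← sq_eq_sq₀ (norm_nonneg _) (norm_nonneg _), hz1.2.1, hz2.2.1]
    rwa [hz3, hz4, norm_mul, norm_mul, norm_pow, norm_pow] at h5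
  exact le_antisymm (le_of_norm_pow_mul_eq hk hk0 hh (key.mono fun z hz => hz.symm))
    (le_of_norm_pow_mul_eq hh hh0 hk key)

end Order

/-! ### Finiteness -/

section Finite

/-- A subset of a compact connected space that is near each point either everything or contained in
that point is finite, unless it is the whole space. -/
theorem finite_of_forall_eventually {S : Type*} [TopologicalSpace S] [CompactSpace S]
    [ConnectedSpace S] {A : Set S} (hA : A ≠ Set.univ)
    (h : ∀ x, (∀ᶠ y in 𝓝 x, y ∈ A) ∨ ∀ᶠ y in 𝓝[≠] x, y ∉ A) :
    A.Finite ∧ ∀ x, ¬∀ᶠ y in 𝓝 x, y ∈ A := by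
  have hcl : IsClopen (interior A) := by
    refine ⟨⟨isOpen_iff_mem_nhds.2 fun x hx => ?_⟩, isOpen_interior⟩
    have h1 := (h x).resolve_left fun h2 => hx (mem_interior_iff_mem_nhds.2 h2)
    have h2 := eventually_nhdsWithin_iff.1 h1
    filter_upwards [h2] with y hy hyA
    by_cases hyx : y = x
    · exact hx (hyx ▸ hyA)
    · exact hy hyx (interior_subset hyA)
  rcases isClopen_iff.1 hcl with h0 | h0
  · have h2 : ∀ x, ¬∀ᶠ y in 𝓝 x, y ∈ A := fun x hx => by
      have : x ∈ interior A := mem_interior_iff_mem_nhds.2 hx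
      rw [h0] at this
      exact this
    refine ⟨?_, h2⟩
    by_contra hinf
    obtain ⟨x, hx⟩ := Set.Infinite.exists_accPt_principal hinf
    have h3 := (h x).resolve_left (h2 x)
    rw [accPt_iff_frequently_nhdsNE] at hx
    exact hx h3
  · exact absurd (Set.eq_univ_of_univ_subset (h0 ▸ interior_subset)) hA

end Finite

/-! ### Complex and anticomplex points are isolated zeros of finite order -/

section Zeros

variable {M : Type*} [TopologicalSpace M] [ChartedSpace C2 M] [IsManifold 𝓘(ℂ, C2) ω M]
  {S : Type*} [TopologicalSpace S] [ChartedSpace ℂ S] [IsManifold 𝓘(ℂ, ℂ) ω S]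
  {g : HermitianMetric M} {f : S → M}

/-- A smooth unitary frame near the point with the coordinate `z₀`, as in `IsFrameOn`, in the chart
of `M` that is used in the definition of orders. -/
def IsFrameNear (g : HermitianMetric M) (f : S → M) (e : OpenPartialHomeomorph S ℂ) (z₀ : ℂ)
    (N : Set ℂ) (e₁ e₂ : ℂ → C2) (σ τ : ℂ → ℂ) : Prop :=
  N ⊆ repDomain f e (targetChart f e z₀) ∧ z₀ ∈ N ∧
    IsFrameOn (localMetric g f e z₀) (localRep f e z₀) N e₁ e₂ σ τ

theorem exists_isFrameNear (hf : IsConformalImmersion g f) (x : S) :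
    ∃ N e₁ e₂ σ τ, IsFrameNear g f (chartAt ℂ x) (chartAt ℂ x x) N e₁ e₂ σ τ := by
  obtain ⟨N, hN, hz, e₁, e₂, σ, τ, h⟩ := (isConformalPatch_rep hf (chart_mem_atlas ℂ x)
    (targetChart_mem_atlas f (chartAt ℂ x) (chartAt ℂ x x))).exists_frame
      (mem_repDomain_targetChart (mem_chart_target ℂ x))
  exact ⟨N, e₁, e₂, σ, τ, hN, hz, h⟩

theorem eventually_chartAt {x : S} {P : ℂ → Prop} (h : ∀ᶠ z in 𝓝 (chartAt ℂ x x), P z) :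
    ∀ᶠ y in 𝓝 x, P (chartAt ℂ x y) :=
  ((chartAt ℂ x).continuousAt (mem_chart_source ℂ x)).eventually h

variable {N : Set ℂ} {e₁ e₂ : ℂ → C2} {σ τ : ℂ → ℂ} {x : S}

theorem IsFrameNear.eventually_mem_iff (hf : IsConformalImmersion g f)
    (h : IsFrameNear g f (chartAt ℂ x) (chartAt ℂ x x) N e₁ e₂ σ τ) :
    ∀ᶠ y in 𝓝 x, (y ∈ complexPoints f ↔ τ (chartAt ℂ x y) = 0) ∧
      (y ∈ anticomplexPoints f ↔ σ (chartAt ℂ x y) = 0) := by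
  obtain ⟨hN, hz, hfr⟩ := h
  filter_upwards [eventually_chartAt (hfr.isOpen.mem_nhds hz),
    (chartAt ℂ x).open_source.mem_nhds (mem_chart_source ℂ x)] with y hy hys
  have h1 := mem_complexPoints_iff hf.contMDiff (chart_mem_atlas ℂ x)
    (targetChart_mem_atlas f (chartAt ℂ x) (chartAt ℂ x x)) (hN hy)
  have h2 := mem_anticomplexPoints_iff hf.contMDiff (chart_mem_atlas ℂ x)
    (targetChart_mem_atlas f (chartAt ℂ x) (chartAt ℂ x x)) (hN hy)
  rw [(chartAt ℂ x).left_inv hys] at h1 h2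
  exact ⟨h1.trans (hfr.delBar_eq_zero_iff hy), h2.trans (hfr.del_eq_zero_iff hy)⟩

theorem eventually_pow_mul_ne_zero {z₀ : ℂ} {p : ℕ} {H : ℂ → ℂ} (hH : ContinuousAt H z₀)
    (h0 : H z₀ ≠ 0) : ∀ᶠ z in 𝓝 z₀, z ≠ z₀ → (z - z₀) ^ p * H z ≠ 0 := by
  filter_upwards [hH.eventually_ne h0] with z hz hne
  exact mul_ne_zero (pow_ne_zero p (sub_ne_zero.2 hne)) hz

theorem eventually_notMem_of_eventually_ne_zero {A : Set S} {u : ℂ → ℂ}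
    (hA : ∀ᶠ y in 𝓝 x, (y ∈ A ↔ u (chartAt ℂ x y) = 0))
    (hu : ∀ᶠ z in 𝓝 (chartAt ℂ x x), z ≠ chartAt ℂ x x → u z ≠ 0) : ∀ᶠ y in 𝓝[≠] x, y ∉ A := by
  rw [eventually_nhdsWithin_iff]
  filter_upwards [hA, eventually_chartAt hu,
    (chartAt ℂ x).open_source.mem_nhds (mem_chart_source ℂ x)] with y hy1 hy2 hys hne hyA
  exact hy2 (fun h => hne ((chartAt ℂ x).injOn hys (mem_chart_source ℂ x) h)) (hy1.1 hyA)

theorem eventually_mem_of_eventually_eq_zero {A : Set S} {u : ℂ → ℂ}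
    (hA : ∀ᶠ y in 𝓝 x, (y ∈ A ↔ u (chartAt ℂ x y) = 0))
    (hu : ∀ᶠ z in 𝓝 (chartAt ℂ x x), u z = 0) : ∀ᶠ y in 𝓝 x, y ∈ A := by
  filter_upwards [hA, eventually_chartAt hu] with y hy1 hy2 using hy1.2 hy2

theorem IsFrameNear.tension (hf : IsConformalImmersion g f) (hmin : IsChernMinimal g f) :
    ∀ z ∈ repDomain f (chartAt ℂ x) (targetChart f (chartAt ℂ x) (chartAt ℂ x x)),
      tension (localMetric g f (chartAt ℂ x) (chartAt ℂ x x))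
        (localRep f (chartAt ℂ x) (chartAt ℂ x x)) z = 0 := fun _ hz =>
  tension_rep_eq_zero hf hmin (chart_mem_atlas ℂ x) (targetChart_mem_atlas f _ _) hz

theorem finite_complexPoints [CompactSpace S] [ConnectedSpace S] (hf : IsConformalImmersion g f)
    (hmin : IsChernMinimal g f) (hhol : ¬IsHolomorphic f) :
    (complexPoints f).Finite ∧ ∀ x, ¬∀ᶠ y in 𝓝 x, y ∈ complexPoints f := by
  refine finite_of_forall_eventually (fun h => hhol fun x => h ▸ Set.mem_univ x) fun x => ?_
  obtain ⟨N, e₁, e₂, σ, τ, h⟩ := exists_isFrameNear hf x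
  have hA := (h.eventually_mem_iff hf).mono fun y hy => hy.1
  rcases h.2.2.delBar_coeff_eq_zero_or (isConformalPatch_rep hf (chart_mem_atlas ℂ x)
    (targetChart_mem_atlas f _ _)) h.1 (IsFrameNear.tension hf hmin) h.2.1 with h0 |
    ⟨p, H, hH, hH0, h1⟩
  · exact Or.inl (eventually_mem_of_eventually_eq_zero hA h0)
  · refine Or.inr (eventually_notMem_of_eventually_ne_zero hA ?_)
    filter_upwards [h1, eventually_pow_mul_ne_zero (p := p) hH.continuousAt hH0] with z hz hz' hne
    rw [hz]
    exact (map_ne_zero _).2 (hz' hne)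

theorem finite_anticomplexPoints [CompactSpace S] [ConnectedSpace S]
    (hf : IsConformalImmersion g f) (hmin : IsChernMinimal g f) (hanti : ¬IsAntiholomorphic f) :
    (anticomplexPoints f).Finite ∧ ∀ x, ¬∀ᶠ y in 𝓝 x, y ∈ anticomplexPoints f := by
  refine finite_of_forall_eventually (fun h => hanti fun x => h ▸ Set.mem_univ x) fun x => ?_
  obtain ⟨N, e₁, e₂, σ, τ, h⟩ := exists_isFrameNear hf x
  have hA := (h.eventually_mem_iff hf).mono fun y hy => hy.2
  rcases h.2.2.del_coeff_eq_zero_or (isConformalPatch_rep hf (chart_mem_atlas ℂ x)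
    (targetChart_mem_atlas f _ _)) h.1 (IsFrameNear.tension hf hmin) h.2.1 with h0 |
    ⟨p, H, hH, hH0, h1⟩
  · exact Or.inl (eventually_mem_of_eventually_eq_zero hA h0)
  · refine Or.inr (eventually_notMem_of_eventually_ne_zero hA ?_)
    filter_upwards [h1, eventually_pow_mul_ne_zero (p := p) hH.continuousAt hH0] with z hz hz' hne
    rw [hz]
    exact hz' hne

/-- Near every point the coefficients `σ` and `τ` of the complex derivatives are, up to factors
without zeros, powers of `z - z₀` and of its conjugate. The exponents are the orders; they are zero
away from the anticomplex, respectively complex, points. -/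
structure HasOrders (g : HermitianMetric M) (f : S → M) (x : S) (p q : ℕ) (N : Set ℂ)
    (e₁ e₂ : ℂ → C2) (σ τ H K : ℂ → ℂ) : Prop where
  isFrameNear : IsFrameNear g f (chartAt ℂ x) (chartAt ℂ x x) N e₁ e₂ σ τ
  contDiffAt_del : ContDiffAt ℝ 2 H (chartAt ℂ x x)
  contDiffAt_delBar : ContDiffAt ℝ 2 K (chartAt ℂ x x)
  ne_zero_del : H (chartAt ℂ x x) ≠ 0
  ne_zero_delBar : K (chartAt ℂ x x) ≠ 0
  del_coeff_eq : ∀ᶠ z in 𝓝 (chartAt ℂ x x), σ z = (z - chartAt ℂ x x) ^ q * H z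
  delBar_coeff_eq : ∀ᶠ z in 𝓝 (chartAt ℂ x x),
    τ z = (starRingEnd ℂ) ((z - chartAt ℂ x x) ^ p * K z)

theorem exists_hasOrders [CompactSpace S] [ConnectedSpace S]
    (hf : IsConformalImmersion g f) (hmin : IsChernMinimal g f) (hhol : ¬IsHolomorphic f)
    (hanti : ¬IsAntiholomorphic f) (x : S) :
    ∃ p q N e₁ e₂ σ τ H K, HasOrders g f x p q N e₁ e₂ σ τ H K := by
  obtain ⟨N, e₁, e₂, σ, τ, h⟩ := exists_isFrameNear hf x
  have hP := isConformalPatch_rep hf (chart_mem_atlas ℂ x)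
    (targetChart_mem_atlas f (chartAt ℂ x) (chartAt ℂ x x))
  have hA := h.eventually_mem_iff hf
  obtain ⟨p, K, hK, hK0, hτ⟩ := (h.2.2.delBar_coeff_eq_zero_or hP h.1
    (IsFrameNear.tension hf hmin) h.2.1).resolve_left fun h0 =>
      (finite_complexPoints hf hmin hhol).2 x
        (eventually_mem_of_eventually_eq_zero (hA.mono fun y hy => hy.1) h0)
  obtain ⟨q, H, hH, hH0, hσ⟩ := (h.2.2.del_coeff_eq_zero_or hP h.1
    (IsFrameNear.tension hf hmin) h.2.1).resolve_left fun h0 =>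
      (finite_anticomplexPoints hf hmin hanti).2 x
        (eventually_mem_of_eventually_eq_zero (hA.mono fun y hy => hy.2) h0)
  exact ⟨p, q, N, e₁, e₂, σ, τ, H, K, h, hH, hK, hH0, hK0, hσ, hτ⟩

namespace HasOrders

variable {p q : ℕ} {H K : ℂ → ℂ}

theorem sqrt_conformalFactor (hf : IsConformalImmersion g f)
    (h : HasOrders g f x p q N e₁ e₂ σ τ H K) :
    ContinuousAt (fun z => ((√(conformalFactor (localMetric g f (chartAt ℂ x) (chartAt ℂ x x))
      (localRep f (chartAt ℂ x) (chartAt ℂ x x)) z) : ℝ) : ℂ)) (chartAt ℂ x x) ∧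
    ((√(conformalFactor (localMetric g f (chartAt ℂ x) (chartAt ℂ x x))
      (localRep f (chartAt ℂ x) (chartAt ℂ x x)) (chartAt ℂ x x)) : ℝ) : ℂ) ≠ 0 := by
  have hP := isConformalPatch_rep hf (chart_mem_atlas ℂ x)
    (targetChart_mem_atlas f (chartAt ℂ x) (chartAt ℂ x x))
  have hz := h.isFrameNear.1 h.isFrameNear.2.1
  refine ⟨Complex.continuous_ofReal.continuousAt.comp
    (hP.contDiffAt_conformalFactor hz).continuousAt.sqrt, ?_⟩
  exact_mod_cast (Real.sqrt_pos.2 (hP.conformalFactor_pos hz)).ne'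

theorem isComplexOrder (hf : IsConformalImmersion g f)
    (h : HasOrders g f x p q N e₁ e₂ σ τ H K) : IsComplexOrder g f x p := by
  obtain ⟨hc, h0⟩ := h.sqrt_conformalFactor hf
  refine ⟨e₁, e₂, _, _, _, fun z => (starRingEnd ℂ) (K z) /
    ((√(conformalFactor (localMetric g f (chartAt ℂ x) (chartAt ℂ x x))
      (localRep f (chartAt ℂ x) (chartAt ℂ x x)) z) : ℝ) : ℂ),
    h.isFrameNear.2.2.isAdaptedFrame hf (chart_mem_atlas ℂ x) h.isFrameNear.1 h.isFrameNear.2.1,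
    (Complex.continuous_conj.continuousAt.comp h.contDiffAt_delBar.continuousAt).div hc h0,
    div_ne_zero (by simpa using h.ne_zero_delBar) h0, ?_⟩
  filter_upwards [h.delBar_coeff_eq] with z hz
  rw [hz, map_mul, map_pow, mul_div_assoc]

theorem isAnticomplexOrder (hf : IsConformalImmersion g f)
    (h : HasOrders g f x p q N e₁ e₂ σ τ H K) : IsAnticomplexOrder g f x q := by
  obtain ⟨hc, h0⟩ := h.sqrt_conformalFactor hf
  refine ⟨e₁, e₂, _, _, _, fun z => H z /
    ((√(conformalFactor (localMetric g f (chartAt ℂ x) (chartAt ℂ x x))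
      (localRep f (chartAt ℂ x) (chartAt ℂ x x)) z) : ℝ) : ℂ),
    h.isFrameNear.2.2.isAdaptedFrame hf (chart_mem_atlas ℂ x) h.isFrameNear.1 h.isFrameNear.2.1,
    h.contDiffAt_del.continuousAt.div hc h0, div_ne_zero h.ne_zero_del h0, ?_⟩
  filter_upwards [h.del_coeff_eq] with z hz
  rw [hz, mul_div_assoc]

theorem mem_complexPoints_iff (hf : IsConformalImmersion g f)
    (h : HasOrders g f x p q N e₁ e₂ σ τ H K) : x ∈ complexPoints f ↔ p ≠ 0 := by
  rw [(h.isFrameNear.eventually_mem_iff hf).self_of_nhds.1, h.delBar_coeff_eq.self_of_nhds]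
  simp [h.ne_zero_delBar]

theorem mem_anticomplexPoints_iff (hf : IsConformalImmersion g f)
    (h : HasOrders g f x p q N e₁ e₂ σ τ H K) : x ∈ anticomplexPoints f ↔ q ≠ 0 := by
  rw [(h.isFrameNear.eventually_mem_iff hf).self_of_nhds.2, h.del_coeff_eq.self_of_nhds]
  simp [h.ne_zero_del]

theorem complexOrder_eq (hf : IsConformalImmersion g f)
    (h : HasOrders g f x p q N e₁ e₂ σ τ H K) : complexOrder g f x = p :=
  (Nat.sInf_mem (s := {p | IsComplexOrder g f x p}) ⟨p, h.isComplexOrder hf⟩ :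
    IsComplexOrder g f x (complexOrder g f x)).unique hf
    (h.isComplexOrder hf)

theorem anticomplexOrder_eq (hf : IsConformalImmersion g f)
    (h : HasOrders g f x p q N e₁ e₂ σ τ H K) : anticomplexOrder g f x = q :=
  (Nat.sInf_mem (s := {q | IsAnticomplexOrder g f x q}) ⟨q, h.isAnticomplexOrder hf⟩ :
    IsAnticomplexOrder g f x (anticomplexOrder g f x)).unique hf (h.isAnticomplexOrder hf)

end HasOrders

end Zeros

/-! ### Real 1-forms and logarithmic derivatives -/

section OneForm

/-- The function `b` with `ρ = Re (b dz)`. -/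
def oneForm (ρ : ℂ → ℂ → ℝ) (z : ℂ) : ℂ := ρ z 1 - Complex.I * ρ z Complex.I

theorem oneForm_add (ρ ρ' : ℂ → ℂ → ℝ) (z : ℂ) :
    oneForm (fun z a => ρ z a + ρ' z a) z = oneForm ρ z + oneForm ρ' z := by
  simp only [oneForm]; push_cast; ring

theorem oneForm_congr {ρ ρ' : ℂ → ℂ → ℝ} {z : ℂ} (h : ∀ a, ρ z a = ρ' z a) :
    oneForm ρ z = oneForm ρ' z := by
  rw [oneForm, oneForm, h, h]

theorem contDiffAt_oneForm {n : WithTop ℕ∞} {ρ : ℂ → ℂ → ℝ} {z : ℂ}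
    (h : ∀ a, ContDiffAt ℝ n (fun w => ρ w a) z) : ContDiffAt ℝ n (oneForm ρ) z :=
  (Complex.ofRealCLM.contDiff.contDiffAt.comp z (h 1)).sub
    (contDiffAt_const.mul (Complex.ofRealCLM.contDiff.contDiffAt.comp z (h Complex.I)))

theorem dForm_oneForm {ρ : ℂ → ℂ → ℝ} {z : ℂ} (h : ∀ a, DifferentiableAt ℝ (fun w => ρ w a) z) :
    dForm (oneForm ρ) z = extDerivCoeff ρ z := by
  have h1 : ∀ a, HasFDerivAt (fun w => ((ρ w a : ℝ) : ℂ))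
      (Complex.ofRealCLM.comp (fderiv ℝ (fun w => ρ w a) z)) z := fun a =>
    Complex.ofRealCLM.hasFDerivAt.comp z (h a).hasFDerivAt
  have h2 : HasFDerivAt (oneForm ρ) _ z := (h1 1).sub ((h1 Complex.I).const_mul Complex.I)
  rw [dForm, dbar, h2.fderiv, extDerivCoeff]
  simp
  ring

/-- The pull-back of a 1-form by a holomorphic map. -/
theorem oneForm_pullback {ρ ρ' : ℂ → ℂ → ℝ} {z w d : ℂ} (h : ∀ a, ρ z a = ρ' w (d * a))
    (hlin : ∀ a, ρ' w a = a.re * ρ' w 1 + a.im * ρ' w Complex.I) :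
    oneForm ρ z = oneForm ρ' w * d := by
  simp only [oneForm, h]
  rw [hlin (d * 1), hlin (d * Complex.I)]
  apply Complex.ext <;> simp <;> ring

/-- The differential `Im (du / u)` of the argument of `u`. -/
def dArg (u : ℂ → ℂ) (z a : ℂ) : ℝ := (fderiv ℝ u z a / u z).im

theorem dArg_congr {u v : ℂ → ℂ} {z : ℂ} (h : u =ᶠ[𝓝 z] v) (a : ℂ) : dArg u z a = dArg v z a := by
  rw [dArg, dArg, h.fderiv_eq, h.self_of_nhds]

theorem dArg_linear (u : ℂ → ℂ) (z a : ℂ) :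
    dArg u z a = a.re * dArg u z 1 + a.im * dArg u z Complex.I := by
  simp only [dArg]
  rw [fderiv_real_apply _ a, add_div, Complex.add_im, Complex.real_smul, Complex.real_smul,
    mul_div_assoc, mul_div_assoc, Complex.im_ofReal_mul, Complex.im_ofReal_mul]

theorem dArg_mul {u v : ℂ → ℂ} {z : ℂ} (hu : DifferentiableAt ℝ u z) (hv : DifferentiableAt ℝ v z)
    (hu0 : u z ≠ 0) (hv0 : v z ≠ 0) (a : ℂ) :
    dArg (fun w => u w * v w) z a = dArg u z a + dArg v z a := by
  simp only [dArg]
  rw [fderiv_fun_mul hu hv, ← Complex.add_im]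
  congr 1
  simp only [add_apply, smul_apply, smul_eq_mul]
  field_simp
  ring

theorem dArg_conj {u : ℂ → ℂ} {z : ℂ} (hu : DifferentiableAt ℝ u z) (a : ℂ) :
    dArg (fun w => (starRingEnd ℂ) (u w)) z a = -dArg u z a := by
  have h : HasFDerivAt (fun z => (starRingEnd ℂ) (u z))
      ((Complex.conjCLE : ℂ →L[ℝ] ℂ).comp (fderiv ℝ u z)) z :=
    (Complex.conjCLE : ℂ →L[ℝ] ℂ).hasFDerivAt.comp z hu.hasFDerivAt
  rw [dArg, dArg, h.fderiv, ← Complex.conj_im, map_div₀]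
  rfl

theorem dArg_ofReal (r : ℂ → ℝ) (z a : ℂ) : dArg (fun w => (r w : ℂ)) z a = 0 := by
  by_cases hr : DifferentiableAt ℝ (fun w => (r w : ℂ)) z
  · have hr' : DifferentiableAt ℝ r z := Complex.reCLM.differentiableAt.comp z hr
    have h : HasFDerivAt (fun w => ((r w : ℝ) : ℂ)) (Complex.ofRealCLM.comp (fderiv ℝ r z)) z :=
      Complex.ofRealCLM.hasFDerivAt.comp z hr'.hasFDerivAt
    rw [dArg, h.fderiv]
    simp only [ContinuousLinearMap.comp_apply, Complex.ofRealCLM_apply]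
    rw [← Complex.ofReal_div, Complex.ofReal_im]
  · rw [dArg, fderiv_zero_of_not_differentiableAt hr]
    simp

theorem dArg_comp {u φ : ℂ → ℂ} {z : ℂ} (hu : DifferentiableAt ℝ u (φ z))
    (hφ : DifferentiableAt ℂ φ z) (a : ℂ) :
    dArg (fun w => u (φ w)) z a = dArg u (φ z) (deriv φ z * a) := by
  have h : fderiv ℝ (fun w => u (φ w)) z = (fderiv ℝ u (φ z)).comp (fderiv ℝ φ z) :=
    fderiv_comp z hu (hφ.restrictScalars ℝ)
  rw [dArg, dArg, h, ContinuousLinearMap.comp_apply, fderiv_real_apply_of_differentiableAt hφ]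

theorem dArg_pow {z z₀ : ℂ} (hz : z ≠ z₀) (p : ℕ) (a : ℂ) :
    dArg (fun w => (w - z₀) ^ p) z a = p * (a / (z - z₀)).im := by
  have h0 : z - z₀ ≠ 0 := sub_ne_zero.2 hz
  have hd : HasDerivAt (fun w : ℂ => (w - z₀) ^ p) (p * (z - z₀) ^ (p - 1)) z := by
    simpa using ((hasDerivAt_id z).sub_const z₀).fun_pow p
  rw [dArg, fderiv_real_apply_of_differentiableAt hd.differentiableAt, hd.deriv]
  rw [← Complex.ofReal_natCast, ← Complex.im_ofReal_mul, Complex.ofReal_natCast]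
  congr 1
  rcases p with - | p
  · simp
  · rw [Nat.add_sub_cancel, pow_succ]
    field_simp

theorem contDiffAt_dArg {u : ℂ → ℂ} {z : ℂ} (hu : ContDiffAt ℝ 2 u z) (h0 : u z ≠ 0) (a : ℂ) :
    ContDiffAt ℝ 1 (fun w => dArg u w a) z := by
  have h1 : ContDiffAt ℝ 1 (fun w => fderiv ℝ u w a) z :=
    (hu.fderiv_right (m := 1) (by norm_num)).clm_apply contDiffAt_const
  have h2 : ContDiffAt ℝ 1 (fun w => (u w)⁻¹) z := (hu.of_le (by norm_num)).inv h0
  have h3 : ContDiffAt ℝ 1 (fun w => fderiv ℝ u w a / u w) z := by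
    simpa only [div_eq_mul_inv] using h1.mul h2
  exact Complex.imCLM.contDiff.contDiffAt.comp z h3

/-- The differential of the argument is closed. -/
theorem dForm_dArg {u : ℂ → ℂ} {z : ℂ} (hu : ContDiffAt ℝ 2 u z) (h0 : u z ≠ 0) :
    dForm (oneForm (dArg u)) z = 0 := by
  have hd : DifferentiableAt ℝ u z := hu.differentiableAt (by norm_num)
  have hd' : DifferentiableAt ℝ (fderiv ℝ u) z :=
    (hu.fderiv_right (m := 1) (by norm_num)).differentiableAt one_ne_zero
  have hs : fderiv ℝ (fderiv ℝ u) z 1 Complex.I = fderiv ℝ (fderiv ℝ u) z Complex.I 1 :=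
    (hu.isSymmSndFDerivAt (by simp)).eq 1 Complex.I
  have hv : DifferentiableAt ℝ (fun w => (u w)⁻¹) z := (hu.inv h0).differentiableAt (by norm_num)
  have hv' : ∀ b, fderiv ℝ (fun w => (u w)⁻¹) z b = -(fderiv ℝ u z b / u z ^ 2) := by
    intro b
    have h1 : (fun w => u w * (u w)⁻¹) =ᶠ[𝓝 z] fun _ => 1 := by
      filter_upwards [hu.continuousAt.eventually_ne h0] with w hw using mul_inv_cancel₀ hw
    have h2 := congrArg (fun L : ℂ →L[ℝ] ℂ => L b) h1.fderiv_eq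
    rw [fderiv_fun_mul hd hv] at h2
    simp only [add_apply, smul_apply, smul_eq_mul, fderiv_fun_const, Pi.zero_apply, zero_apply]
      at h2
    field_simp at h2 ⊢
    linear_combination h2
  have h1 : ∀ a b, fderiv ℝ (fun w => dArg u w a) z b
      = (fderiv ℝ (fderiv ℝ u) z b a / u z - fderiv ℝ u z a * fderiv ℝ u z b / u z ^ 2).im := by
    intro a b
    have h2 : HasFDerivAt (fun w => fderiv ℝ u w a) _ z :=
      hd'.hasFDerivAt.clm_apply (hasFDerivAt_const a z)
    have h3 : HasFDerivAt (fun w => fderiv ℝ u w a * (u w)⁻¹) _ z := h2.mul hv.hasFDerivAt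
    have h5 : (fun w => dArg u w a) = fun w => (fderiv ℝ u w a * (u w)⁻¹).im := by
      simp only [dArg, div_eq_mul_inv]
    have h4 : HasFDerivAt (fun w => (fderiv ℝ u w a * (u w)⁻¹).im) _ z :=
      Complex.imCLM.hasFDerivAt.comp z h3
    rw [h5, h4.fderiv]
    simp only [ContinuousLinearMap.comp_apply, Complex.imCLM_apply, add_apply, smul_apply,
      smul_eq_mul, hv', ContinuousLinearMap.flip_apply]
    congr 1
    simp
    field_simp
    ring
  rw [dForm_oneForm fun a => (contDiffAt_dArg hu h0 a).differentiableAt one_ne_zero,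
    extDerivCoeff, h1, h1, ← Complex.sub_im, hs]
  rw [mul_comm (fderiv ℝ u z 1), sub_self, Complex.zero_im]

theorem oneForm_im_div (k : ℝ) (w z : ℂ) :
    oneForm (fun _ a => k * (a / w).im) z = -(Complex.I * k / w) := by
  have h1 : (1 / w).im = (w⁻¹).im := by rw [one_div]
  have h2 : (Complex.I / w).im = (w⁻¹).re := by rw [div_eq_mul_inv]; simp
  rw [oneForm, h1, h2, mul_div_assoc, div_eq_mul_inv (k : ℂ)]
  apply Complex.ext <;> simp

end OneForm

/-! ### The Chern connection on the determinant bundle along a conformal immersion -/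

section ChernTrace

theorem eq_smul_single (v : C2) : v = v 0 • Pi.single 0 1 + v 1 • Pi.single 1 1 := by
  ext k; fin_cases k <;> simp

/-- The trace of the endomorphism `v ↦ ∇_u v` for constant vector fields `v`. -/
def chernTrace (G : C2 → C2 →L[ℝ] C2 →L[ℝ] ℝ) (q u : C2) : ℂ :=
  ∑ k : Fin 2, chern G q u (Pi.single k 1) k

variable {G : C2 → C2 →L[ℝ] C2 →L[ℝ] ℝ} {q : C2}

theorem IsHermitianAt.chern_eq_right (h : IsHermitianAt G q) (u v : C2) :
    chern G q u v = v 0 • chern G q u (Pi.single 0 1) + v 1 • chern G q u (Pi.single 1 1) := by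
  conv_lhs => rw [eq_smul_single v, chern_add_right, h.chern_smul_right, h.chern_smul_right]

theorem IsHermitianAt.chern_eq_left (h : IsHermitianAt G q) (u v : C2) :
    chern G q u v = u 0 • chern G q (Pi.single 0 1) v + u 1 • chern G q (Pi.single 1 1) v := by
  conv_lhs => rw [eq_smul_single u, chern_add_left, h.chern_smul_left, h.chern_smul_left]

theorem IsHermitianAt.det2_chern (h : IsHermitianAt G q) (u x y : C2) :
    det2 (chern G q u x) y + det2 x (chern G q u y) = chernTrace G q u * det2 x y := by
  rw [h.chern_eq_right u x, h.chern_eq_right u y]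
  simp [chernTrace, det2, Fin.sum_univ_two]
  ring

/-- The commutator terms do not contribute to the trace of the curvature. -/
theorem IsHermitianAt.sum_chern_chern (h : IsHermitianAt G q) (u v : C2) :
    ∑ k : Fin 2, chern G q u (chern G q v (Pi.single k 1)) k
      = ∑ k : Fin 2, chern G q v (chern G q u (Pi.single k 1)) k := by
  simp only [Fin.sum_univ_two]
  rw [h.chern_eq_right u (chern G q v (Pi.single 0 1)),
    h.chern_eq_right u (chern G q v (Pi.single 1 1)),
    h.chern_eq_right v (chern G q u (Pi.single 0 1)),
    h.chern_eq_right v (chern G q u (Pi.single 1 1))]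
  simp
  ring

theorem fderiv_comp_apply {X : ℂ → C2} {z : ℂ} (hX : DifferentiableAt ℝ X z) (a : ℂ) (k : Fin 2) :
    fderiv ℝ (fun w => X w k) z a = fderiv ℝ X z a k := by
  have h : HasFDerivAt (fun w => X w k)
      ((ContinuousLinearMap.proj (R := ℝ) (φ := fun _ : Fin 2 => ℂ) k).comp (fderiv ℝ X z)) z :=
    (ContinuousLinearMap.proj (R := ℝ) (φ := fun _ : Fin 2 => ℂ) k).hasFDerivAt.comp z
      hX.hasFDerivAt
  rw [h.fderiv]; rfl

theorem differentiableAt_comp_apply {X : ℂ → C2} {z : ℂ} (hX : DifferentiableAt ℝ X z)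
    (k : Fin 2) : DifferentiableAt ℝ (fun w => X w k) z := differentiableAt_pi.1 hX k

theorem fderiv_det2 {X Y : ℂ → C2} {z : ℂ} (hX : DifferentiableAt ℝ X z)
    (hY : DifferentiableAt ℝ Y z) (a : ℂ) : fderiv ℝ (fun w => det2 (X w) (Y w)) z a
      = det2 (fderiv ℝ X z a) (Y z) + det2 (X z) (fderiv ℝ Y z a) := by
  have hx := differentiableAt_comp_apply hX
  have hy := differentiableAt_comp_apply hY
  simp only [det2]
  rw [fderiv_fun_sub ((hx 0).fun_mul (hy 1)) ((hx 1).fun_mul (hy 0)), fderiv_fun_mul (hx 0) (hy 1),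
    fderiv_fun_mul (hx 1) (hy 0)]
  simp only [sub_apply, add_apply, smul_apply, smul_eq_mul, fderiv_comp_apply hX,
    fderiv_comp_apply hY]
  ring

theorem contDiffAt_det2 {n : WithTop ℕ∞} {X Y : ℂ → C2} {z : ℂ} (hX : ContDiffAt ℝ n X z)
    (hY : ContDiffAt ℝ n Y z) : ContDiffAt ℝ n (fun w => det2 (X w) (Y w)) z :=
  ((contDiffAt_pi.1 hX 0).mul (contDiffAt_pi.1 hY 1)).sub
    ((contDiffAt_pi.1 hX 1).mul (contDiffAt_pi.1 hY 0))

end ChernTrace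

section ChernForm

/-- The complex determinant of the two coordinate tangent vectors. -/
def detMap (F : ℂ → C2) (z : ℂ) : ℂ := det2 (fderiv ℝ F z 1) (fderiv ℝ F z Complex.I)

/-- The imaginary part of the connection form of the determinant bundle, for the section `∂F/∂x ∧
∂F/∂y`. -/
def chernForm (G : C2 → C2 →L[ℝ] C2 →L[ℝ] ℝ) (F : ℂ → C2) (z a : ℂ) : ℝ :=
  ((det2 (cov (chern G) F (fun w => fderiv ℝ F w 1) z a) (fderiv ℝ F z Complex.I)
    + det2 (fderiv ℝ F z 1) (cov (chern G) F (fun w => fderiv ℝ F w Complex.I) z a))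
      / detMap F z).im

theorem detMap_eq (F : ℂ → C2) (z : ℂ) :
    detMap F z = -2 * Complex.I * det2 (del F z) (delBar F z) := by
  rw [detMap, fderiv_one_eq, fderiv_I_eq]
  simp [det2]
  ring

namespace IsConformalPatch

variable {U : Set C2} {G : C2 → C2 →L[ℝ] C2 →L[ℝ] ℝ} {F : ℂ → C2} {W : Set ℂ} {z : ℂ}

theorem detMap_ne_zero_iff (h : IsConformalPatch U G F W) (hz : z ∈ W) :
    detMap F z ≠ 0 ↔ del F z ≠ 0 ∧ delBar F z ≠ 0 := by
  rw [detMap_eq]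
  constructor
  · intro h0
    constructor <;> intro h1 <;> refine h0 ?_ <;> simp [h1, det2]
  · rintro ⟨h1, h2⟩
    simpa using (h.isHermitianForm hz).det2_ne_zero (h.herm_del_delBar hz) h1 h2

theorem contDiffAt_detMap (h : IsConformalPatch U G F W) (hz : z ∈ W) :
    ContDiffAt ℝ ∞ (detMap F) z :=
  contDiffAt_det2 (contDiffAt_fderiv_apply (h.contDiffAt hz) 1)
    (contDiffAt_fderiv_apply (h.contDiffAt hz) Complex.I)

theorem chernForm_eq (h : IsConformalPatch U G F W) (hz : z ∈ W) (h0 : detMap F z ≠ 0) (a : ℂ) :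
    chernForm G F z a = dArg (detMap F) z a + (chernTrace G (F z) (fderiv ℝ F z a)).im := by
  have hd : ∀ b, DifferentiableAt ℝ (fun w => fderiv ℝ F w b) z := fun b =>
    (contDiffAt_fderiv_apply (h.contDiffAt hz) b).differentiableAt (by simp)
  have h1 : fderiv ℝ (detMap F) z a = _ := fderiv_det2 (hd 1) (hd Complex.I) a
  have h2 := (h.isHermitianAt hz).det2_chern (fderiv ℝ F z a) (fderiv ℝ F z 1)
    (fderiv ℝ F z Complex.I)
  rw [← detMap] at h2
  have h3 : chernTrace G (F z) (fderiv ℝ F z a)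
      = chernTrace G (F z) (fderiv ℝ F z a) * detMap F z / detMap F z := by field_simp
  rw [chernForm, dArg, h1, h3, ← h2, ← Complex.add_im, ← add_div]
  congr 2
  simp only [cov, det2, Pi.add_apply]
  ring

theorem contDiffAt_chernTrace (h : IsConformalPatch U G F W) (hz : z ∈ W) (a : ℂ) :
    ContDiffAt ℝ ∞ (fun w => (chernTrace G (F w) (fderiv ℝ F w a)).im) z := by
  have h1 : ContDiffAt ℝ ∞ (fun w => chernTrace G (F w) (fderiv ℝ F w a)) z :=
    ContDiffAt.sum fun k _ => contDiffAt_pi.1 (h.contDiffAt_chern_apply hz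
      (contDiffAt_fderiv_apply (h.contDiffAt hz) a) contDiffAt_const) k
  exact Complex.imCLM.contDiff.contDiffAt.comp z h1

theorem contDiffAt_chern_const (h : IsConformalPatch U G F W) (hz : z ∈ W) (u v : C2) :
    ContDiffAt ℝ ∞ (fun p => chern G p u v) (F z) :=
  contDiffAt_chern (F := fun p : C2 => p) (h.contDiffAt_metric hz) (h.isHermitianForm hz).pos
    contDiffAt_id contDiffAt_const contDiffAt_const

theorem fderiv_chern_const (h : IsConformalPatch U G F W) (hz : z ∈ W) (u v b : C2) :
    fderiv ℝ (fun p => chern G p u v) (F z) b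
      = u 0 • fderiv ℝ (fun p => chern G p (Pi.single 0 1) v) (F z) b
        + u 1 • fderiv ℝ (fun p => chern G p (Pi.single 1 1) v) (F z) b := by
  have h1 : (fun p => chern G p u v) =ᶠ[𝓝 (F z)] fun p =>
      u 0 • chern G p (Pi.single 0 1) v + u 1 • chern G p (Pi.single 1 1) v := by
    filter_upwards [h.hermitian.isOpen.mem_nhds (h.mapsTo hz)] with p hp
    exact (h.hermitian.isHermitianAt hp).chern_eq_left u v
  have hd := fun j : Fin 2 => (h.contDiffAt_chern_const hz (Pi.single j 1) v).differentiableAt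
    (by simp)
  rw [h1.fderiv_eq, fderiv_fun_add ((hd 0).fun_const_smul _) ((hd 1).fun_const_smul _),
    fderiv_fun_const_smul (hd 0), fderiv_fun_const_smul (hd 1)]
  rfl

theorem fderiv_chern_comp (h : IsConformalPatch U G F W) (hz : z ∈ W) {X : ℂ → C2}
    (hX : DifferentiableAt ℝ X z) (v : C2) (a : ℂ) :
    fderiv ℝ (fun w => chern G (F w) (X w) v) z a
      = fderiv ℝ (fun p => chern G p (X z) v) (F z) (fderiv ℝ F z a)
        + chern G (F z) (fderiv ℝ X z a) v := by
  have h1 : (fun w => chern G (F w) (X w) v) =ᶠ[𝓝 z] fun w =>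
      X w 0 • chern G (F w) (Pi.single 0 1) v + X w 1 • chern G (F w) (Pi.single 1 1) v := by
    filter_upwards [h.isOpen.mem_nhds hz] with w hw
    exact (h.isHermitianAt hw).chern_eq_left (X w) v
  have hF := (h.contDiffAt hz).differentiableAt (n := ∞) (by simp)
  have hd := fun j : Fin 2 => (h.contDiffAt_chern_const hz (Pi.single j 1) v).differentiableAt
    (by simp)
  have hd' : ∀ j : Fin 2, DifferentiableAt ℝ (fun w => chern G (F w) (Pi.single j 1) v) z :=
    fun j => (hd j).comp z hF
  have hc : ∀ j : Fin 2, fderiv ℝ (fun w => chern G (F w) (Pi.single j 1) v) z a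
      = fderiv ℝ (fun p => chern G p (Pi.single j 1) v) (F z) (fderiv ℝ F z a) := fun j =>
    congrArg (fun L : ℂ →L[ℝ] C2 => L a) (fderiv_comp z (hd j) hF)
  have hx := differentiableAt_comp_apply hX
  have hxs : ∀ j : Fin 2, DifferentiableAt ℝ
      (fun w => X w j • chern G (F w) (Pi.single j 1) v) z := fun j => (hx j).fun_smul (hd' j)
  rw [h1.fderiv_eq, fderiv_fun_add (hxs 0) (hxs 1), add_apply,
    fderiv_complex_smul (hx 0) (hd' 0), fderiv_complex_smul (hx 1) (hd' 1), hc, hc,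
    h.fderiv_chern_const hz (X z), (h.isHermitianAt hz).chern_eq_left (fderiv ℝ X z a),
    fderiv_comp_apply hX, fderiv_comp_apply hX]
  abel

/-- The trace of the curvature is the exterior derivative of the trace of the connection form. -/
theorem dForm_chernTrace (h : IsConformalPatch U G F W) (hz : z ∈ W) :
    dForm (oneForm fun w a => (chernTrace G (F w) (fderiv ℝ F w a)).im) z
      = -ricciForm G (F z) (fderiv ℝ F z 1) (fderiv ℝ F z Complex.I) := by
  rw [dForm_oneForm fun a => (h.contDiffAt_chernTrace hz a).differentiableAt (by simp),
    extDerivCoeff]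
  have hF := h.contDiffAt hz
  have hX : ∀ a, DifferentiableAt ℝ (fun w => fderiv ℝ F w a) z := fun a =>
    (contDiffAt_fderiv_apply hF a).differentiableAt (by simp)
  have hk : ∀ a, DifferentiableAt ℝ (fun w => chernTrace G (F w) (fderiv ℝ F w a)) z := by
    intro a
    refine DifferentiableAt.fun_sum fun k _ => ?_
    exact differentiableAt_comp_apply ((h.contDiffAt_chern_apply hz
      (contDiffAt_fderiv_apply hF a) contDiffAt_const).differentiableAt (by simp)) k
  have hD : ∀ a b, fderiv ℝ (fun w => (chernTrace G (F w) (fderiv ℝ F w a)).im) z b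
      = (∑ k : Fin 2, (fderiv ℝ (fun p => chern G p (fderiv ℝ F z a) (Pi.single k 1)) (F z)
          (fderiv ℝ F z b) + chern G (F z) (fderiv ℝ (fderiv ℝ F) z b a) (Pi.single k 1)) k).im := by
    intro a b
    have h1 : HasFDerivAt (fun w => (chernTrace G (F w) (fderiv ℝ F w a)).im) _ z :=
      Complex.imCLM.hasFDerivAt.comp z (hk a).hasFDerivAt
    have hd : ∀ k : Fin 2, DifferentiableAt ℝ
        (fun w => chern G (F w) (fderiv ℝ F w a) (Pi.single k 1)) z := fun k =>
      (h.contDiffAt_chern_apply hz (contDiffAt_fderiv_apply hF a)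
        contDiffAt_const).differentiableAt (by simp)
    rw [h1.fderiv]
    simp only [ContinuousLinearMap.comp_apply, Complex.imCLM_apply, chernTrace]
    rw [fderiv_fun_sum fun k _ => differentiableAt_comp_apply (hd k) k]
    congr 1
    rw [sum_apply]
    refine Finset.sum_congr rfl fun k _ => ?_
    rw [fderiv_comp_apply (hd k), h.fderiv_chern_comp hz (hX a), fderiv_fderiv_apply hF]
  rw [hD, hD, fderiv_fderiv_symm hF Complex.I 1, ← Complex.sub_im, ← Finset.sum_sub_distrib,
    ricciForm]
  have hs := (h.isHermitianAt hz).sum_chern_chern (fderiv ℝ F z 1) (fderiv ℝ F z Complex.I)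
  simp only [curvature, Fin.sum_univ_two, Pi.add_apply, Pi.sub_apply] at hs ⊢
  rw [Complex.I_mul_re, neg_neg]
  congr 1
  linear_combination -hs

theorem dForm_chernForm (h : IsConformalPatch U G F W) (hz : z ∈ W) (h0 : detMap F z ≠ 0) :
    dForm (oneForm (chernForm G F)) z
      = -ricciForm G (F z) (fderiv ℝ F z 1) (fderiv ℝ F z Complex.I) := by
  have hD := (h.contDiffAt_detMap hz).of_le (m := 2) ENat.LEInfty.out
  have h1 : oneForm (chernForm G F) =ᶠ[𝓝 z] fun w => oneForm (dArg (detMap F)) w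
      + oneForm (fun w a => (chernTrace G (F w) (fderiv ℝ F w a)).im) w := by
    filter_upwards [h.isOpen.mem_nhds hz, hD.continuousAt.eventually_ne h0] with w hw hw0
    rw [← oneForm_add]
    exact oneForm_congr fun a => h.chernForm_eq hw hw0 a
  rw [dForm_congr h1, dForm_add, dForm_dArg hD h0, zero_add, h.dForm_chernTrace hz]
  · exact (contDiffAt_oneForm fun a => contDiffAt_dArg hD h0 a).differentiableAt one_ne_zero
  · exact (contDiffAt_oneForm fun a => h.contDiffAt_chernTrace hz a).differentiableAt (by simp)

theorem contDiffAt_chernForm (h : IsConformalPatch U G F W) (hz : z ∈ W) (h0 : detMap F z ≠ 0) :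
    ContDiffAt ℝ 1 (oneForm (chernForm G F)) z := by
  have hD := (h.contDiffAt_detMap hz).of_le (m := 2) ENat.LEInfty.out
  refine contDiffAt_oneForm fun a => ?_
  refine ((contDiffAt_dArg hD h0 a).add
    ((h.contDiffAt_chernTrace hz a).of_le ENat.LEInfty.out)).congr_of_eventuallyEq ?_
  filter_upwards [h.isOpen.mem_nhds hz, hD.continuousAt.eventually_ne h0] with w hw hw0
  exact h.chernForm_eq hw hw0 a

end IsConformalPatch

end ChernForm

/-! ### The first Chern number -/

section ChernNumber

variable {M : Type*} [TopologicalSpace M] [ChartedSpace C2 M] [IsManifold 𝓘(ℂ, C2) ω M]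
  {S : Type*} [TopologicalSpace S] [ChartedSpace ℂ S] [IsManifold 𝓘(ℂ, ℂ) ω S]
  {g : HermitianMetric M} {f : S → M} {e e' : OpenPartialHomeomorph S ℂ}
  {c c' : OpenPartialHomeomorph M C2} {z : ℂ}

/-- The points where the complex derivatives of `f` are not both different from zero. -/
def specialPoints (f : S → M) : Set S := complexPoints f ∪ anticomplexPoints f

theorem notMem_specialPoints_iff (hf : IsConformalImmersion g f) (he : e ∈ atlas ℂ S)
    (hc : c ∈ atlas C2 M) (hz : z ∈ repDomain f e c) :
    e.symm z ∉ specialPoints f ↔ del (rep f e c) z ≠ 0 ∧ delBar (rep f e c) z ≠ 0 := by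
  rw [specialPoints, Set.mem_union, mem_complexPoints_iff hf.contMDiff he hc hz,
    mem_anticomplexPoints_iff hf.contMDiff he hc hz]
  tauto

theorem detMap_rep_ne_zero_iff (hf : IsConformalImmersion g f) (he : e ∈ atlas ℂ S)
    (hc : c ∈ atlas C2 M) (hz : z ∈ repDomain f e c) :
    detMap (rep f e c) z ≠ 0 ↔ e.symm z ∉ specialPoints f := by
  rw [(isConformalPatch_rep hf he hc).detMap_ne_zero_iff hz, notMem_specialPoints_iff hf he hc hz]

theorem dTrans_smul (hc : c ∈ atlas C2 M) (hc' : c' ∈ atlas C2 M) {q : C2} (hq : q ∈ c.target)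
    (hq' : c.symm q ∈ c'.source) (k : ℂ) (u : C2) :
    dTrans c c' q (k • u) = k • dTrans c c' q u := by
  rw [complex_smul_eq k u, map_add, map_smul_real, map_smul_real, dTrans_I_smul hc hc' hq hq',
    ← complex_smul_eq]

theorem det2_map_dTrans (hc : c ∈ atlas C2 M) (hc' : c' ∈ atlas C2 M) {q : C2} (hq : q ∈ c.target)
    (hq' : c.symm q ∈ c'.source) (u v : C2) :
    det2 (dTrans c c' q u) (dTrans c c' q v)
      = det2 (dTrans c c' q (Pi.single 0 1)) (dTrans c c' q (Pi.single 1 1)) * det2 u v := by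
  have hs := dTrans_smul hc hc' hq hq'
  have hd : ∀ u, dTrans c c' q u = u 0 • dTrans c c' q (Pi.single 0 1)
      + u 1 • dTrans c c' q (Pi.single 1 1) := by
    intro u
    conv_lhs => rw [eq_smul_single u, map_add, hs, hs]
  rw [hd u, hd v]
  simp [det2]
  ring

theorem chernForm_change_target (hf : IsConformalImmersion g f) (he : e ∈ atlas ℂ S)
    (hc : c ∈ atlas C2 M) (hc' : c' ∈ atlas C2 M) (hz : z ∈ repDomain f e c)
    (hz' : f (e.symm z) ∈ c'.source) (h0 : e.symm z ∉ specialPoints f) (a : ℂ) :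
    chernForm (g.inChart c') (rep f e c') z a = chernForm (g.inChart c) (rep f e c) z a := by
  have hq := rep_mem_target hz
  have hq' : c.symm (rep f e c z) ∈ c'.source := by rwa [symm_rep hz]
  have hcov : ∀ a b, cov (chern (g.inChart c')) (rep f e c') (fun w => fderiv ℝ (rep f e c') w b) z a
      = dTrans c c' (rep f e c z)
        (cov (chern (g.inChart c)) (rep f e c) (fun w => fderiv ℝ (rep f e c) w b) z a) :=
    fun a b => cov_rep_change_target hf he hc hc' hz hz'
      (connectionsRelated_chern_inChart g hc hc' hq hq')
      ((contDiffAt_fderiv_apply ((isConformalPatch_rep hf he hc).contDiffAt hz) b).differentiableAt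
        (by simp))
      (fderiv_rep_change_target_eventually hf.contMDiff he hc hc' hz hz' b) a
  have hd : ∀ b, fderiv ℝ (rep f e c') z b
      = dTrans c c' (rep f e c z) (fderiv ℝ (rep f e c) z b) := fun b =>
    fderiv_rep_change_target hf.contMDiff he hc hc' hz hz' b
  obtain ⟨k, hL⟩ : ∃ k, ∀ u v, det2 (dTrans c c' (rep f e c z) u) (dTrans c c' (rep f e c z) v)
      = k * det2 u v := ⟨_, det2_map_dTrans hc hc' hq hq'⟩
  have hD' : detMap (rep f e c') z = k * detMap (rep f e c) z := by
    rw [detMap, hd, hd, hL, detMap]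
  have hk := left_ne_zero_of_mul (hD' ▸ (detMap_rep_ne_zero_iff hf he hc' ⟨hz.1, hz'⟩).2 h0)
  rw [chernForm, chernForm, hcov, hcov, hd, hd, hL, hL, hD', ← mul_add, mul_div_mul_left _ _ hk]

theorem chernTrace_linear (G : C2 → C2 →L[ℝ] C2 →L[ℝ] ℝ) (q : C2) (L : ℂ →L[ℝ] C2) (a : ℂ) :
    (chernTrace G q (L a)).im
      = a.re * (chernTrace G q (L 1)).im + a.im * (chernTrace G q (L Complex.I)).im := by
  rw [fderiv_real_apply L a]
  simp only [chernTrace, Fin.sum_univ_two, chern_add_left, chern_smul_left_real, Pi.add_apply,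
    Pi.smul_apply, Complex.real_smul, Complex.add_im, Complex.im_ofReal_mul]
  ring

theorem dTrans_eq_deriv_mul (he : e ∈ atlas ℂ S) (he' : e' ∈ atlas ℂ S) (hz : z ∈ e.target)
    (hz' : e.symm z ∈ e'.source) (a : ℂ) :
    dTrans e e' z a = deriv (fun w => e' (e.symm w)) z * a :=
  fderiv_real_apply_of_differentiableAt
    ((contDiffAt_transition he he' hz hz').differentiableAt (by simp)) a

theorem detMap_change_source (hf : IsConformalImmersion g f) (he : e ∈ atlas ℂ S)
    (he' : e' ∈ atlas ℂ S) (hc : c ∈ atlas C2 M) (hz : z ∈ repDomain f e c)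
    (hz' : e.symm z ∈ e'.source) : detMap (rep f e c) z
      = (Complex.normSq (deriv (fun w => e' (e.symm w)) z) : ℂ)
        * detMap (rep f e' c) (e' (e.symm z)) := by
  have hφd : DifferentiableAt ℂ (fun w => e' (e.symm w)) z :=
    (contDiffAt_transition he he' hz.1 hz').differentiableAt (by simp)
  have hd : DifferentiableAt ℝ (rep f e' c) (e' (e.symm z)) :=
    ((isConformalPatch_rep hf he' hc).contDiffAt
      (mem_repDomain_change_source hz hz')).differentiableAt (by simp)
  rw [detMap_eq, detMap_eq, del_congr (rep_change_source hz.1 hz'),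
    delBar_congr (rep_change_source hz.1 hz'), del_comp hd hφd, delBar_comp hd hφd, det2_smul_left,
    det2_smul_right, ← Complex.mul_conj]
  ring

theorem chernForm_change_source (hf : IsConformalImmersion g f) (he : e ∈ atlas ℂ S)
    (he' : e' ∈ atlas ℂ S) (hc : c ∈ atlas C2 M) (hz : z ∈ repDomain f e c)
    (hz' : e.symm z ∈ e'.source) (h0 : e.symm z ∉ specialPoints f) (a : ℂ) :
    chernForm (g.inChart c) (rep f e c) z a = chernForm (g.inChart c) (rep f e' c)
      (e' (e.symm z)) (deriv (fun w => e' (e.symm w)) z * a) := by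
  have hφ := contDiffAt_transition he he' hz.1 hz'
  have hφd : DifferentiableAt ℂ (fun w => e' (e.symm w)) z := hφ.differentiableAt (by simp)
  have hφ' : DifferentiableAt ℂ (deriv fun w => e' (e.symm w)) z :=
    hφ.analyticAt.deriv.differentiableAt
  have hP := isConformalPatch_rep hf he hc
  have hP' := isConformalPatch_rep hf he' hc
  have hφz := mem_repDomain_change_source hz hz'
  have hD := (detMap_rep_ne_zero_iff hf he hc hz).2 h0
  have hD2 := hD
  rw [detMap_change_source hf he he' hc hz hz'] at hD2
  have hD' := right_ne_zero_of_mul hD2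
  have hn := left_ne_zero_of_mul hD2
  rw [hP.chernForm_eq hz hD, hP'.chernForm_eq hφz hD']
  have h1 : detMap (rep f e c) =ᶠ[𝓝 z] fun w =>
      (Complex.normSq (deriv (fun w => e' (e.symm w)) w) : ℂ)
        * detMap (rep f e' c) (e' (e.symm w)) := by
    filter_upwards [eventually_mem_target_and_source hz.1 hz', hP.isOpen.mem_nhds hz] with w hw hw'
    exact detMap_change_source hf he he' hc hw' hw.2
  have hd1 : DifferentiableAt ℝ
      (fun w => (Complex.normSq (deriv (fun w => e' (e.symm w)) w) : ℂ)) z := by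
    have h2 := hφ'.restrictScalars ℝ
    have h3 : DifferentiableAt ℝ (fun w => deriv (fun w => e' (e.symm w)) w
        * (starRingEnd ℂ) (deriv (fun w => e' (e.symm w)) w)) z :=
      h2.mul (Complex.conjCLE.differentiableAt.comp z h2)
    simpa only [Complex.mul_conj] using h3
  have hd2 : DifferentiableAt ℝ (detMap (rep f e' c)) (e' (e.symm z)) :=
    (hP'.contDiffAt_detMap hφz).differentiableAt (by simp)
  have hd3 : DifferentiableAt ℝ (fun w => detMap (rep f e' c) (e' (e.symm w))) z :=
    DifferentiableAt.comp (g := detMap (rep f e' c)) (f := fun w => e' (e.symm w)) z hd2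
      (hφd.restrictScalars ℝ)
  rw [dArg_congr h1, dArg_mul hd1 hd3 hn hD',
    dArg_ofReal (fun w => Complex.normSq (deriv (fun w => e' (e.symm w)) w)), zero_add,
    dArg_comp hd2 hφd, fderiv_rep_change_source hf.contMDiff he he' hc hz hz',
    dTrans_eq_deriv_mul he he' hz.1 hz', (rep_change_source hz.1 hz').self_of_nhds]

/-- The connection form of the determinant bundle in the preferred charts of `S`. -/
def chernOneForm (g : HermitianMetric M) (f : S → M) (p : S) (z : ℂ) : ℂ :=
  oneForm (chernForm (localMetric g f (chartAt ℂ p) z) (localRep f (chartAt ℂ p) z)) z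

theorem chernOneForm_eq (hf : IsConformalImmersion g f) {p : S} (hc : c ∈ atlas C2 M)
    (hz : z ∈ repDomain f (chartAt ℂ p) c) (h0 : (chartAt ℂ p).symm z ∉ specialPoints f) :
    chernOneForm g f p z = oneForm (chernForm (g.inChart c) (rep f (chartAt ℂ p) c)) z :=
  oneForm_congr fun a => chernForm_change_target hf (chart_mem_atlas ℂ p) hc
    (targetChart_mem_atlas f _ _) hz (mem_repDomain_targetChart hz.1).2 h0 a

theorem isOneForm_chernOneForm (hf : IsConformalImmersion g f) :
    IsOneForm (specialPoints f) (chernOneForm g f) := by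
  intro p q z hz hz' h0
  have he := chart_mem_atlas ℂ p
  have he' := chart_mem_atlas ℂ q
  have hc := targetChart_mem_atlas f (chartAt ℂ p) z
  have hzc : z ∈ repDomain f (chartAt ℂ p) (targetChart f (chartAt ℂ p) z) :=
    mem_repDomain_targetChart hz
  have hzc' := mem_repDomain_change_source hzc hz'
  have h0' : (chartAt ℂ q).symm (coordChange p q z) ∉ specialPoints f := by
    rwa [coordChange, (chartAt ℂ q).left_inv hz']
  have h1 : chernOneForm g f q (coordChange p q z) = _ := chernOneForm_eq hf hc hzc' h0'
  rw [chernOneForm_eq hf hc hzc h0, h1]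
  refine oneForm_pullback (fun a => chernForm_change_source hf he he' hc hzc hz' h0 a) fun a => ?_
  have hP' := isConformalPatch_rep hf he' hc
  have hD' := (detMap_rep_ne_zero_iff hf he' hc hzc').2 h0'
  rw [coordChange, hP'.chernForm_eq hzc' hD', hP'.chernForm_eq hzc' hD',
    hP'.chernForm_eq hzc' hD', dArg_linear, chernTrace_linear]
  ring

theorem eventually_eq_of_isClosed {p : S} {z₀ : ℂ} (hcl : IsClosed (specialPoints f))
    (hf : IsConformalImmersion g f) (hz : z₀ ∈ (chartAt ℂ p).target)
    (h0 : (chartAt ℂ p).symm z₀ ∉ specialPoints f) :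
    ∀ᶠ z in 𝓝 z₀, z ∈ repDomain f (chartAt ℂ p) (targetChart f (chartAt ℂ p) z₀) ∧
      (chartAt ℂ p).symm z ∉ specialPoints f :=
  ((isOpen_repDomain hf.contMDiff.continuous).eventually_mem (mem_repDomain_targetChart hz)).and
    (((chartAt ℂ p).continuousAt_symm hz).eventually (hcl.isOpen_compl.eventually_mem h0))

theorem contDiffAt_chernOneForm (hf : IsConformalImmersion g f) (hcl : IsClosed (specialPoints f))
    {p : S} (hz : z ∈ (chartAt ℂ p).target) (h0 : (chartAt ℂ p).symm z ∉ specialPoints f) :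
    ContDiffAt ℝ 1 (chernOneForm g f p) z ∧
      dForm (chernOneForm g f p) z
        = -(2 * Real.pi) * pullbackFirstChernForm g f (chartAt ℂ p) z := by
  have hc := targetChart_mem_atlas f (chartAt ℂ p) z
  have h1 : chernOneForm g f p =ᶠ[𝓝 z] oneForm (chernForm
      (g.inChart (targetChart f (chartAt ℂ p) z))
      (rep f (chartAt ℂ p) (targetChart f (chartAt ℂ p) z))) := by
    filter_upwards [eventually_eq_of_isClosed hcl hf hz h0] with w hw
    exact chernOneForm_eq hf hc hw.1 hw.2
  have hP := isConformalPatch_rep hf (chart_mem_atlas ℂ p) hc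
  have hzc : z ∈ repDomain f (chartAt ℂ p) (targetChart f (chartAt ℂ p) z) :=
    mem_repDomain_targetChart hz
  have hD := (detMap_rep_ne_zero_iff hf (chart_mem_atlas ℂ p) hc hzc).2 h0
  refine ⟨(hP.contDiffAt_chernForm hzc hD).congr_of_eventuallyEq h1, ?_⟩
  rw [dForm_congr h1, hP.dForm_chernForm hzc hD, pullbackFirstChernForm]
  have := Real.pi_pos
  field_simp
  rfl

/-- At a point where `∂f/∂z` and `∂f/∂z̄` vanish to the orders `q` and `p`, the connection form of the
determinant bundle has the residue of the argument of `z ^ q z̄ ^ p`. -/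
theorem HasOrders.chernOneForm_eq (hf : IsConformalImmersion g f) {x : S} {p q : ℕ} {N : Set ℂ}
    {e₁ e₂ : ℂ → C2} {σ τ H K : ℂ → ℂ} (h : HasOrders g f x p q N e₁ e₂ σ τ H K) :
    ∃ b' : ℂ → ℂ, ContDiffAt ℝ 1 b' (chartAt ℂ x x) ∧ ∀ᶠ z in 𝓝[≠] (chartAt ℂ x x),
      chernOneForm g f x z = b' z - Complex.I * ((q : ℝ) - p : ℝ) / (z - chartAt ℂ x x) := by
  set e := chartAt ℂ x
  set z₀ := e x
  have he : e ∈ atlas ℂ S := chart_mem_atlas ℂ x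
  have hc := targetChart_mem_atlas f e z₀
  obtain ⟨hN, hzN, hfr⟩ := h.isFrameNear
  have hP := isConformalPatch_rep hf he hc
  have hPz := hP.isHermitianForm (hN hzN)
  set R : ℂ → ℂ := fun w => -2 * Complex.I * H w * (starRingEnd ℂ) (K w) * det2 (e₁ w) (e₂ w)
    with hR
  have hR2 : ContDiffAt ℝ 2 R z₀ :=
    (((contDiffAt_const.mul h.contDiffAt_del).mul
      (Complex.conjCLE.contDiff.contDiffAt.comp z₀ h.contDiffAt_delBar)).mul
      ((contDiffAt_det2 (hfr.contDiffAt_fst z₀ hzN) (hfr.contDiffAt_snd z₀ hzN)).of_le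
        ENat.LEInfty.out))
  have hR0 : R z₀ ≠ 0 := by
    have h1 := (hfr.isUnitary z₀ hzN).det2_ne_zero hPz
    have h2 : H z₀ ≠ 0 := h.ne_zero_del
    have h3 : K z₀ ≠ 0 := h.ne_zero_delBar
    simp [hR, h1, h2, h3]
  have hDeq : ∀ᶠ w in 𝓝 z₀, detMap (rep f e (targetChart f e z₀)) w
      = (w - z₀) ^ q * ((starRingEnd ℂ) ((w - z₀) ^ p) * R w) := by
    filter_upwards [hfr.isOpen.mem_nhds hzN, h.del_coeff_eq, h.delBar_coeff_eq] with w hw h1 h2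
    have h3 : del (rep f e (targetChart f e z₀)) w = _ := hfr.del_eq w hw
    have h4 : delBar (rep f e (targetChart f e z₀)) w = _ := hfr.delBar_eq w hw
    rw [detMap_eq, h3, h4, det2_smul_left, det2_smul_right, h1, h2, map_mul, hR]
    ring
  refine ⟨fun w => oneForm (dArg R) w + oneForm (fun w a =>
    (chernTrace (localMetric g f e z₀) (localRep f e z₀ w)
      (fderiv ℝ (localRep f e z₀) w a)).im) w,
    (contDiffAt_oneForm fun a => contDiffAt_dArg hR2 hR0 a).add
      (contDiffAt_oneForm fun a => (hP.contDiffAt_chernTrace (hN hzN) a).of_le ENat.LEInfty.out), ?_⟩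
  rw [eventually_nhdsWithin_iff]
  filter_upwards [hfr.isOpen.mem_nhds hzN, hDeq.eventually_nhds, hR2.eventually (by simp),
    hR2.continuousAt.eventually_ne hR0] with w hw hDw hRw hRw0 hne
  have hw0 : w - z₀ ≠ 0 := sub_ne_zero.2 hne
  have hD0 : detMap (rep f e (targetChart f e z₀)) w ≠ 0 := by
    rw [hDw.self_of_nhds]
    exact mul_ne_zero (pow_ne_zero q hw0)
      (mul_ne_zero ((map_ne_zero _).2 (pow_ne_zero p hw0)) hRw0)
  have hsp := (detMap_rep_ne_zero_iff hf he hc (hN hw)).1 hD0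
  have hpd : ∀ k : ℕ, DifferentiableAt ℝ (fun w : ℂ => (w - z₀) ^ k) w := fun k =>
    (differentiableAt_id.sub_const z₀).fun_pow k
  have hRd := hRw.differentiableAt (by norm_num)
  have hconj : DifferentiableAt ℝ (fun w : ℂ => (starRingEnd ℂ) ((w - z₀) ^ p)) w :=
    Complex.conjCLE.differentiableAt.comp w (hpd p)
  have hd : ∀ a, dArg (detMap (rep f e (targetChart f e z₀))) w a
      = ((q : ℝ) - p) * (a / (w - z₀)).im + dArg R w a := by
    intro a
    rw [dArg_congr hDw, dArg_mul (hpd q) (hconj.fun_mul hRd) (pow_ne_zero q hw0)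
      (mul_ne_zero ((map_ne_zero _).2 (pow_ne_zero p hw0)) hRw0),
      dArg_mul hconj hRd ((map_ne_zero _).2 (pow_ne_zero p hw0)) hRw0, dArg_conj (hpd p),
      dArg_pow hne, dArg_pow hne]
    ring
  rw [ChernMinimal.chernOneForm_eq hf hc (hN hw) hsp,
    oneForm_congr (ρ' := fun w a => ((q : ℝ) - p) * (a / (w - z₀)).im + (dArg R w a
      + (chernTrace (localMetric g f e z₀) (localRep f e z₀ w)
          (fderiv ℝ (localRep f e z₀) w a)).im))
      fun a => by rw [hP.chernForm_eq (hN hw) hD0, hd]; simp only [add_assoc]; rfl]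
  have h5 := oneForm_im_div ((q : ℝ) - p) (w - z₀) w
  rw [oneForm_add, oneForm_add]
  have h6 : oneForm (fun w a => ((q : ℝ) - p) * (a / (w - z₀)).im) w
      = oneForm (fun _ a => ((q : ℝ) - p) * (a / (w - z₀)).im) w := rfl
  rw [h6, h5]
  push_cast
  ring

/-- The Chern number counts the zeros of `∂f/∂z` minus those of `∂f/∂z̄`. -/
theorem chernNumber_eq [T2Space S] [CompactSpace S] (hf : IsConformalImmersion g f) {Z : Finset S}
    (hZ : (Z : Set S) = specialPoints f) {p q : S → ℕ} {N : S → Set ℂ} {e₁ e₂ : S → ℂ → C2}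
    {σ τ H K : S → ℂ → ℂ}
    (h : ∀ x, HasOrders g f x (p x) (q x) (N x) (e₁ x) (e₂ x) (σ x) (τ x) (H x) (K x)) :
    chernNumber g f = ∑ x ∈ Z, ((q x : ℝ) - p x) := by
  have hcl : IsClosed (specialPoints f) := hZ ▸ Z.finite_toSet.isClosed
  have hmem : ∀ y, y ∈ Z ↔ y ∈ specialPoints f := fun y => by rw [← hZ]; rfl
  have h1 := formIntegral_eq_neg_two_pi_mul_sum Z (b := chernOneForm g f)
    (hZ ▸ isOneForm_chernOneForm hf)
    (fun p z hz h0 => (contDiffAt_chernOneForm hf hcl hz (mt (hmem _).2 h0)).1)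
    (fun x => (q x : ℝ) - p x) (fun x _ => (h x).chernOneForm_eq hf)
    (w := fun p z => -(2 * Real.pi) * pullbackFirstChernForm g f (chartAt ℂ p) z)
    (fun p z hz h0 => ((contDiffAt_chernOneForm hf hcl hz (mt (hmem _).2 h0)).2).symm)
  have h2 : formIntegral (fun p z => -(2 * Real.pi) * pullbackFirstChernForm g f (chartAt ℂ p) z)
      = -(2 * Real.pi) * chernNumber g f := by
    rw [chernNumber, surfaceIntegral_eq_formIntegral, formIntegral, formIntegral, Finset.mul_sum]
    refine Finset.sum_congr rfl fun x _ => ?_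
    rw [← MeasureTheory.integral_const_mul]
    congr 1
    ext z
    ring
  rw [h2] at h1
  have h3 := h1.2
  have := Real.pi_pos
  have h4 : (2 * Real.pi) * (chernNumber g f - ∑ x ∈ Z, ((q x : ℝ) - p x)) = 0 := by
    linear_combination -h3
  have h5 := (mul_eq_zero.1 h4).resolve_left (by positivity)
  linarith

end ChernNumber

/-! ### Orientation and normal vectors in `ℂ²` -/

section Orientation

/-- The determinant of four vectors of `ℂ²` with respect to the complex orientation. -/
def det4 (a b c d : C2) : ℝ :=
  Matrix.det (Matrix.of ![realCoords a, realCoords b, realCoords c, realCoords d])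

/-- The real matrix of the complex linear map with columns `u` and `v`. -/
def realMatrix (u v : C2) : Matrix (Fin 4) (Fin 4) ℝ :=
  !![(u 0).re, (u 0).im, (u 1).re, (u 1).im; -(u 0).im, (u 0).re, -(u 1).im, (u 1).re;
    (v 0).re, (v 0).im, (v 1).re, (v 1).im; -(v 0).im, (v 0).re, -(v 1).im, (v 1).re]

theorem det_realMatrix (u v : C2) : (realMatrix u v).det = Complex.normSq (det2 u v) := by
  rw [realMatrix]
  simp [Matrix.det_succ_row_zero, Fin.sum_univ_succ, Fin.succAbove, det2, Complex.normSq_apply]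
  ring

theorem realCoords_combination (u v : C2) (a b : ℂ) :
    realCoords (a • u + b • v) = Matrix.vecMul (realCoords ![a, b]) (realMatrix u v) := by
  ext k
  fin_cases k <;>
    simp [realCoords, realMatrix, Matrix.vecMul, dotProduct, Fin.sum_univ_succ] <;> ring

theorem det4_combination (u v : C2) (a b : Fin 4 → ℂ) :
    det4 (a 0 • u + b 0 • v) (a 1 • u + b 1 • v) (a 2 • u + b 2 • v) (a 3 • u + b 3 • v)
      = det4 ![a 0, b 0] ![a 1, b 1] ![a 2, b 2] ![a 3, b 3] * Complex.normSq (det2 u v) := by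
  rw [← det_realMatrix, det4, det4, ← Matrix.det_mul]
  congr 1
  ext i j
  fin_cases i <;> simp [realCoords_combination, Matrix.mul_apply, Matrix.vecMul, dotProduct]

theorem det4_neg_right (a b c d : C2) : det4 a b c (-d) = -det4 a b c d := by
  have h : realCoords (-d) = -realCoords d := by ext k; fin_cases k <;> simp [realCoords]
  rw [det4, det4, h]
  simp [Matrix.det_succ_row_zero, Fin.sum_univ_succ, Fin.succAbove]
  ring

variable {B : C2 →L[ℝ] C2 →L[ℝ] ℝ} {e₁ e₂ : C2}

/-- For a real linear map `a ↦ σ a e₁ + τ ā e₂` from `ℂ` to `ℂ²`, where `e₁`, `e₂` is a unitary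
basis, these are the vectors that are orthogonal to its image. -/
def normalVec (σ τ : ℂ) (e₁ e₂ : C2) (d : ℂ) : C2 :=
  (-((starRingEnd ℂ) d * τ)) • e₁ + (d * σ) • e₂

theorem normalVec_eq (σ τ : ℂ) (e₁ e₂ : C2) (d : ℂ) : normalVec σ τ e₁ e₂ d
    = d.re • normalVec σ τ e₁ e₂ 1 + d.im • normalVec σ τ e₁ e₂ Complex.I := by
  have h1 : (starRingEnd ℂ) d = d.re - d.im * Complex.I := by apply Complex.ext <;> simp
  have h2 : d = d.re + d.im * Complex.I := (Complex.re_add_im d).symm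
  simp only [normalVec, map_one, Complex.conj_I]
  rw [h1]
  ext k
  simp only [Pi.add_apply, Pi.smul_apply, smul_eq_mul, Complex.real_smul]
  linear_combination (σ * e₂ k) * h2

theorem IsUnitary.herm_combination (h : IsHermitianForm B) (he : IsUnitary B e₁ e₂)
    (a b a' b' : ℂ) : herm B (a • e₁ + b • e₂) (a' • e₁ + b' • e₂)
      = a * (starRingEnd ℂ) a' + b * (starRingEnd ℂ) b' := by
  have h1 := he.orthogonal
  have h2 := (he.swap h).orthogonal
  simp only [herm_add_left, h.herm_add_right, h.herm_smul_left, h.herm_smul_right, he.fst, he.snd,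
    h1, h2]
  ring

theorem IsUnitary.apply_combination (h : IsHermitianForm B) (he : IsUnitary B e₁ e₂)
    (a b a' b' : ℂ) : B (a • e₁ + b • e₂) (a' • e₁ + b' • e₂)
      = (a * (starRingEnd ℂ) a' + b * (starRingEnd ℂ) b').re := by
  rw [← he.herm_combination h, re_herm]

theorem IsUnitary.apply_normalVec (h : IsHermitianForm B) (he : IsUnitary B e₁ e₂)
    (σ τ d d' : ℂ) : B (normalVec σ τ e₁ e₂ d) (normalVec σ τ e₁ e₂ d')
      = (‖σ‖ ^ 2 + ‖τ‖ ^ 2) * (d * (starRingEnd ℂ) d').re := by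
  rw [normalVec, normalVec, he.apply_combination h, ← Complex.normSq_eq_norm_sq,
    ← Complex.normSq_eq_norm_sq]
  simp [Complex.normSq_apply]
  ring

theorem IsUnitary.apply_tangent_normalVec (h : IsHermitianForm B) (he : IsUnitary B e₁ e₂)
    (σ τ a d : ℂ) :
    B ((a * σ) • e₁ + ((starRingEnd ℂ) a * τ) • e₂) (normalVec σ τ e₁ e₂ d) = 0 := by
  rw [normalVec, he.apply_combination h]
  simp
  ring

/-- Every vector orthogonal to the image of `a ↦ σ a e₁ + τ ā e₂` is a `normalVec`. -/
theorem IsUnitary.exists_eq_normalVec (h : IsHermitianForm B) (he : IsUnitary B e₁ e₂)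
    {σ τ : ℂ} (h0 : 0 < ‖σ‖ ^ 2 + ‖τ‖ ^ 2) {n : C2}
    (hn : ∀ a : ℂ, B ((a * σ) • e₁ + ((starRingEnd ℂ) a * τ) • e₂) n = 0) :
    ∃ d, n = normalVec σ τ e₁ e₂ d := by
  obtain ⟨x, y, rfl⟩ : ∃ x y : ℂ, n = x • e₁ + y • e₂ := ⟨_, _, he.eq_add h n⟩
  simp only [he.apply_combination h] at hn
  have key : σ * (starRingEnd ℂ) x + (starRingEnd ℂ) τ * y = 0 := by
    have h1 := hn 1
    have h2 := hn Complex.I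
    apply Complex.ext
    · simp at h1 ⊢
      linarith
    · simp at h2 ⊢
      linarith
  have key' := congrArg (starRingEnd ℂ) key
  simp only [map_add, map_mul, Complex.conj_conj, map_zero] at key'
  have hl : σ * (starRingEnd ℂ) σ + τ * (starRingEnd ℂ) τ ≠ 0 := by
    rw [Complex.mul_conj, Complex.mul_conj, Complex.normSq_eq_norm_sq, Complex.normSq_eq_norm_sq]
    exact_mod_cast h0.ne'
  refine ⟨(y * (starRingEnd ℂ) σ - (starRingEnd ℂ) x * τ)
    / (σ * (starRingEnd ℂ) σ + τ * (starRingEnd ℂ) τ), ?_⟩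
  rw [normalVec]
  congr 2
  · simp only [map_div₀, map_sub, map_add, map_mul, Complex.conj_conj]
    rw [mul_comm ((starRingEnd ℂ) σ), mul_comm ((starRingEnd ℂ) τ), div_mul_eq_mul_div, ← neg_div,
      eq_div_iff hl]
    linear_combination σ * key'
  · rw [div_mul_eq_mul_div, eq_div_iff hl]
    linear_combination τ * key

/-- The images of `1` and `i`, followed by the normal vectors with parameters `d` and `i d`, are
positively oriented if they are independent. -/
theorem det4_normalVec (σ τ d : ℂ) (e₁ e₂ : C2) :
    det4 (σ • e₁ + τ • e₂) ((Complex.I * σ) • e₁ + (-(Complex.I * τ)) • e₂)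
      (normalVec σ τ e₁ e₂ d) (normalVec σ τ e₁ e₂ (Complex.I * d))
      = (‖σ‖ ^ 2 + ‖τ‖ ^ 2) ^ 2 * ‖d‖ ^ 2 * Complex.normSq (det2 e₁ e₂) := by
  have h := det4_combination e₁ e₂
    ![σ, Complex.I * σ, -((starRingEnd ℂ) d * τ), -((starRingEnd ℂ) (Complex.I * d) * τ)]
    ![τ, -(Complex.I * τ), d * σ, Complex.I * d * σ]
  simp only [Matrix.cons_val] at h
  rw [normalVec, normalVec, h]
  congr 1
  rw [← Complex.normSq_eq_norm_sq, ← Complex.normSq_eq_norm_sq, ← Complex.normSq_eq_norm_sq, det4]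
  simp [Matrix.det_succ_row_zero, Fin.sum_univ_succ, Fin.succAbove, Complex.normSq_apply,
    realCoords]
  ring

/-- The second vector of an oriented orthonormal basis of the normal space is obtained from the
first one by a rotation. -/
theorem IsUnitary.eq_normalVec_of_oriented (h : IsHermitianForm B) (he : IsUnitary B e₁ e₂)
    {σ τ d d' : ℂ} (h0 : 0 < ‖σ‖ ^ 2 + ‖τ‖ ^ 2)
    (h1 : B (normalVec σ τ e₁ e₂ d) (normalVec σ τ e₁ e₂ d) = 1)
    (h2 : B (normalVec σ τ e₁ e₂ d') (normalVec σ τ e₁ e₂ d') = 1)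
    (h3 : B (normalVec σ τ e₁ e₂ d) (normalVec σ τ e₁ e₂ d') = 0)
    (hor : 0 < det4 (σ • e₁ + τ • e₂) ((Complex.I * σ) • e₁ + (-(Complex.I * τ)) • e₂)
      (normalVec σ τ e₁ e₂ d) (normalVec σ τ e₁ e₂ d')) : d' = Complex.I * d := by
  rw [he.apply_normalVec h] at h1 h2 h3
  have h3' := (mul_eq_zero.1 h3).resolve_left h0.ne'
  have h4 : (d' * (starRingEnd ℂ) d').re = (d * (starRingEnd ℂ) d).re :=
    mul_left_cancel₀ h0.ne' (h2.trans h1.symm)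
  have hd : d ≠ 0 := by
    rintro rfl
    simp at h1
  have h5 : (d' - Complex.I * d) * (d' + Complex.I * d) = 0 := by
    have e1 : d.re * d'.re + d.im * d'.im = 0 := by
      simp at h3'
      linarith
    have e2 : d'.re ^ 2 + d'.im ^ 2 = d.re ^ 2 + d.im ^ 2 := by
      simp at h4
      nlinarith
    have hn : 0 < d.re ^ 2 + d.im ^ 2 := by
      have := Complex.normSq_pos.2 hd
      rw [Complex.normSq_apply] at this
      nlinarith
    have e3 : (d'.re ^ 2 - d.im ^ 2) * (d.re ^ 2 + d.im ^ 2) = 0 := by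
      linear_combination (d.re * d'.re - d.im * d'.im) * e1 + d.im ^ 2 * e2
    have e4 : (d'.im ^ 2 - d.re ^ 2) * (d.re ^ 2 + d.im ^ 2) = 0 := by
      linear_combination (d.im * d'.im - d.re * d'.re) * e1 + d.re ^ 2 * e2
    have e5 : (d'.re * d'.im + d.re * d.im) * (d.re ^ 2 + d.im ^ 2) = 0 := by
      linear_combination (d'.im * d.re + d'.re * d.im) * e1 - d.re * d.im * e2
    have e3' := (mul_eq_zero.1 e3).resolve_right hn.ne'
    have e4' := (mul_eq_zero.1 e4).resolve_right hn.ne'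
    have e5' := (mul_eq_zero.1 e5).resolve_right hn.ne'
    apply Complex.ext
    · simp
      linear_combination e3' - e4'
    · simp
      linear_combination 2 * e5'
  rcases mul_eq_zero.1 h5 with h6 | h6
  · exact sub_eq_zero.1 h6
  · exfalso
    have h7 : normalVec σ τ e₁ e₂ d' = -normalVec σ τ e₁ e₂ (Complex.I * d) := by
      rw [eq_neg_of_add_eq_zero_left h6]
      simp only [normalVec, map_neg]
      module
    rw [h7, det4_neg_right, det4_normalVec] at hor
    have : 0 ≤ (‖σ‖ ^ 2 + ‖τ‖ ^ 2) ^ 2 * ‖d‖ ^ 2 * Complex.normSq (det2 e₁ e₂) :=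
      mul_nonneg (by positivity) (Complex.normSq_nonneg _)
    linarith

end Orientation

/-! ### The rotation of a normal frame along a map -/

section Rotation

variable {V : Type*} [NormedAddCommGroup V] [NormedSpace ℝ V]
  {G : V → V →L[ℝ] V →L[ℝ] ℝ} {F : ℂ → V} {z : ℂ}

theorem cov_congr {Γ : V → V → V → V} {F' X X' : ℂ → V} (hF : F =ᶠ[𝓝 z] F')
    (hX : X =ᶠ[𝓝 z] X') (a : ℂ) : cov Γ F X z a = cov Γ F' X' z a := by
  rw [cov, cov, hF.fderiv_eq, hX.fderiv_eq, hF.self_of_nhds, hX.self_of_nhds]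

theorem cov_combination {X Y : ℂ → V} {u v : ℂ → ℝ} (hX : DifferentiableAt ℝ X z)
    (hY : DifferentiableAt ℝ Y z) (hu : DifferentiableAt ℝ u z) (hv : DifferentiableAt ℝ v z)
    (a : ℂ) : cov (leviCivita G) F (fun w => u w • X w + v w • Y w) z a
      = u z • cov (leviCivita G) F X z a + v z • cov (leviCivita G) F Y z a
        + fderiv ℝ u z a • X z + fderiv ℝ v z a • Y z := by
  rw [cov, fderiv_fun_add (hu.fun_smul hX) (hv.fun_smul hY), fderiv_fun_smul hu hX,
    fderiv_fun_smul hv hY, leviCivita_add_right, leviCivita_smul_right, leviCivita_smul_right,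
    cov, cov]
  simp only [add_apply, smul_apply, ContinuousLinearMap.smulRight_apply]
  module

theorem cov_comp {Γ : V → V → V → V} {X : ℂ → V} {φ : ℂ → ℂ}
    (hF : DifferentiableAt ℝ F (φ z)) (hX : DifferentiableAt ℝ X (φ z))
    (hφ : DifferentiableAt ℂ φ z) (a : ℂ) :
    cov Γ (fun w => F (φ w)) (fun w => X (φ w)) z a = cov Γ F X (φ z) (deriv φ z * a) := by
  have h : ∀ Y : ℂ → V, DifferentiableAt ℝ Y (φ z) →
      fderiv ℝ (fun w => Y (φ w)) z a = fderiv ℝ Y (φ z) (deriv φ z * a) := by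
    intro Y hY
    rw [← fderiv_real_apply_of_differentiableAt hφ]
    exact congrArg (fun L : ℂ →L[ℝ] V => L a) (fderiv_comp z hY (hφ.restrictScalars ℝ))
  rw [cov, cov, h F hF, h X hX]

variable [FiniteDimensional ℝ V]

/-- Covariant derivatives are compatible with the metric. -/
theorem IsMetricAt.fderiv_apply (hG : IsMetricAt G (F z)) (hF : DifferentiableAt ℝ F z)
    {X Y : ℂ → V} (hX : DifferentiableAt ℝ X z) (hY : DifferentiableAt ℝ Y z) (a : ℂ) :
    fderiv ℝ (fun w => G (F w) (X w) (Y w)) z a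
      = G (F z) (cov (leviCivita G) F X z a) (Y z)
        + G (F z) (X z) (cov (leviCivita G) F Y z a) := by
  have h1 : DifferentiableAt ℝ (fun w => G (F w)) z :=
    DifferentiableAt.comp (g := G) (f := F) z hG.differentiableAt hF
  have h2 : fderiv ℝ (fun w => G (F w)) z a = fderiv ℝ G (F z) (fderiv ℝ F z a) :=
    congrArg (fun L : ℂ →L[ℝ] V →L[ℝ] V →L[ℝ] ℝ => L a)
      (fderiv_comp (g := G) (f := F) z hG.differentiableAt hF)
  rw [hasFDerivAt_clm_apply₂ h1 hX hY, h2, hG.leviCivita_metric, cov, cov]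
  simp only [map_add, add_apply]
  ring

/-- The Levi-Civita connection has no torsion. -/
theorem IsMetricAt.leviCivita_comm {q : V} (hG : IsMetricAt G q) (u v : V) :
    leviCivita G q u v = leviCivita G q v u :=
  eq_of_forall_apply_eq hG.pos fun w => by
    rw [hG.leviCivita_apply, hG.leviCivita_apply, hG.fderiv_symm w u v]
    ring

/-- The connection form `⟨D_a X, Y⟩ / |X|²`. If `X`, `Y` are orthogonal of the same length, then it
is the connection form of the orthonormal frame `X / |X|`, `Y / |Y|`. -/
def rotationForm (G : V → V →L[ℝ] V →L[ℝ] ℝ) (F X Y : ℂ → V) (z a : ℂ) : ℝ :=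
  G (F z) (cov (leviCivita G) F X z a) (Y z) / G (F z) (X z) (X z)

theorem rotationForm_congr {F' X Y X' Y' : ℂ → V} (hF : F =ᶠ[𝓝 z] F') (hX : X =ᶠ[𝓝 z] X')
    (hY : Y =ᶠ[𝓝 z] Y') (a : ℂ) : rotationForm G F X Y z a = rotationForm G F' X' Y' z a := by
  rw [rotationForm, rotationForm, cov_congr hF hX, hF.self_of_nhds, hX.self_of_nhds,
    hY.self_of_nhds]

theorem rotationForm_comp {X Y : ℂ → V} {φ : ℂ → ℂ} (hF : DifferentiableAt ℝ F (φ z))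
    (hX : DifferentiableAt ℝ X (φ z)) (hφ : DifferentiableAt ℂ φ z) (a : ℂ) :
    rotationForm G (fun w => F (φ w)) (fun w => X (φ w)) (fun w => Y (φ w)) z a
      = rotationForm G F X Y (φ z) (deriv φ z * a) := by
  rw [rotationForm, cov_comp hF hX hφ, rotationForm]

theorem rotationForm_linear {X Y : ℂ → V} (hG : IsMetricAt G (F z)) (a : ℂ) :
    rotationForm G F X Y z a
      = a.re * rotationForm G F X Y z 1 + a.im * rotationForm G F X Y z Complex.I := by
  have h1 : cov (leviCivita G) F X z a = a.re • cov (leviCivita G) F X z 1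
      + a.im • cov (leviCivita G) F X z Complex.I := by
    simp only [cov, fun u => hG.leviCivita_comm u (X z)]
    rw [fderiv_real_apply (fderiv ℝ X z) a, fderiv_real_apply (fderiv ℝ F z) a,
      leviCivita_add_right, leviCivita_smul_right, leviCivita_smul_right]
    module
  rw [rotationForm, h1]
  simp only [rotationForm, map_add, map_smul_real, add_apply, smul_apply, smul_eq_mul]
  ring

/-- Rotating and stretching a conformal frame by the complex function `c` adds the differential of
the argument of `c` to its connection form. -/
theorem rotationForm_rotate (hG : IsMetricAt G (F z)) (hF : DifferentiableAt ℝ F z)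
    {X Y : ℂ → V} {c : ℂ → ℂ} (hX : DifferentiableAt ℝ X z) (hY : DifferentiableAt ℝ Y z)
    (hc : DifferentiableAt ℝ c z) (hc0 : c z ≠ 0) (hX0 : X z ≠ 0)
    (h1 : ∀ᶠ w in 𝓝 z, G (F w) (X w) (X w) = G (F w) (Y w) (Y w))
    (h2 : ∀ᶠ w in 𝓝 z, G (F w) (X w) (Y w) = 0) (a : ℂ) :
    rotationForm G F (fun w => (c w).re • X w + (c w).im • Y w)
      (fun w => -(c w).im • X w + (c w).re • Y w) z a
      = rotationForm G F X Y z a + dArg c z a := by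
  have hpos := hG.pos _ hX0
  have hs := hG.symm.self_of_nhds
  have e1 := congrArg (fun L : ℂ →L[ℝ] ℝ => L a) (Filter.EventuallyEq.fderiv_eq h1)
  have e2 := congrArg (fun L : ℂ →L[ℝ] ℝ => L a) (Filter.EventuallyEq.fderiv_eq h2)
  simp only [hG.fderiv_apply hF hX hX, hG.fderiv_apply hF hY hY] at e1
  simp only [hG.fderiv_apply hF hX hY, fderiv_fun_const, Pi.zero_apply, zero_apply] at e2
  have hre : DifferentiableAt ℝ (fun w => (c w).re) z :=
    Complex.reCLM.differentiableAt.comp z hc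
  have him : DifferentiableAt ℝ (fun w => (c w).im) z :=
    Complex.imCLM.differentiableAt.comp z hc
  have dre : fderiv ℝ (fun w => (c w).re) z a = (fderiv ℝ c z a).re :=
    congrArg (fun L : ℂ →L[ℝ] ℝ => L a)
      (Complex.reCLM.hasFDerivAt.comp z hc.hasFDerivAt).fderiv
  have dim : fderiv ℝ (fun w => (c w).im) z a = (fderiv ℝ c z a).im :=
    congrArg (fun L : ℂ →L[ℝ] ℝ => L a)
      (Complex.imCLM.hasFDerivAt.comp z hc.hasFDerivAt).fderiv
  have hn : (c z).re ^ 2 + (c z).im ^ 2 ≠ 0 := by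
    intro h0
    have := Complex.normSq_pos.2 hc0
    rw [Complex.normSq_apply] at this
    nlinarith
  have harg : dArg c z a = ((c z).re * (fderiv ℝ c z a).im - (c z).im * (fderiv ℝ c z a).re)
      / ((c z).re ^ 2 + (c z).im ^ 2) := by
    rw [dArg, Complex.div_im, Complex.normSq_apply]
    field_simp
  rw [rotationForm, cov_combination hX hY hre him, dre, dim, rotationForm, harg]
  have s1 := hs (cov (leviCivita G) F Y z a) (X z)
  have s2 := hs (Y z) (X z)
  have s3 := h2.self_of_nhds
  have s4 := h1.self_of_nhds
  have s5 := hs (cov (leviCivita G) F X z a) (X z)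
  have s6 := hs (cov (leviCivita G) F Y z a) (Y z)
  simp only [map_add, map_smul_real, add_apply, smul_apply, smul_eq_mul]
  rw [s1, s2, s3, ← s4, div_add_div _ _ hpos.ne' hn]
  rw [s5, s6] at e1
  congr 1
  · linear_combination (-(c z).re * (c z).im / 2) * e1 - (c z).im ^ 2 * e2
      - (c z).re * (c z).im * s5 + (c z).re * (c z).im * s6
  · ring

end Rotation

/-! ### Normal vector fields -/

section NormalField

/-- The normal vector field `i (|∂F/∂z̄|² a ∂F/∂z + |∂F/∂z|² ā ∂F/∂z̄)` along `F`. It vanishes exactly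
at the complex and anticomplex points. -/
def normalField (G : C2 → C2 →L[ℝ] C2 →L[ℝ] ℝ) (F : ℂ → C2) (a z : ℂ) : C2 :=
  Complex.I • (((G (F z) (delBar F z) (delBar F z) : ℂ) * a) • del F z
    + ((G (F z) (del F z) (del F z) : ℂ) * (starRingEnd ℂ) a) • delBar F z)

/-- The connection form of the oriented normal frame that is given by `normalField`. -/
def normalForm (G : C2 → C2 →L[ℝ] C2 →L[ℝ] ℝ) (F : ℂ → C2) (z a : ℂ) : ℝ :=
  rotationForm G F (normalField G F 1) (fun w => -normalField G F Complex.I w) z a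

variable {U : Set C2} {G : C2 → C2 →L[ℝ] C2 →L[ℝ] ℝ} {F : ℂ → C2} {W : Set ℂ} {z : ℂ}

theorem normalField_eq (a : ℂ) : normalField G F a z
    = a.re • normalField G F 1 z + a.im • normalField G F Complex.I z := by
  have h1 : (starRingEnd ℂ) a = a.re - a.im * Complex.I := by apply Complex.ext <;> simp
  have h2 : a = a.re + a.im * Complex.I := (Complex.re_add_im a).symm
  simp only [normalField, map_one, Complex.conj_I]
  rw [h1]
  ext k
  simp only [Pi.add_apply, Pi.smul_apply, smul_eq_mul, Complex.real_smul]
  linear_combination (Complex.I * G (F z) (delBar F z) (delBar F z) * del F z k) * h2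

theorem IsConformalPatch.contDiffAt_normalField (h : IsConformalPatch U G F W) (hz : z ∈ W)
    (a : ℂ) : ContDiffAt ℝ ∞ (normalField G F a) z := by
  have hV := contDiffAt_del (h.contDiffAt hz)
  have hW := contDiffAt_delBar (h.contDiffAt hz)
  have h1 : ∀ X : ℂ → C2, ContDiffAt ℝ ∞ X z →
      ContDiffAt ℝ ∞ (fun w => ((G (F w) (X w) (X w) : ℝ) : ℂ)) z := fun X hX =>
    Complex.ofRealCLM.contDiff.contDiffAt.comp z
      (contDiffAt_apply₂ (h.contDiffAt_metric_comp hz) hX hX)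
  exact contDiffAt_complex_smul contDiffAt_const
    ((contDiffAt_complex_smul ((h1 _ hW).mul contDiffAt_const) hV).add
      (contDiffAt_complex_smul ((h1 _ hV).mul contDiffAt_const) hW))

theorem IsConformalPatch.contDiffAt_rotationForm (h : IsConformalPatch U G F W) (hz : z ∈ W)
    {X Y : ℂ → C2} (hX : ContDiffAt ℝ ∞ X z) (hY : ContDiffAt ℝ ∞ Y z) (h0 : X z ≠ 0) (a : ℂ) :
    ContDiffAt ℝ ∞ (fun w => rotationForm G F X Y w a) z := by
  have hG := h.contDiffAt_metric_comp hz
  have h1 : ContDiffAt ℝ ∞ (fun w => cov (leviCivita G) F X w a) z :=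
    (contDiffAt_fderiv_apply hX a).add (contDiffAt_leviCivita (h.contDiffAt_metric hz)
      (h.isHermitianForm hz).pos (h.contDiffAt hz) (contDiffAt_fderiv_apply (h.contDiffAt hz) a) hX)
  exact (contDiffAt_apply₂ hG h1 hY).div (contDiffAt_apply₂ hG hX hX)
    ((h.isHermitianForm hz).pos _ h0).ne'

namespace IsFrameOn

variable {N : Set ℂ} {e₁ e₂ : ℂ → C2} {σ τ : ℂ → ℂ}

theorem normalField_eq (hf : IsFrameOn G F N e₁ e₂ σ τ) (h : IsConformalPatch U G F W)
    (hN : N ⊆ W) (hz : z ∈ N) (a : ℂ) : normalField G F a z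
      = normalVec (σ z) (τ z) (e₁ z) (e₂ z)
        (Complex.I * (starRingEnd ℂ) a * (τ z * (starRingEnd ℂ) (σ z))) := by
  have hh := h.isHermitianForm (hN hz)
  have h1 := hh.herm_self (e₁ z)
  have h2 := hh.herm_self (e₂ z)
  rw [(hf.isUnitary z hz).fst] at h1
  rw [(hf.isUnitary z hz).snd] at h2
  have h1' : G (F z) (e₁ z) (e₁ z) = 1 := by exact_mod_cast h1.symm
  have h2' : G (F z) (e₂ z) (e₂ z) = 1 := by exact_mod_cast h2.symm
  rw [normalField, hf.del_eq z hz, hf.delBar_eq z hz, hh.apply_smul_self, hh.apply_smul_self, h1',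
    h2', mul_one, mul_one, ← Complex.normSq_eq_norm_sq, ← Complex.normSq_eq_norm_sq,
    ← Complex.mul_conj, ← Complex.mul_conj, normalVec]
  simp only [map_mul, Complex.conj_conj, Complex.conj_I]
  module

theorem fderiv_eq (hf : IsFrameOn G F N e₁ e₂ σ τ) (hz : z ∈ N) (a : ℂ) :
    fderiv ℝ F z a = (a * σ z) • e₁ z + ((starRingEnd ℂ) a * τ z) • e₂ z := by
  rw [fderiv_eq_del_add_delBar, hf.del_eq z hz, hf.delBar_eq z hz, smul_smul, smul_smul]

theorem contDiffAt_normalVec (hf : IsFrameOn G F N e₁ e₂ σ τ) (hz : z ∈ N) {n : WithTop ℕ∞}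
    (hn : n ≤ ∞) {d : ℂ → ℂ} (hd : ContDiffAt ℝ n d z) :
    ContDiffAt ℝ n (fun w => normalVec (σ w) (τ w) (e₁ w) (e₂ w) (d w)) z :=
  (contDiffAt_complex_smul ((Complex.conjCLE.contDiff.contDiffAt.comp z hd).mul
      ((hf.contDiffAt_delBar_coeff z hz).of_le hn)).neg ((hf.contDiffAt_fst z hz).of_le hn)).add
    (contDiffAt_complex_smul (hd.mul ((hf.contDiffAt_del_coeff z hz).of_le hn))
      ((hf.contDiffAt_snd z hz).of_le hn))

theorem apply_normalVec (hf : IsFrameOn G F N e₁ e₂ σ τ) (h : IsConformalPatch U G F W)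
    (hN : N ⊆ W) (hz : z ∈ N) (d d' : ℂ) :
    G (F z) (normalVec (σ z) (τ z) (e₁ z) (e₂ z) d) (normalVec (σ z) (τ z) (e₁ z) (e₂ z) d')
      = conformalFactor G F z * (d * (starRingEnd ℂ) d').re := by
  rw [(hf.isUnitary z hz).apply_normalVec (h.isHermitianForm (hN hz)),
    hf.conformalFactor_eq h hN hz]

theorem normalVec_ne_zero (hf : IsFrameOn G F N e₁ e₂ σ τ) (h : IsConformalPatch U G F W)
    (hN : N ⊆ W) (hz : z ∈ N) : normalVec (σ z) (τ z) (e₁ z) (e₂ z) 1 ≠ 0 := by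
  intro h0
  have h1 := hf.apply_normalVec h hN hz 1 1
  rw [h0] at h1
  simp only [map_zero, map_one, mul_one, Complex.one_re] at h1
  exact (h.conformalFactor_pos (hN hz)).ne h1

/-- The connection form of the normal frame without zeros that is given by a unitary frame. -/
def normalFrameForm (G : C2 → C2 →L[ℝ] C2 →L[ℝ] ℝ) (F e₁ e₂ : ℂ → C2) (σ τ : ℂ → ℂ) (z a : ℂ) :
    ℝ :=
  rotationForm G F (fun w => normalVec (σ w) (τ w) (e₁ w) (e₂ w) 1)
    (fun w => normalVec (σ w) (τ w) (e₁ w) (e₂ w) Complex.I) z a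

theorem contDiffAt_normalFrameForm (hf : IsFrameOn G F N e₁ e₂ σ τ) (h : IsConformalPatch U G F W)
    (hN : N ⊆ W) (hz : z ∈ N) (a : ℂ) :
    ContDiffAt ℝ ∞ (fun w => normalFrameForm G F e₁ e₂ σ τ w a) z :=
  h.contDiffAt_rotationForm (hN hz) (hf.contDiffAt_normalVec hz le_rfl contDiffAt_const)
    (hf.contDiffAt_normalVec hz le_rfl contDiffAt_const) (hf.normalVec_ne_zero h hN hz) a

/-- The connection form of a normal frame with parameter `d` relative to the frame without zeros. -/
theorem rotationForm_eq (hf : IsFrameOn G F N e₁ e₂ σ τ) (h : IsConformalPatch U G F W)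
    (hN : N ⊆ W) (hz : z ∈ N) {X Y : ℂ → C2} {d : ℂ → ℂ} (hd : DifferentiableAt ℝ d z)
    (h0 : d z ≠ 0) (hX : ∀ᶠ w in 𝓝 z, X w = normalVec (σ w) (τ w) (e₁ w) (e₂ w) (d w))
    (hY : ∀ᶠ w in 𝓝 z, Y w = normalVec (σ w) (τ w) (e₁ w) (e₂ w) (Complex.I * d w)) (a : ℂ) :
    rotationForm G F X Y z a = normalFrameForm G F e₁ e₂ σ τ z a + dArg d z a := by
  have hX' := hX.mono fun w hw => hw.trans (normalVec_eq _ _ _ _ _)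
  have hY' : Y =ᶠ[𝓝 z] fun w => -(d w).im • normalVec (σ w) (τ w) (e₁ w) (e₂ w) 1
      + (d w).re • normalVec (σ w) (τ w) (e₁ w) (e₂ w) Complex.I := by
    filter_upwards [hY] with w hw
    rw [hw, normalVec_eq]
    simp
  have hn : ∀ b, DifferentiableAt ℝ (fun w => normalVec (σ w) (τ w) (e₁ w) (e₂ w) b) z := fun b =>
    (hf.contDiffAt_normalVec hz le_rfl contDiffAt_const).differentiableAt (by simp)
  rw [rotationForm_congr Filter.EventuallyEq.rfl hX' hY', normalFrameForm]
  refine rotationForm_rotate (h.isHermitianAt (hN hz)).toIsMetricAt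
    ((h.contDiffAt (hN hz)).differentiableAt (by simp)) (hn 1) (hn Complex.I) hd h0
    (hf.normalVec_ne_zero h hN hz) ?_ ?_ a
  · filter_upwards [hf.isOpen.mem_nhds hz] with w hw
    simp [hf.apply_normalVec h hN hw]
  · filter_upwards [hf.isOpen.mem_nhds hz] with w hw
    simp [hf.apply_normalVec h hN hw]

theorem normalForm_eq (hf : IsFrameOn G F N e₁ e₂ σ τ) (h : IsConformalPatch U G F W)
    (hN : N ⊆ W) (hz : z ∈ N) (h1 : σ z ≠ 0) (h2 : τ z ≠ 0) (a : ℂ) :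
    normalForm G F z a = normalFrameForm G F e₁ e₂ σ τ z a
      + dArg (fun w => Complex.I * (τ w * (starRingEnd ℂ) (σ w))) z a := by
  have hσ := (hf.contDiffAt_del_coeff z hz).differentiableAt (by simp)
  have hτ := (hf.contDiffAt_delBar_coeff z hz).differentiableAt (by simp)
  have hd : DifferentiableAt ℝ (fun w => Complex.I * (τ w * (starRingEnd ℂ) (σ w))) z :=
    (hτ.fun_mul (Complex.conjCLE.differentiableAt.comp z hσ)).const_mul Complex.I
  refine hf.rotationForm_eq h hN hz hd (by simp [h1, h2]) ?_ ?_ a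
  · filter_upwards [hf.isOpen.mem_nhds hz] with w hw
    rw [hf.normalField_eq h hN hw]
    simp
  · filter_upwards [hf.isOpen.mem_nhds hz] with w hw
    have e1 : Complex.I * (starRingEnd ℂ) Complex.I * (τ w * (starRingEnd ℂ) (σ w))
        = τ w * (starRingEnd ℂ) (σ w) := by simp
    have e2 : Complex.I * (Complex.I * (τ w * (starRingEnd ℂ) (σ w)))
        = -(τ w * (starRingEnd ℂ) (σ w)) := by rw [← mul_assoc, Complex.I_mul_I, neg_one_mul]
    rw [hf.normalField_eq h hN hw, e1, e2]
    simp only [normalVec, map_neg]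
    module

/-- Away from the complex and anticomplex points the connection forms of the two normal frames have
the same exterior derivative, as they differ by the closed form `d arg (i τ σ̄)`. -/
theorem oneForm_normalForm (hf : IsFrameOn G F N e₁ e₂ σ τ) (h : IsConformalPatch U G F W)
    (hN : N ⊆ W) (hz : z ∈ N) (h1 : σ z ≠ 0) (h2 : τ z ≠ 0) :
    ContDiffAt ℝ 1 (oneForm (normalForm G F)) z ∧
      dForm (oneForm (normalForm G F)) z
        = extDerivCoeff (normalFrameForm G F e₁ e₂ σ τ) z := by
  have hσ := hf.contDiffAt_del_coeff z hz
  have hτ := hf.contDiffAt_delBar_coeff z hz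
  have hd : ContDiffAt ℝ 2 (fun w => Complex.I * (τ w * (starRingEnd ℂ) (σ w))) z :=
    (contDiffAt_const.mul (hτ.mul
      (Complex.conjCLE.contDiff.contDiffAt.comp z hσ))).of_le ENat.LEInfty.out
  have h0 : Complex.I * (τ z * (starRingEnd ℂ) (σ z)) ≠ 0 := by simp [h1, h2]
  have heq : oneForm (normalForm G F) =ᶠ[𝓝 z] fun w =>
      oneForm (normalFrameForm G F e₁ e₂ σ τ) w
        + oneForm (dArg fun w => Complex.I * (τ w * (starRingEnd ℂ) (σ w))) w := by
    filter_upwards [hf.isOpen.mem_nhds hz, hσ.continuousAt.eventually_ne h1,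
      hτ.continuousAt.eventually_ne h2] with w hw hw1 hw2
    rw [← oneForm_add]
    exact oneForm_congr fun a => hf.normalForm_eq h hN hw hw1 hw2 a
  have c1 : ContDiffAt ℝ 1 (oneForm (normalFrameForm G F e₁ e₂ σ τ)) z :=
    contDiffAt_oneForm fun a =>
      (hf.contDiffAt_normalFrameForm h hN hz a).of_le ENat.LEInfty.out
  have c2 := contDiffAt_oneForm fun a => contDiffAt_dArg hd h0 a
  refine ⟨(c1.add c2).congr_of_eventuallyEq heq, ?_⟩
  rw [dForm_congr heq, dForm_add (c1.differentiableAt one_ne_zero)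
    (c2.differentiableAt one_ne_zero), dForm_dArg hd h0, add_zero, dForm_oneForm fun a =>
    (hf.contDiffAt_normalFrameForm h hN hz a).differentiableAt (by simp)]

end IsFrameOn

end NormalField

/-! ### The Gaussian curvature of a conformal metric -/

section Gauss

theorem conformalCoeff_congr {l l' : ℂ → ℝ} {z : ℂ} (h : l =ᶠ[𝓝 z] l') :
    conformalCoeff l z = conformalCoeff l' z := by
  rw [conformalCoeff, conformalCoeff, h.fderiv_eq, h.self_of_nhds]

theorem contDiffAt_conformalCoeff {l : ℂ → ℝ} {z : ℂ} (hl : ContDiffAt ℝ ∞ l z) (h0 : l z ≠ 0) :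
    ContDiffAt ℝ ∞ (conformalCoeff l) z := by
  have h1 : ∀ a, ContDiffAt ℝ ∞ (fun w => ((fderiv ℝ l w a : ℝ) : ℂ)) z := fun a =>
    Complex.ofRealCLM.contDiff.contDiffAt.comp z
      ((hl.fderiv_right (m := ∞) (by simp)).clm_apply contDiffAt_const)
  have h2 : ContDiffAt ℝ ∞ (fun w => (l w : ℂ)) z :=
    Complex.ofRealCLM.contDiff.contDiffAt.comp z hl
  have h3 : ContDiffAt ℝ ∞ (fun w => (2 * l w : ℂ)⁻¹) z :=
    (contDiffAt_const.mul h2).inv (by simp [h0])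
  exact (((h1 1).sub (contDiffAt_const (c := Complex.I) |>.mul (h1 Complex.I))).mul h3).congr_of_eventuallyEq
    (Filter.Eventually.of_forall fun w => by simp only [conformalCoeff, div_eq_mul_inv])

/-- The transformation of the coefficient `∂ log λ / ∂z` under a holomorphic change of the
coordinate. -/
theorem conformalCoeff_comp {l : ℂ → ℝ} {φ : ℂ → ℂ} {z : ℂ} (hφ : DifferentiableAt ℂ φ z)
    (hφ' : DifferentiableAt ℂ (deriv φ) z) (h0 : deriv φ z ≠ 0)
    (hl : DifferentiableAt ℝ l (φ z)) (hl0 : l (φ z) ≠ 0) :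
    conformalCoeff (fun w => Complex.normSq (deriv φ w) * l (φ w)) z
      = conformalCoeff l (φ z) * deriv φ z + deriv (deriv φ) z / deriv φ z := by
  have h1 : ∀ a, fderiv ℝ (fun w => l (φ w)) z a = fderiv ℝ l (φ z) (deriv φ z * a) := by
    intro a
    rw [← fderiv_real_apply_of_differentiableAt hφ]
    exact congrArg (fun L : ℂ →L[ℝ] ℝ => L a) (fderiv_comp z hl (hφ.restrictScalars ℝ))
  have hd := hφ'.restrictScalars ℝ
  have hn : ∀ w, Complex.normSq (deriv φ w)
      = (deriv φ w).re * (deriv φ w).re + (deriv φ w).im * (deriv φ w).im := fun w =>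
    Complex.normSq_apply _
  have hre : HasFDerivAt (fun w => (deriv φ w).re)
      (Complex.reCLM.comp (fderiv ℝ (deriv φ) z)) z :=
    Complex.reCLM.hasFDerivAt.comp z hd.hasFDerivAt
  have him : HasFDerivAt (fun w => (deriv φ w).im)
      (Complex.imCLM.comp (fderiv ℝ (deriv φ) z)) z :=
    Complex.imCLM.hasFDerivAt.comp z hd.hasFDerivAt
  have h2 := (hre.fun_mul hre).fun_add (him.fun_mul him)
  simp only [← hn] at h2
  have h3 : ∀ a, fderiv ℝ (fun w => Complex.normSq (deriv φ w)) z a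
      = 2 * ((starRingEnd ℂ) (deriv φ z) * (deriv (deriv φ) z * a)).re := by
    intro a
    rw [h2.fderiv]
    simp [fderiv_real_apply_of_differentiableAt hφ']
    ring
  have h4 : DifferentiableAt ℝ (fun w => l (φ w)) z := hl.comp z (hφ.restrictScalars ℝ)
  simp only [conformalCoeff]
  rw [fderiv_fun_mul h2.differentiableAt h4]
  simp only [add_apply, smul_apply, smul_eq_mul, h1, h3]
  rw [fderiv_real_apply _ (deriv φ z * 1), fderiv_real_apply _ (deriv φ z * Complex.I)]
  have hl0' : (l (φ z) : ℂ) ≠ 0 := by exact_mod_cast hl0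
  have e1 : (Complex.normSq (deriv φ z) : ℂ) = deriv φ z * (starRingEnd ℂ) (deriv φ z) :=
    (Complex.mul_conj _).symm
  have hc0 : (starRingEnd ℂ) (deriv φ z) ≠ 0 := (map_ne_zero _).2 h0
  set k := (starRingEnd ℂ) (deriv φ z) * deriv (deriv φ) z with hk
  have e2 : (((starRingEnd ℂ) (deriv φ z) * (deriv (deriv φ) z * 1)).re : ℂ)
      - Complex.I * ((starRingEnd ℂ) (deriv φ z) * (deriv (deriv φ) z * Complex.I)).re = k := by
    rw [← mul_assoc, ← mul_assoc, ← hk]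
    apply Complex.ext <;> simp
  have e3 : (((deriv φ z * 1).re : ℂ) - Complex.I * (deriv φ z * Complex.I).re) = deriv φ z := by
    apply Complex.ext <;> simp
  have e4 : (((deriv φ z * 1).im : ℂ) - Complex.I * (deriv φ z * Complex.I).im)
      = -(Complex.I * deriv φ z) := by
    apply Complex.ext <;> simp
  have e5 : deriv (deriv φ) z / deriv φ z = k / (deriv φ z * (starRingEnd ℂ) (deriv φ z)) := by
    rw [hk]; field_simp
  have e6 : ∀ x₁ x₂ y₁ y₂ P L a b r s : ℝ, ∀ k d : ℂ, (r : ℂ) - Complex.I * s = k →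
      (x₁ : ℂ) - Complex.I * x₂ = d → (y₁ : ℂ) - Complex.I * y₂ = -(Complex.I * d) →
      (((P * (x₁ • a + y₁ • b) + L * (2 * r) : ℝ) : ℂ)
        - Complex.I * ((P * (x₂ • a + y₂ • b) + L * (2 * s) : ℝ) : ℂ))
      = P * d * (a - Complex.I * b) + 2 * L * k := by
    intro x₁ x₂ y₁ y₂ P L a b r s k d h1 h2 h3
    simp only [smul_eq_mul]
    push_cast
    linear_combination 2 * (L : ℂ) * h1 + (P : ℂ) * a * h2 + (P : ℂ) * b * h3
  rw [e6 _ _ _ _ _ _ _ _ _ _ _ _ e2 e3 e4, e5]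
  push_cast
  rw [e1]
  field_simp

/-- The formula `K λ = - Δ log λ / 2` for the curvature of `λ |dz|²`. -/
theorem curvature_of_conformal {H : ℂ → ℂ →L[ℝ] ℂ →L[ℝ] ℝ} {l : ℂ → ℝ} {z : ℂ}
    (hl : ContDiffAt ℝ ∞ l z) (hpos : 0 < l z)
    (h : ∀ᶠ w in 𝓝 z, ∀ a b, H w a b = l w * (a * (starRingEnd ℂ) b).re) :
    H z (curvature (leviCivita H) z 1 Complex.I Complex.I) 1
      = l z * (-2 * (dbar (conformalCoeff l) z).re) := by
  have hLC : ∀ u v, (fun w => leviCivita H w u v)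
      =ᶠ[𝓝 z] fun w => conformalCoeff l w * u * v := by
    intro u v
    filter_upwards [h.eventually_nhds, (hl.of_le (m := 1) (by simp)).eventually (by simp),
      hl.continuousAt.eventually (lt_mem_nhds hpos)] with w h1 h2 h3
    exact leviCivita_of_conformal (h2.differentiableAt (by simp)) h3 h1 u v
  have hm : DifferentiableAt ℝ (conformalCoeff l) z :=
    (contDiffAt_conformalCoeff hl hpos.ne').differentiableAt (by simp)
  have hd : ∀ u v a, fderiv ℝ (fun w => leviCivita H w u v) z a
      = fderiv ℝ (conformalCoeff l) z a * (u * v) := by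
    intro u v a
    have h1 : (fun w => conformalCoeff l w * u * v) = fun w => conformalCoeff l w * (u * v) := by
      funext w; ring
    rw [(hLC u v).fderiv_eq, h1, (hm.hasFDerivAt.mul_const (u * v)).fderiv]
    simp [mul_comm]
  have hz : ∀ u v, leviCivita H z u v = conformalCoeff l z * u * v := fun u v =>
    (hLC u v).self_of_nhds
  have hc : curvature (leviCivita H) z 1 Complex.I Complex.I
      = -2 * dbar (conformalCoeff l) z := by
    simp only [curvature, hd, hz, dbar]
    linear_combination (fderiv ℝ (conformalCoeff l) z 1) * Complex.I_sq
  rw [h.self_of_nhds, hc]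
  simp

end Gauss

/-! ### Change of charts -/

section Charts

variable {M : Type*} [TopologicalSpace M] [ChartedSpace C2 M] [IsManifold 𝓘(ℂ, C2) ω M]
  {S : Type*} [TopologicalSpace S] [ChartedSpace ℂ S] [IsManifold 𝓘(ℂ, ℂ) ω S]
  {g : HermitianMetric M} {f : S → M} {e e' : OpenPartialHomeomorph S ℂ}
  {c c' : OpenPartialHomeomorph M C2} {z : ℂ}

theorem conformalFactor_change_target (hf : IsConformalImmersion g f) (he : e ∈ atlas ℂ S)
    (hc : c ∈ atlas C2 M) (hc' : c' ∈ atlas C2 M) (hz : z ∈ repDomain f e c)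
    (hz' : z ∈ repDomain f e c') : conformalFactor (g.inChart c') (rep f e c') z
      = conformalFactor (g.inChart c) (rep f e c) z := by
  rw [conformalFactor, conformalFactor, inChart_rep_apply hf.contMDiff he hc hz,
    inChart_rep_apply hf.contMDiff he hc' hz']

/-- The conformal factor of the induced metric in the chart `e`. -/
def inducedFactor (g : HermitianMetric M) (f : S → M) (e : OpenPartialHomeomorph S ℂ) (z : ℂ) : ℝ :=
  conformalFactor (localMetric g f e z) (localRep f e z) z

theorem inducedFactor_eq (hf : IsConformalImmersion g f) (he : e ∈ atlas ℂ S)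
    (hc : c ∈ atlas C2 M) (hz : z ∈ repDomain f e c) :
    inducedFactor g f e z = conformalFactor (g.inChart c) (rep f e c) z :=
  conformalFactor_change_target hf he hc (targetChart_mem_atlas f e z) hz
    (mem_repDomain_targetChart hz.1)

theorem inducedFactor_eventuallyEq (hf : IsConformalImmersion g f) (he : e ∈ atlas ℂ S)
    (hc : c ∈ atlas C2 M) (hz : z ∈ repDomain f e c) :
    inducedFactor g f e =ᶠ[𝓝 z] conformalFactor (g.inChart c) (rep f e c) := by
  filter_upwards [(isOpen_repDomain hf.contMDiff.continuous).mem_nhds hz] with w hw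
  exact inducedFactor_eq hf he hc hw

theorem contDiffAt_inducedFactor (hf : IsConformalImmersion g f) (he : e ∈ atlas ℂ S)
    (hz : z ∈ e.target) : ContDiffAt ℝ ∞ (inducedFactor g f e) z := by
  have hc := targetChart_mem_atlas f e z
  have hzc : z ∈ repDomain f e (targetChart f e z) := mem_repDomain_targetChart hz
  exact ((isConformalPatch_rep hf he hc).contDiffAt_conformalFactor hzc).congr_of_eventuallyEq
    (inducedFactor_eventuallyEq hf he hc hzc)

theorem inducedFactor_pos (hf : IsConformalImmersion g f) (he : e ∈ atlas ℂ S)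
    (hz : z ∈ e.target) : 0 < inducedFactor g f e z :=
  (isConformalPatch_rep hf he (targetChart_mem_atlas f e z)).conformalFactor_pos
    (mem_repDomain_targetChart hz)

theorem inducedMetric_eventually (hf : IsConformalImmersion g f) (he : e ∈ atlas ℂ S)
    (hz : z ∈ e.target) : ∀ᶠ w in 𝓝 z, ∀ a b,
      inducedMetric g f e z w a b = inducedFactor g f e w * (a * (starRingEnd ℂ) b).re := by
  have hc := targetChart_mem_atlas f e z
  have hzc : z ∈ repDomain f e (targetChart f e z) := mem_repDomain_targetChart hz
  filter_upwards [(isOpen_repDomain hf.contMDiff.continuous).mem_nhds hzc] with w hw a b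
  rw [inducedFactor_eq hf he hc hw]
  exact (isConformalPatch_rep hf he hc).metric_apply hw a b

theorem areaDensity_eq (hf : IsConformalImmersion g f) (he : e ∈ atlas ℂ S)
    (hz : z ∈ e.target) : areaDensity g f e z = inducedFactor g f e z := by
  have h := (inducedMetric_eventually hf he hz).self_of_nhds
  rw [areaDensity, h, h, h]
  simp only [map_one, mul_one, Complex.one_re, Complex.conj_I, one_mul, mul_neg, Complex.I_mul_I,
    neg_neg, Complex.neg_re, Complex.I_re, neg_zero, mul_zero]
  rw [zero_pow two_ne_zero, sub_zero, Real.sqrt_mul_self (inducedFactor_pos hf he hz).le]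

theorem gaussCurvature_mul_areaDensity (hf : IsConformalImmersion g f) (he : e ∈ atlas ℂ S)
    (hz : z ∈ e.target) : gaussCurvature g f e z * areaDensity g f e z
      = -2 * (dbar (conformalCoeff (inducedFactor g f e)) z).re := by
  have hpos := inducedFactor_pos hf he hz
  rw [gaussCurvature, areaDensity_eq hf he hz, curvature_of_conformal
    (contDiffAt_inducedFactor hf he hz) hpos (inducedMetric_eventually hf he hz)]
  field_simp

theorem inducedFactor_change_source (hf : IsConformalImmersion g f) (he : e ∈ atlas ℂ S)
    (he' : e' ∈ atlas ℂ S) (hz : z ∈ e.target) (hz' : e.symm z ∈ e'.source) :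
    inducedFactor g f e z = Complex.normSq (deriv (fun w => e' (e.symm w)) z)
      * inducedFactor g f e' (e' (e.symm z)) := by
  have hc := targetChart_mem_atlas f e z
  have hzc : z ∈ repDomain f e (targetChart f e z) := mem_repDomain_targetChart hz
  have hzc' := mem_repDomain_change_source hzc hz'
  rw [inducedFactor_eq hf he hc hzc, inducedFactor_eq hf he' hc hzc', conformalFactor,
    fderiv_rep_change_source hf.contMDiff he he' hc hzc hz', (rep_change_source hz hz').self_of_nhds,
    (isConformalPatch_rep hf he' hc).metric_apply hzc', dTrans_eq_deriv_mul he he' hz hz', mul_one,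
    Complex.mul_conj, Complex.ofReal_re, mul_comm]

theorem deriv_transition_ne_zero (he : e ∈ atlas ℂ S) (he' : e' ∈ atlas ℂ S) (hz : z ∈ e.target)
    (hz' : e.symm z ∈ e'.source) : deriv (fun w => e' (e.symm w)) z ≠ 0 := by
  intro h0
  have h1 := (bijective_dTrans he he' hz hz').1 (a₁ := 1) (a₂ := 0) (by
    rw [dTrans_eq_deriv_mul he he' hz hz', dTrans_eq_deriv_mul he he' hz hz', h0, zero_mul,
      zero_mul])
  exact one_ne_zero h1

/-- The connection form of the tangent bundle is affected by the change of the coordinate frame. -/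
theorem conformalCoeff_change_source (hf : IsConformalImmersion g f) (he : e ∈ atlas ℂ S)
    (he' : e' ∈ atlas ℂ S) (hz : z ∈ e.target) (hz' : e.symm z ∈ e'.source) :
    conformalCoeff (inducedFactor g f e) z
      = conformalCoeff (inducedFactor g f e') (e' (e.symm z)) * deriv (fun w => e' (e.symm w)) z
        + deriv (deriv fun w => e' (e.symm w)) z / deriv (fun w => e' (e.symm w)) z := by
  have hφ := contDiffAt_transition he he' hz hz'
  have h1 : inducedFactor g f e =ᶠ[𝓝 z] fun w => Complex.normSq (deriv (fun w => e' (e.symm w)) w)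
      * inducedFactor g f e' (e' (e.symm w)) := by
    filter_upwards [eventually_mem_target_and_source hz hz'] with w hw
    exact inducedFactor_change_source hf he he' hw.1 hw.2
  rw [conformalCoeff_congr h1]
  exact conformalCoeff_comp (hφ.differentiableAt (by simp))
    hφ.analyticAt.deriv.differentiableAt (deriv_transition_ne_zero he he' hz hz')
    ((contDiffAt_inducedFactor hf he' (e'.map_source hz')).differentiableAt (by simp))
    (inducedFactor_pos hf he' (e'.map_source hz')).ne'

theorem normalField_change_target (hf : IsConformalImmersion g f) (he : e ∈ atlas ℂ S)
    (hc : c ∈ atlas C2 M) (hc' : c' ∈ atlas C2 M) (hz : z ∈ repDomain f e c)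
    (hz' : f (e.symm z) ∈ c'.source) (a : ℂ) :
    normalField (g.inChart c') (rep f e c') a z
      = dTrans c c' (rep f e c z) (normalField (g.inChart c) (rep f e c) a z) := by
  have hq := rep_mem_target hz
  have hq' : c.symm (rep f e c z) ∈ c'.source := by rwa [symm_rep hz]
  have hd : ∀ b, fderiv ℝ (rep f e c') z b
      = dTrans c c' (rep f e c z) (fderiv ℝ (rep f e c) z b) := fun b =>
    fderiv_rep_change_target hf.contMDiff he hc hc' hz hz' b
  have hs := dTrans_smul hc hc' hq hq'
  have h1 : del (rep f e c') z = dTrans c c' (rep f e c z) (del (rep f e c) z) := by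
    rw [del, linPart, hd, hd, del, linPart, hs, map_sub, hs]
  have h2 : delBar (rep f e c') z = dTrans c c' (rep f e c z) (delBar (rep f e c) z) := by
    rw [delBar, antiPart, hd, hd, delBar, antiPart, hs, map_add, hs]
  have hG := g.inChart_dTrans hc hc' hq hq'
  rw [symm_rep hz] at hG
  rw [normalField, normalField, h1, h2, rep, ← hG, ← hG, hs, map_add, hs, hs]

theorem normalField_ne_zero (hf : IsConformalImmersion g f) (he : e ∈ atlas ℂ S)
    (hc : c ∈ atlas C2 M) (hz : z ∈ repDomain f e c) (h0 : e.symm z ∉ specialPoints f) :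
    normalField (g.inChart c) (rep f e c) 1 z ≠ 0 := by
  have hP := isConformalPatch_rep hf he hc
  obtain ⟨N, hN, hzN, e₁, e₂, σ, τ, hfr⟩ := hP.exists_frame hz
  have h1 := (notMem_specialPoints_iff hf he hc hz).1 h0
  have h2 : σ z ≠ 0 := mt (hfr.del_eq_zero_iff hzN).2 h1.1
  have h3 : τ z ≠ 0 := mt (hfr.delBar_eq_zero_iff hzN).2 h1.2
  intro h4
  have h5 := hfr.apply_normalVec hP hN hzN
    (Complex.I * (starRingEnd ℂ) 1 * (τ z * (starRingEnd ℂ) (σ z)))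
    (Complex.I * (starRingEnd ℂ) 1 * (τ z * (starRingEnd ℂ) (σ z)))
  rw [← hfr.normalField_eq hP hN hzN, h4, map_zero, Complex.mul_conj, Complex.ofReal_re] at h5
  refine (mul_pos (hP.conformalFactor_pos hz) (Complex.normSq_pos.2 ?_)).ne h5
  simp [h2, h3]

theorem normalForm_change_target (hf : IsConformalImmersion g f) (he : e ∈ atlas ℂ S)
    (hc : c ∈ atlas C2 M) (hc' : c' ∈ atlas C2 M) (hz : z ∈ repDomain f e c)
    (hz' : f (e.symm z) ∈ c'.source) (a : ℂ) :
    normalForm (g.inChart c') (rep f e c') z a = normalForm (g.inChart c) (rep f e c) z a := by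
  have hq := rep_mem_target hz
  have hq' : c.symm (rep f e c z) ∈ c'.source := by rwa [symm_rep hz]
  have hG := g.inChart_dTrans hc hc' hq hq'
  rw [symm_rep hz] at hG
  have hn : ∀ b, normalField (g.inChart c') (rep f e c') b
      =ᶠ[𝓝 z] fun w => dTrans c c' (rep f e c w) (normalField (g.inChart c) (rep f e c) b w) := by
    intro b
    have h1 : z ∈ repDomain f e c' := ⟨hz.1, hz'⟩
    filter_upwards [(isOpen_repDomain hf.contMDiff.continuous).mem_nhds hz,
      (isOpen_repDomain hf.contMDiff.continuous).mem_nhds h1] with w hw hw'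
    exact normalField_change_target hf he hc hc' hw hw'.2 b
  rw [normalForm, normalForm, rotationForm, rotationForm,
    cov_rep_change_target hf he hc hc' hz hz'
      (connectionsRelated_leviCivita_inChart g hc hc' hq hq')
      (((isConformalPatch_rep hf he hc).contDiffAt_normalField hz 1).differentiableAt (by simp))
      (hn 1), (hn 1).self_of_nhds, (hn Complex.I).self_of_nhds, ← map_neg, rep, ← hG, ← hG]

theorem normalField_change_source (hf : IsConformalImmersion g f) (he : e ∈ atlas ℂ S)
    (he' : e' ∈ atlas ℂ S) (hc : c ∈ atlas C2 M) (hz : z ∈ repDomain f e c)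
    (hz' : e.symm z ∈ e'.source) (a : ℂ) : normalField (g.inChart c) (rep f e c) a z
      = Complex.normSq (deriv (fun w => e' (e.symm w)) z) • normalField (g.inChart c) (rep f e' c)
        (deriv (fun w => e' (e.symm w)) z * a) (e' (e.symm z)) := by
  have hφd : DifferentiableAt ℂ (fun w => e' (e.symm w)) z :=
    (contDiffAt_transition he he' hz.1 hz').differentiableAt (by simp)
  have hP' := isConformalPatch_rep hf he' hc
  have hzc' := mem_repDomain_change_source hz hz'
  have hh := hP'.isHermitianForm hzc'
  have hd : DifferentiableAt ℝ (rep f e' c) (e' (e.symm z)) :=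
    (hP'.contDiffAt hzc').differentiableAt (by simp)
  have h1 := (del_congr (rep_change_source hz.1 hz')).trans (del_comp hd hφd)
  have h2 := (delBar_congr (rep_change_source hz.1 hz')).trans (delBar_comp hd hφd)
  rw [normalField, normalField, h1, h2, (rep_change_source hz.1 hz').self_of_nhds,
    hh.apply_smul_self, hh.apply_smul_self, Complex.norm_conj, ← Complex.normSq_eq_norm_sq]
  ext k
  simp only [Pi.add_apply, Pi.smul_apply, smul_eq_mul, Complex.real_smul, map_mul]
  push_cast
  ring

/-- Under a holomorphic change `φ` of the coordinate of `S`, the frame of `normalField` is rotated by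
the argument of the conjugate of `φ'`. -/
theorem normalForm_change_source (hf : IsConformalImmersion g f) (he : e ∈ atlas ℂ S)
    (he' : e' ∈ atlas ℂ S) (hc : c ∈ atlas C2 M) (hz : z ∈ repDomain f e c)
    (hz' : e.symm z ∈ e'.source) (h0 : e.symm z ∉ specialPoints f) (a : ℂ) :
    normalForm (g.inChart c) (rep f e c) z a = normalForm (g.inChart c) (rep f e' c)
      (e' (e.symm z)) (deriv (fun w => e' (e.symm w)) z * a)
      - (deriv (deriv fun w => e' (e.symm w)) z / deriv (fun w => e' (e.symm w)) z * a).im := by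
  set φ : ℂ → ℂ := fun w => e' (e.symm w) with hφ
  have hφc := contDiffAt_transition he he' hz.1 hz'
  have hφd : DifferentiableAt ℂ φ z := hφc.differentiableAt (by simp)
  have hφ' : DifferentiableAt ℂ (deriv φ) z := hφc.analyticAt.deriv.differentiableAt
  have hφ0 : deriv φ z ≠ 0 := deriv_transition_ne_zero he he' hz.1 hz'
  have hP' := isConformalPatch_rep hf he' hc
  have hzc' : φ z ∈ repDomain f e' c := mem_repDomain_change_source hz hz'
  set G := g.inChart c
  set F' := rep f e' c with hF'
  have hn : ∀ b, ∀ᶠ w in 𝓝 z, normalField G (rep f e c) b w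
      = Complex.normSq (deriv φ w) • normalField G F' (deriv φ w * b) (φ w) := by
    intro b
    filter_upwards [(isOpen_repDomain hf.contMDiff.continuous).mem_nhds hz,
      eventually_mem_target_and_source hz.1 hz'] with w hw hw'
    exact normalField_change_source hf he he' hc hw hw'.2 b
  -- The frame is conjugate linear in the tangent vector, so it is rotated by the conjugate of `φ'`.
  set k : ℂ → ℂ := fun w => (Complex.normSq (deriv φ w) : ℂ) * (starRingEnd ℂ) (deriv φ w) with hk
  have hX : normalField G (rep f e c) 1 =ᶠ[𝓝 z] fun w => (k w).re • normalField G F' 1 (φ w)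
      + (k w).im • -normalField G F' Complex.I (φ w) := by
    filter_upwards [hn 1] with w hw
    rw [hw, normalField_eq, hk]
    simp only [mul_one, Complex.re_ofReal_mul, Complex.im_ofReal_mul, Complex.conj_re,
      Complex.conj_im]
    module
  have hY : (fun w => -normalField G (rep f e c) Complex.I w)
      =ᶠ[𝓝 z] fun w => -(k w).im • normalField G F' 1 (φ w)
      + (k w).re • -normalField G F' Complex.I (φ w) := by
    filter_upwards [hn Complex.I] with w hw
    rw [hw, normalField_eq, hk]
    simp only [Complex.conj_re, Complex.conj_im, Complex.mul_re, Complex.mul_im, Complex.I_re,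
      Complex.I_im, Complex.ofReal_re, Complex.ofReal_im, mul_zero, mul_one, zero_sub, add_zero,
      sub_zero, zero_mul]
    module
  have hkd : DifferentiableAt ℝ (fun w => (starRingEnd ℂ) (deriv φ w)) z :=
    Complex.conjCLE.differentiableAt.comp z (hφ'.restrictScalars ℝ)
  have hnd : DifferentiableAt ℝ (fun w => (Complex.normSq (deriv φ w) : ℂ)) z := by
    have h3 : DifferentiableAt ℝ (fun w => deriv φ w * (starRingEnd ℂ) (deriv φ w)) z :=
      (hφ'.restrictScalars ℝ).mul hkd
    simpa only [Complex.mul_conj] using h3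
  have hn0 : (Complex.normSq (deriv φ z) : ℂ) ≠ 0 := by
    exact_mod_cast (Complex.normSq_pos.2 hφ0).ne'
  have hc0 : (starRingEnd ℂ) (deriv φ z) ≠ 0 := (map_ne_zero _).2 hφ0
  have hF'd : DifferentiableAt ℝ F' (φ z) := (hP'.contDiffAt hzc').differentiableAt (by simp)
  have hNd : ∀ b, DifferentiableAt ℝ (normalField G F' b) (φ z) := fun b =>
    (hP'.contDiffAt_normalField hzc' b).differentiableAt (by simp)
  have hr := hφd.restrictScalars ℝ
  have hNc : ∀ b, DifferentiableAt ℝ (fun w => normalField G F' b (φ w)) z := fun b =>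
    DifferentiableAt.comp (g := normalField G F' b) (f := φ) z (hNd b) hr
  have hcont : ContinuousAt φ z := hφd.continuousAt
  obtain ⟨N, hN, hzN, e₁, e₂, σ, τ, hfr⟩ := hP'.exists_frame hzc'
  have hsp : e'.symm (φ z) ∉ specialPoints f := by rwa [hφ, e'.left_inv hz']
  have hx0 : normalField G F' 1 (φ z) ≠ 0 := normalField_ne_zero hf he' hc hzc' hsp
  have happ : ∀ᶠ w in 𝓝 z, ∀ b b', G (F' (φ w)) (normalField G F' b (φ w))
      (normalField G F' b' (φ w)) = conformalFactor G F' (φ w)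
        * (Complex.normSq (τ (φ w)) * Complex.normSq (σ (φ w)) * (b' * (starRingEnd ℂ) b).re) := by
    filter_upwards [hcont.eventually (hfr.isOpen.mem_nhds hzN)] with w hw b b'
    rw [hfr.normalField_eq hP' hN hw, hfr.normalField_eq hP' hN hw, hfr.apply_normalVec hP' hN hw]
    congr 1
    simp [Complex.normSq_apply]
    ring
  have hG : IsMetricAt G (F' (φ z)) := (hP'.isHermitianAt hzc').toIsMetricAt
  rw [normalForm, rotationForm_congr (rep_change_source hz.1 hz') hX hY]
  have h1 := rotationForm_rotate (F := fun w => F' (φ w)) hG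
    (DifferentiableAt.comp (g := F') (f := φ) z hF'd hr) (hNc 1)
    (hNc Complex.I).fun_neg (hnd.fun_mul hkd) (mul_ne_zero hn0 hc0) hx0
    (by
      filter_upwards [happ] with w hw
      rw [map_neg, map_neg, neg_apply, neg_neg, hw, hw]
      simp)
    (by
      filter_upwards [happ] with w hw
      rw [map_neg, hw]
      simp) a
  refine h1.trans ?_
  rw [rotationForm_comp (Y := fun w => -normalField G F' Complex.I w) hF'd (hNd 1) hφd,
    dArg_mul hnd hkd hn0 hc0,
    dArg_ofReal (fun w => Complex.normSq (deriv φ w)), zero_add, dArg_conj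
    (hφ'.restrictScalars ℝ), dArg, fderiv_real_apply_of_differentiableAt hφ', normalForm,
    ← sub_eq_add_neg, div_mul_eq_mul_div]

end Charts

/-! ### The normal curvature -/

section NormalFrame

variable {M : Type*} [TopologicalSpace M] [ChartedSpace C2 M] [IsManifold 𝓘(ℂ, C2) ω M]
  {S : Type*} [TopologicalSpace S] [ChartedSpace ℂ S] [IsManifold 𝓘(ℂ, ℂ) ω S]
  {g : HermitianMetric M} {f : S → M} {e : OpenPartialHomeomorph S ℂ} {z₀ : ℂ} {N : Set ℂ}
  {e₁ e₂ : ℂ → C2} {σ τ : ℂ → ℂ}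

namespace IsFrameNear

/-- An oriented orthonormal normal frame is given by a complex function without zeros. -/
theorem exists_eq_normalVec (hf : IsConformalImmersion g f) (he : e ∈ atlas ℂ S)
    (h : IsFrameNear g f e z₀ N e₁ e₂ σ τ) {n : (ℂ → C2) × (ℂ → C2)}
    (hn : IsNormalFrame g f e z₀ n) : ∃ d : ℂ → ℂ, ContDiffAt ℝ 2 d z₀ ∧ d z₀ ≠ 0 ∧
      (∀ᶠ w in 𝓝 z₀, n.1 w = normalVec (σ w) (τ w) (e₁ w) (e₂ w) (d w)) ∧
      ∀ᶠ w in 𝓝 z₀, n.2 w = normalVec (σ w) (τ w) (e₁ w) (e₂ w) (Complex.I * d w) := by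
  obtain ⟨hN, hz, hfr⟩ := h
  have hP := isConformalPatch_rep hf he (targetChart_mem_atlas f e z₀)
  set G := localMetric g f e z₀ with hG
  set F := localRep f e z₀ with hF
  set ν : ℂ → ℂ → C2 := fun b w => normalVec (σ w) (τ w) (e₁ w) (e₂ w) b with hν
  -- The coordinates of `n.1` in the basis of normal vectors of length `√λ`.
  set d : ℂ → ℂ := fun w => ((G (F w) (n.1 w) (ν 1 w) / conformalFactor G F w : ℝ) : ℂ)
    + Complex.I * ((G (F w) (n.1 w) (ν Complex.I w) / conformalFactor G F w : ℝ) : ℂ) with hd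
  have key : ∀ᶠ w in 𝓝 z₀, n.1 w = normalVec (σ w) (τ w) (e₁ w) (e₂ w) (d w) ∧
      n.2 w = normalVec (σ w) (τ w) (e₁ w) (e₂ w) (Complex.I * d w) ∧ d w ≠ 0 := by
    filter_upwards [hfr.isOpen.mem_nhds hz, hn.normal, hn.orthonormal, hn.oriented]
      with w hw h1 h2 h3
    have hh := hP.isHermitianForm (hN hw)
    have hu := hfr.isUnitary w hw
    have hl : 0 < conformalFactor G F w := hP.conformalFactor_pos (hN hw)
    have h0 : 0 < ‖σ w‖ ^ 2 + ‖τ w‖ ^ 2 := by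
      rw [← hfr.conformalFactor_eq hP hN hw]
      exact hl
    have hFd : ∀ a, fderiv ℝ F w a = _ := hfr.fderiv_eq hw
    obtain ⟨a, ha⟩ := hu.exists_eq_normalVec hh h0 (n := n.1 w) fun b => by
      rw [← hFd]; exact (h1 b).1
    obtain ⟨b, hb⟩ := hu.exists_eq_normalVec hh h0 (n := n.2 w) fun b => by
      rw [← hFd]; exact (h1 b).2
    have hab : ∀ a b : ℂ, G (F w) (normalVec (σ w) (τ w) (e₁ w) (e₂ w) a)
        (normalVec (σ w) (τ w) (e₁ w) (e₂ w) b)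
        = conformalFactor G F w * (a * (starRingEnd ℂ) b).re := fun a b =>
      hfr.apply_normalVec hP hN hw a b
    have hda : d w = a := by
      simp only [hd, hν]
      rw [ha, hab, hab, mul_div_cancel_left₀ _ hl.ne', mul_div_cancel_left₀ _ hl.ne']
      apply Complex.ext <;> simp
    obtain ⟨n11, n22, n12⟩ := h2
    have hor : 0 < det4 (fderiv ℝ F w 1) (fderiv ℝ F w Complex.I) (n.1 w) (n.2 w) := h3
    have f1 : fderiv ℝ F w 1 = σ w • e₁ w + τ w • e₂ w := by
      rw [hFd, map_one, one_mul, one_mul]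
    have f2 : fderiv ℝ F w Complex.I
        = (Complex.I * σ w) • e₁ w + (-(Complex.I * τ w)) • e₂ w := by
      rw [hFd, Complex.conj_I, neg_mul]
    rw [f1, f2] at hor
    rw [ha] at n11 n12 hor
    rw [hb] at n22 n12 hor
    have hba := hu.eq_normalVec_of_oriented hh h0 n11 n22 n12 hor
    refine ⟨by rw [hda, ha], by rw [hda, hb, hba], ?_⟩
    rw [hda]
    rintro rfl
    have h5 := (hab 0 0).symm.trans n11
    simp at h5
  refine ⟨d, ?_, key.self_of_nhds.2.2, key.mono fun w hw => hw.1, key.mono fun w hw => hw.2.1⟩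
  have h1 : ∀ b, ContDiffAt ℝ ∞ (fun w => ((G (F w) (n.1 w) (ν b w)
      / conformalFactor G F w : ℝ) : ℂ)) z₀ := fun b =>
    Complex.ofRealCLM.contDiff.contDiffAt.comp z₀
      ((contDiffAt_apply₂ (hP.contDiffAt_metric_comp (hN hz)) hn.contDiffAt_fst
        (hfr.contDiffAt_normalVec hz le_rfl contDiffAt_const)).div
        (hP.contDiffAt_conformalFactor (hN hz)) (hP.conformalFactor_pos (hN hz)).ne')
  exact ((h1 1).add (contDiffAt_const (c := Complex.I) |>.mul (h1 Complex.I))).of_le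
    ENat.LEInfty.out

theorem exists_isNormalFrame (hf : IsConformalImmersion g f) (he : e ∈ atlas ℂ S)
    (h : IsFrameNear g f e z₀ N e₁ e₂ σ τ) : ∃ n, IsNormalFrame g f e z₀ n := by
  obtain ⟨hN, hz, hfr⟩ := h
  have hP := isConformalPatch_rep hf he (targetChart_mem_atlas f e z₀)
  set l := conformalFactor (localMetric g f e z₀) (localRep f e z₀) with hl
  set r : ℂ → ℂ := fun w => (((√(l w))⁻¹ : ℝ) : ℂ) with hr
  have hlp : ∀ w ∈ N, 0 < l w := fun w hw => hP.conformalFactor_pos (hN hw)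
  have hrc : ContDiffAt ℝ ∞ r z₀ := Complex.ofRealCLM.contDiff.contDiffAt.comp z₀
    (((hP.contDiffAt_conformalFactor (hN hz)).sqrt (hlp z₀ hz).ne').inv
      (Real.sqrt_pos.2 (hlp z₀ hz)).ne')
  have hab : ∀ w ∈ N, ∀ a b : ℂ, localMetric g f e z₀ (localRep f e z₀ w)
      (normalVec (σ w) (τ w) (e₁ w) (e₂ w) a) (normalVec (σ w) (τ w) (e₁ w) (e₂ w) b)
        = l w * (a * (starRingEnd ℂ) b).re := fun w hw a b =>
    hfr.apply_normalVec hP hN hw a b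
  have hFd : ∀ w ∈ N, ∀ a, fderiv ℝ (localRep f e z₀) w a
      = (a * σ w) • e₁ w + ((starRingEnd ℂ) a * τ w) • e₂ w := fun w hw =>
    hfr.fderiv_eq hw
  have hrr : ∀ w ∈ N, l w * ((√(l w))⁻¹ * (√(l w))⁻¹) = 1 := fun w hw => by
    rw [← mul_inv, Real.mul_self_sqrt (hlp w hw).le, mul_inv_cancel₀ (hlp w hw).ne']
  refine ⟨⟨fun w => normalVec (σ w) (τ w) (e₁ w) (e₂ w) (r w),
    fun w => normalVec (σ w) (τ w) (e₁ w) (e₂ w) (Complex.I * r w)⟩,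
    hfr.contDiffAt_normalVec hz le_rfl hrc,
    hfr.contDiffAt_normalVec hz le_rfl (contDiffAt_const.mul hrc), ?_, ?_, ?_⟩
  · filter_upwards [hfr.isOpen.mem_nhds hz] with w hw a
    have hh := hP.isHermitianForm (hN hw)
    rw [hFd w hw]
    exact ⟨(hfr.isUnitary w hw).apply_tangent_normalVec hh _ _ _ _,
      (hfr.isUnitary w hw).apply_tangent_normalVec hh _ _ _ _⟩
  · filter_upwards [hfr.isOpen.mem_nhds hz] with w hw
    have h1 := hrr w hw
    refine ⟨?_, ?_, ?_⟩
    · rw [hab w hw, ← h1]; simp [hr]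
    · rw [hab w hw, ← h1]; simp [hr]
    · rw [hab w hw]; simp [hr]
  · filter_upwards [hfr.isOpen.mem_nhds hz] with w hw
    have hh := hP.isHermitianForm (hN hw)
    have f1 : fderiv ℝ (localRep f e z₀) w 1 = σ w • e₁ w + τ w • e₂ w := by
      rw [hFd w hw, map_one, one_mul, one_mul]
    have f2 : fderiv ℝ (localRep f e z₀) w Complex.I
        = (Complex.I * σ w) • e₁ w + (-(Complex.I * τ w)) • e₂ w := by
      rw [hFd w hw, Complex.conj_I, neg_mul]
    rw [f1, f2]
    refine lt_of_lt_of_eq ?_ (det4_normalVec (σ w) (τ w) (r w) (e₁ w) (e₂ w)).symm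
    have h0 : 0 < ‖σ w‖ ^ 2 + ‖τ w‖ ^ 2 := by
      rw [← hfr.conformalFactor_eq hP hN hw]
      exact hlp w hw
    have hr0 : r w ≠ 0 := by
      simp only [hr]
      exact_mod_cast (inv_pos.2 (Real.sqrt_pos.2 (hlp w hw))).ne'
    have := Complex.normSq_pos.2 ((hfr.isUnitary w hw).det2_ne_zero hh)
    have := norm_pos_iff.2 hr0
    positivity

/-- The normal curvature can be computed from any oriented conformal normal frame: the connection
forms of two frames differ by the differential of an argument. -/
theorem normalCurvature_mul_areaDensity (hf : IsConformalImmersion g f) (he : e ∈ atlas ℂ S)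
    (h : IsFrameNear g f e z₀ N e₁ e₂ σ τ) :
    normalCurvature g f e z₀ * areaDensity g f e z₀
      = -extDerivCoeff (IsFrameOn.normalFrameForm (localMetric g f e z₀) (localRep f e z₀)
        e₁ e₂ σ τ) z₀ := by
  have hn : IsNormalFrame g f e z₀ (Classical.epsilon (IsNormalFrame g f e z₀)) :=
    Classical.epsilon_spec (h.exists_isNormalFrame hf he)
  rw [normalCurvature, areaDensity_eq hf he (h.1 h.2.1).1,
    div_mul_cancel₀ _ (inducedFactor_pos hf he (h.1 h.2.1).1).ne', neg_inj]
  set n := Classical.epsilon (IsNormalFrame g f e z₀)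
  obtain ⟨d, hd, hd0, h1, h2⟩ := h.exists_eq_normalVec hf he hn
  obtain ⟨hN, hz, hfr⟩ := h
  have hP := isConformalPatch_rep hf he (targetChart_mem_atlas f e z₀)
  have heq : ∀ᶠ w in 𝓝 z₀, ∀ a, normalConnectionForm g f e z₀ n w a
      = IsFrameOn.normalFrameForm (localMetric g f e z₀) (localRep f e z₀) e₁ e₂ σ τ w a
        + dArg d w a := by
    filter_upwards [hfr.isOpen.mem_nhds hz, hn.orthonormal, h1.eventually_nhds,
      h2.eventually_nhds, hd.eventually (by simp), hd.continuousAt.eventually_ne hd0]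
      with w hw h3 h4 h5 h6 h7 a
    have h8 := hfr.rotationForm_eq hP hN hw (h6.differentiableAt (by norm_num)) h7 h4 h5 a
    rw [← h8, rotationForm]
    exact (div_one _).symm.trans (congrArg _ h3.1.symm)
  have c1 := contDiffAt_oneForm fun a =>
    (hfr.contDiffAt_normalFrameForm hP hN hz a).of_le (m := 1) ENat.LEInfty.out
  have c2 := contDiffAt_oneForm fun a => contDiffAt_dArg hd hd0 a
  have heq' : oneForm (normalConnectionForm g f e z₀ n) =ᶠ[𝓝 z₀] fun w =>
      oneForm (IsFrameOn.normalFrameForm (localMetric g f e z₀) (localRep f e z₀) e₁ e₂ σ τ) w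
        + oneForm (dArg d) w := by
    filter_upwards [heq] with w hw
    rw [← oneForm_add]
    exact oneForm_congr hw
  have hdiff : ∀ a, DifferentiableAt ℝ (fun w => normalConnectionForm g f e z₀ n w a) z₀ :=
    fun a => (((hfr.contDiffAt_normalFrameForm hP hN hz a).differentiableAt (by simp)).fun_add
      ((contDiffAt_dArg hd hd0 a).differentiableAt one_ne_zero)).congr_of_eventuallyEq
      (heq.mono fun w hw => hw a)
  rw [← dForm_oneForm hdiff, dForm_congr heq', dForm_add (c1.differentiableAt one_ne_zero)
    (c2.differentiableAt one_ne_zero), dForm_dArg hd hd0, add_zero, dForm_oneForm fun a =>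
    (hfr.contDiffAt_normalFrameForm hP hN hz a).differentiableAt (by simp)]

end IsFrameNear

end NormalFrame

/-! ### The Euler numbers of the tangent and normal bundles -/

section Integrability

variable {S : Type*} [TopologicalSpace S] [ChartedSpace ℂ S] [IsManifold 𝓘(ℂ, ℂ) ω S]
  [T2Space S] [CompactSpace S]

/-- The functions of `chartPartition` have compact supports inside the charts. -/
theorem integrableForm_of_continuousAt {w : S → ℂ → ℝ}
    (h : ∀ p : S, ∀ z ∈ (chartAt ℂ p).target, ContinuousAt (w p) z) : IntegrableForm w := by
  intro x
  set e := chartAt ℂ x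
  have hs := tsupport_chartPartition_subset x
  have hKt : e '' tsupport (chartPartition S x) ⊆ e.target :=
    Set.image_subset_iff.2 fun y hy => e.map_source (hs hy)
  have hK : IsCompact (e '' tsupport (chartPartition S x)) :=
    (isClosed_tsupport _).isCompact.image_of_continuousOn (e.continuousOn.mono hs)
  have hc : ContinuousOn (fun z => chartPartition S x (e.symm z) * w x z)
      (e '' tsupport (chartPartition S x)) := fun z hz =>
    ((contDiffAt_chartPartition x x (hKt hz)).continuousAt.mul (h x z (hKt hz))).continuousWithinAt
  refine (hc.integrableOn_compact hK).of_forall_sdiff_eq_zero e.open_target.measurableSet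
    fun z hz => ?_
  have h0 : e.symm z ∉ tsupport (chartPartition S x) := fun h1 =>
    hz.2 ⟨e.symm z, h1, e.right_inv hz.1⟩
  rw [image_eq_zero_of_notMem_tsupport h0, zero_mul]

end Integrability

section EulerNumber

theorem oneForm_im_mul (u z : ℂ) : oneForm (fun _ a => -(u * a).im) z = Complex.I * u := by
  rw [oneForm]
  apply Complex.ext <;> simp

theorem dForm_neg_I_mul {m : ℂ → ℂ} {z : ℂ} (hm : DifferentiableAt ℝ m z) :
    dForm (fun w => -Complex.I * m w) z = 2 * (dbar m z).re := by
  have h : dbar (fun w => -Complex.I * m w) z = -Complex.I * dbar m z := by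
    rw [dbar_mul (differentiableAt_const _) hm]
    simp [dbar]
  rw [dForm, h]
  simp

variable {M : Type*} [TopologicalSpace M] [ChartedSpace C2 M] [IsManifold 𝓘(ℂ, C2) ω M]
  {S : Type*} [TopologicalSpace S] [ChartedSpace ℂ S] [IsManifold 𝓘(ℂ, ℂ) ω S]
  {g : HermitianMetric M} {f : S → M} {z : ℂ}

/-- The sum of the connection forms of the normal bundle, for the frame given by `normalField`, and
of the tangent bundle, for the coordinate frame. Neither summand is a 1-form on `S`, as the frames
depend on the coordinate of `S`, but these contributions cancel in the sum. -/
def eulerForm (g : HermitianMetric M) (f : S → M) (p : S) (z : ℂ) : ℂ :=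
  oneForm (normalForm (localMetric g f (chartAt ℂ p) z) (localRep f (chartAt ℂ p) z)) z
    + -Complex.I * conformalCoeff (inducedFactor g f (chartAt ℂ p)) z

theorem eulerForm_eq (hf : IsConformalImmersion g f) {p : S} {c : OpenPartialHomeomorph M C2}
    (hc : c ∈ atlas C2 M) (hz : z ∈ repDomain f (chartAt ℂ p) c) : eulerForm g f p z
      = oneForm (normalForm (g.inChart c) (rep f (chartAt ℂ p) c)) z
        + -Complex.I * conformalCoeff (inducedFactor g f (chartAt ℂ p)) z := by
  have h : oneForm (normalForm (localMetric g f (chartAt ℂ p) z) (localRep f (chartAt ℂ p) z)) z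
      = oneForm (normalForm (g.inChart c) (rep f (chartAt ℂ p) c)) z :=
    oneForm_congr fun a => normalForm_change_target hf (chart_mem_atlas ℂ p) hc
      (targetChart_mem_atlas f _ _) hz (mem_repDomain_targetChart hz.1).2 a
  rw [eulerForm, h]

theorem normalForm_linear (hf : IsConformalImmersion g f) {e : OpenPartialHomeomorph S ℂ}
    (he : e ∈ atlas ℂ S) {c : OpenPartialHomeomorph M C2} (hc : c ∈ atlas C2 M)
    (hz : z ∈ repDomain f e c) (a : ℂ) : normalForm (g.inChart c) (rep f e c) z a
      = a.re * normalForm (g.inChart c) (rep f e c) z 1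
        + a.im * normalForm (g.inChart c) (rep f e c) z Complex.I :=
  rotationForm_linear ((isConformalPatch_rep hf he hc).isHermitianAt hz).toIsMetricAt a

/-- The derivative of the argument of the conjugate of `φ'` from the normal frame cancels the term
`φ'' / φ'` from the Christoffel symbol of the tangent bundle. -/
theorem isOneForm_eulerForm (hf : IsConformalImmersion g f) :
    IsOneForm (specialPoints f) (eulerForm g f) := by
  intro p q z hz hz' h0
  have he := chart_mem_atlas ℂ p
  have he' := chart_mem_atlas ℂ q
  have hc := targetChart_mem_atlas f (chartAt ℂ p) z
  have hzc : z ∈ repDomain f (chartAt ℂ p) (targetChart f (chartAt ℂ p) z) :=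
    mem_repDomain_targetChart hz
  have hzc' := mem_repDomain_change_source hzc hz'
  have h1 : eulerForm g f q (coordChange p q z) = _ := eulerForm_eq hf hc hzc'
  have h2 : deriv (coordChange p q) z
      = deriv (fun w => (chartAt ℂ q) ((chartAt ℂ p).symm w)) z := rfl
  rw [eulerForm_eq hf hc hzc, h1, h2, conformalCoeff_change_source hf he he' hz hz']
  set φ : ℂ → ℂ := fun w => (chartAt ℂ q) ((chartAt ℂ p).symm w) with hφ
  set c := targetChart f (chartAt ℂ p) z
  have h3 : oneForm (normalForm (g.inChart c) (rep f (chartAt ℂ p) c)) z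
      = oneForm (normalForm (g.inChart c) (rep f (chartAt ℂ q) c)) (φ z) * deriv φ z
        + Complex.I * (deriv (deriv φ) z / deriv φ z) := by
    have h4 : oneForm (fun _ a => normalForm (g.inChart c) (rep f (chartAt ℂ q) c) (φ z)
        (deriv φ z * a)) z
        = oneForm (normalForm (g.inChart c) (rep f (chartAt ℂ q) c)) (φ z) * deriv φ z :=
      oneForm_pullback (fun a => rfl) (normalForm_linear hf he' hc hzc')
    rw [← oneForm_im_mul (deriv (deriv φ) z / deriv φ z) z, ← h4, ← oneForm_add]
    refine oneForm_congr fun a => ?_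
    rw [normalForm_change_source hf he he' hc hzc hz' h0, sub_eq_add_neg]
  rw [h3]
  simp only [coordChange, hφ]
  ring

theorem contDiffAt_eulerForm (hf : IsConformalImmersion g f) (hcl : IsClosed (specialPoints f))
    {p : S} (hz : z ∈ (chartAt ℂ p).target) (h0 : (chartAt ℂ p).symm z ∉ specialPoints f) :
    ContDiffAt ℝ 1 (eulerForm g f p) z ∧ dForm (eulerForm g f p) z
      = -(gaussCurvature g f (chartAt ℂ p) z * areaDensity g f (chartAt ℂ p) z
        + normalCurvature g f (chartAt ℂ p) z * areaDensity g f (chartAt ℂ p) z) := by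
  have he := chart_mem_atlas ℂ p
  have hc := targetChart_mem_atlas f (chartAt ℂ p) z
  have hzc : z ∈ repDomain f (chartAt ℂ p) (targetChart f (chartAt ℂ p) z) :=
    mem_repDomain_targetChart hz
  have h1 : eulerForm g f p =ᶠ[𝓝 z] fun w => oneForm (normalForm
      (g.inChart (targetChart f (chartAt ℂ p) z))
      (rep f (chartAt ℂ p) (targetChart f (chartAt ℂ p) z))) w
        + -Complex.I * conformalCoeff (inducedFactor g f (chartAt ℂ p)) w := by
    filter_upwards [eventually_eq_of_isClosed hcl hf hz h0] with w hw
    exact eulerForm_eq hf hc hw.1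
  have hP := isConformalPatch_rep hf he hc
  obtain ⟨N, hN, hzN, e₁, e₂, σ, τ, hfr⟩ := hP.exists_frame hzc
  have h2 := (notMem_specialPoints_iff hf he hc hzc).1 h0
  obtain ⟨c1, d1⟩ := hfr.oneForm_normalForm hP hN hzN (mt (hfr.del_eq_zero_iff hzN).2 h2.1)
    (mt (hfr.delBar_eq_zero_iff hzN).2 h2.2)
  have hm : ContDiffAt ℝ 1 (conformalCoeff (inducedFactor g f (chartAt ℂ p))) z :=
    (contDiffAt_conformalCoeff (contDiffAt_inducedFactor hf he hz)
      (inducedFactor_pos hf he hz).ne').of_le (by simp)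
  have hm' : ContDiffAt ℝ 1
      (fun w => -Complex.I * conformalCoeff (inducedFactor g f (chartAt ℂ p)) w) z :=
    contDiffAt_const.mul hm
  refine ⟨(c1.add hm').congr_of_eventuallyEq h1, ?_⟩
  have h3 := IsFrameNear.normalCurvature_mul_areaDensity hf he
    (show IsFrameNear g f (chartAt ℂ p) z N e₁ e₂ σ τ from ⟨hN, hzN, hfr⟩)
  rw [dForm_congr h1, dForm_add (c1.differentiableAt one_ne_zero)
    (hm'.differentiableAt one_ne_zero), d1, dForm_neg_I_mul (hm.differentiableAt one_ne_zero),
    gaussCurvature_mul_areaDensity hf he hz, h3]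
  simp only [localMetric, neg_add, neg_mul, neg_neg]
  rw [add_comm]
  rfl

/-- At a point where `∂f/∂z` and `∂f/∂z̄` vanish to the orders `q` and `p`, the frame of `normalField`
rotates like `i τ σ̄`, hence like `z̄ ^ (p + q)`. -/
theorem HasOrders.eulerForm_eq (hf : IsConformalImmersion g f) {x : S} {p q : ℕ} {N : Set ℂ}
    {e₁ e₂ : ℂ → C2} {σ τ H K : ℂ → ℂ} (h : HasOrders g f x p q N e₁ e₂ σ τ H K) :
    ∃ b' : ℂ → ℂ, ContDiffAt ℝ 1 b' (chartAt ℂ x x) ∧ ∀ᶠ z in 𝓝[≠] (chartAt ℂ x x),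
      eulerForm g f x z
        = b' z - Complex.I * (-((p : ℝ) + q) : ℝ) / (z - chartAt ℂ x x) := by
  set e := chartAt ℂ x
  set z₀ := e x
  have he : e ∈ atlas ℂ S := chart_mem_atlas ℂ x
  have hc := targetChart_mem_atlas f e z₀
  obtain ⟨hN, hzN, hfr⟩ := h.isFrameNear
  have hP := isConformalPatch_rep hf he hc
  set R : ℂ → ℂ := fun w => Complex.I * (starRingEnd ℂ) (K w) * (starRingEnd ℂ) (H w) with hR
  have hR2 : ContDiffAt ℝ 2 R z₀ :=
    (contDiffAt_const.mul (Complex.conjCLE.contDiff.contDiffAt.comp z₀ h.contDiffAt_delBar)).mul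
      (Complex.conjCLE.contDiff.contDiffAt.comp z₀ h.contDiffAt_del)
  have hR0 : R z₀ ≠ 0 := by
    have h2 : H z₀ ≠ 0 := h.ne_zero_del
    have h3 : K z₀ ≠ 0 := h.ne_zero_delBar
    simp [hR, h2, h3]
  have hDeq : ∀ᶠ w in 𝓝 z₀, Complex.I * (τ w * (starRingEnd ℂ) (σ w))
      = (starRingEnd ℂ) ((w - z₀) ^ p) * ((starRingEnd ℂ) ((w - z₀) ^ q) * R w) := by
    filter_upwards [h.del_coeff_eq, h.delBar_coeff_eq] with w h1 h2
    rw [h1, h2, map_mul, map_mul, hR]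
    ring
  have hzt : z₀ ∈ e.target := (hN hzN).1
  have hm : ContDiffAt ℝ 1 (conformalCoeff (inducedFactor g f e)) z₀ :=
    (contDiffAt_conformalCoeff (contDiffAt_inducedFactor hf he hzt)
      (inducedFactor_pos hf he hzt).ne').of_le (by simp)
  refine ⟨fun w => oneForm (dArg R) w + (oneForm (IsFrameOn.normalFrameForm
      (localMetric g f e z₀) (localRep f e z₀) e₁ e₂ σ τ) w
      + -Complex.I * conformalCoeff (inducedFactor g f e) w),
    (contDiffAt_oneForm fun a => contDiffAt_dArg hR2 hR0 a).add
      ((contDiffAt_oneForm fun a => (hfr.contDiffAt_normalFrameForm hP hN hzN a).of_le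
        ENat.LEInfty.out).add (contDiffAt_const.mul hm)), ?_⟩
  rw [eventually_nhdsWithin_iff]
  filter_upwards [hfr.isOpen.mem_nhds hzN, hDeq.eventually_nhds, hR2.eventually (by simp),
    hR2.continuousAt.eventually_ne hR0] with w hw hDw hRw hRw0 hne
  have hw0 : w - z₀ ≠ 0 := sub_ne_zero.2 hne
  have hpw : ∀ k : ℕ, (starRingEnd ℂ) ((w - z₀) ^ k) ≠ 0 := fun k =>
    (map_ne_zero _).2 (pow_ne_zero k hw0)
  have hD0 : Complex.I * (τ w * (starRingEnd ℂ) (σ w)) ≠ 0 := by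
    rw [hDw.self_of_nhds]
    exact mul_ne_zero (hpw p) (mul_ne_zero (hpw q) hRw0)
  have hτ0 : τ w ≠ 0 := fun h0 => hD0 (by simp [h0])
  have hσ0 : σ w ≠ 0 := fun h0 => hD0 (by simp [h0])
  have hpd : ∀ k : ℕ, DifferentiableAt ℝ (fun w : ℂ => (w - z₀) ^ k) w := fun k =>
    (differentiableAt_id.sub_const z₀).fun_pow k
  have hconj : ∀ k : ℕ, DifferentiableAt ℝ (fun w : ℂ => (starRingEnd ℂ) ((w - z₀) ^ k)) w :=
    fun k => Complex.conjCLE.differentiableAt.comp w (hpd k)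
  have hRd := hRw.differentiableAt (by norm_num)
  have hd : ∀ a, dArg (fun w => Complex.I * (τ w * (starRingEnd ℂ) (σ w))) w a
      = (-((p : ℝ) + q)) * (a / (w - z₀)).im + dArg R w a := by
    intro a
    rw [dArg_congr hDw, dArg_mul (hconj p) ((hconj q).fun_mul hRd) (hpw p)
      (mul_ne_zero (hpw q) hRw0), dArg_mul (hconj q) hRd (hpw q) hRw0, dArg_conj (hpd p),
      dArg_conj (hpd q), dArg_pow hne, dArg_pow hne]
    ring
  have hn : ∀ a, normalForm (g.inChart (targetChart f e z₀)) (rep f e (targetChart f e z₀)) w a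
      = (-((p : ℝ) + q)) * (a / (w - z₀)).im + (dArg R w a + IsFrameOn.normalFrameForm
        (localMetric g f e z₀) (localRep f e z₀) e₁ e₂ σ τ w a) := by
    intro a
    refine (hfr.normalForm_eq hP hN hw hσ0 hτ0 a).trans ?_
    rw [hd]
    ring
  rw [ChernMinimal.eulerForm_eq hf hc (hN hw), oneForm_congr (ρ' := fun w a =>
    (-((p : ℝ) + q)) * (a / (w - z₀)).im + (dArg R w a + IsFrameOn.normalFrameForm
        (localMetric g f e z₀) (localRep f e z₀) e₁ e₂ σ τ w a)) hn]
  have h5 := oneForm_im_div (-((p : ℝ) + q)) (w - z₀) w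
  rw [oneForm_add, oneForm_add]
  have h6 : oneForm (fun w a => (-((p : ℝ) + q)) * (a / (w - z₀)).im) w
      = oneForm (fun _ a => (-((p : ℝ) + q)) * (a / (w - z₀)).im) w := rfl
  rw [h6, h5]
  ring

/-- The sum of the Euler numbers counts the zeros of `∂f/∂z` and of `∂f/∂z̄`. -/
theorem eulerTangent_add_eulerNormal_eq [T2Space S] [CompactSpace S]
    (hf : IsConformalImmersion g f) {Z : Finset S}
    (hZ : (Z : Set S) = specialPoints f) {p q : S → ℕ} {N : S → Set ℂ} {e₁ e₂ : S → ℂ → C2}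
    {σ τ H K : S → ℂ → ℂ}
    (h : ∀ x, HasOrders g f x (p x) (q x) (N x) (e₁ x) (e₂ x) (σ x) (τ x) (H x) (K x)) :
    eulerTangent g f + eulerNormal g f = -∑ x ∈ Z, ((p x : ℝ) + q x) := by
  have hcl : IsClosed (specialPoints f) := hZ ▸ Z.finite_toSet.isClosed
  have hmem : ∀ y, y ∈ Z ↔ y ∈ specialPoints f := fun y => by rw [← hZ]; rfl
  set kT : S → ℂ → ℝ := fun p z =>
    gaussCurvature g f (chartAt ℂ p) z * areaDensity g f (chartAt ℂ p) z with hkT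
  set kN : S → ℂ → ℝ := fun p z =>
    normalCurvature g f (chartAt ℂ p) z * areaDensity g f (chartAt ℂ p) z with hkN
  obtain ⟨hi, h3⟩ := formIntegral_eq_neg_two_pi_mul_sum Z (b := eulerForm g f)
    (hZ ▸ isOneForm_eulerForm hf)
    (fun p z hz h0 => (contDiffAt_eulerForm hf hcl hz (mt (hmem _).2 h0)).1)
    (fun x => -((p x : ℝ) + q x)) (fun x _ => (h x).eulerForm_eq hf)
    (w := fun p z => -(kT p z + kN p z))
    (fun p z hz h0 => ((contDiffAt_eulerForm hf hcl hz (mt (hmem _).2 h0)).2).symm)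
  have hT : IntegrableForm kT := by
    refine integrableForm_of_continuousAt fun p z hz => ?_
    have he := chart_mem_atlas ℂ p
    have h4 : kT p =ᶠ[𝓝 z] fun w =>
        -2 * (dbar (conformalCoeff (inducedFactor g f (chartAt ℂ p))) w).re := by
      filter_upwards [(chartAt ℂ p).open_target.mem_nhds hz] with w hw
      exact gaussCurvature_mul_areaDensity hf he hw
    have h5 := contDiffAt_conformalCoeff (contDiffAt_inducedFactor hf he hz)
      (inducedFactor_pos hf he hz).ne'
    have h6 : ∀ a, ContinuousAt (fun w => fderiv ℝ (conformalCoeff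
        (inducedFactor g f (chartAt ℂ p))) w a) z := fun a =>
      ((h5.fderiv_right (m := ∞) (by simp)).clm_apply contDiffAt_const).continuousAt
    refine ContinuousAt.congr ?_ h4.symm
    exact continuousAt_const.mul (Complex.continuous_re.continuousAt.comp
      (((h6 1).add (continuousAt_const.mul (h6 Complex.I))).div_const 2))
  have hN' : IntegrableForm kN := by
    intro x
    refine ((hi x).neg.sub (hT x)).congr (Filter.Eventually.of_forall fun z => ?_)
    simp only [Pi.sub_apply, Pi.neg_apply]
    ring
  have h7 : formIntegral (fun p z => -(kT p z + kN p z)) = -(formIntegral kT + formIntegral kN) := by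
    rw [← formIntegral_add hT hN', formIntegral, formIntegral, ← Finset.sum_neg_distrib]
    refine Finset.sum_congr rfl fun x _ => ?_
    rw [← MeasureTheory.integral_neg]
    congr 1
    ext z
    ring
  rw [h7] at h3
  rw [eulerTangent, eulerNormal, surfaceIntegral_eq_formIntegral, surfaceIntegral_eq_formIntegral,
    ← mul_add]
  change 1 / (2 * Real.pi) * (formIntegral kT + formIntegral kN) = _
  rw [Finset.sum_neg_distrib] at h3
  have := Real.pi_pos
  rw [one_div, inv_mul_eq_iff_eq_mul₀ (by positivity)]
  linarith

end EulerNumber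

/-! ### The numbers of complex and anticomplex points -/

section Count

theorem finsum_mem_eq_sum_of_subset {α : Type*} {A : Set α} {Z : Finset α} {n m : α → ℕ}
    (hA : A ⊆ Z) (h : ∀ x ∈ A, n x = m x) (h0 : ∀ x ∉ A, m x = 0) :
    ∑ᶠ x ∈ A, n x = ∑ x ∈ Z, m x := by
  have hfin : A.Finite := Z.finite_toSet.subset hA
  rw [finsum_mem_congr rfl h, finsum_mem_eq_finite_toFinset_sum m hfin]
  exact Finset.sum_subset (fun x hx => hA (hfin.mem_toFinset.1 hx)) fun x _ hx =>
    h0 x (mt hfin.mem_toFinset.2 hx)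

variable {M : Type*} [TopologicalSpace M] [ChartedSpace C2 M] [IsManifold 𝓘(ℂ, C2) ω M]
  {S : Type*} [TopologicalSpace S] [ChartedSpace ℂ S] [IsManifold 𝓘(ℂ, ℂ) ω S]
  {g : HermitianMetric M} {f : S → M} {p q : S → ℕ} {N : S → Set ℂ} {e₁ e₂ : S → ℂ → C2}
  {σ τ H K : S → ℂ → ℂ}

theorem numComplex_eq (hf : IsConformalImmersion g f) {Z : Finset S}
    (hZ : (Z : Set S) = specialPoints f)
    (h : ∀ x, HasOrders g f x (p x) (q x) (N x) (e₁ x) (e₂ x) (σ x) (τ x) (H x) (K x)) :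
    numComplex g f = ∑ x ∈ Z, p x :=
  finsum_mem_eq_sum_of_subset (hZ ▸ Set.subset_union_left)
    (fun x _ => (h x).complexOrder_eq hf)
    fun x hx => by_contra fun h0 => hx (((h x).mem_complexPoints_iff hf).2 h0)

theorem numAnticomplex_eq (hf : IsConformalImmersion g f) {Z : Finset S}
    (hZ : (Z : Set S) = specialPoints f)
    (h : ∀ x, HasOrders g f x (p x) (q x) (N x) (e₁ x) (e₂ x) (σ x) (τ x) (H x) (K x)) :
    numAnticomplex g f = ∑ x ∈ Z, q x :=
  finsum_mem_eq_sum_of_subset (hZ ▸ Set.subset_union_right)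
    (fun x _ => (h x).anticomplexOrder_eq hf)
    fun x hx => by_contra fun h0 => hx (((h x).mem_anticomplexPoints_iff hf).2 h0)

end Count

end ChernMinimal

end

open ChernMinimal in
theorem theorem1p2 {S M : Type*}
    [TopologicalSpace S] [ChartedSpace ℂ S] [IsManifold 𝓘(ℂ, ℂ) ω S]
    [T2Space S] [CompactSpace S] [ConnectedSpace S]
    [TopologicalSpace M] [ChartedSpace C2 M] [IsManifold 𝓘(ℂ, C2) ω M]
    [T2Space M] [SecondCountableTopology M]
    (g : HermitianMetric M) (f : S → M)
    (hf : IsConformalImmersion g f) (hmin : IsChernMinimal g f)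
    (hhol : ¬ IsHolomorphic f) (hanti : ¬ IsAntiholomorphic f) :
    (complexPoints f).Finite ∧ (anticomplexPoints f).Finite ∧
    (∀ x ∈ complexPoints f, 0 < complexOrder g f x ∧ ∃! p : ℕ, IsComplexOrder g f x p) ∧
    (∀ x ∈ anticomplexPoints f,
      0 < anticomplexOrder g f x ∧ ∃! p : ℕ, IsAnticomplexOrder g f x p) ∧
    (numComplex g f : ℝ) - numAnticomplex g f = -chernNumber g f ∧
    (numComplex g f : ℝ) + numAnticomplex g f = -(eulerTangent g f + eulerNormal g f) := by
  have hfin := (finite_complexPoints hf hmin hhol).1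
  have hfin' := (finite_anticomplexPoints hf hmin hanti).1
  choose p q N e₁ e₂ σ τ H K h using exists_hasOrders hf hmin hhol hanti
  have hZ : (((hfin.union hfin').toFinset : Finset S) : Set S) = specialPoints f :=
    (hfin.union hfin').coe_toFinset
  refine ⟨hfin, hfin', fun x hx => ?_, fun x hx => ?_, ?_, ?_⟩
  · rw [(h x).complexOrder_eq hf]
    exact ⟨Nat.pos_of_ne_zero (((h x).mem_complexPoints_iff hf).1 hx), p x,
      (h x).isComplexOrder hf, fun k hk => hk.unique hf ((h x).isComplexOrder hf)⟩
  · rw [(h x).anticomplexOrder_eq hf]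
    exact ⟨Nat.pos_of_ne_zero (((h x).mem_anticomplexPoints_iff hf).1 hx), q x,
      (h x).isAnticomplexOrder hf, fun k hk => hk.unique hf ((h x).isAnticomplexOrder hf)⟩
  · rw [numComplex_eq hf hZ h, numAnticomplex_eq hf hZ h, chernNumber_eq hf hZ h,
      Finset.sum_sub_distrib]
    push_cast
    ring
  · rw [numComplex_eq hf hZ h, numAnticomplex_eq hf hZ h,
      eulerTangent_add_eulerNormal_eq hf hZ h, neg_neg, Finset.sum_add_distrib]
    push_cast
    ring
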